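/- Let $\mathcal G$ be a non-zero finite-dimensional real Lie superalgebra with a homogeneous basis $\{\varepsilon_r\}$ of Grassmann parities $[r]$ and structure constants $[\varepsilon_i,\varepsilon_j]=c^r_{ij}\varepsilon_r$, where $c^r_{ij}=-(-1)^{[i][j]}c^r_{ji}$, $[r]=[i]+[j]$ whenever $c^r_{ij}\neq 0$, and the graded Jacobi identity holds. Suppose that the universal enveloping algebra of $\mathcal G$ has an even quadratic Casimir (i.e. central) element $h^{ij}\varepsilon_i\varepsilon_j$ whose coefficient matrix is graded symmetric, $h^{ij}=(-1)^{[i][j]}h^{ji}$, and non-degenerate; let $(h_{ij})$ be the inverse matrix. Let $n\ge 2$, let $U\subset\mathbb R^n$ be a non-empty open set (any coordinate chart, trivializing the bundles involved, of the $n$-dimensional base manifold), with coordinates $x^\lambda$ and a smooth pseudo-Riemannian metric $g$ of any signature, and put $\omega=dx^1\wedge\dots\wedge dx^n$. Consider gauge fields $a^r_\lambda$, ghosts $c^r$, antifields $\bar a^\lambda_r$ and Noether antifields $\bar c_r$ of parities $[a^r_\lambda]=[r]$, $[c^r]=[\bar a^\lambda_r]=[r]+1$, $[\bar c_r]=[r]$,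 and the graded commutative algebra $\mathcal P$ of graded functions of their jets: smooth functions of $x\in U$ and of finitely many even jet variables, tensored with the Grassmann algebra of the odd jet variables. Let $d_\lambda$ be the total derivatives, $d_\Lambda$ their iterates, and identify a density $f\omega$ with $f$; $f\omega$ is $d_H$-exact iff $f=\sum_\lambda d_\lambda\sigma^\lambda$ for some $\sigma^\lambda\in\mathcal P$. Let $$L_{\rm YM}=\tfrac14 h_{ij}g^{\lambda\mu}g^{\beta\nu}\mathcal F^i_{\lambda\beta}\mathcal F^j_{\mu\nu}\sqrt{|\det g|}\,\omega,\qquad \mathcal F^r_{\lambda\mu}=d_\lambda a^r_\mu-d_\mu a^r_\lambda+c^r_{ij}a^i_\lambda a^j_\mu ,$$ and let $\mathcal E_r^\lambda$ be its left variational derivatives with respect to $a^r_\lambda$. Then the following hold. 1. (Noether identities.) $c^r_{ji}a^i_\lambda\mathcal E_r^\lambda+d_\lambda\mathcal E_j^\lambda=0$ for all $j$. Equivalently, $\Delta_j=c^r_{ji}a^i_\lambda\bar a^\lambda_r+d_\lambda\bar a^\lambda_j$ is a cycle of the right derivation $\bar\delta$ given by $\bar a^\lambda_r\mapsto\mathcal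 E^\lambda_r$, acting on ghost-free elements polynomial in the jets of the antifields $\bar a^\lambda_r$, with graded functions of the jets of $a^r_\lambda$ as coefficients. 2. (Completeness.) The classes of the $\Delta_j$ in the homology $H_1(\bar\delta)$ of antifield number one are linearly independent over $C^\infty(U)$, and every one-cycle $\Phi$ has the form $\Phi=\sum G^{r,\Xi}d_\Xi\Delta_r+\bar\delta\Psi$ (finite sum), where $G^{r,\Xi}$ are graded functions of the jets of $a^r_\lambda$ and $\Psi$ is quadratic in the jets of the $\bar a^\lambda_r$. 3. (Irreducibility.) Let $\delta_0$ be the Koszul–Tate operator, i.e. the right derivation with $\bar a^\lambda_r\mapsto\mathcal E_r^\lambda$, $\bar c_r\mapsto\Delta_r$, where $\bar a^\lambda_r$ and $\bar c_r$ have antifield numbers $1$ and $2$. Every two-cycle $\sum G^{r,\Lambda}\bar c_{\Lambda r}+H$ of $\delta_0$, with $H$ quadratic in the jets of the $\bar a^\lambda_r$, is the $\delta_0$-boundary of a three-chain, or all the $G^{r,\Lambda}$ vanish on-shell, i.e. lie in the ideal generated by all the $d_\Lambda\mathcal E^\lambda_r$. 4. (Gauge operator.) The gauge operator associated with the Noether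 operators $-\Delta_r$, i.e. $u^A=\sum_{r,\Lambda}(-1)^{|\Lambda|}d_\Lambda\bigl(c^r(-\Delta_r)^{A,\Lambda}\bigr)$ for $\Delta_r=\sum\Delta_r^{A,\Lambda}\bar s_{\Lambda A}$, where $s^A$ runs over the $a^r_\lambda$ and $\bar s_{\Lambda A}$ are the jets of the antifield $\bar s_A$ of $s^A$, is $$u=(c^r_\lambda-c^r_{ji}c^ja^i_\lambda)\frac{\partial}{\partial a^r_\lambda},$$ and its prolongation is a variational symmetry of $L_{\rm YM}$. 5. (BRST operator.) The prolongation of $\displaystyle {\bf b}=u-\tfrac12(-1)^{[i]}c^r_{ij}c^ic^j\frac{\partial}{\partial c^r}$ is nilpotent: ${\bf b}({\bf b}f)=0$ for all $f\in\mathcal P$. 6. (Master equation.) The density $$L_E=L_{\rm YM}+(c^r_\lambda-c^r_{ji}c^ja^i_\lambda)\bar a^\lambda_r\,\omega-\tfrac12(-1)^{[i]}c^r_{ij}c^ic^j\bar c_r\,\omega$$ is a proper solution of the classical master equation. That is, with $z^a$ running over $a^r_\lambda,c^r$ and $\bar z_a$ over their antifields, the antibracket $\{L_E,L_E\}=2\frac{\overleftarrow{\delta}L_E}{\delta\bar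 z_a}\frac{\delta L_E}{\delta z^a}\,\omega$ is $d_H$-exact; both derivations $\frac{\overleftarrow{\delta}L_E}{\delta\bar z_a}\frac{\partial}{\partial z^a}$ and $\frac{\overleftarrow{\partial}}{\partial\bar z_a}\frac{\delta L_E}{\delta z^a}$ are non-zero; $L_E$ reduces to $L_{\rm YM}$ when all antifields are put to zero; and $\delta L_E/\delta a^r_\lambda$, $\delta L_E/\delta c^r$ reduce, when all ghosts are put to zero, to $\mathcal E_r^\lambda$ and $-\Delta_r$, the components of the Koszul–Tate operator of the Noether operators $-\Delta_r$. -/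

import Mathlib

open TopologicalSpace
open scoped TensorProduct ContDiff

namespace SuperYM

noncomputable section

/-! ## Smooth functions of the base point and of finitely many fibre coordinates -/

section Smooth

variable {n : ℕ} (U : Opens (Fin n → ℝ)) (V : Type*)

/-- `f(x, y)`, with `x` in the chart domain `U` and `y` a family of fibre coordinates indexed
by `V`, depends on finitely many of the coordinates `y`, and does so smoothly. -/
def IsSmoothFn (f : U × (V → ℝ) → ℝ) : Prop :=
  ∃ (s : Finset V) (F : (Fin n → ℝ) × (s → ℝ) → ℝ),
    ContDiffOn ℝ ∞ F ((U : Set (Fin n → ℝ)) ×ˢ Set.univ) ∧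
      ∀ x y, f (x, y) = F (x, fun v => y v)

variable {U V}

theorem IsSmoothFn.enlarge {f : U × (V → ℝ) → ℝ} (hf : IsSmoothFn U V f) :
    ∃ s : Finset V, ∀ t : Finset V, s ⊆ t → ∃ F : (Fin n → ℝ) × (t → ℝ) → ℝ,
      ContDiffOn ℝ ∞ F ((U : Set (Fin n → ℝ)) ×ˢ Set.univ) ∧
        ∀ x y, f (x, y) = F (x, fun v => y v) := by
  obtain ⟨s, F, hF, hfF⟩ := hf
  refine ⟨s, fun t hst => ⟨fun p => F (p.1, fun v => p.2 ⟨v, hst v.2⟩), ?_, ?_⟩⟩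
  · refine hF.comp (t := (U : Set (Fin n → ℝ)) ×ˢ Set.univ) ?_ ?_
    · exact ContDiff.contDiffOn (by fun_prop)
    · intro p hp
      exact ⟨hp.1, trivial⟩
  · intro x y
    exact hfF x y

theorem IsSmoothFn.op₂ {f g : U × (V → ℝ) → ℝ} (hf : IsSmoothFn U V f)
    (hg : IsSmoothFn U V g) (o : ℝ × ℝ → ℝ) (ho : ContDiff ℝ ∞ o) :
    IsSmoothFn U V (fun p => o (f p, g p)) := by
  classical
  obtain ⟨s, hs⟩ := hf.enlarge
  obtain ⟨t, ht⟩ := hg.enlarge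
  obtain ⟨F, hF, hfF⟩ := hs (s ∪ t) Finset.subset_union_left
  obtain ⟨G, hG, hgG⟩ := ht (s ∪ t) Finset.subset_union_right
  refine ⟨s ∪ t, fun p => o (F p, G p), ho.comp_contDiffOn (hF.prodMk hG), fun x y => ?_⟩
  simp only [hfF, hgG]

theorem isSmoothFn_const (r : ℝ) : IsSmoothFn U V (fun _ => r) :=
  ⟨∅, fun _ => r, contDiffOn_const, fun _ _ => rfl⟩

variable (U V) in
/-- The commutative real algebra `C^∞` of smooth functions in the coordinates `x ∈ U` and in
finitely many of the fibre coordinates indexed by `V`. -/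
def SmoothFn : Subalgebra ℝ (U × (V → ℝ) → ℝ) where
  carrier := {f | IsSmoothFn U V f}
  mul_mem' ha hb := IsSmoothFn.op₂ ha hb (fun p => p.1 * p.2) (by fun_prop)
  add_mem' ha hb := IsSmoothFn.op₂ ha hb (fun p => p.1 + p.2) (by fun_prop)
  algebraMap_mem' r := isSmoothFn_const r

/-- A smooth function on `U`, as an element of `SmoothFn U V`. -/
def baseFn (f : (Fin n → ℝ) → ℝ) (hf : ContDiffOn ℝ ∞ f U) : SmoothFn U V :=
  ⟨fun p => f p.1, ∅, fun p => f p.1,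
    hf.comp (t := (U : Set (Fin n → ℝ))) contDiff_fst.contDiffOn (fun _ hp => hp.1),
    fun _ _ => rfl⟩

/-- The fibre coordinate `y ↦ y v`. -/
def coordFn (v : V) : SmoothFn U V :=
  ⟨fun p => p.2 v, {v}, fun p => p.2 ⟨v, Finset.mem_singleton_self v⟩,
    ContDiff.contDiffOn (by fun_prop), fun _ _ => rfl⟩

open scoped Classical in
/-- The value at `(x, y)` of the partial derivative with respect to the fibre coordinate `v`. -/
def fibreDerivFun (v : V) (f : U × (V → ℝ) → ℝ) (p : U × (V → ℝ)) : ℝ :=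
  deriv (fun t : ℝ => f (p.1, Function.update p.2 v t)) (p.2 v)

open scoped Classical in
/-- The value at `(x, y)` of the partial derivative with respect to the base coordinate `x^l`
(`f` is extended by zero for `x ∉ U`; as `U` is open this does not affect the derivative). -/
def baseDerivFun (l : Fin n) (f : U × (V → ℝ) → ℝ) (p : U × (V → ℝ)) : ℝ :=
  deriv (fun t : ℝ => if h : (p.1 : Fin n → ℝ) + t • Pi.single l 1 ∈ U
    then f (⟨_, h⟩, p.2) else 0) 0

open scoped Classical in
theorem fibre_hasDerivAt (v : V) {t : Finset V} (hv : v ∈ t) {f : U × (V → ℝ) → ℝ}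
    {F : (Fin n → ℝ) × (t → ℝ) → ℝ}
    (hF : ContDiffOn ℝ ∞ F ((U : Set (Fin n → ℝ)) ×ˢ Set.univ))
    (hfF : ∀ x y, f (x, y) = F (x, fun v => y v)) (x : U) (y : V → ℝ) :
    HasDerivAt (fun s : ℝ => f (x, Function.update y v s))
      (fderiv ℝ F (x, fun w => y w) (0, Pi.single ⟨v, hv⟩ 1)) (y v) := by
  have hnhds : ((U : Set (Fin n → ℝ)) ×ˢ (Set.univ : Set (t → ℝ))) ∈
      nhds ((x : Fin n → ℝ), fun w : t => y w) :=
    (U.isOpen.prod isOpen_univ).mem_nhds ⟨x.2, trivial⟩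
  have hd : HasFDerivAt F (fderiv ℝ F ((x : Fin n → ℝ), fun w : t => y w))
      ((x : Fin n → ℝ), fun w : t => y w) :=
    ((hF.contDiffAt hnhds).differentiableAt (by simp)).hasFDerivAt
  have hc : HasDerivAt (fun s : ℝ => ((x : Fin n → ℝ),
      (Function.update (fun w : t => y w) ⟨v, hv⟩ s : t → ℝ)))
      ((0 : Fin n → ℝ), (Pi.single ⟨v, hv⟩ 1 : t → ℝ)) (y v) :=
    (hasDerivAt_const _ _).prodMk (hasDerivAt_update _ _ _)
  have h0 : ((x : Fin n → ℝ), (Function.update (fun w : t => y w) ⟨v, hv⟩ (y v) : t → ℝ))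
      = ((x : Fin n → ℝ), fun w : t => y w) := by
    simp
  rw [← h0] at hd
  have := hd.comp_hasDerivAt (y v) hc
  rw [h0] at this
  refine this.congr_of_eventuallyEq (Filter.Eventually.of_forall fun s => ?_)
  simp only [hfF, Function.comp]
  congr 2
  funext w
  by_cases hw : w = ⟨v, hv⟩
  · subst hw; simp
  · rw [Function.update_of_ne hw, Function.update_of_ne]
    exact fun h => hw (Subtype.ext h)

open scoped Classical in
theorem base_hasDerivAt (l : Fin n) {t : Finset V} {f : U × (V → ℝ) → ℝ}
    {F : (Fin n → ℝ) × (t → ℝ) → ℝ}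
    (hF : ContDiffOn ℝ ∞ F ((U : Set (Fin n → ℝ)) ×ˢ Set.univ))
    (hfF : ∀ x y, f (x, y) = F (x, fun v => y v)) (x : U) (y : V → ℝ) :
    HasDerivAt (fun s : ℝ => if h : (x : Fin n → ℝ) + s • Pi.single l 1 ∈ U
      then f (⟨_, h⟩, y) else 0)
      (fderiv ℝ F (x, fun w => y w) (Pi.single l 1, 0)) 0 := by
  have hnhds : ((U : Set (Fin n → ℝ)) ×ˢ (Set.univ : Set (t → ℝ))) ∈
      nhds ((x : Fin n → ℝ), fun w : t => y w) :=
    (U.isOpen.prod isOpen_univ).mem_nhds ⟨x.2, trivial⟩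
  have hd : HasFDerivAt F (fderiv ℝ F ((x : Fin n → ℝ), fun w : t => y w))
      ((x : Fin n → ℝ), fun w : t => y w) :=
    ((hF.contDiffAt hnhds).differentiableAt (by simp)).hasFDerivAt
  have hl : HasDerivAt (fun s : ℝ => (x : Fin n → ℝ) + s • (Pi.single l 1 : Fin n → ℝ))
      (Pi.single l 1) 0 := by
    simpa using ((hasDerivAt_id (0 : ℝ)).smul_const (Pi.single l 1 : Fin n → ℝ)).const_add
      (x : Fin n → ℝ)
  have hc := hl.prodMk (hasDerivAt_const (0 : ℝ) (fun w : t => y w))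
  have h0 : ((x : Fin n → ℝ) + (0 : ℝ) • (Pi.single l 1 : Fin n → ℝ), fun w : t => y w)
      = ((x : Fin n → ℝ), fun w : t => y w) := by
    simp
  rw [← h0] at hd
  have := hd.comp_hasDerivAt (0 : ℝ) hc
  rw [h0] at this
  refine this.congr_of_eventuallyEq ?_
  have hU : ∀ᶠ s : ℝ in nhds 0, (x : Fin n → ℝ) + s • (Pi.single l 1 : Fin n → ℝ) ∈ U := by
    refine hl.continuousAt.eventually_mem (U.isOpen.mem_nhds ?_)
    simp
  filter_upwards [hU] with s hs
  rw [dif_pos hs]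
  simp [hfF]

theorem fderiv_smooth {t : Finset V} {F : (Fin n → ℝ) × (t → ℝ) → ℝ}
    (hF : ContDiffOn ℝ ∞ F ((U : Set (Fin n → ℝ)) ×ˢ Set.univ))
    (w : (Fin n → ℝ) × (t → ℝ)) :
    ContDiffOn ℝ ∞ (fun p => fderiv ℝ F p w) ((U : Set (Fin n → ℝ)) ×ˢ Set.univ) :=
  (hF.fderiv_of_isOpen (m := ∞) (U.isOpen.prod isOpen_univ) (by simp)).clm_apply
    contDiffOn_const

/-- The partial derivative `∂/∂y^v` of smooth functions. -/
def fibreDeriv (v : V) : SmoothFn U V →ₗ[ℝ] SmoothFn U V where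
  toFun f := ⟨fibreDerivFun v f.1, by
    classical
    obtain ⟨s, hs⟩ := IsSmoothFn.enlarge f.2
    obtain ⟨F, hF, hfF⟩ := hs (insert v s) (Finset.subset_insert v s)
    exact ⟨insert v s, _, fderiv_smooth hF (0, Pi.single ⟨v, Finset.mem_insert_self v s⟩ 1),
      fun x y =>
        (fibre_hasDerivAt v _ hF hfF x y).deriv⟩⟩
  map_add' f g := by
    classical
    obtain ⟨s, hs⟩ := IsSmoothFn.enlarge f.2
    obtain ⟨F, hF, hfF⟩ := hs (insert v s) (Finset.subset_insert v s)
    obtain ⟨s', hs'⟩ := IsSmoothFn.enlarge g.2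
    obtain ⟨G, hG, hgG⟩ := hs' (insert v s') (Finset.subset_insert v s')
    ext ⟨x, y⟩
    have h1 := fibre_hasDerivAt v (Finset.mem_insert_self v s) hF hfF x y
    have h2 := fibre_hasDerivAt v (Finset.mem_insert_self v s') hG hgG x y
    have h3 := (h1.add h2).deriv
    rw [← h1.deriv, ← h2.deriv] at h3
    exact h3
  map_smul' r f := by
    classical
    obtain ⟨s, hs⟩ := IsSmoothFn.enlarge f.2
    obtain ⟨F, hF, hfF⟩ := hs (insert v s) (Finset.subset_insert v s)
    ext ⟨x, y⟩
    have h1 := fibre_hasDerivAt v (Finset.mem_insert_self v s) hF hfF x y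
    have h3 := (h1.const_mul r).deriv
    rw [← h1.deriv] at h3
    exact h3

/-- The partial derivative `∂/∂x^l` of smooth functions. -/
def baseDeriv (l : Fin n) : SmoothFn U V →ₗ[ℝ] SmoothFn U V where
  toFun f := ⟨baseDerivFun l f.1, by
    classical
    obtain ⟨s, F, hF, hfF⟩ := f.2
    exact ⟨s, _, fderiv_smooth hF (Pi.single l 1, 0), fun x y => by
        exact (base_hasDerivAt l hF hfF x y).deriv⟩⟩
  map_add' f g := by
    classical
    obtain ⟨s, F, hF, hfF⟩ := f.2
    obtain ⟨s', G, hG, hgG⟩ := g.2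
    ext ⟨x, y⟩
    have h1 := base_hasDerivAt l hF hfF x y
    have h2 := base_hasDerivAt l hG hgG x y
    have h3 := (h1.add h2).deriv
    rw [← h1.deriv, ← h2.deriv] at h3
    simp only [baseDerivFun, Subalgebra.coe_add, Pi.add_apply]
    rw [← h3]
    congr 1
    funext z
    by_cases hz : (x : Fin n → ℝ) + z • Pi.single l 1 ∈ U <;> simp [hz]
  map_smul' r f := by
    classical
    obtain ⟨s, F, hF, hfF⟩ := f.2
    ext ⟨x, y⟩
    have h1 := base_hasDerivAt l hF hfF x y
    have h3 := (h1.const_mul r).deriv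
    rw [← h1.deriv] at h3
    simp only [baseDerivFun, Subalgebra.coe_smul, Pi.smul_apply, RingHom.id_apply, smul_eq_mul]
    rw [← h3]
    congr 1
    funext z
    by_cases hz : (x : Fin n → ℝ) + z • Pi.single l 1 ∈ U <;> simp [hz]

end Smooth

/-! ## The graded jet algebra and its calculus -/

section Jets

variable {n : ℕ} (U : Opens (Fin n → ℝ)) {φ : Type*} (par : φ → ZMod 2)

/-- A jet variable `s^A_Λ`: a field label `A` and a multi-index `Λ = (λ_1 ... λ_k)`, a
collection of base indices modulo permutations. -/
abbrev Jet (n : ℕ) (φ : Type*) := φ × Multiset (Fin n)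

/-- Jet variables of the even fields. -/
abbrev EvenJet (n : ℕ) {φ : Type*} (par : φ → ZMod 2) := {v : Jet n φ // par v.1 = 0}

/-- Jet variables of the odd fields. -/
abbrev OddJet (n : ℕ) {φ : Type*} (par : φ → ZMod 2) := {v : Jet n φ // par v.1 ≠ 0}

/-- The algebra of graded functions on the infinite order graded jet manifold over a chart `U`,
for fields labelled by `φ` with Grassmann parities `par`: smooth functions of `x` and of finitely
many even jet variables, tensored with the Grassmann algebra generated by the odd jet variables.
A graded density `f ω`, `ω = dx^1 ∧ ... ∧ dx^n`, is represented by its coefficient `f`. -/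
def JetAlg := SmoothFn U (EvenJet n par) ⊗[ℝ] ExteriorAlgebra ℝ (OddJet n par →₀ ℝ)

instance : Ring (JetAlg U par) :=
  inferInstanceAs (Ring (SmoothFn U (EvenJet n par) ⊗[ℝ] ExteriorAlgebra ℝ (OddJet n par →₀ ℝ)))

instance : Algebra ℝ (JetAlg U par) :=
  inferInstanceAs
    (Algebra ℝ (SmoothFn U (EvenJet n par) ⊗[ℝ] ExteriorAlgebra ℝ (OddJet n par →₀ ℝ)))

variable {U par}

/-- The graded function `f w`, with `f` smooth and `w` in the Grassmann algebra. -/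
def JetAlg.of (f : SmoothFn U (EvenJet n par))
    (w : ExteriorAlgebra ℝ (OddJet n par →₀ ℝ)) : JetAlg U par :=
  f ⊗ₜ[ℝ] w

theorem JetAlg.induction {P : JetAlg U par → Prop} (h0 : P 0)
    (hof : ∀ f w, P (JetAlg.of f w)) (hadd : ∀ x y, P x → P y → P (x + y))
    (x : JetAlg U par) : P x :=
  TensorProduct.induction_on (motive := P) x h0 hof hadd

theorem JetAlg.zero_of (w : ExteriorAlgebra ℝ (OddJet n par →₀ ℝ)) :
    (JetAlg.of 0 w : JetAlg U par) = 0 :=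
  TensorProduct.zero_tmul _ _

theorem JetAlg.of_zero (f : SmoothFn U (EvenJet n par)) :
    (JetAlg.of f 0 : JetAlg U par) = 0 :=
  TensorProduct.tmul_zero _ _

/-- The function of `x` alone, as a graded function. -/
def ofBase (f : (Fin n → ℝ) → ℝ) (hf : ContDiffOn ℝ ∞ f U) : JetAlg U par :=
  JetAlg.of (baseFn f hf) 1

/-- The jet variable `s^A_Λ` as a graded function. -/
def gen (v : Jet n φ) : JetAlg U par :=
  if h : par v.1 = 0 then JetAlg.of (coordFn ⟨v, h⟩) 1
  else JetAlg.of 1 (ExteriorAlgebra.ι ℝ (Finsupp.single ⟨v, h⟩ 1))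

/-- The left graded derivative `∂_A^Λ = ∂/∂s^A_Λ`. -/
def pd (v : Jet n φ) : JetAlg U par →ₗ[ℝ] JetAlg U par :=
  (if h : par v.1 = 0 then LinearMap.rTensor _ (fibreDeriv ⟨v, h⟩)
  else LinearMap.lTensor _ (CliffordAlgebra.contractLeft (Finsupp.lapply ⟨v, h⟩)) :
    SmoothFn U (EvenJet n par) ⊗[ℝ] ExteriorAlgebra ℝ (OddJet n par →₀ ℝ) →ₗ[ℝ]
      SmoothFn U (EvenJet n par) ⊗[ℝ] ExteriorAlgebra ℝ (OddJet n par →₀ ℝ))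

/-- The right graded derivative with respect to `s^A_Λ`. -/
def pdR (v : Jet n φ) : JetAlg U par →ₗ[ℝ] JetAlg U par :=
  (if h : par v.1 = 0 then LinearMap.rTensor _ (fibreDeriv ⟨v, h⟩)
  else LinearMap.lTensor _ (CliffordAlgebra.contractRight.flip (Finsupp.lapply ⟨v, h⟩)) :
    SmoothFn U (EvenJet n par) ⊗[ℝ] ExteriorAlgebra ℝ (OddJet n par →₀ ℝ) →ₗ[ℝ]
      SmoothFn U (EvenJet n par) ⊗[ℝ] ExteriorAlgebra ℝ (OddJet n par →₀ ℝ))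

/-- The partial derivative `∂_λ = ∂/∂x^λ`. -/
def pdBase (l : Fin n) : JetAlg U par →ₗ[ℝ] JetAlg U par :=
  (LinearMap.rTensor _ (baseDeriv l) :
    SmoothFn U (EvenJet n par) ⊗[ℝ] ExteriorAlgebra ℝ (OddJet n par →₀ ℝ) →ₗ[ℝ]
      SmoothFn U (EvenJet n par) ⊗[ℝ] ExteriorAlgebra ℝ (OddJet n par →₀ ℝ))

/-- The total derivative `d_λ = ∂_λ + ∑ s^A_{λ+Λ} ∂_A^Λ`. -/
def totalD (l : Fin n) (f : JetAlg U par) : JetAlg U par :=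
  pdBase l f + ∑ᶠ v : Jet n φ, gen (v.1, l ::ₘ v.2) * pd v f

/-- The iterated total derivative `d_Λ`. -/
def totalDs (Λ : Multiset (Fin n)) (f : JetAlg U par) : JetAlg U par :=
  (Λ.sort (· ≤ ·)).foldr totalD f

/-- The left variational derivative `δf/δs^A = ∑_Λ (-1)^{|Λ|} d_Λ (∂_A^Λ f)`. -/
def varDeriv (A : φ) (f : JetAlg U par) : JetAlg U par :=
  ∑ᶠ Λ : Multiset (Fin n), (-1 : ℝ) ^ Multiset.card Λ • totalDs Λ (pd (A, Λ) f)

/-- The right variational derivative. -/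
def varDerivR (A : φ) (f : JetAlg U par) : JetAlg U par :=
  ∑ᶠ Λ : Multiset (Fin n), (-1 : ℝ) ^ Multiset.card Λ • totalDs Λ (pdR (A, Λ) f)

/-- The vertical contact graded derivation `∑ d_Λ(υ^A) ∂_A^Λ` prolonging `υ = υ^A ∂_A`. -/
def contactDer (υ : φ → JetAlg U par) (f : JetAlg U par) : JetAlg U par :=
  ∑ᶠ v : Jet n φ, totalDs v.2 (υ v.1) * pd v f

/-- The right contact graded derivation prolonging `←∂_A υ^A`. -/
def contactDerR (υ : φ → JetAlg U par) (f : JetAlg U par) : JetAlg U par :=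
  ∑ᶠ v : Jet n φ, pdR v f * totalDs v.2 (υ v.1)

/-- The density `f ω` is `d_H`-exact: `f ω = d_H (σ^λ ω_λ) = (∑_λ d_λ σ^λ) ω`. -/
def IsHorizontallyExact (f : JetAlg U par) : Prop :=
  ∃ σ : Fin n → JetAlg U par, f = ∑ l, totalD l (σ l)

/-- `υ` is a variational symmetry of the Lagrangian `L ω`. -/
def IsVariationalSymmetry (υ : φ → JetAlg U par) (L : JetAlg U par) : Prop :=
  IsHorizontallyExact (contactDer υ L)

/-- `υ` is nilpotent: `υ(υ(f)) = 0` for all `f`. -/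
def IsNilpotentDer (υ : φ → JetAlg U par) : Prop :=
  ∀ f : JetAlg U par, contactDer υ (contactDer υ f) = 0

/-- The graded functions of `x` and of the jets of the fields in `K` only. -/
def functionsOf (K : Set φ) : Submodule ℝ (JetAlg U par) :=
  ⨅ (v : Jet n φ) (_ : v.1 ∉ K), LinearMap.ker (pd v)

end Jets

/-! ### Local finiteness of the sums over jet variables -/

section Finiteness

variable {n : ℕ} {U : Opens (Fin n → ℝ)} {φ : Type*} {par : φ → ZMod 2}

theorem finite_fibreDeriv {V : Type*} (f : SmoothFn U V) :
    {v : V | fibreDeriv v f ≠ 0}.Finite := by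
  classical
  obtain ⟨s, F, hF, hfF⟩ := f.2
  refine s.finite_toSet.subset fun v hv => ?_
  by_contra hvs
  refine hv ?_
  ext ⟨x, y⟩
  have : (fun t : ℝ => f.1 (x, Function.update y v t)) = fun _ => f.1 (x, y) := by
    funext t
    rw [hfF, hfF]
    congr 2
    funext w
    rw [Function.update_of_ne]
    rintro rfl
    exact hvs w.2
  change deriv (fun t : ℝ => f.1 (x, Function.update y v t)) (y v) = 0
  rw [this]
  simp

theorem finite_contractLeft {V : Type*} (w : ExteriorAlgebra ℝ (V →₀ ℝ)) :
    {v : V | CliffordAlgebra.contractLeft (Q := (0 : QuadraticForm ℝ (V →₀ ℝ)))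
      (Finsupp.lapply v) w ≠ 0}.Finite := by
  classical
  induction w using CliffordAlgebra.left_induction with
  | algebraMap r => simp
  | add x y hx hy =>
    refine (hx.union hy).subset fun v hv => ?_
    by_contra h
    simp only [Set.mem_union, Set.mem_ofPred_eq, not_or, not_not] at h
    exact hv (by rw [map_add, h.1, h.2, add_zero])
  | ι_mul x m hx =>
    refine (hx.union m.support.finite_toSet).subset fun v hv => ?_
    by_contra h
    simp only [Set.mem_union, Set.mem_ofPred_eq, not_or, not_not, Finset.mem_coe,
      Finsupp.mem_support_iff] at h
    refine hv ?_
    rw [CliffordAlgebra.contractLeft_ι_mul, h.1]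
    simp [h.2]

theorem finite_contractRight {V : Type*} (w : ExteriorAlgebra ℝ (V →₀ ℝ)) :
    {v : V | (CliffordAlgebra.contractRight (Q := (0 : QuadraticForm ℝ (V →₀ ℝ)))).flip
      (Finsupp.lapply v) w ≠ 0}.Finite := by
  refine (finite_contractLeft (CliffordAlgebra.reverse w)).subset fun v hv h => hv ?_
  rw [LinearMap.flip_apply, CliffordAlgebra.contractRight_eq, h, map_zero]

theorem pd_of_even {v : Jet n φ} (h : par v.1 = 0) (f : SmoothFn U (EvenJet n par))
    (w : ExteriorAlgebra ℝ (OddJet n par →₀ ℝ)) :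
    pd v (JetAlg.of f w) = JetAlg.of (fibreDeriv ⟨v, h⟩ f) w := by
  unfold pd
  rw [dif_pos h]
  rfl

theorem pd_of_odd {v : Jet n φ} (h : par v.1 ≠ 0) (f : SmoothFn U (EvenJet n par))
    (w : ExteriorAlgebra ℝ (OddJet n par →₀ ℝ)) :
    pd v (JetAlg.of f w)
      = JetAlg.of f (CliffordAlgebra.contractLeft (Finsupp.lapply ⟨v, h⟩) w) := by
  unfold pd
  rw [dif_neg h]
  rfl

/-- A graded function depends on finitely many jet variables. -/
theorem finite_pd (f : JetAlg U par) : {v : Jet n φ | pd v f ≠ 0}.Finite := by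
  induction f using JetAlg.induction with
  | h0 => simp
  | hadd x y hx hy =>
    refine (hx.union hy).subset fun v hv => ?_
    by_contra h
    simp only [Set.mem_union, Set.mem_ofPred_eq, not_or, not_not] at h
    exact hv (by rw [map_add, h.1, h.2, add_zero])
  | hof f w =>
    refine (((finite_fibreDeriv f).image Subtype.val).union
      ((finite_contractLeft w).image Subtype.val)).subset fun v hv => ?_
    by_cases h : par v.1 = 0
    · refine Or.inl ⟨⟨v, h⟩, fun h0 => hv ?_, rfl⟩
      rw [pd_of_even h, h0, JetAlg.zero_of]
    · refine Or.inr ⟨⟨v, h⟩, fun h0 => hv ?_, rfl⟩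
      rw [pd_of_odd h]
      exact (congrArg _ h0).trans (JetAlg.of_zero f)

theorem pdR_of_even {v : Jet n φ} (h : par v.1 = 0) (f : SmoothFn U (EvenJet n par))
    (w : ExteriorAlgebra ℝ (OddJet n par →₀ ℝ)) :
    pdR v (JetAlg.of f w) = JetAlg.of (fibreDeriv ⟨v, h⟩ f) w := by
  unfold pdR
  rw [dif_pos h]
  rfl

theorem pdR_of_odd {v : Jet n φ} (h : par v.1 ≠ 0) (f : SmoothFn U (EvenJet n par))
    (w : ExteriorAlgebra ℝ (OddJet n par →₀ ℝ)) :
    pdR v (JetAlg.of f w)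
      = JetAlg.of f (CliffordAlgebra.contractRight.flip (Finsupp.lapply ⟨v, h⟩) w) := by
  unfold pdR
  rw [dif_neg h]
  rfl

/-- The same for right derivatives. -/
theorem finite_pdR (f : JetAlg U par) : {v : Jet n φ | pdR v f ≠ 0}.Finite := by
  induction f using JetAlg.induction with
  | h0 => simp
  | hadd x y hx hy =>
    refine (hx.union hy).subset fun v hv => ?_
    by_contra h
    simp only [Set.mem_union, Set.mem_ofPred_eq, not_or, not_not] at h
    exact hv (by rw [map_add, h.1, h.2, add_zero])
  | hof f w =>
    refine (((finite_fibreDeriv f).image Subtype.val).union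
      ((finite_contractRight w).image Subtype.val)).subset fun v hv => ?_
    by_cases h : par v.1 = 0
    · refine Or.inl ⟨⟨v, h⟩, fun h0 => hv ?_, rfl⟩
      rw [pdR_of_even h, h0, JetAlg.zero_of]
    · refine Or.inr ⟨⟨v, h⟩, fun h0 => hv ?_, rfl⟩
      rw [pdR_of_odd h]
      exact (congrArg _ h0).trans (JetAlg.of_zero f)

end Finiteness

/-! ## Field-antifield theory -/

section BV

variable {n : ℕ} {U : Opens (Fin n → ℝ)} {Z : Type*} {par : Z → ZMod 2}

/-- Parities of fields `z` (left summand) and of their antifields (right summand). -/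
def bvPar (par : Z → ZMod 2) : Z ⊕ Z → ZMod 2 := Sum.elim par fun z => par z + 1

/-- The antibracket of even or odd graded densities. (The sign `(-1)^{[g]([g]+1)}` in front of
the second term is always `+1`.) -/
def antibracket [Fintype Z] (f g : JetAlg U (bvPar par)) : JetAlg U (bvPar par) :=
  ∑ z : Z, (varDerivR (Sum.inr z) f * varDeriv (Sum.inl z) g
    + varDerivR (Sum.inr z) g * varDeriv (Sum.inl z) f)

/-- The classical master equation: the antibracket of `S` with itself is `d_H`-exact. -/
def MasterEquation [Fintype Z] (S : JetAlg U (bvPar par)) : Prop :=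
  IsHorizontallyExact (antibracket S S)

/-- Components of the left derivation `υ_S = (←δS/δz̄_a) ∂/∂z^a`. -/
def fieldDer (S : JetAlg U (bvPar par)) : Z ⊕ Z → JetAlg U (bvPar par) :=
  Sum.elim (fun z => varDerivR (Sum.inr z) S) fun _ => 0

/-- Components of the right derivation `ῡ_S = (←∂/∂z̄_a) (δS/δz^a)`. -/
def antifieldDer (S : JetAlg U (bvPar par)) : Z ⊕ Z → JetAlg U (bvPar par) :=
  Sum.elim (fun _ => 0) fun z => varDeriv (Sum.inl z) S

/-- A solution of the master equation is non-trivial if both derivations are non-zero. -/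
def IsNontrivialSolution [Fintype Z] (S : JetAlg U (bvPar par)) : Prop :=
  MasterEquation S ∧ (∃ f, contactDer (fieldDer S) f ≠ 0) ∧
    ∃ f, contactDerR (antifieldDer S) f ≠ 0

/-- The ideal generated by the jets of the fields and antifields with labels in `K`. -/
def jetIdeal (K : Set (Z ⊕ Z)) : Ideal (JetAlg U (bvPar par)) :=
  Ideal.span {f | ∃ v : Jet n (Z ⊕ Z), v.1 ∈ K ∧ f = gen v}

end BV

/-! ## Noether identities of a gauge theory -/

section Noether

/-- Fields of the gauge theory: gauge fields `a^r_λ` (left) and ghosts `c^r` (right). -/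
abbrev YMField (ι : Type*) (n : ℕ) := (ι × Fin n) ⊕ ι

variable {n : ℕ} {ι : Type*}

/-- Parities: `[a^r_λ] = [r]`, `[c^r] = [r] + 1`. -/
def ymFieldPar (n : ℕ) (par : ι → ZMod 2) : YMField ι n → ZMod 2 :=
  Sum.elim (fun p => par p.1) fun r => par r + 1

/-- The algebra `P{0}` of graded functions of gauge fields, ghosts and their antifields;
`[ā^λ_r] = [r] + 1` and `[c̄_r] = [r]`. -/
abbrev YMAlg (U : Opens (Fin n → ℝ)) (par : ι → ZMod 2) := JetAlg U (bvPar (ymFieldPar n par))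

/-- Label of the gauge field `a^r_λ`. -/
abbrev gaugeL (r : ι) (l : Fin n) : YMField ι n ⊕ YMField ι n := Sum.inl (Sum.inl (r, l))
/-- Label of the ghost `c^r`. -/
abbrev ghostL (n : ℕ) (r : ι) : YMField ι n ⊕ YMField ι n := Sum.inl (Sum.inr r)
/-- Label of the antifield `ā^λ_r`. -/
abbrev gaugeBarL (r : ι) (l : Fin n) : YMField ι n ⊕ YMField ι n := Sum.inr (Sum.inl (r, l))
/-- Label of the Noether antifield `c̄_r`. -/
abbrev ghostBarL (n : ℕ) (r : ι) : YMField ι n ⊕ YMField ι n := Sum.inr (Sum.inr r)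

variable {U : Opens (Fin n → ℝ)} {par : ι → ZMod 2}

/-- The original field system algebra: graded functions of the jets of gauge fields only. -/
def fieldAlg : Submodule ℝ (YMAlg U par) :=
  functionsOf (Set.range fun p : ι × Fin n => gaugeL p.1 p.2)

/-- Antifield numbers: `Ant[ā^λ_r] = 1`, `Ant[c̄_r] = 2`. -/
def antNum : YMField ι n ⊕ YMField ι n → ℕ :=
  Sum.elim (fun _ => 0) (Sum.elim (fun _ => 1) fun _ => 2)

/-- Ghost-free graded densities of antifield number `k`, involving only antifields with
labels in `K`: sums of products of a graded function of the gauge fields and of jets of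
antifields whose antifield numbers add up to `k`. -/
def chains (K : Set (YMField ι n ⊕ YMField ι n)) (k : ℕ) : Submodule ℝ (YMAlg U par) :=
  Submodule.span ℝ {Φ | ∃ f ∈ (fieldAlg : Submodule ℝ (YMAlg U par)),
    ∃ l : List (Jet n (YMField ι n ⊕ YMField ι n)), (∀ v ∈ l, v.1 ∈ K) ∧
      (l.map fun v => antNum v.1).sum = k ∧ Φ = f * (l.map gen).prod}

/-- Labels of the antifields `ā^λ_r`. -/
def gaugeBars : Set (YMField ι n ⊕ YMField ι n) := Set.range fun p => Sum.inr (Sum.inl p)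

/-- Labels of all antifields `ā^λ_r`, `c̄_r`. -/
def allBars : Set (YMField ι n ⊕ YMField ι n) := Set.range Sum.inr

/-- Labels of the ghosts `c^r`. -/
def ghosts : Set (YMField ι n ⊕ YMField ι n) := Set.range fun r => Sum.inl (Sum.inr r)

/-- Components of the Koszul-Tate operator of the Lagrangian `L` and the Noether operators `Δ_r`:
`ā^λ_r ↦ ℰ_r^λ`, `c̄_r ↦ Δ_r`. -/
def koszulTateComp (L : YMAlg U par) (Δ : ι → YMAlg U par) :
    YMField ι n ⊕ YMField ι n → YMAlg U par :=
  Sum.elim (fun _ => 0) (Sum.elim (fun p => varDeriv (gaugeL p.1 p.2) L) Δ)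

/-- The right derivation `δ̄ = ←∂^A ℰ_A`. -/
def deltaBar (L : YMAlg U par) : YMAlg U par → YMAlg U par :=
  contactDerR (koszulTateComp L fun _ => 0)

/-- The Koszul-Tate operator `δ_0 = δ̄ + ←∂^r Δ_r`. -/
def koszulTate (L : YMAlg U par) (Δ : ι → YMAlg U par) : YMAlg U par → YMAlg U par :=
  contactDerR (koszulTateComp L Δ)

/-- The ideal of graded functions vanishing on-shell, generated by all `d_Λ ℰ_r^λ`. -/
def onShellIdeal (L : YMAlg U par) : Ideal (YMAlg U par) :=
  Ideal.span {f | ∃ (r : ι) (l : Fin n) (Λ : Multiset (Fin n)),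
    f = totalDs Λ (varDeriv (gaugeL r l) L)}

/-- The Noether operators `Δ_r` define complete (non-trivial) Noether identities of `L`: they are
one-cycles of `δ̄`, whose homology classes are a basis of a free module over the smooth
functions of `x`, and every one-cycle factorizes through them up to a boundary. -/
structure IsCompleteNoether [Fintype ι] (L : YMAlg U par) (Δ : ι → YMAlg U par) : Prop where
  chain : ∀ r, Δ r ∈ (chains gaugeBars 1 : Submodule ℝ (YMAlg U par))
  cycle : ∀ r, deltaBar L (Δ r) = 0
  independent : ∀ f : ι → YMAlg U par, (∀ r, f r ∈ functionsOf ∅) →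
    (∃ Ψ ∈ (chains gaugeBars 2 : Submodule ℝ (YMAlg U par)),
      ∑ r, f r * Δ r = deltaBar L Ψ) → ∀ r, f r = 0
  complete : ∀ Φ ∈ (chains gaugeBars 1 : Submodule ℝ (YMAlg U par)), deltaBar L Φ = 0 →
    ∃ G : (ι × Multiset (Fin n)) →₀ YMAlg U par, (∀ p, G p ∈ fieldAlg) ∧
      ∃ Ψ ∈ (chains gaugeBars 2 : Submodule ℝ (YMAlg U par)),
        Φ = (G.sum fun p g => g * totalDs p.2 (Δ p.1)) + deltaBar L Ψ

/-- Irreducibility: every two-cycle `∑ G^{r,Λ} c̄_{Λr} + H` of `δ_0` (a first-stage Noether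
identity) is trivial, i.e. it is a `δ_0`-boundary or its summand `G` vanishes on-shell. -/
def IsIrreducibleNoether (L : YMAlg U par) (Δ : ι → YMAlg U par) : Prop :=
  ∀ G : (ι × Multiset (Fin n)) →₀ YMAlg U par, (∀ p, G p ∈ fieldAlg) →
    ∀ H ∈ (chains gaugeBars 2 : Submodule ℝ (YMAlg U par)),
      koszulTate L Δ ((G.sum fun p g => g * gen (ghostBarL n p.1, p.2)) + H) = 0 →
        (∃ Ψ ∈ (chains allBars 3 : Submodule ℝ (YMAlg U par)),
          (G.sum fun p g => g * gen (ghostBarL n p.1, p.2)) + H = koszulTate L Δ Ψ) ∨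
        ∀ p, G p ∈ onShellIdeal L

/-- Components of the gauge operator associated with Noether operators
`Δ_r = ∑ Δ_r^{A,Λ} s̄_{ΛA}`: the formal adjoint
`u^A = ∑_{r,Λ} (-1)^{|Λ|} d_Λ (c^r Δ_r^{A,Λ})`, acting on gauge fields only. -/
def gaugeOperatorOf [Fintype ι] (Δ : ι → YMAlg U par) :
    YMField ι n ⊕ YMField ι n → YMAlg U par :=
  Sum.elim (Sum.elim (fun p => ∑ r, ∑ᶠ Λ : Multiset (Fin n), (-1 : ℝ) ^ Multiset.card Λ •
    totalDs Λ (gen (ghostL n r, 0) * pdR (gaugeBarL p.1 p.2, Λ) (Δ r))) fun _ => 0) fun _ => 0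

/-- `S` is a proper solution of the master equation, extending the Lagrangian `L` with Noether
operators `Δ_r`: it is a non-trivial solution, it reduces to `L` if antifields are put to zero,
and the derivation `ῡ_S` reduces to the Koszul-Tate operator if ghosts are put to zero. -/
structure IsProperSolution [Fintype ι] (L : YMAlg U par) (Δ : ι → YMAlg U par)
    (S : YMAlg U par) : Prop where
  nontrivial : IsNontrivialSolution S
  extends_L : S - L ∈ jetIdeal allBars
  koszul_tate : ∀ z, antifieldDer S (Sum.inr z) - koszulTateComp L Δ (Sum.inr z) ∈ jetIdeal ghosts

end Noether

/-! ## Lie superalgebras and Casimir elements -/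

section Algebra

/-- The sign `(-1)^s`. -/
def sgn (s : ZMod 2) : ℝ := (-1) ^ s.val

/-- A finite-dimensional real Lie superalgebra given by a homogeneous basis `e_r`, `r ∈ ι`, of
parities `[r]` and structure constants `c r i j = c^r_{ij}`, `[e_i, e_j] = ∑_r c^r_{ij} e_r`. -/
structure LieSuperalgebra (ι : Type*) [Fintype ι] where
  par : ι → ZMod 2
  c : ι → ι → ι → ℝ
  c_par : ∀ r i j, c r i j ≠ 0 → par r = par i + par j
  c_skew : ∀ r i j, c r i j = -(sgn (par i * par j) * c r j i)
  jacobi : ∀ r i a b, ∑ j, (sgn (par i * par b) * c r i j * c j a b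
    + sgn (par a * par i) * c r a j * c j b i + sgn (par b * par a) * c r b j * c j i a) = 0

namespace LieSuperalgebra

variable {ι : Type*} [Fintype ι] (𝔤 : LieSuperalgebra ι)

/-- Defining relations `e_i e_j = (-1)^{[i][j]} e_j e_i + ∑_r c^r_{ij} e_r`. -/
inductive EnvelopingRel : FreeAlgebra ℝ ι → FreeAlgebra ℝ ι → Prop
  | bracket (i j : ι) : EnvelopingRel (FreeAlgebra.ι ℝ i * FreeAlgebra.ι ℝ j)
      (sgn (𝔤.par i * 𝔤.par j) • (FreeAlgebra.ι ℝ j * FreeAlgebra.ι ℝ i)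
        + ∑ r, 𝔤.c r i j • FreeAlgebra.ι ℝ r)

/-- The universal enveloping algebra. -/
abbrev Enveloping := RingQuot 𝔤.EnvelopingRel

/-- The basis element `e_i` in the universal enveloping algebra. -/
def e (i : ι) : 𝔤.Enveloping := RingQuot.mkAlgHom ℝ 𝔤.EnvelopingRel (FreeAlgebra.ι ℝ i)

/-- `∑ h^{ij} e_i e_j` is an even quadratic Casimir element of the universal enveloping algebra,
with a non-degenerate graded symmetric coefficient matrix `h`. -/
structure IsNondegenerateCasimir [DecidableEq ι] (h : Matrix ι ι ℝ) : Prop where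
  even : ∀ i j, h i j ≠ 0 → 𝔤.par i = 𝔤.par j
  symm : ∀ i j, h i j = sgn (𝔤.par i * 𝔤.par j) * h j i
  nondegenerate : IsUnit h.det
  central : ∀ z : 𝔤.Enveloping, z * (∑ i, ∑ j, h i j • (𝔤.e i * 𝔤.e j))
    = (∑ i, ∑ j, h i j • (𝔤.e i * 𝔤.e j)) * z

end LieSuperalgebra

end Algebra

/-! ## Metrics -/

section Metric

variable {n : ℕ}

/-- A smooth (pseudo-Riemannian, of any signature) metric on the chart domain `U`. -/
structure MetricTensor (U : Opens (Fin n → ℝ)) where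
  g : (Fin n → ℝ) → Matrix (Fin n) (Fin n) ℝ
  smooth : ∀ l m, ContDiffOn ℝ ∞ (fun x => g x l m) U
  symm : ∀ x ∈ U, (g x).IsSymm
  nondegenerate : ∀ x ∈ U, IsUnit (g x).det

variable {U : Opens (Fin n → ℝ)} (g : MetricTensor U)

theorem contDiffOn_det {s : Set (Fin n → ℝ)} {A : (Fin n → ℝ) → Matrix (Fin n) (Fin n) ℝ}
    (hA : ∀ l m, ContDiffOn ℝ ∞ (fun x => A x l m) s) :
    ContDiffOn ℝ ∞ (fun x => (A x).det) s := by
  simp only [Matrix.det_apply]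
  refine ContDiffOn.sum fun σ _ => ?_
  refine ContDiffOn.const_smul _ ?_
  exact contDiffOn_prod fun i _ => hA _ _

/-- The coefficient `√|det g| g^{λμ} g^{βν}`. -/
def MetricTensor.coeff (l m b k : Fin n) (x : Fin n → ℝ) : ℝ :=
  √|(g.g x).det| * (g.g x)⁻¹ l m * (g.g x)⁻¹ b k

theorem MetricTensor.inv_smooth (l m : Fin n) :
    ContDiffOn ℝ ∞ (fun x => (g.g x)⁻¹ l m) U := by
  have hd := contDiffOn_det g.smooth
  have hadj : ContDiffOn ℝ ∞ (fun x => (g.g x).adjugate l m) U := by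
    simp only [Matrix.adjugate_apply]
    refine contDiffOn_det fun i j => ?_
    by_cases hi : i = m
    · subst hi
      simpa using contDiffOn_const
    · simpa [Matrix.updateRow_ne hi] using g.smooth i j
  refine ((hd.inv fun x hx => (g.nondegenerate x hx).ne_zero).mul hadj).congr fun x _ => ?_
  simp [Matrix.inv_def]

theorem MetricTensor.coeff_smooth (l m b k : Fin n) :
    ContDiffOn ℝ ∞ (g.coeff l m b k) U := by
  have hd := contDiffOn_det g.smooth
  have habs : ContDiffOn ℝ ∞ (fun x => √|(g.g x).det|) U := fun x hx => by
    have h0 := (g.nondegenerate x hx).ne_zero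
    exact ((contDiffAt_abs h0).comp_contDiffWithinAt x (hd x hx)).sqrt (by simpa using h0)
  exact (habs.mul (g.inv_smooth l m)).mul (g.inv_smooth b k)

end Metric

/-! ## Graded Yang-Mills theory -/

section YM

variable {n : ℕ} {U : Opens (Fin n → ℝ)} {ι : Type*} [Fintype ι] (𝔤 : LieSuperalgebra ι)

/-- The algebra of gauge fields, ghosts and antifields of the Lie superalgebra. -/
abbrev Alg (U : Opens (Fin n → ℝ)) := YMAlg U 𝔤.par

/-- The gauge field jet `a^r_{Λ λ}`, with `λ` the covector index. -/
def a (r : ι) (l : Fin n) (Λ : Multiset (Fin n)) : Alg 𝔤 U := gen (gaugeL r l, Λ)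
/-- The ghost jet `c^r_Λ`. -/
def gh (r : ι) (Λ : Multiset (Fin n)) : Alg 𝔤 U := gen (ghostL n r, Λ)
/-- The antifield jet `ā^λ_{Λ r}`. -/
def aBar (r : ι) (l : Fin n) (Λ : Multiset (Fin n)) : Alg 𝔤 U := gen (gaugeBarL r l, Λ)
/-- The Noether antifield jet `c̄_{Λ r}`. -/
def ghBar (r : ι) (Λ : Multiset (Fin n)) : Alg 𝔤 U := gen (ghostBarL n r, Λ)

/-- The strength `ℱ^r_{λμ} = a^r_{λμ} - a^r_{μλ} + c^r_{ij} a^i_λ a^j_μ`, where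
`a^r_{λμ} = d_λ a^r_μ`. -/
def strength (r : ι) (l m : Fin n) : Alg 𝔤 U :=
  a 𝔤 r m {l} - a 𝔤 r l {m} + ∑ i, ∑ j, 𝔤.c r i j • (a 𝔤 i l 0 * a 𝔤 j m 0)

/-- The graded Yang-Mills Lagrangian
`¼ h_{ij} g^{λμ} g^{βν} ℱ^i_{λβ} ℱ^j_{μν} √|det g|`, with `h_{ij}` the inverse of `h^{ij}`. -/
def lagrangian [DecidableEq ι] (g : MetricTensor U) (h : Matrix ι ι ℝ) : Alg 𝔤 U :=
  ∑ i, ∑ j, ∑ l, ∑ m, ∑ b, ∑ k, (1 / 4 * h⁻¹ i j) •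
    (ofBase (g.coeff l m b k) (g.coeff_smooth l m b k) * strength 𝔤 i l b * strength 𝔤 j m k)

/-- The Noether operators `Δ_j = c^r_{ji} a^i_λ ā^λ_r + d_λ ā^λ_j`. -/
def noetherOp (j : ι) : Alg 𝔤 U :=
  ∑ r, ∑ i, ∑ l, 𝔤.c r j i • (a 𝔤 i l 0 * aBar 𝔤 r l 0) + ∑ l, aBar 𝔤 j l {l}

/-- `u^r_λ = c^r_λ - c^r_{ji} c^j a^i_λ`. -/
def gaugeComp (r : ι) (l : Fin n) : Alg 𝔤 U :=
  gh 𝔤 r {l} - ∑ j, ∑ i, 𝔤.c r j i • (gh 𝔤 j 0 * a 𝔤 i l 0 : Alg 𝔤 U)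

/-- `γ^r = -½ (-1)^{[i]} c^r_{ij} c^i c^j`. -/
def ghostComp (r : ι) : Alg 𝔤 U :=
  -∑ i, ∑ j, (1 / 2 * sgn (𝔤.par i) * 𝔤.c r i j) • (gh 𝔤 i 0 * gh 𝔤 j 0 : Alg 𝔤 U)

/-- The gauge operator `u = u^r_λ ∂/∂a^r_λ`. -/
def gaugeOp : YMField ι n ⊕ YMField ι n → Alg 𝔤 U :=
  Sum.elim (Sum.elim (fun p => gaugeComp 𝔤 p.1 p.2) fun _ => 0) fun _ => 0

/-- The BRST operator `u^r_λ ∂/∂a^r_λ + γ^r ∂/∂c^r`. -/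
def brstOp : YMField ι n ⊕ YMField ι n → Alg 𝔤 U :=
  gaugeOp 𝔤 + Sum.elim (Sum.elim (fun _ => 0) fun r => ghostComp 𝔤 r) fun _ => 0

/-- `L_E = L + u^r_λ ā^λ_r + γ^r c̄_r`. -/
def extendedLagrangian [DecidableEq ι] (g : MetricTensor U) (h : Matrix ι ι ℝ) : Alg 𝔤 U :=
  lagrangian 𝔤 g h + ∑ r, ∑ l, gaugeComp 𝔤 r l * aBar 𝔤 r l 0
    + ∑ r, ghostComp 𝔤 r * ghBar 𝔤 r 0

end YM

end

end SuperYM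

open TopologicalSpace
open scoped TensorProduct ContDiff

namespace SuperYM

noncomputable section

/-! ## Calculus of smooth functions of base and fibre coordinates -/

/-! ### Smoothness of integrals depending on parameters. -/

section ParametricIntegral

open MeasureTheory

variable {E : Type*} [NormedAddCommGroup E] [NormedSpace ℝ E] [FiniteDimensional ℝ E]

/-! All assertions except completeness are graded algebra, resting on the Jacobi identity and on the
invariance of the bilinear form `h⁻¹`.

Invariance. Centrality of `h^{ij} e_i e_j` says that its bracket with each `e_k` vanishes in the
enveloping algebra; that the coefficients of this bracket vanish is an instance of the
Poincaré-Birkhoff-Witt theorem in degree two. The theorem is used in dual form: a function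
prescribed on normally ordered words extends to all words compatibly with the relations
(`defect_normalForm`). This is a diamond lemma, in which two overlapping ways of reordering are
compared by the Jacobi identity. It yields `casimirBracket_eq_zero`, and inverting the matrix yields
`invariance`.

Noether identities and symmetries. The Yang-Mills expressions are covariant divergences of momenta
that are antisymmetric in their two base indices. In the second covariant divergence, symmetrization
leaves only the contraction of the bracket of strengths with momenta, which vanishes by invariance
(`noether_identity`). Contracted with ghosts, the identity turns `u^A ℰ_A` into a total divergence,
and the first variational formula makes `u` a variational symmetry. The BRST operator `b` is odd, so
`b² = 0` need only be checked on its components, where it is the Jacobi identity again. Since the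
antifield part of `L_E` is linear in antifields with the components of `b` as coefficients, the
antibracket is `2 b^A δL_E/δs^A`; up to a divergence this is `2 b(L_E) = 2 b(L_YM)`, which is exact.

Independence and irreducibility. `Δ_j` contains the first derivatives `∑ d_l ā^l_j` with coefficient
one, while every antifield coefficient of a boundary of a quadratic chain vanishes on-shell. Reading
off the coefficient of a leading antifield jet, by descending induction on the jet order, shows that
the coefficients of a two-cycle vanish on-shell. For coefficients depending on `x` only, evaluation
on the zero section, where all equations hold, gives zero.

Completeness. Fix a base index `l0`. The relation `d_Ξ Δ_j` expresses `ā^{l0}_j` with jet index `l0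
+ Ξ` through the other antifield jets, so a one-cycle reduces modulo the `d_Ξ Δ_j` to a combination
of the remaining, independent jets (`bar_mem_sup_fieldSpan`). The corresponding equations `d_Λ ℰ`
must be shown to behave like a regular sequence. Their leading symbols are linearly independent
(`eq_zero_of_sum_symbolEntry`): a relation among them is a polynomial identity `∑ Q_l (p^l p^k -
g^{lk} p²) = 0`, which forces the `Q_l` to be proportional to `p_l`, and this is excluded by the
choice of independent jets as soon as there are two base indices. A smooth right inverse of the
symbol matrix gives, for each independent equation `E`, a vertical derivation `D` with coefficients
depending on `x` only, such that `D E = 1` and `D` kills the other independent equations of no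
higher order (`exists_isSeparating`). Along the flow of `D` the equation `E` is a coordinate. For
even `E`, integrating along the flow inverts `1 + E D`, first on smooth functions
(`bijective_add_mul_baseField`), then on graded functions since souls are nilpotent
(`bijective_add_mul_baseDer`); for odd `E` everything is algebraic as `D² = E² = 0`. With these
divisions, equations are eliminated one at a time, highest order first, every exchange of equations
being a Koszul boundary (`sum_mul_bar_mem_boundaries`). -/

theorem hasFDerivAt_integral_unitInterval {O : Set E} (hO : IsOpen O) {K : E × ℝ → ℝ}
    (hK : ContDiffOn ℝ 1 K (O ×ˢ Set.univ)) {p : E} (hp : p ∈ O) :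
    IntervalIntegrable (fun s => (fderiv ℝ K (p, s)).comp (ContinuousLinearMap.inl ℝ E ℝ))
        volume 0 1 ∧
      HasFDerivAt (fun p => ∫ s in (0 : ℝ)..1, K (p, s))
        (∫ s in (0 : ℝ)..1, (fderiv ℝ K (p, s)).comp (ContinuousLinearMap.inl ℝ E ℝ)) p := by
  have hOU : IsOpen (O ×ˢ (Set.univ : Set ℝ)) := hO.prod isOpen_univ
  have hK' : ContinuousOn (fun q : E × ℝ => (fderiv ℝ K q).comp (ContinuousLinearMap.inl ℝ E ℝ))
      (O ×ˢ Set.univ) :=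
    (hK.continuousOn_fderiv_of_isOpen hOU le_rfl).clm_comp continuousOn_const
  have hslice : ∀ q ∈ O, Continuous fun s : ℝ => K (q, s) := fun q hq => by
    refine continuousOn_univ.1 (hK.continuousOn.comp (by fun_prop) fun s _ => ⟨hq, trivial⟩)
  have hslice' : ∀ q ∈ O, Continuous fun s : ℝ =>
      (fderiv ℝ K (q, s)).comp (ContinuousLinearMap.inl ℝ E ℝ) := fun q hq =>
    continuousOn_univ.1 (hK'.comp (f := fun s : ℝ => (q, s)) (by fun_prop)
      fun s _ => ⟨hq, trivial⟩)
  obtain ⟨ε, hε, hball⟩ := Metric.nhds_basis_closedBall.mem_iff.1 (hO.mem_nhds hp)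
  have hcomp : IsCompact (Metric.closedBall p ε ×ˢ Set.Icc (0 : ℝ) 1) :=
    (isCompact_closedBall p ε).prod isCompact_Icc
  -- The dominating constant: the partial derivative is continuous, hence bounded on a compact ball
  -- times the interval.
  obtain ⟨C, hC⟩ := hcomp.exists_bound_of_continuousOn
    (hK'.mono fun q hq => ⟨hball hq.1, trivial⟩)
  refine ⟨(hslice' p hp).intervalIntegrable _ _, ?_⟩
  refine intervalIntegral.hasFDerivAt_integral_of_dominated_of_fderiv_le
    (F := fun p s => K (p, s)) (bound := fun _ => C)
    (F' := fun p s => (fderiv ℝ K (p, s)).comp (ContinuousLinearMap.inl ℝ E ℝ))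
    (Metric.closedBall_mem_nhds p hε) ?_ ((hslice p hp).intervalIntegrable _ _)
    (hslice' p hp).aestronglyMeasurable ?_ intervalIntegrable_const ?_
  · filter_upwards [hO.mem_nhds hp] with q hq
    exact (hslice q hq).aestronglyMeasurable
  · refine Filter.Eventually.of_forall fun s hs q hq => hC (q, s) ⟨hq, ?_⟩
    rw [Set.uIoc_of_le zero_le_one] at hs
    exact ⟨hs.1.le, hs.2⟩
  · refine Filter.Eventually.of_forall fun s _ q hq => ?_
    have h1 : HasFDerivAt K (fderiv ℝ K (q, s)) (q, s) :=
      ((hK.contDiffAt (hOU.mem_nhds ⟨hball hq, trivial⟩)).differentiableAt (by simp)).hasFDerivAt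
    exact h1.comp q (hasFDerivAt_prodMk_left q s)

/-- Each directional derivative of the integral is the integral of a smooth integrand of the same
kind, so the order of differentiability rises by induction over all integrands at once. -/
theorem contDiffOn_integral_unitInterval {O : Set E} (hO : IsOpen O) {K : E × ℝ → ℝ}
    (hK : ContDiffOn ℝ ∞ K (O ×ˢ Set.univ)) :
    ContDiffOn ℝ ∞ (fun p => ∫ s in (0 : ℝ)..1, K (p, s)) O := by
  refine contDiffOn_infty.2 fun m => ?_
  induction m generalizing K with
  | zero =>
    refine contDiffOn_zero.2 fun p hp => ?_
    exact (hasFDerivAt_integral_unitInterval hO (hK.of_le (by simp)) hp).2.continuousAt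
      |>.continuousWithinAt
  | succ m ih =>
    have hd := fun p hp => hasFDerivAt_integral_unitInterval hO (p := p) (hK.of_le (by simp)) hp
    rw [Nat.cast_succ, contDiffOn_succ_iff_fderiv_apply hO.uniqueDiffOn]
    refine ⟨fun p hp => (hd p hp).2.differentiableAt.differentiableWithinAt, by simp, fun y => ?_⟩
    have hOU : IsOpen (O ×ˢ (Set.univ : Set ℝ)) := hO.prod isOpen_univ
    refine (ih (K := fun q => fderiv ℝ K q (y, 0))
      ((hK.fderiv_of_isOpen (m := ∞) hOU (by simp)).clm_apply contDiffOn_const)).congr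
      fun p hp => ?_
    rw [fderivWithin_of_isOpen hO hp, (hd p hp).2.fderiv,
      ContinuousLinearMap.intervalIntegral_apply (hd p hp).1]
    simp

end ParametricIntegral

/-! ### Partial derivatives, and vector fields that straighten a function. -/

section Smooth

variable {n : ℕ} {U : Opens (Fin n → ℝ)} {V : Type*}

@[ext]
theorem SmoothFn.ext {f g : SmoothFn U V} (h : ∀ x y, f.1 (x, y) = g.1 (x, y)) : f = g :=
  Subtype.ext (funext fun p => h p.1 p.2)

theorem isOpen_chart (t : Finset V) :
    IsOpen ((U : Set (Fin n → ℝ)) ×ˢ (Set.univ : Set (t → ℝ))) :=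
  U.isOpen.prod isOpen_univ

/-- `F` represents the smooth function `f` in the coordinates `x` and `y v`, `v ∈ t`. -/
def Represents (t : Finset V) (F : (Fin n → ℝ) × (t → ℝ) → ℝ) (f : SmoothFn U V) : Prop :=
  ContDiffOn ℝ ∞ F ((U : Set (Fin n → ℝ)) ×ˢ Set.univ) ∧
    ∀ x y, f.1 (x, y) = F (x, fun v => y v)

open scoped Classical in
theorem exists_represents (f : SmoothFn U V) (s : Finset V) :
    ∃ t, s ⊆ t ∧ ∃ F, Represents t F f := by
  obtain ⟨s', hs'⟩ := IsSmoothFn.enlarge f.2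
  exact ⟨s ∪ s', Finset.subset_union_left, hs' _ Finset.subset_union_right⟩

open scoped Classical in
theorem exists_represents₂ (f g : SmoothFn U V) (s : Finset V) :
    ∃ t, s ⊆ t ∧ (∃ F, Represents t F f) ∧ ∃ G, Represents t G g := by
  obtain ⟨s₁, h₁⟩ := IsSmoothFn.enlarge f.2
  obtain ⟨s₂, h₂⟩ := IsSmoothFn.enlarge g.2
  exact ⟨s ∪ (s₁ ∪ s₂), Finset.subset_union_left,
    h₁ _ (Finset.subset_union_left.trans Finset.subset_union_right),
    h₂ _ (Finset.subset_union_right.trans Finset.subset_union_right)⟩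

namespace Represents

variable {t : Finset V} {F : (Fin n → ℝ) × (t → ℝ) → ℝ} {f : SmoothFn U V}

open scoped Classical in
theorem fibreDeriv (hF : Represents t F f) {v : V} (hv : v ∈ t) :
    Represents t (fun p => fderiv ℝ F p (0, Pi.single ⟨v, hv⟩ 1)) (fibreDeriv v f) :=
  ⟨fderiv_smooth hF.1 _, fun x y => (fibre_hasDerivAt v hv hF.1 hF.2 x y).deriv⟩

open scoped Classical in
theorem baseDeriv (hF : Represents t F f) (l : Fin n) :
    Represents t (fun p => fderiv ℝ F p (Pi.single l 1, 0)) (baseDeriv l f) :=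
  ⟨fderiv_smooth hF.1 _, fun x y => (base_hasDerivAt l hF.1 hF.2 x y).deriv⟩

theorem contDiffAt (hF : Represents t F f) (x : U) (y : t → ℝ) :
    ContDiffAt ℝ ∞ F ((x : Fin n → ℝ), y) :=
  hF.1.contDiffAt ((isOpen_chart t).mem_nhds ⟨x.2, trivial⟩)

/-- Symmetry of the second derivative, in arbitrary directions: it covers base-base, base-fibre and
fibre-fibre commutation at once. -/
theorem fderiv_fderiv_comm (hF : Represents t F f) (x : U) (y : t → ℝ)
    (a b : (Fin n → ℝ) × (t → ℝ)) :
    fderiv ℝ (fun p => fderiv ℝ F p a) ((x : Fin n → ℝ), y) b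
      = fderiv ℝ (fun p => fderiv ℝ F p b) ((x : Fin n → ℝ), y) a := by
  have hd : DifferentiableAt ℝ (fderiv ℝ F) ((x : Fin n → ℝ), y) :=
    ((hF.contDiffAt x y).fderiv_right (m := ∞) (by simp)).differentiableAt (by simp)
  have hs : IsSymmSndFDerivAt ℝ F ((x : Fin n → ℝ), y) :=
    (hF.contDiffAt x y).isSymmSndFDerivAt (by
      rw [minSmoothness_of_isRCLikeNormedField]
      exact WithTop.coe_le_coe.2 (le_top : (2 : ℕ∞) ≤ ⊤))
  rw [fderiv_clm_apply hd (differentiableAt_const a), fderiv_clm_apply hd (differentiableAt_const b)]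
  simpa using hs b a

end Represents

open scoped Classical in
theorem fibreDeriv_hasDerivAt (f : SmoothFn U V) (v : V) (x : U) (y : V → ℝ) :
    HasDerivAt (fun s : ℝ => f.1 (x, Function.update y v s)) ((fibreDeriv v f).1 (x, y)) (y v) := by
  obtain ⟨t, ht, F, hF⟩ := exists_represents f {v}
  have hv : v ∈ t := ht (Finset.mem_singleton_self v)
  rw [(hF.fibreDeriv hv).2]
  exact fibre_hasDerivAt v hv hF.1 hF.2 x y

open scoped Classical in
theorem baseDeriv_hasDerivAt (f : SmoothFn U V) (l : Fin n) (x : U) (y : V → ℝ) :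
    HasDerivAt (fun s : ℝ => if h : (x : Fin n → ℝ) + s • Pi.single l 1 ∈ U
      then f.1 (⟨_, h⟩, y) else 0) ((baseDeriv l f).1 (x, y)) 0 := by
  obtain ⟨t, -, F, hF⟩ := exists_represents f ∅
  rw [(hF.baseDeriv l).2]
  exact base_hasDerivAt l hF.1 hF.2 x y

theorem fibreDeriv_mul (v : V) (f g : SmoothFn U V) :
    fibreDeriv v (f * g) = fibreDeriv v f * g + f * fibreDeriv v g := by
  classical
  ext x y
  have h := (fibreDeriv_hasDerivAt f v x y).mul (fibreDeriv_hasDerivAt g v x y)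
  have h' := fibreDeriv_hasDerivAt (f * g) v x y
  simpa using h'.unique h

theorem baseDeriv_mul (l : Fin n) (f g : SmoothFn U V) :
    baseDeriv l (f * g) = baseDeriv l f * g + f * baseDeriv l g := by
  classical
  ext x y
  have h := (baseDeriv_hasDerivAt f l x y).mul (baseDeriv_hasDerivAt g l x y)
  have h' := baseDeriv_hasDerivAt (f * g) l x y
  have e : (fun s : ℝ => if h : (x : Fin n → ℝ) + s • Pi.single l 1 ∈ U
      then (f * g).1 (⟨_, h⟩, y) else 0) = (fun s : ℝ => if h : (x : Fin n → ℝ) + s •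
      Pi.single l 1 ∈ U then f.1 (⟨_, h⟩, y) else 0) * (fun s : ℝ => if h : (x : Fin n → ℝ) + s •
      Pi.single l 1 ∈ U then g.1 (⟨_, h⟩, y) else 0) := by
    funext s
    by_cases hs : (x : Fin n → ℝ) + s • Pi.single l 1 ∈ U <;> simp [hs]
  rw [e] at h'
  simpa using h'.unique h

theorem fibreDeriv_comm (v w : V) (f : SmoothFn U V) :
    fibreDeriv v (fibreDeriv w f) = fibreDeriv w (fibreDeriv v f) := by
  classical
  obtain ⟨t, ht, F, hF⟩ := exists_represents f {v, w}
  have hv : v ∈ t := ht (by simp)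
  have hw : w ∈ t := ht (by simp)
  ext x y
  rw [((hF.fibreDeriv hw).fibreDeriv hv).2, ((hF.fibreDeriv hv).fibreDeriv hw).2]
  exact hF.fderiv_fderiv_comm x _ _ _

theorem baseDeriv_comm (l m : Fin n) (f : SmoothFn U V) :
    baseDeriv l (baseDeriv m f) = baseDeriv m (baseDeriv l f) := by
  obtain ⟨t, -, F, hF⟩ := exists_represents f ∅
  ext x y
  rw [((hF.baseDeriv m).baseDeriv l).2, ((hF.baseDeriv l).baseDeriv m).2]
  exact hF.fderiv_fderiv_comm x _ _ _

theorem baseDeriv_fibreDeriv (l : Fin n) (v : V) (f : SmoothFn U V) :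
    baseDeriv l (fibreDeriv v f) = fibreDeriv v (baseDeriv l f) := by
  classical
  obtain ⟨t, ht, F, hF⟩ := exists_represents f {v}
  have hv : v ∈ t := ht (by simp)
  ext x y
  rw [((hF.fibreDeriv hv).baseDeriv l).2, ((hF.baseDeriv l).fibreDeriv hv).2]
  exact hF.fderiv_fderiv_comm x _ _ _

theorem fibreDeriv_one (v : V) : fibreDeriv v (1 : SmoothFn U V) = 0 := by
  have := fibreDeriv_mul v (1 : SmoothFn U V) 1
  rw [one_mul, mul_one, one_mul] at this
  exact left_eq_add.1 this

theorem baseDeriv_one (l : Fin n) : baseDeriv l (1 : SmoothFn U V) = 0 := by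
  have := baseDeriv_mul l (1 : SmoothFn U V) 1
  rw [one_mul, mul_one, one_mul] at this
  exact left_eq_add.1 this

theorem fibreDeriv_coordFn_self (v : V) : fibreDeriv v (coordFn v : SmoothFn U V) = 1 := by
  classical
  ext x y
  refine (fibreDeriv_hasDerivAt _ v x y).unique ?_
  simpa [coordFn] using hasDerivAt_id' (y v)

theorem fibreDeriv_coordFn_of_ne {v w : V} (h : w ≠ v) :
    fibreDeriv v (coordFn w : SmoothFn U V) = 0 := by
  classical
  ext x y
  refine (fibreDeriv_hasDerivAt _ v x y).unique ?_
  simpa [coordFn, Function.update_of_ne h] using hasDerivAt_const (y v) (y w)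

theorem baseDeriv_coordFn (l : Fin n) (v : V) : baseDeriv l (coordFn v : SmoothFn U V) = 0 := by
  classical
  ext x y
  refine (baseDeriv_hasDerivAt _ l x y).unique ?_
  have hx : ∀ᶠ s : ℝ in nhds 0, (x : Fin n → ℝ) + s • (Pi.single l 1 : Fin n → ℝ) ∈ U := by
    have : Continuous fun s : ℝ => (x : Fin n → ℝ) + s • (Pi.single l 1 : Fin n → ℝ) := by
      fun_prop
    refine this.continuousAt.eventually_mem (U.isOpen.mem_nhds ?_)
    simp
  refine (hasDerivAt_const (0 : ℝ) (y v)).congr_of_eventuallyEq ?_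
  filter_upwards [hx] with s hs
  rw [dif_pos hs]
  rfl

theorem fibreDeriv_baseFn (v : V) (f : (Fin n → ℝ) → ℝ) (hf : ContDiffOn ℝ ∞ f U) :
    fibreDeriv v (baseFn f hf : SmoothFn U V) = 0 := by
  classical
  ext x y
  exact (fibreDeriv_hasDerivAt _ v x y).unique (hasDerivAt_const (y v) (f x))

/-- A smooth function with vanishing fibre derivatives does not depend on the fibre coordinates. -/
theorem eq_of_fibreDeriv_eq_zero {f : SmoothFn U V} (hf : ∀ v, fibreDeriv v f = 0) (x : U)
    (y z : V → ℝ) : f.1 (x, y) = f.1 (x, z) := by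
  classical
  have hupd : ∀ (y : V → ℝ) (v : V) (s : ℝ), f.1 (x, Function.update y v s) = f.1 (x, y) := by
    intro y v s
    have hd : ∀ s, HasDerivAt (fun s : ℝ => f.1 (x, Function.update y v s)) 0 s := fun s => by
      have := fibreDeriv_hasDerivAt f v x (Function.update y v s)
      simpa [hf] using this
    have := is_const_of_deriv_eq_zero (fun s => (hd s).differentiableAt) (fun s => (hd s).deriv) s
      (y v)
    simpa using this
  obtain ⟨t, -, F, hF⟩ := exists_represents f ∅
  -- Only finitely many coordinates matter, so those of `y` may be replaced by those of `z` one at a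
  -- time.
  have key : ∀ s : Finset V, f.1 (x, fun v => if v ∈ s then z v else y v) = f.1 (x, y) := by
    intro s
    induction s using Finset.induction_on with
    | empty => simp
    | insert v s hv ih =>
      rw [← ih, ← hupd (fun w => if w ∈ s then z w else y w) v (z v)]
      refine congrArg (fun y => f.1 (x, y)) (funext fun w => ?_)
      by_cases hw : w = v
      · subst hw; simp
      · simp [hw]
  rw [← key t, hF.2, hF.2]
  congr 2
  funext v
  simp

/-- The vertical vector field `∑ β^v(x) ∂/∂y^v`, with `v` running over a finite set. -/
def baseField (s : Finset V) (β : V → (Fin n → ℝ) → ℝ) (hβ : ∀ v, ContDiffOn ℝ ∞ (β v) U) :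
    SmoothFn U V →ₗ[ℝ] SmoothFn U V :=
  ∑ v ∈ s, LinearMap.mulLeft ℝ (baseFn (β v) (hβ v)) ∘ₗ fibreDeriv v

variable (s : Finset V) (β : V → (Fin n → ℝ) → ℝ) (hβ : ∀ v, ContDiffOn ℝ ∞ (β v) U)

theorem baseField_apply (f : SmoothFn U V) :
    baseField s β hβ f = ∑ v ∈ s, baseFn (β v) (hβ v) * fibreDeriv v f := by
  simp [baseField]

theorem baseField_val (f : SmoothFn U V) (x : U) (y : V → ℝ) :
    (baseField s β hβ f).1 (x, y) = ∑ v ∈ s, β v x * (fibreDeriv v f).1 (x, y) := by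
  rw [baseField_apply]
  have : ∀ p, (∑ v ∈ s, baseFn (β v) (hβ v) * fibreDeriv v f : SmoothFn U V).1 p
      = ∑ v ∈ s, (baseFn (β v) (hβ v) * fibreDeriv v f : SmoothFn U V).1 p := fun p => by
    rw [AddSubmonoidClass.coe_finsetSum, Finset.sum_apply]
  rw [this]
  rfl

open scoped Classical in
/-- The flow of the vector field `baseField`. -/
def baseFlow (x : Fin n → ℝ) (y : V → ℝ) (c : ℝ) : V → ℝ :=
  fun v => y v + c * (if v ∈ s then β v x else 0)

/-- The coefficients do not depend on the fibre coordinates, so the flow is a translation in each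
fibre and exists for all times. Working in finitely many coordinates that include `s` makes this the
chain rule. -/
theorem baseFlow_hasDerivAt (f : SmoothFn U V) (x : U) (y : V → ℝ) (c : ℝ) :
    HasDerivAt (fun c => f.1 (x, baseFlow s β x y c))
      ((baseField s β hβ f).1 (x, baseFlow s β x y c)) c := by
  classical
  obtain ⟨t, ht, F, hF⟩ := exists_represents f s
  set d : (Fin n → ℝ) × (t → ℝ) := (0, fun w => if (w : V) ∈ s then β w x else 0) with hd
  have hc : HasDerivAt (fun c : ℝ => ((x : Fin n → ℝ), fun w : t => baseFlow s β x y c w)) d c := by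
    refine (hasDerivAt_const _ _).prodMk (hasDerivAt_pi.2 fun w => ?_)
    simpa [baseFlow] using ((hasDerivAt_id c).mul_const (if (w : V) ∈ s then β w x else 0)).const_add
      (y w)
  have hF' : HasFDerivAt F (fderiv ℝ F ((x : Fin n → ℝ), fun w : t => baseFlow s β x y c w))
      ((x : Fin n → ℝ), fun w : t => baseFlow s β x y c w) :=
    ((hF.contDiffAt x _).differentiableAt (by simp)).hasFDerivAt
  have hcomp := hF'.comp_hasDerivAt c hc
  have hval : (baseField s β hβ f).1 (x, baseFlow s β x y c)
      = fderiv ℝ F ((x : Fin n → ℝ), fun w : t => baseFlow s β x y c w) d := by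
    have hdsum : d = ∑ v ∈ s.attach, β v x •
        ((0, Pi.single ⟨v, ht v.2⟩ 1) : (Fin n → ℝ) × (t → ℝ)) := by
      refine Prod.ext ?_ ?_
      · simp [hd, Prod.fst_sum]
      · rw [Prod.snd_sum]
        funext w
        rw [Finset.sum_apply]
        by_cases hw : (w : V) ∈ s
        · rw [Finset.sum_eq_single ⟨(w : V), hw⟩]
          · simp [hd, hw]
          · intro v _ hv
            have : w ≠ (⟨(v : V), ht v.2⟩ : t) := fun h => hv (Subtype.ext (congrArg Subtype.val h).symm)
            simp [this]
          · simp
        · rw [Finset.sum_eq_zero]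
          · simp [hd, hw]
          · intro v _
            have : w ≠ (⟨(v : V), ht v.2⟩ : t) := fun h => hw (by rw [h]; exact v.2)
            simp [this]
    rw [baseField_val, hdsum, map_sum, ← Finset.sum_attach]
    refine Finset.sum_congr rfl fun v _ => ?_
    rw [map_smul, (hF.fibreDeriv (ht v.2)).2, smul_eq_mul]
  rw [hval]
  refine hcomp.congr_of_eventuallyEq (Filter.Eventually.of_forall fun c => ?_)
  simp only [hF.2, Function.comp]

theorem baseFlow_zero (x : Fin n → ℝ) (y : V → ℝ) : baseFlow s β x y 0 = y := by
  funext v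
  simp [baseFlow]

theorem baseFlow_baseFlow (x : Fin n → ℝ) (y : V → ℝ) (b c : ℝ) :
    baseFlow s β x (baseFlow s β x y b) c = baseFlow s β x y (b + c) := by
  funext v
  simp only [baseFlow]
  ring

variable {e : SmoothFn U V}

/-- Since `D e = 1`, the function `e` is the time along flow lines up to an additive constant. -/
theorem baseFlow_coordinate (he : baseField s β hβ e = 1) (x : U) (y : V → ℝ) (c : ℝ) :
    e.1 (x, baseFlow s β x y c) = e.1 (x, y) + c := by
  have hd : ∀ c, HasDerivAt (fun c => e.1 (x, baseFlow s β x y c) - c) 0 c := fun c => by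
    have := (baseFlow_hasDerivAt s β hβ e x y c).sub (hasDerivAt_id' c)
    rw [he] at this
    exact this.congr_deriv (sub_self 1)
  have := is_const_of_deriv_eq_zero (fun c => (hd c).differentiableAt) (fun c => (hd c).deriv) c 0
  simp only [baseFlow_zero, sub_zero] at this
  linarith

/-- The integral `∫₀¹ f(x, y + (s-1) e(x,y) β(x)) ds`. -/
def integralAlong (e f : SmoothFn U V) : SmoothFn U V :=
  ⟨fun p => ∫ r in (0 : ℝ)..1, f.1 (p.1, baseFlow s β p.1 p.2 ((r - 1) * e.1 p)), by
    classical
    obtain ⟨t, ht, ⟨F, hF⟩, ⟨G, hG⟩⟩ := exists_represents₂ f e s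
    refine ⟨t, fun p => ∫ r in (0 : ℝ)..1, F (p.1, fun w => p.2 w + (r - 1) * G p *
      (if (w : V) ∈ s then β w p.1 else 0)), ?_, ?_⟩
    · refine contDiffOn_integral_unitInterval (isOpen_chart t)
        (K := fun q => F (q.1.1, fun w => q.1.2 w + (q.2 - 1) * G q.1 *
          (if (w : V) ∈ s then β w q.1.1 else 0))) ?_
      have h1 : ContDiffOn ℝ ∞ (fun q : ((Fin n → ℝ) × (t → ℝ)) × ℝ => G q.1)
          (((U : Set (Fin n → ℝ)) ×ˢ Set.univ) ×ˢ Set.univ) :=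
        hG.1.comp (f := fun q : ((Fin n → ℝ) × (t → ℝ)) × ℝ => q.1)
          contDiff_fst.contDiffOn fun q hq => hq.1
      refine hF.1.comp (t := (U : Set (Fin n → ℝ)) ×ˢ Set.univ) (ContDiffOn.prodMk
        (by fun_prop) (contDiffOn_pi.2 fun w => ContDiffOn.add (by fun_prop)
          (((ContDiffOn.sub (by fun_prop) contDiffOn_const).mul h1).mul ?_)))
        fun q hq => ⟨hq.1.1, trivial⟩
      by_cases hw : (w : V) ∈ s
      · simp only [hw, if_true]
        exact (hβ w).comp (f := fun q : ((Fin n → ℝ) × (t → ℝ)) × ℝ => q.1.1)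
          (by fun_prop) fun q hq => hq.1.1
      · simp only [hw, if_false]
        exact contDiffOn_const
    · intro x y
      simp only [hF.2, hG.2]
      rfl⟩

/-- The substitution `r ↦ (e + c) r - e` turns the parameter into flow time. The time `-e(x, y)` is
the one at which the flow line meets `e = 0`, so `e` times the integral is the primitive of `f`
along the flow line that vanishes there. -/
theorem integralAlong_baseFlow (he : baseField s β hβ e = 1) (f : SmoothFn U V) (x : U)
    (y : V → ℝ) (c : ℝ) :
    (e.1 (x, y) + c) * (integralAlong s β hβ e f).1 (x, baseFlow s β x y c)
      = ∫ r in (-e.1 (x, y))..c, f.1 (x, baseFlow s β x y r) := by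
  have h := intervalIntegral.mul_integral_comp_mul_add
    (f := fun r => f.1 (x, baseFlow s β x y r)) (a := 0) (b := 1) (e.1 (x, y) + c) (-e.1 (x, y))
  rw [show (e.1 (x, y) + c) * 0 + -e.1 (x, y) = -e.1 (x, y) by ring,
    show (e.1 (x, y) + c) * 1 + -e.1 (x, y) = c by ring] at h
  rw [← h]
  congr 1
  change (∫ r in (0 : ℝ)..1, f.1 (x, baseFlow s β x (baseFlow s β x y c)
    ((r - 1) * e.1 (x, baseFlow s β x y c)))) = _
  refine intervalIntegral.integral_congr fun r _ => ?_
  simp only [baseFlow_baseFlow, baseFlow_coordinate s β hβ he]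
  rw [show c + (r - 1) * (e.1 (x, y) + c) = (e.1 (x, y) + c) * r + -e.1 (x, y) by ring]

/-- If `e` is a fibre coordinate along the vector field `D`, then `1 + e D` is invertible. -/
theorem bijective_add_mul_baseField (he : baseField s β hβ e = 1) :
    Function.Bijective fun f : SmoothFn U V => f + e * baseField s β hβ f := by
  constructor
  · intro f g hfg
    rw [← sub_eq_zero]
    have hfg' : (f - g) + e * baseField s β hβ (f - g) = 0 := by
      rw [map_sub, mul_sub]
      simp only at hfg
      linear_combination hfg
    generalize f - g = k at hfg'
    have hk : ∀ x y, k.1 (x, y) + e.1 (x, y) * (baseField s β hβ k).1 (x, y) = 0 := fun x y =>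
      congrFun (congrArg Subtype.val hfg') (x, y)
    ext x y
    -- As `k + e D k = D(e k)`, the product `e k` is constant along flow lines, and it vanishes
    -- where the line meets `e = 0`.
    have hd : ∀ c, HasDerivAt (fun c => (e.1 (x, y) + c) * k.1 (x, baseFlow s β x y c)) 0 c := by
      intro c
      have := ((hasDerivAt_id c).const_add (e.1 (x, y))).mul (baseFlow_hasDerivAt s β hβ k x y c)
      refine this.congr_deriv ?_
      have := hk x (baseFlow s β x y c)
      rw [baseFlow_coordinate s β hβ he] at this
      simpa using this
    have := is_const_of_deriv_eq_zero (fun c => (hd c).differentiableAt) (fun c => (hd c).deriv) 0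
      (-e.1 (x, y))
    simp only [baseFlow_zero, add_neg_cancel, zero_mul, add_zero, mul_eq_zero] at this
    -- From `e k = 0`: at points where `e` vanishes, the equation `k + e D k = 0` itself gives `k =
    -- 0`.
    rcases this with h | h
    · have := hk x y
      rwa [h, zero_mul, add_zero] at this
    · exact h
  · intro f
    refine ⟨integralAlong s β hβ e f, ?_⟩
    ext x y
    -- With `F` the integral, `F + e D F = D(e F)` is the derivative along the flow of the primitive
    -- of `f`; the fundamental theorem of calculus returns `f`.
    have h1 := ((hasDerivAt_id (0 : ℝ)).const_add (e.1 (x, y))).mul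
      (baseFlow_hasDerivAt s β hβ (integralAlong s β hβ e f) x y 0)
    have hc : Continuous fun r => f.1 (x, baseFlow s β x y r) :=
      continuous_iff_continuousAt.2 fun r => (baseFlow_hasDerivAt s β hβ f x y r).continuousAt
    have h2 : HasDerivAt (fun c => ∫ r in (-e.1 (x, y))..c, f.1 (x, baseFlow s β x y r))
        (f.1 (x, baseFlow s β x y 0)) 0 :=
      intervalIntegral.integral_hasDerivAt_right (hc.intervalIntegrable _ _)
        (hc.stronglyMeasurableAtFilter _ _) hc.continuousAt
    have h3 := h1.unique (h2.congr_of_eventuallyEq (Filter.Eventually.of_forall fun c =>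
      integralAlong_baseFlow s β hβ he f x y c))
    simpa [baseFlow_zero] using h3

end Smooth

end

end SuperYM

namespace SuperYM

noncomputable section

/-! ## Signs -/

section Signs

theorem parity_cases (s : ZMod 2) : s = 0 ∨ s = 1 := by
  fin_cases s
  · exact Or.inl rfl
  · exact Or.inr rfl

@[simp]
theorem sgn_zero : sgn 0 = 1 := by simp [sgn]

@[simp]
theorem sgn_one : sgn 1 = -1 := pow_one _

@[simp]
theorem parity_one_add_one : (1 : ZMod 2) + 1 = 0 := rfl

theorem sgn_add (s t : ZMod 2) : sgn (s + t) = sgn s * sgn t := by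
  rcases parity_cases s with rfl | rfl <;> rcases parity_cases t with rfl | rfl <;> simp

theorem sgn_mul_self (s : ZMod 2) : sgn s * sgn s = 1 := by
  rcases parity_cases s with rfl | rfl <;> simp

theorem parity_mul_self (s : ZMod 2) : s * s = s := by
  rcases parity_cases s with rfl | rfl <;> simp

theorem parity_add_self (s : ZMod 2) : s + s = 0 := by
  rcases parity_cases s with rfl | rfl <;> simp

end Signs

/-! ## Contractions in the Grassmann algebra -/

section Contraction

open CliffordAlgebra

variable {R M : Type*} [CommRing R] [AddCommGroup M] [Module R M] {Q : QuadraticForm R M}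
  (d : Module.Dual R M)

theorem contractLeft_mul (x y : CliffordAlgebra Q) :
    contractLeft d (x * y) = contractLeft d x * y + involute x * contractLeft d y := by
  induction x using CliffordAlgebra.left_induction with
  | algebraMap r => simp [contractLeft_algebraMap_mul]
  | add x z hx hz =>
    simp only [add_mul, map_add, hx, hz]
    abel
  | ι_mul x m hx =>
    rw [mul_assoc, contractLeft_ι_mul, hx, contractLeft_ι_mul, map_mul, involute_ι]
    simp only [sub_mul, smul_mul_assoc, mul_add, mul_assoc, neg_mul]
    abel

theorem contractLeft_involute (x : CliffordAlgebra Q) :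
    contractLeft d (involute x) = -involute (contractLeft d x) := by
  induction x using CliffordAlgebra.left_induction with
  | algebraMap r => simp
  | add x z hx hz =>
    simp only [map_add, hx, hz]
    abel
  | ι_mul x m hx =>
    rw [map_mul, involute_ι, neg_mul, map_neg, contractLeft_ι_mul, contractLeft_ι_mul, hx,
      map_sub, map_mul, involute_ι, map_smul]
    simp

/-- The sign counts the transpositions needed to bring the removed factor from one end to the other.
Through this identity right graded derivatives reduce to left ones. -/
theorem contractRight_eq_involute (x : CliffordAlgebra Q) :
    contractRight x d = involute (contractLeft d x) := by
  induction x using CliffordAlgebra.right_induction with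
  | algebraMap r => simp
  | add x z hx hz => simp only [map_add, LinearMap.add_apply, hx, hz]
  | mul_ι m x hx =>
    rw [contractRight_mul_ι, hx, contractLeft_mul]
    simp only [map_add, map_mul, involute_ι, contractLeft_ι, involute_involute, AlgHom.commutes,
      mul_neg]
    rw [← Algebra.commutes, ← Algebra.smul_def]
    abel

theorem ι_mul_eq_involute_mul_ι (m : M) (x : ExteriorAlgebra R M) :
    ExteriorAlgebra.ι R m * x = involute x * ExteriorAlgebra.ι R m := by
  induction x using CliffordAlgebra.left_induction with
  | algebraMap r =>
    rw [AlgHom.commutes]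
    exact (Algebra.commutes _ _).symm
  | add x z hx hz => simp only [map_add, mul_add, add_mul, hx, hz]
  | ι_mul x k hx =>
    have hs : ExteriorAlgebra.ι R m * ExteriorAlgebra.ι R k
        = -(ExteriorAlgebra.ι R k * ExteriorAlgebra.ι R m) :=
      eq_neg_of_add_eq_zero_left (ExteriorAlgebra.ι_add_mul_swap m k)
    have hι : CliffordAlgebra.ι (0 : QuadraticForm R M) k = ExteriorAlgebra.ι R k := rfl
    rw [hι, ← mul_assoc, hs, neg_mul, mul_assoc, hx, map_mul, ← hι, involute_ι, hι]
    simp only [neg_mul, mul_assoc]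

/-- The two combinations are twice the even and the odd part of `x`: graded commutativity stated
without decomposing `x`. The two claims are proved together because multiplication by a generator
interchanges them. -/
theorem add_involute_comm (x y : ExteriorAlgebra R M) :
    (x + involute x) * y = y * (x + involute x) ∧
      (x - involute x) * y = involute y * (x - involute x) := by
  induction x using CliffordAlgebra.left_induction generalizing y with
  | algebraMap r =>
    constructor
    · rw [AlgHom.commutes, add_mul, mul_add, Algebra.commutes]
    · simp
  | add x z hx hz =>
    rw [map_add, add_add_add_comm, add_sub_add_comm]
    exact ⟨by rw [add_mul, (hx y).1, (hz y).1, ← mul_add],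
      by rw [add_mul, (hx y).2, (hz y).2, ← mul_add]⟩
  | ι_mul x k hx =>
    have hι : CliffordAlgebra.ι (0 : QuadraticForm R M) k = ExteriorAlgebra.ι R k := rfl
    have e1 : CliffordAlgebra.ι 0 k * x + involute (CliffordAlgebra.ι 0 k * x)
        = ExteriorAlgebra.ι R k * (x - involute x) := by
      rw [map_mul, involute_ι, hι, mul_sub, neg_mul, sub_eq_add_neg]
    have e2 : CliffordAlgebra.ι 0 k * x - involute (CliffordAlgebra.ι 0 k * x)
        = ExteriorAlgebra.ι R k * (x + involute x) := by
      rw [map_mul, involute_ι, hι, mul_add, neg_mul, sub_neg_eq_add]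
    rw [e1, e2]
    constructor
    · rw [mul_assoc, (hx y).2, ← mul_assoc, ι_mul_eq_involute_mul_ι, involute_involute, mul_assoc]
    · rw [mul_assoc, (hx y).1, ← mul_assoc, ι_mul_eq_involute_mul_ι, mul_assoc]

end Contraction

/-! ## The graded commutative algebra of graded functions -/

section JetAlgebra

variable {n : ℕ} {U : Opens (Fin n → ℝ)} {φ : Type*} {par : φ → ZMod 2}

theorem JetAlg.of_mul_of (f g : SmoothFn U (EvenJet n par))
    (w z : ExteriorAlgebra ℝ (OddJet n par →₀ ℝ)) :
    JetAlg.of f w * JetAlg.of g z = JetAlg.of (f * g) (w * z) :=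
  Algebra.TensorProduct.tmul_mul_tmul _ _ _ _

theorem JetAlg.of_add (f : SmoothFn U (EvenJet n par))
    (w z : ExteriorAlgebra ℝ (OddJet n par →₀ ℝ)) :
    JetAlg.of f (w + z) = JetAlg.of f w + JetAlg.of f z :=
  TensorProduct.tmul_add _ _ _

theorem JetAlg.add_of (f g : SmoothFn U (EvenJet n par))
    (w : ExteriorAlgebra ℝ (OddJet n par →₀ ℝ)) :
    JetAlg.of (f + g) w = JetAlg.of f w + JetAlg.of g w :=
  TensorProduct.add_tmul _ _ _

theorem JetAlg.of_neg (f : SmoothFn U (EvenJet n par))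
    (w : ExteriorAlgebra ℝ (OddJet n par →₀ ℝ)) : JetAlg.of f (-w) = -JetAlg.of f w :=
  TensorProduct.tmul_neg _ _

theorem JetAlg.of_smul (r : ℝ) (f : SmoothFn U (EvenJet n par))
    (w : ExteriorAlgebra ℝ (OddJet n par →₀ ℝ)) : JetAlg.of f (r • w) = r • JetAlg.of f w :=
  TensorProduct.tmul_smul _ _ _

/-- The automorphism `x ↦ (-1)^{s[x]} x`. -/
def twist (s : ZMod 2) : JetAlg U par →ₐ[ℝ] JetAlg U par :=
  if s = 0 then AlgHom.id ℝ _ else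
    (Algebra.TensorProduct.map (AlgHom.id ℝ (SmoothFn U (EvenJet n par))) CliffordAlgebra.involute :
      SmoothFn U (EvenJet n par) ⊗[ℝ] ExteriorAlgebra ℝ (OddJet n par →₀ ℝ) →ₐ[ℝ]
        SmoothFn U (EvenJet n par) ⊗[ℝ] ExteriorAlgebra ℝ (OddJet n par →₀ ℝ))

@[simp]
theorem twist_zero (x : JetAlg U par) : twist 0 x = x := by
  simp [twist]

theorem twist_one_of (f : SmoothFn U (EvenJet n par))
    (w : ExteriorAlgebra ℝ (OddJet n par →₀ ℝ)) :
    twist 1 (JetAlg.of f w) = JetAlg.of f (CliffordAlgebra.involute w) := by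
  have h : (twist 1 : JetAlg U par →ₐ[ℝ] JetAlg U par) =
    (Algebra.TensorProduct.map (AlgHom.id ℝ (SmoothFn U (EvenJet n par))) CliffordAlgebra.involute :
      SmoothFn U (EvenJet n par) ⊗[ℝ] ExteriorAlgebra ℝ (OddJet n par →₀ ℝ) →ₐ[ℝ]
        SmoothFn U (EvenJet n par) ⊗[ℝ] ExteriorAlgebra ℝ (OddJet n par →₀ ℝ)) :=
    if_neg one_ne_zero
  rw [h]
  exact Algebra.TensorProduct.map_tmul _ _ _ _

@[simp]
theorem twist_one_twist_one (x : JetAlg U par) : twist 1 (twist 1 x) = x := by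
  induction x using JetAlg.induction with
  | h0 => simp
  | hadd x y hx hy => simp [hx, hy]
  | hof f w => rw [twist_one_of, twist_one_of, CliffordAlgebra.involute_involute]

theorem twist_twist (s t : ZMod 2) (x : JetAlg U par) : twist s (twist t x) = twist (s + t) x := by
  rcases parity_cases s with rfl | rfl <;> rcases parity_cases t with rfl | rfl <;> simp

/-- `x` is homogeneous of Grassmann parity `s`. -/
def IsHomog (s : ZMod 2) (x : JetAlg U par) : Prop := twist 1 x = sgn s • x

namespace IsHomog

variable {s t : ZMod 2} {x y : JetAlg U par}

theorem twist (h : IsHomog s x) (t : ZMod 2) : twist t x = sgn (t * s) • x := by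
  rcases parity_cases t with rfl | rfl
  · simp
  · rw [one_mul]
    exact h

theorem zero : IsHomog s (0 : JetAlg U par) := by simp [IsHomog]

theorem add (hx : IsHomog s x) (hy : IsHomog s y) : IsHomog s (x + y) := by
  unfold IsHomog at *
  rw [map_add, hx, hy, smul_add]

theorem smul (hx : IsHomog s x) (r : ℝ) : IsHomog s (r • x) := by
  unfold IsHomog at *
  rw [map_smul, hx, smul_comm]

theorem neg (hx : IsHomog s x) : IsHomog s (-x) := by
  unfold IsHomog at *
  rw [map_neg, hx, smul_neg]

theorem sub (hx : IsHomog s x) (hy : IsHomog s y) : IsHomog s (x - y) := by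
  rw [sub_eq_add_neg]
  exact hx.add hy.neg

theorem mul (hx : IsHomog s x) (hy : IsHomog t y) : IsHomog (s + t) (x * y) := by
  unfold IsHomog at *
  rw [map_mul, hx, hy, smul_mul_smul_comm, sgn_add]

theorem sum {κ : Type*} {S : Finset κ} {x : κ → JetAlg U par} (h : ∀ k ∈ S, IsHomog s (x k)) :
    IsHomog s (∑ k ∈ S, x k) := by
  classical
  induction S using Finset.induction_on with
  | empty => simpa using zero
  | insert k S hk ih =>
    rw [Finset.sum_insert hk]
    exact (h k (Finset.mem_insert_self k S)).add
      (ih fun j hj => h j (Finset.mem_insert_of_mem hj))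

theorem cast (hx : IsHomog s x) (h : s = t) : IsHomog t x := h ▸ hx

end IsHomog

theorem add_twist_comm (x y : JetAlg U par) :
    (x + twist 1 x) * y = y * (x + twist 1 x) ∧
      (x - twist 1 x) * y = twist 1 y * (x - twist 1 x) := by
  induction x using JetAlg.induction with
  | h0 => simp
  | hadd x z hx hz =>
    rw [map_add, add_add_add_comm, add_sub_add_comm]
    exact ⟨by rw [add_mul, hx.1, hz.1, ← mul_add],
      by rw [add_mul, hx.2, hz.2, ← mul_add]⟩
  | hof f w =>
    induction y using JetAlg.induction with
    | h0 => simp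
    | hadd y z hy hz =>
      exact ⟨by rw [mul_add, hy.1, hz.1, ← add_mul],
        by rw [mul_add, hy.2, hz.2, ← add_mul, ← map_add (twist 1)]⟩
    | hof g z =>
      simp only [twist_one_of]
      rw [sub_eq_add_neg, ← JetAlg.of_neg, ← JetAlg.of_add, ← JetAlg.of_add]
      simp only [JetAlg.of_mul_of]
      rw [← sub_eq_add_neg, (add_involute_comm w z).1, (add_involute_comm w z).2, mul_comm f g]
      exact ⟨rfl, rfl⟩

/-- Graded commutativity. -/
theorem IsHomog.mul_comm {s : ZMod 2} {x : JetAlg U par} (h : IsHomog s x) (y : JetAlg U par) :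
    x * y = SuperYM.twist s y * x := by
  have h2 : (2 : ℝ) ≠ 0 := two_ne_zero
  unfold IsHomog at h
  rcases parity_cases s with rfl | rfl
  · have := (add_twist_comm x y).1
    rw [h, sgn_zero, one_smul, ← two_smul ℝ x, smul_mul_assoc, mul_smul_comm] at this
    simpa using smul_right_injective _ h2 this
  · have := (add_twist_comm x y).2
    rw [h, sgn_one, neg_one_smul, sub_neg_eq_add, ← two_smul ℝ x, smul_mul_assoc,
      mul_smul_comm] at this
    simpa using smul_right_injective _ h2 this

theorem IsHomog.mul_comm' {s t : ZMod 2} {x y : JetAlg U par} (h : IsHomog s x)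
    (h' : IsHomog t y) : x * y = sgn (s * t) • (y * x) := by
  rw [h.mul_comm, h'.twist, smul_mul_assoc]

theorem isHomog_of_one (f : SmoothFn U (EvenJet n par)) : IsHomog 0 (JetAlg.of f 1) := by
  simp [IsHomog, twist_one_of]

theorem isHomog_ofBase (f : (Fin n → ℝ) → ℝ) (hf : ContDiffOn ℝ ∞ f U) :
    IsHomog 0 (ofBase f hf : JetAlg U par) :=
  isHomog_of_one _

theorem isHomog_gen (v : Jet n φ) : IsHomog (par v.1) (gen v : JetAlg U par) := by
  unfold gen
  split_ifs with h
  · rw [h]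
    exact isHomog_of_one _
  · rw [(parity_cases (par v.1)).resolve_left h, IsHomog, twist_one_of]
    change JetAlg.of _ (CliffordAlgebra.involute (CliffordAlgebra.ι _ _)) = _
    rw [CliffordAlgebra.involute_ι, JetAlg.of_neg, sgn_one, neg_one_smul]

/-! ### Derivatives -/

theorem pdBase_of (l : Fin n) (f : SmoothFn U (EvenJet n par))
    (w : ExteriorAlgebra ℝ (OddJet n par →₀ ℝ)) :
    pdBase l (JetAlg.of f w) = JetAlg.of (baseDeriv l f) w := rfl

theorem pd_mul (v : Jet n φ) (x y : JetAlg U par) :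
    pd v (x * y) = pd v x * y + twist (par v.1) x * pd v y := by
  induction x using JetAlg.induction with
  | h0 => simp
  | hadd x z hx hz =>
    simp only [add_mul, map_add, hx, hz]
    abel
  | hof f w =>
    induction y using JetAlg.induction with
    | h0 => simp
    | hadd y z hy hz =>
      simp only [mul_add, map_add, hy, hz]
      abel
    | hof g z =>
      by_cases h : par v.1 = 0
      · rw [JetAlg.of_mul_of, pd_of_even h, pd_of_even h, pd_of_even h, h, twist_zero,
          JetAlg.of_mul_of, JetAlg.of_mul_of, fibreDeriv_mul, JetAlg.add_of]
      · rw [JetAlg.of_mul_of, pd_of_odd h, pd_of_odd h, pd_of_odd h,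
          (parity_cases (par v.1)).resolve_left h, twist_one_of,
          JetAlg.of_mul_of, JetAlg.of_mul_of, contractLeft_mul, JetAlg.of_add]

theorem pdBase_mul (l : Fin n) (x y : JetAlg U par) :
    pdBase l (x * y) = pdBase l x * y + x * pdBase l y := by
  induction x using JetAlg.induction with
  | h0 => simp
  | hadd x z hx hz =>
    simp only [add_mul, map_add, hx, hz]
    abel
  | hof f w =>
    induction y using JetAlg.induction with
    | h0 => simp
    | hadd y z hy hz =>
      simp only [mul_add, map_add, hy, hz]
      abel
    | hof g z =>
      simp only [JetAlg.of_mul_of, pdBase_of, baseDeriv_mul, JetAlg.add_of]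

theorem pdBase_twist (l : Fin n) (s : ZMod 2) (x : JetAlg U par) :
    pdBase l (twist s x) = twist s (pdBase l x) := by
  rcases parity_cases s with rfl | rfl
  · simp
  induction x using JetAlg.induction with
  | h0 => simp
  | hadd x z hx hz => simp only [map_add, hx, hz]
  | hof f w => simp only [twist_one_of, pdBase_of]

theorem pd_twist (v : Jet n φ) (s : ZMod 2) (x : JetAlg U par) :
    pd v (twist s x) = sgn (s * par v.1) • twist s (pd v x) := by
  rcases parity_cases s with rfl | rfl
  · simp
  rw [one_mul]
  induction x using JetAlg.induction with
  | h0 => simp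
  | hadd x z hx hz => simp only [map_add, hx, hz, smul_add]
  | hof f w =>
    by_cases h : par v.1 = 0
    · rw [twist_one_of, pd_of_even h, pd_of_even h, h, twist_one_of, sgn_zero, one_smul]
    · rw [twist_one_of, pd_of_odd h, pd_of_odd h, (parity_cases (par v.1)).resolve_left h,
        twist_one_of, sgn_one, contractLeft_involute, JetAlg.of_neg, neg_one_smul]

theorem pdR_eq_twist (v : Jet n φ) (x : JetAlg U par) : pdR v x = twist (par v.1) (pd v x) := by
  induction x using JetAlg.induction with
  | h0 => simp
  | hadd x z hx hz => simp only [map_add, hx, hz]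
  | hof f w =>
    by_cases h : par v.1 = 0
    · rw [pdR_of_even h, pd_of_even h, h, twist_zero]
    · rw [pdR_of_odd h, pd_of_odd h, (parity_cases (par v.1)).resolve_left h, twist_one_of,
        LinearMap.flip_apply, contractRight_eq_involute]

theorem pd_pd (v w : Jet n φ) (x : JetAlg U par) :
    pd v (pd w x) = sgn (par v.1 * par w.1) • pd w (pd v x) := by
  induction x using JetAlg.induction with
  | h0 => simp
  | hadd x z hx hz => simp only [map_add, hx, hz, smul_add]
  | hof f z =>
    by_cases h : par v.1 = 0 <;> by_cases h' : par w.1 = 0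
    · rw [pd_of_even h', pd_of_even h, pd_of_even h, pd_of_even h', fibreDeriv_comm, h]
      simp
    · rw [pd_of_odd h', pd_of_even h, pd_of_even h, pd_of_odd h', h]
      simp
    · rw [pd_of_even h', pd_of_odd h, pd_of_odd h, pd_of_even h', h']
      simp
    · rw [pd_of_odd h', pd_of_odd h, pd_of_odd h, pd_of_odd h',
        (parity_cases (par v.1)).resolve_left h, (parity_cases (par w.1)).resolve_left h',
        CliffordAlgebra.contractLeft_comm, JetAlg.of_neg]
      simp

theorem pdBase_pd (l : Fin n) (v : Jet n φ) (x : JetAlg U par) :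
    pdBase l (pd v x) = pd v (pdBase l x) := by
  induction x using JetAlg.induction with
  | h0 => simp
  | hadd x z hx hz => simp only [map_add, hx, hz]
  | hof f z =>
    by_cases h : par v.1 = 0
    · rw [pd_of_even h, pdBase_of, pdBase_of, pd_of_even h, baseDeriv_fibreDeriv]
    · rw [pd_of_odd h, pdBase_of, pdBase_of, pd_of_odd h]

theorem pdBase_pdBase (l m : Fin n) (x : JetAlg U par) :
    pdBase l (pdBase m x) = pdBase m (pdBase l x) := by
  induction x using JetAlg.induction with
  | h0 => simp
  | hadd x z hx hz => simp only [map_add, hx, hz]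
  | hof f z => rw [pdBase_of, pdBase_of, pdBase_of, pdBase_of, baseDeriv_comm]

theorem pd_one (v : Jet n φ) : pd v (1 : JetAlg U par) = 0 := by
  have := pd_mul v (1 : JetAlg U par) 1
  rw [one_mul, mul_one, map_one (twist _), one_mul] at this
  exact left_eq_add.1 this

theorem pd_ofBase (v : Jet n φ) (f : (Fin n → ℝ) → ℝ) (hf : ContDiffOn ℝ ∞ f U) :
    pd v (ofBase f hf : JetAlg U par) = 0 := by
  by_cases h : par v.1 = 0
  · rw [ofBase, pd_of_even h, fibreDeriv_baseFn, JetAlg.zero_of]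
  · rw [ofBase, pd_of_odd h, CliffordAlgebra.contractLeft_one, JetAlg.of_zero]

theorem pdBase_gen (l : Fin n) (v : Jet n φ) : pdBase l (gen v : JetAlg U par) = 0 := by
  unfold gen
  split_ifs with h
  · rw [pdBase_of, baseDeriv_coordFn, JetAlg.zero_of]
  · rw [pdBase_of, baseDeriv_one, JetAlg.zero_of]

theorem pd_gen_self (v : Jet n φ) : pd v (gen v : JetAlg U par) = 1 := by
  unfold gen
  split_ifs with h
  · rw [pd_of_even h, fibreDeriv_coordFn_self]
    rfl
  · rw [pd_of_odd h]
    change JetAlg.of 1 (CliffordAlgebra.contractLeft _ (CliffordAlgebra.ι _ _)) = _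
    rw [CliffordAlgebra.contractLeft_ι, Finsupp.lapply_apply, Finsupp.single_eq_same, map_one]
    rfl

theorem pd_gen_of_ne {v w : Jet n φ} (hvw : v ≠ w) : pd v (gen w : JetAlg U par) = 0 := by
  unfold gen
  by_cases h : par v.1 = 0 <;> split_ifs with h'
  · rw [pd_of_even h, fibreDeriv_coordFn_of_ne (fun e => hvw (congrArg Subtype.val e).symm),
      JetAlg.zero_of]
  · rw [pd_of_even h, fibreDeriv_one, JetAlg.zero_of]
  · rw [pd_of_odd h, CliffordAlgebra.contractLeft_one, JetAlg.of_zero]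
  · rw [pd_of_odd h]
    change JetAlg.of 1 (CliffordAlgebra.contractLeft _ (CliffordAlgebra.ι _ _)) = _
    rw [CliffordAlgebra.contractLeft_ι, Finsupp.lapply_apply, Finsupp.single_eq_of_ne,
      map_zero, JetAlg.of_zero]
    exact fun e => hvw (congrArg Subtype.val e)

open scoped Classical in
theorem pd_gen (v w : Jet n φ) : pd v (gen w : JetAlg U par) = if v = w then 1 else 0 := by
  split_ifs with h
  · rw [h, pd_gen_self]
  · exact pd_gen_of_ne h

theorem IsHomog.pd {s : ZMod 2} {x : JetAlg U par} (h : IsHomog s x) (v : Jet n φ) :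
    IsHomog (s + par v.1) (pd v x) := by
  have h1 := pd_twist v 1 x
  unfold IsHomog at *
  rw [h, one_mul, map_smul] at h1
  rw [sgn_add, _root_.mul_comm, mul_smul, h1, smul_smul, sgn_mul_self, one_smul]

/-! ### The body of a graded function -/

/-- The body map, putting the odd jet variables to zero. -/
def body : JetAlg U par →ₐ[ℝ] SmoothFn U (EvenJet n par) :=
  (Algebra.TensorProduct.lift (AlgHom.id ℝ _) ((Algebra.ofId ℝ _).comp
    ExteriorAlgebra.algebraMapInv) fun _ _ => Commute.all _ _ :
      SmoothFn U (EvenJet n par) ⊗[ℝ] ExteriorAlgebra ℝ (OddJet n par →₀ ℝ) →ₐ[ℝ]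
        SmoothFn U (EvenJet n par))

theorem body_of (f : SmoothFn U (EvenJet n par)) (w : ExteriorAlgebra ℝ (OddJet n par →₀ ℝ)) :
    body (JetAlg.of f w) = f * algebraMap ℝ _ (ExteriorAlgebra.algebraMapInv w) :=
  Algebra.TensorProduct.lift_tmul _ _ _ _ _

theorem body_of_one (f : SmoothFn U (EvenJet n par)) : body (JetAlg.of f 1) = f := by
  rw [body_of, map_one, map_one, mul_one]

/-- Adding the twist produces twice the even part, which is central, so nilpotency passes to sums.
For a product with a generator `m` on the left, the even part is `m` times an odd element, whose
square contains `m` twice. -/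
theorem isNilpotent_soul (x : JetAlg U par) :
    IsNilpotent ((x - JetAlg.of (body x) 1) + twist 1 (x - JetAlg.of (body x) 1)) := by
  have key : ∀ z w : JetAlg U par, Commute (z + twist 1 z) w := fun z w => (add_twist_comm z w).1
  induction x using JetAlg.induction with
  | h0 =>
    rw [map_zero, JetAlg.zero_of, sub_zero, map_zero, add_zero]
    exact IsNilpotent.zero
  | hadd x y hx hy =>
    have := (key (x - JetAlg.of (body x) 1) _).isNilpotent_add hx hy
    convert this using 1
    rw [map_add (body (U := U) (par := par)), JetAlg.add_of]
    simp only [map_sub, map_add]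
    abel
  | hof f w =>
    induction w using CliffordAlgebra.left_induction with
    | algebraMap r =>
      have : JetAlg.of (body (JetAlg.of f (algebraMap ℝ _ r))) 1
          = (JetAlg.of f (algebraMap ℝ _ r) : JetAlg U par) := by
        rw [body_of]
        have : ExteriorAlgebra.algebraMapInv (algebraMap ℝ (ExteriorAlgebra ℝ
          (OddJet n par →₀ ℝ)) r) = r := AlgHom.commutes _ _
        erw [this]
        rw [mul_comm, ← Algebra.smul_def, Algebra.algebraMap_eq_smul_one]
        exact TensorProduct.smul_tmul _ _ _
      rw [this, sub_self, map_zero, add_zero]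
      exact IsNilpotent.zero
    | add x y hx hy =>
      have := (key (JetAlg.of f x - JetAlg.of (body (JetAlg.of f x)) 1) _).isNilpotent_add hx hy
      convert this using 1
      rw [JetAlg.of_add, map_add (body (U := U) (par := par)), JetAlg.add_of]
      simp only [map_sub, map_add]
      abel
    | ι_mul x m _ =>
      have hb : body (JetAlg.of f (CliffordAlgebra.ι _ m * x)) = 0 := by
        rw [body_of]
        have : ExteriorAlgebra.algebraMapInv (CliffordAlgebra.ι (0 : QuadraticForm ℝ
            (OddJet n par →₀ ℝ)) m * x) = 0 := by
          rw [map_mul]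
          have : ExteriorAlgebra.algebraMapInv (ExteriorAlgebra.ι ℝ m) = 0 := by
            simp [ExteriorAlgebra.algebraMapInv]
          erw [this]
          rw [zero_mul]
        erw [this]
        rw [map_zero, mul_zero]
      rw [hb, JetAlg.zero_of, sub_zero, twist_one_of, ← JetAlg.of_add]
      refine ⟨2, ?_⟩
      have hι : CliffordAlgebra.ι (0 : QuadraticForm ℝ (OddJet n par →₀ ℝ)) m
        = ExteriorAlgebra.ι ℝ m := rfl
      rw [pow_two, JetAlg.of_mul_of, map_mul, CliffordAlgebra.involute_ι, neg_mul,
        ← sub_eq_add_neg, ← mul_sub, hι]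
      have : ExteriorAlgebra.ι ℝ m * (x - CliffordAlgebra.involute x)
          * (ExteriorAlgebra.ι ℝ m * (x - CliffordAlgebra.involute x)) = 0 := by
        nth_rewrite 1 [ι_mul_eq_involute_mul_ι]
        rw [mul_assoc, ← mul_assoc (ExteriorAlgebra.ι ℝ m), ExteriorAlgebra.ι_sq_zero, zero_mul,
          mul_zero]
      rw [this, JetAlg.of_zero]

/-- The soul of an even graded function is nilpotent. -/
theorem IsHomog.isNilpotent_soul {x : JetAlg U par} (h : IsHomog 0 x) :
    IsNilpotent (x - JetAlg.of (body x) 1) := by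
  have h0 := SuperYM.isNilpotent_soul x
  have h1 : IsHomog 0 (x - JetAlg.of (body x) 1) := h.sub (isHomog_of_one _)
  unfold IsHomog at h1
  rw [h1, sgn_zero, one_smul, ← two_smul ℝ] at h0
  have := h0.smul ((2 : ℝ)⁻¹)
  rwa [smul_smul, inv_mul_cancel₀ two_ne_zero, one_smul] at this

end JetAlgebra

end

end SuperYM

namespace SuperYM

noncomputable section

/-! ## Graded derivations and total derivatives -/

section Derivations

variable {n : ℕ} {U : Opens (Fin n → ℝ)} {φ : Type*} {par : φ → ZMod 2}

theorem finite_support_mul_pd (X : Jet n φ → JetAlg U par) (f : JetAlg U par) :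
    (Function.support fun v => X v * pd v f).Finite :=
  (finite_pd f).subset fun v hv h => hv (by simp only [h, mul_zero])

/-- The vertical graded derivation `∑ X_v ∂/∂v`. -/
def derSum (X : Jet n φ → JetAlg U par) : JetAlg U par →ₗ[ℝ] JetAlg U par where
  toFun f := ∑ᶠ v, X v * pd v f
  map_add' f g := by
    rw [← finsum_add_distrib (finite_support_mul_pd X f) (finite_support_mul_pd X g)]
    simp only [map_add, mul_add]
  map_smul' r f := by
    rw [RingHom.id_apply, smul_finsum]
    simp only [map_smul, mul_smul_comm]

theorem derSum_apply (X : Jet n φ → JetAlg U par) (f : JetAlg U par) :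
    derSum X f = ∑ᶠ v, X v * pd v f := rfl

theorem derSum_eq_sum (X : Jet n φ → JetAlg U par) {f : JetAlg U par} {S : Finset (Jet n φ)}
    (hS : ∀ v ∉ S, pd v f = 0) : derSum X f = ∑ v ∈ S, X v * pd v f := by
  refine finsum_eq_sum_of_support_subset _ fun v hv => ?_
  by_contra h
  exact hv (by simp only [hS v h, mul_zero])

theorem exists_finset_pd (f : JetAlg U par) : ∃ S : Finset (Jet n φ), ∀ v ∉ S, pd v f = 0 := by
  refine ⟨(finite_pd f).toFinset, fun v hv => ?_⟩
  simpa using hv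

theorem derSum_smul (r : ℝ) (X : Jet n φ → JetAlg U par) (f : JetAlg U par) :
    derSum (fun v => r • X v) f = r • derSum X f := by
  obtain ⟨S, hS⟩ := exists_finset_pd f
  simp only [derSum_eq_sum _ hS, smul_mul_assoc, Finset.smul_sum]

theorem derSum_sub (X Y : Jet n φ → JetAlg U par) (f : JetAlg U par) :
    derSum (fun v => X v - Y v) f = derSum X f - derSum Y f := by
  obtain ⟨S, hS⟩ := exists_finset_pd f
  simp only [derSum_eq_sum _ hS, sub_mul, Finset.sum_sub_distrib]

theorem derSum_zero (f : JetAlg U par) : derSum (fun _ => 0) f = 0 := by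
  obtain ⟨S, hS⟩ := exists_finset_pd f
  simp [derSum_eq_sum _ hS]

theorem derSum_gen (X : Jet n φ → JetAlg U par) (v : Jet n φ) : derSum X (gen v) = X v := by
  classical
  rw [derSum_eq_sum X (S := {v}) fun w hw => pd_gen_of_ne (by simpa using hw)]
  simp [pd_gen_self]

theorem derSum_ofBase (X : Jet n φ → JetAlg U par) (f : (Fin n → ℝ) → ℝ)
    (hf : ContDiffOn ℝ ∞ f U) : derSum X (ofBase f hf) = 0 := by
  rw [derSum_eq_sum X (S := ∅) fun w _ => pd_ofBase w f hf]
  simp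

/-- The hypothesis says that the derivation has parity `p`. Moving `X v` past the twist by `[v]`
leaves exactly the twist by `p`. -/
theorem derSum_mul {p : ZMod 2} {X : Jet n φ → JetAlg U par}
    (hX : ∀ v, IsHomog (p + par v.1) (X v)) (f g : JetAlg U par) :
    derSum X (f * g) = derSum X f * g + twist p f * derSum X g := by
  classical
  obtain ⟨S, hS⟩ := exists_finset_pd f
  obtain ⟨T, hT⟩ := exists_finset_pd g
  have hS' : ∀ v ∉ S ∪ T, pd v f = 0 := fun v hv => hS v fun h => hv (Finset.mem_union_left _ h)
  have hT' : ∀ v ∉ S ∪ T, pd v g = 0 := fun v hv => hT v fun h => hv (Finset.mem_union_right _ h)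
  have hST : ∀ v ∉ S ∪ T, pd v (f * g) = 0 := fun v hv => by
    rw [pd_mul, hS' v hv, hT' v hv, zero_mul, mul_zero, add_zero]
  rw [derSum_eq_sum X hS', derSum_eq_sum X hT', derSum_eq_sum X hST, Finset.sum_mul,
    Finset.mul_sum, ← Finset.sum_add_distrib]
  refine Finset.sum_congr rfl fun v _ => ?_
  rw [pd_mul, mul_add, mul_assoc, ← mul_assoc (X v) (twist _ f), (hX v).mul_comm (twist _ f),
    twist_twist, add_assoc, parity_add_self, add_zero, mul_assoc]

/-- The second order terms cancel, by graded symmetry of second derivatives and graded commutativity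
of the coefficients. A graded commutator is therefore a vertical derivation, determined by its
values on jet variables; both the commutation with total derivatives and the nilpotency criterion
come from this. -/
theorem derSum_commutator {p q : ZMod 2} {X Y : Jet n φ → JetAlg U par}
    (hX : ∀ v, IsHomog (p + par v.1) (X v)) (hY : ∀ v, IsHomog (q + par v.1) (Y v))
    (f : JetAlg U par) :
    derSum X (derSum Y f) - sgn (p * q) • derSum Y (derSum X f)
      = derSum (fun v => derSum X (Y v) - sgn (p * q) • derSum Y (X v)) f := by
  obtain ⟨S, hS⟩ := exists_finset_pd f
  have hS' : ∀ w, ∀ v ∉ S, pd v (pd w f) = 0 := fun w v hv => by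
    rw [pd_pd, hS v hv, map_zero, smul_zero]
  have expand : ∀ {p : ZMod 2} {X : Jet n φ → JetAlg U par} (Y : Jet n φ → JetAlg U par),
      (∀ v, IsHomog (p + par v.1) (X v)) → derSum X (derSum Y f)
        = derSum (fun v => derSum X (Y v)) f
          + ∑ v ∈ S, ∑ w ∈ S, twist p (Y v) * (X w * pd w (pd v f)) := by
    intro p X Y hX
    rw [derSum_eq_sum Y hS, map_sum, derSum_eq_sum _ hS, ← Finset.sum_add_distrib]
    refine Finset.sum_congr rfl fun v _ => ?_
    rw [derSum_mul hX, derSum_eq_sum X (hS' v), Finset.mul_sum]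
  rw [expand Y hX, expand X hY, derSum_sub, derSum_smul, Finset.sum_comm (s := S) (t := S)]
  rw [smul_add, add_sub_add_comm, add_eq_left, sub_eq_zero, Finset.smul_sum]
  refine Finset.sum_congr rfl fun v _ => ?_
  rw [Finset.smul_sum]
  refine Finset.sum_congr rfl fun w _ => ?_
  rw [(hY w).twist, (hX v).twist, pd_pd v w, smul_mul_assoc, smul_mul_assoc, mul_smul_comm,
    mul_smul_comm, ← mul_assoc, ← mul_assoc, (hX v).mul_comm' (hY w), smul_mul_assoc]
  simp only [smul_smul]
  congr 1
  rcases parity_cases p with rfl | rfl <;> rcases parity_cases q with rfl | rfl <;>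
    rcases parity_cases (par v.1) with h | h <;> rcases parity_cases (par w.1) with h' | h' <;>
      simp [h, h']

theorem pdBase_derSum (l : Fin n) (X : Jet n φ → JetAlg U par) (f : JetAlg U par) :
    pdBase l (derSum X f) = derSum (fun v => pdBase l (X v)) f + derSum X (pdBase l f) := by
  obtain ⟨S, hS⟩ := exists_finset_pd f
  have hS' : ∀ v ∉ S, pd v (pdBase l f) = 0 := fun v hv => by
    rw [← pdBase_pd, hS v hv, map_zero]
  rw [derSum_eq_sum _ hS, derSum_eq_sum _ hS, derSum_eq_sum _ hS', map_sum,
    ← Finset.sum_add_distrib]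
  refine Finset.sum_congr rfl fun v _ => ?_
  rw [pdBase_mul, pdBase_pd]

theorem derSum_twist {p : ZMod 2} {X : Jet n φ → JetAlg U par}
    (hX : ∀ v, IsHomog (p + par v.1) (X v)) (s : ZMod 2) (f : JetAlg U par) :
    derSum X (twist s f) = sgn (s * p) • twist s (derSum X f) := by
  obtain ⟨S, hS⟩ := exists_finset_pd f
  have hS' : ∀ v ∉ S, pd v (twist s f) = 0 := fun v hv => by
    rw [pd_twist, hS v hv, map_zero, smul_zero]
  rw [derSum_eq_sum _ hS, derSum_eq_sum _ hS', map_sum, Finset.smul_sum]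
  refine Finset.sum_congr rfl fun v _ => ?_
  rw [pd_twist, map_mul, (hX v).twist, mul_smul_comm, smul_mul_assoc, smul_smul]
  congr 1
  rw [mul_add, sgn_add, ← mul_assoc, sgn_mul_self, one_mul]

/-! ### Total derivatives -/

/-- The total derivative as a linear map. -/
def totalDL (l : Fin n) : JetAlg U par →ₗ[ℝ] JetAlg U par :=
  pdBase l + derSum fun v => gen (v.1, l ::ₘ v.2)

theorem totalD_eq (l : Fin n) (f : JetAlg U par) : totalD l f = totalDL l f := rfl

theorem totalD_eq_add (l : Fin n) (f : JetAlg U par) :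
    totalD l f = pdBase l f + derSum (fun v => gen (v.1, l ::ₘ v.2)) f := rfl

theorem isHomog_gen_cons (l : Fin n) (v : Jet n φ) :
    IsHomog (0 + par v.1) (gen (v.1, l ::ₘ v.2) : JetAlg U par) :=
  (isHomog_gen (v.1, l ::ₘ v.2)).cast (zero_add _).symm

theorem totalD_mul (l : Fin n) (f g : JetAlg U par) :
    totalD l (f * g) = totalD l f * g + f * totalD l g := by
  rw [totalD_eq_add, totalD_eq_add, totalD_eq_add, derSum_mul (isHomog_gen_cons l), pdBase_mul,
    twist_zero, add_mul, mul_add]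
  abel

theorem totalD_gen (l : Fin n) (v : Jet n φ) :
    totalD l (gen v : JetAlg U par) = gen (v.1, l ::ₘ v.2) := by
  rw [totalD_eq_add, pdBase_gen, derSum_gen, zero_add]

theorem totalD_twist (l : Fin n) (s : ZMod 2) (f : JetAlg U par) :
    totalD l (twist s f) = twist s (totalD l f) := by
  rw [totalD_eq_add, totalD_eq_add, pdBase_twist, derSum_twist (isHomog_gen_cons l), map_add]
  simp

theorem IsHomog.totalD {s : ZMod 2} {f : JetAlg U par} (h : IsHomog s f) (l : Fin n) :
    IsHomog s (totalD l f) := by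
  unfold IsHomog at *
  rw [← totalD_twist, h, totalD_eq, map_smul, totalD_eq]

theorem totalD_totalD (l m : Fin n) (f : JetAlg U par) :
    totalD l (totalD m f) = totalD m (totalD l f) := by
  have h := derSum_commutator (isHomog_gen_cons (U := U) (par := par) l) (isHomog_gen_cons m) f
  simp only [mul_zero, sgn_zero, one_smul, derSum_gen] at h
  simp only [totalD_eq_add, map_add]
  rw [pdBase_derSum, pdBase_derSum, pdBase_pdBase l m]
  simp only [pdBase_gen, derSum_zero, zero_add]
  have h0 : ∀ v : Jet n φ, (gen (v.1, l ::ₘ m ::ₘ v.2) : JetAlg U par)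
      - gen (v.1, m ::ₘ l ::ₘ v.2) = 0 := fun v => by rw [Multiset.cons_swap, sub_self]
  simp only [h0, derSum_zero] at h
  rw [sub_eq_zero.1 h]
  abel

@[simp]
theorem totalD_zero (l : Fin n) : totalD l (0 : JetAlg U par) = 0 := map_zero (totalDL l)

theorem totalD_add (l : Fin n) (f g : JetAlg U par) :
    totalD l (f + g) = totalD l f + totalD l g := map_add (totalDL l) f g

theorem totalD_neg (l : Fin n) (f : JetAlg U par) : totalD l (-f) = -totalD l f :=
  map_neg (totalDL l) f

theorem totalD_smul (l : Fin n) (r : ℝ) (f : JetAlg U par) : totalD l (r • f) = r • totalD l f :=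
  map_smul (totalDL l) r f

theorem totalD_sum {κ : Type*} (l : Fin n) (S : Finset κ) (f : κ → JetAlg U par) :
    totalD l (∑ k ∈ S, f k) = ∑ k ∈ S, totalD l (f k) := map_sum (totalDL l) f S

open scoped Classical in
-- Multi-indices are unordered, so `s^A_M` occurs in the coefficients of `d_l` exactly once if `l ∈
-- M`, namely in front of the derivative with index `M` minus one `l`; no multiplicity appears.
theorem pd_totalD (A : φ) (M : Multiset (Fin n)) (l : Fin n) (f : JetAlg U par) :
    pd (A, M) (totalD l f) = totalD l (pd (A, M) f)
      + if l ∈ M then pd (A, M.erase l) f else 0 := by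
  obtain ⟨S, hS⟩ := exists_finset_pd f
  have hS' : ∀ v ∉ S, pd v (pd (A, M) f) = 0 := fun v hv => by
    rw [pd_pd, hS v hv, map_zero, smul_zero]
  rw [totalD_eq_add, totalD_eq_add, map_add, ← pdBase_pd, derSum_eq_sum _ hS, derSum_eq_sum _ hS',
    map_sum, add_assoc]
  congr 1
  have hterm : ∀ v : Jet n φ, pd (A, M) ((gen (v.1, l ::ₘ v.2) : JetAlg U par) * pd v f)
      = gen (v.1, l ::ₘ v.2) * pd v (pd (A, M) f)
        + if (A, M) = (v.1, l ::ₘ v.2) then pd v f else 0 := fun v => by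
    rw [pd_mul, pd_gen, (isHomog_gen _).twist, pd_pd (A, M) v, smul_mul_smul_comm, sgn_mul_self,
      one_smul, add_comm]
    split_ifs <;> simp
  simp only [hterm, Finset.sum_add_distrib]
  congr 1
  split_ifs with h
  · rw [Finset.sum_eq_single (A, M.erase l)]
    · rw [if_pos]
      rw [Multiset.cons_erase h]
    · intro v _ hv
      rw [if_neg]
      intro e
      refine hv ?_
      rw [Prod.mk.injEq] at e
      rw [e.1, e.2, Multiset.erase_cons_head]
    · intro hv
      rw [hS _ hv, ite_self]
  · refine Finset.sum_eq_zero fun v _ => if_neg fun e => h ?_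
    rw [Prod.mk.injEq] at e
    rw [e.2]
    exact Multiset.mem_cons_self l v.2

/-! ### Iterated total derivatives -/

@[simp]
theorem totalDs_zero (f : JetAlg U par) : totalDs 0 f = f := by
  simp [totalDs]

theorem totalDs_cons (l : Fin n) (Λ : Multiset (Fin n)) (f : JetAlg U par) :
    totalDs (l ::ₘ Λ) f = totalD l (totalDs Λ f) := by
  have : LeftCommutative (totalD : Fin n → JetAlg U par → JetAlg U par) :=
    ⟨fun l m f => totalD_totalD l m f⟩
  have hp : ((l ::ₘ Λ).sort (· ≤ ·)).Perm (l :: Λ.sort (· ≤ ·)) := by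
    rw [← Multiset.coe_eq_coe, Multiset.sort_eq, ← Multiset.cons_coe, Multiset.sort_eq]
  exact hp.foldr_eq f

theorem totalDs_singleton (l : Fin n) (f : JetAlg U par) : totalDs {l} f = totalD l f := by
  rw [← Multiset.cons_zero, totalDs_cons, totalDs_zero]

/-- The iterated total derivative as a linear map. -/
def totalDsL (Λ : Multiset (Fin n)) : JetAlg U par →ₗ[ℝ] JetAlg U par where
  toFun := totalDs Λ
  map_add' f g := by
    induction Λ using Multiset.induction with
    | empty => simp
    | cons l Λ ih => rw [totalDs_cons, totalDs_cons, totalDs_cons, ih, totalD_add]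
  map_smul' r f := by
    induction Λ using Multiset.induction with
    | empty => simp
    | cons l Λ ih => rw [totalDs_cons, totalDs_cons, ih, RingHom.id_apply, totalD_smul]

theorem totalDs_eq (Λ : Multiset (Fin n)) (f : JetAlg U par) : totalDs Λ f = totalDsL Λ f := rfl

theorem totalDs_totalD (Λ : Multiset (Fin n)) (l : Fin n) (f : JetAlg U par) :
    totalDs Λ (totalD l f) = totalD l (totalDs Λ f) := by
  induction Λ using Multiset.induction with
  | empty => simp
  | cons m Λ ih => rw [totalDs_cons, totalDs_cons, ih, totalD_totalD]

theorem totalDs_gen (Λ : Multiset (Fin n)) (v : Jet n φ) :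
    totalDs Λ (gen v : JetAlg U par) = gen (v.1, Λ + v.2) := by
  induction Λ using Multiset.induction with
  | empty => simp
  | cons m Λ ih => rw [totalDs_cons, ih, totalD_gen, Multiset.cons_add]

theorem IsHomog.totalDs {s : ZMod 2} {f : JetAlg U par} (h : IsHomog s f)
    (Λ : Multiset (Fin n)) : IsHomog s (totalDs Λ f) := by
  induction Λ using Multiset.induction with
  | empty => simpa using h
  | cons m Λ ih =>
    rw [totalDs_cons]
    exact ih.totalD m

/-! ### Contact derivations -/

theorem contactDer_eq (υ : φ → JetAlg U par) (f : JetAlg U par) :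
    contactDer υ f = derSum (fun v => SuperYM.totalDs v.2 (υ v.1)) f := rfl

theorem isHomog_prolong {p : ZMod 2} {υ : φ → JetAlg U par}
    (hυ : ∀ A, IsHomog (p + par A) (υ A)) (v : Jet n φ) :
    IsHomog (p + par v.1) (SuperYM.totalDs v.2 (υ v.1)) :=
  (hυ v.1).totalDs v.2

/-- The prolonged components satisfy `X_{l+Λ} = d_l X_Λ`, so the vertical part of the commutator
with `d_l` reduces to the explicit `x`-derivatives of the components, which the term `∂_l` of `d_l`
cancels. -/
theorem contactDer_totalD {p : ZMod 2} {υ : φ → JetAlg U par}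
    (hυ : ∀ A, IsHomog (p + par A) (υ A)) (l : Fin n) (f : JetAlg U par) :
    contactDer υ (totalD l f) = totalD l (contactDer υ f) := by
  have h := derSum_commutator (isHomog_prolong hυ) (isHomog_gen_cons l) f
  simp only [mul_zero, sgn_zero, one_smul, derSum_gen, totalDs_cons] at h
  simp only [contactDer_eq, totalD_eq_add l f, totalD_eq_add l (derSum _ f), map_add,
    pdBase_derSum]
  have h2 : ∀ v : Jet n φ, totalD l (SuperYM.totalDs v.2 (υ v.1))
      - derSum (fun v => gen (v.1, l ::ₘ v.2)) (SuperYM.totalDs v.2 (υ v.1))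
        = pdBase l (SuperYM.totalDs v.2 (υ v.1)) := fun v => by
    rw [totalD_eq_add, add_sub_cancel_right]
  simp only [h2] at h
  rw [← h]
  abel

theorem contactDer_totalDs {p : ZMod 2} {υ : φ → JetAlg U par}
    (hυ : ∀ A, IsHomog (p + par A) (υ A)) (Λ : Multiset (Fin n)) (f : JetAlg U par) :
    contactDer υ (totalDs Λ f) = totalDs Λ (contactDer υ f) := by
  induction Λ using Multiset.induction with
  | empty => simp
  | cons l Λ ih => rw [totalDs_cons, totalDs_cons, contactDer_totalD hυ, ih]

theorem contactDer_mul {p : ZMod 2} {υ : φ → JetAlg U par}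
    (hυ : ∀ A, IsHomog (p + par A) (υ A)) (f g : JetAlg U par) :
    contactDer υ (f * g) = contactDer υ f * g + twist p f * contactDer υ g :=
  derSum_mul (isHomog_prolong hυ) f g

theorem contactDer_gen (υ : φ → JetAlg U par) (v : Jet n φ) :
    contactDer υ (gen v) = totalDs v.2 (υ v.1) :=
  derSum_gen _ v

/-- An odd contact derivation whose square vanishes on its components is nilpotent. -/
theorem isNilpotentDer_of_components {υ : φ → JetAlg U par}
    (hυ : ∀ A, IsHomog (1 + par A) (υ A)) (h : ∀ A, contactDer υ (υ A) = 0) :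
    IsNilpotentDer υ := by
  intro f
  have hc := derSum_commutator (isHomog_prolong hυ) (isHomog_prolong hυ) f
  have h0 : ∀ v : Jet n φ, derSum (fun v => totalDs v.2 (υ v.1)) (totalDs v.2 (υ v.1)) = 0 :=
    fun v => by
      rw [← contactDer_eq, contactDer_totalDs hυ, h, totalDs_eq, map_zero]
  simp only [h0, mul_one, sgn_one, smul_zero, sub_zero, derSum_zero, neg_smul, one_smul,
    sub_neg_eq_add] at hc
  rw [← two_smul ℝ] at hc
  exact (smul_eq_zero.1 hc).resolve_left two_ne_zero

/-- A right derivation is a left derivation after a twist, with signs absorbed in the components;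
thus the calculus of `derSum` covers the Koszul-Tate operator. -/
theorem contactDerR_eq {p : ZMod 2} {υ : φ → JetAlg U par}
    (hυ : ∀ A, IsHomog (p + par A) (υ A)) (f : JetAlg U par) :
    contactDerR υ f
      = derSum (fun v => sgn (p * par v.1) • totalDs v.2 (υ v.1)) (twist p f) := by
  refine finsum_congr fun v => ?_
  rw [pdR_eq_twist, pd_twist, smul_mul_smul_comm, sgn_mul_self, one_smul,
    (isHomog_prolong hυ v).mul_comm, twist_twist, add_right_comm, parity_add_self, zero_add]

theorem isHomog_prolong_smul {p : ZMod 2} {υ : φ → JetAlg U par}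
    (hυ : ∀ A, IsHomog (p + par A) (υ A)) (v : Jet n φ) :
    IsHomog (p + par v.1) (sgn (p * par v.1) • SuperYM.totalDs v.2 (υ v.1)) :=
  (isHomog_prolong hυ v).smul _

theorem contactDerR_mul {p : ZMod 2} {υ : φ → JetAlg U par}
    (hυ : ∀ A, IsHomog (p + par A) (υ A)) (f g : JetAlg U par) :
    contactDerR υ (f * g) = contactDerR υ f * twist p g + f * contactDerR υ g := by
  simp only [contactDerR_eq hυ]
  rw [map_mul, derSum_mul (isHomog_prolong_smul hυ), twist_twist, parity_add_self, twist_zero]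

theorem contactDerR_gen {p : ZMod 2} {υ : φ → JetAlg U par}
    (hυ : ∀ A, IsHomog (p + par A) (υ A)) (v : Jet n φ) :
    contactDerR υ (gen v) = totalDs v.2 (υ v.1) := by
  rw [contactDerR_eq hυ, (isHomog_gen v).twist, map_smul, derSum_gen, smul_smul, sgn_mul_self,
    one_smul]

theorem contactDerR_totalD {p : ZMod 2} {υ : φ → JetAlg U par}
    (hυ : ∀ A, IsHomog (p + par A) (υ A)) (l : Fin n) (f : JetAlg U par) :
    contactDerR υ (totalD l f) = totalD l (contactDerR υ f) := by
  have e : ∀ f, contactDerR υ f = contactDer (fun A => sgn (p * par A) • υ A) (twist p f) := by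
    intro f
    rw [contactDerR_eq hυ, contactDer_eq]
    simp only [totalDs_eq, map_smul]
  rw [e, e, ← totalD_twist, contactDer_totalD fun A => (hυ A).smul _]

theorem contactDerR_totalDs {p : ZMod 2} {υ : φ → JetAlg U par}
    (hυ : ∀ A, IsHomog (p + par A) (υ A)) (Λ : Multiset (Fin n)) (f : JetAlg U par) :
    contactDerR υ (totalDs Λ f) = totalDs Λ (contactDerR υ f) := by
  induction Λ using Multiset.induction with
  | empty => simp
  | cons l Λ ih => rw [totalDs_cons, totalDs_cons, contactDerR_totalD hυ, ih]

/-- A right contact derivation as a linear map. -/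
def contactDerRL (p : ZMod 2) (υ : φ → JetAlg U par) :
    JetAlg U par →ₗ[ℝ] JetAlg U par :=
  derSum (fun v => sgn (p * par v.1) • totalDs v.2 (υ v.1)) ∘ₗ (twist p).toLinearMap

theorem contactDerRL_apply {p : ZMod 2} {υ : φ → JetAlg U par}
    (hυ : ∀ A, IsHomog (p + par A) (υ A)) (f : JetAlg U par) :
    contactDerRL p υ f = contactDerR υ f :=
  (contactDerR_eq hυ f).symm

/-! ### Variational derivatives -/

theorem varDeriv_eq_sum (A : φ) {f : JetAlg U par} {T : Finset (Multiset (Fin n))}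
    (hT : ∀ Λ ∉ T, pd (A, Λ) f = 0) :
    varDeriv A f = ∑ Λ ∈ T, (-1 : ℝ) ^ Multiset.card Λ • totalDs Λ (pd (A, Λ) f) := by
  refine finsum_eq_sum_of_support_subset _ fun Λ hΛ => ?_
  by_contra h
  exact hΛ (by simp only [hT Λ h, totalDs_eq, map_zero, smul_zero])

theorem varDerivR_eq_sum (A : φ) {f : JetAlg U par} {T : Finset (Multiset (Fin n))}
    (hT : ∀ Λ ∉ T, pdR (A, Λ) f = 0) :
    varDerivR A f = ∑ Λ ∈ T, (-1 : ℝ) ^ Multiset.card Λ • totalDs Λ (pdR (A, Λ) f) := by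
  refine finsum_eq_sum_of_support_subset _ fun Λ hΛ => ?_
  by_contra h
  exact hΛ (by simp only [hT Λ h, totalDs_eq, map_zero, smul_zero])

theorem exists_finset_pd_label (f : JetAlg U par) :
    ∃ T : Finset (Multiset (Fin n)), ∀ Λ ∉ T, ∀ A : φ, pd (A, Λ) f = 0 := by
  classical
  obtain ⟨S, hS⟩ := exists_finset_pd f
  refine ⟨S.image Prod.snd, fun Λ hΛ A => hS _ fun h => hΛ ?_⟩
  exact Finset.mem_image_of_mem Prod.snd h

theorem IsHomog.varDeriv {s : ZMod 2} {f : JetAlg U par} (h : IsHomog s f) (A : φ) :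
    IsHomog (s + par A) (varDeriv A f) := by
  obtain ⟨T, hT⟩ := exists_finset_pd_label f
  rw [varDeriv_eq_sum A fun Λ hΛ => hT Λ hΛ A]
  exact IsHomog.sum fun Λ _ => ((h.pd (A, Λ)).totalDs Λ).smul _

theorem varDeriv_add (A : φ) (f g : JetAlg U par) :
    varDeriv A (f + g) = varDeriv A f + varDeriv A g := by
  classical
  obtain ⟨S, hS⟩ := exists_finset_pd_label f
  obtain ⟨T, hT⟩ := exists_finset_pd_label g
  have hS' : ∀ Λ ∉ S ∪ T, pd (A, Λ) f = 0 := fun v hv =>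
    hS v (fun h => hv (Finset.mem_union_left _ h)) A
  have hT' : ∀ Λ ∉ S ∪ T, pd (A, Λ) g = 0 := fun v hv =>
    hT v (fun h => hv (Finset.mem_union_right _ h)) A
  have hST : ∀ Λ ∉ S ∪ T, pd (A, Λ) (f + g) = 0 := fun v hv => by
    rw [map_add, hS' v hv, hT' v hv, add_zero]
  rw [varDeriv_eq_sum A hS', varDeriv_eq_sum A hT', varDeriv_eq_sum A hST,
    ← Finset.sum_add_distrib]
  simp only [map_add, totalDs_eq, smul_add]

/-! ### Horizontally exact densities -/

namespace IsHorizontallyExact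

theorem zero : IsHorizontallyExact (0 : JetAlg U par) := ⟨0, by simp⟩

theorem add {f g : JetAlg U par} (hf : IsHorizontallyExact f) (hg : IsHorizontallyExact g) :
    IsHorizontallyExact (f + g) := by
  obtain ⟨σ, rfl⟩ := hf
  obtain ⟨τ, rfl⟩ := hg
  exact ⟨fun l => σ l + τ l, by simp only [totalD_add, Finset.sum_add_distrib]⟩

theorem smul {f : JetAlg U par} (hf : IsHorizontallyExact f) (r : ℝ) :
    IsHorizontallyExact (r • f) := by
  obtain ⟨σ, rfl⟩ := hf
  exact ⟨fun l => r • σ l, by simp only [totalD_smul, Finset.smul_sum]⟩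

theorem neg {f : JetAlg U par} (hf : IsHorizontallyExact f) : IsHorizontallyExact (-f) := by
  simpa using hf.smul (-1)

theorem sub {f g : JetAlg U par} (hf : IsHorizontallyExact f) (hg : IsHorizontallyExact g) :
    IsHorizontallyExact (f - g) := by
  rw [sub_eq_add_neg]
  exact hf.add hg.neg

theorem sum {κ : Type*} {S : Finset κ} {f : κ → JetAlg U par}
    (h : ∀ k ∈ S, IsHorizontallyExact (f k)) : IsHorizontallyExact (∑ k ∈ S, f k) := by
  classical
  induction S using Finset.induction_on with
  | empty => simpa using zero
  | insert k S hk ih =>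
    rw [Finset.sum_insert hk]
    exact (h k (Finset.mem_insert_self k S)).add
      (ih fun j hj => h j (Finset.mem_insert_of_mem hj))

theorem totalD (l : Fin n) (f : JetAlg U par) : IsHorizontallyExact (totalD l f) := by
  classical
  refine ⟨Pi.single l f, ?_⟩
  rw [Finset.sum_eq_single l]
  · simp
  · intro m _ hm
    simp [hm]
  · simp

end IsHorizontallyExact

/-- Integration by parts. -/
theorem isHorizontallyExact_totalDs_mul_sub (Λ : Multiset (Fin n)) (f g : JetAlg U par) :
    IsHorizontallyExact (totalDs Λ f * g - (-1 : ℝ) ^ Multiset.card Λ • (f * totalDs Λ g)) := by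
  induction Λ using Multiset.induction generalizing g with
  | empty => simpa using IsHorizontallyExact.zero
  | cons l Λ ih =>
    have h1 := IsHorizontallyExact.totalD l (totalDs Λ f * g)
    have h2 := ih (totalD l g)
    convert h1.sub h2 using 1
    rw [totalDs_cons, totalDs_cons, totalD_mul, Multiset.card_cons, pow_succ, totalDs_totalD]
    simp only [mul_neg, mul_one, neg_smul]
    abel

/-- The first variational formula. -/
theorem isHorizontallyExact_contactDer_sub [Fintype φ] (υ : φ → JetAlg U par) (L : JetAlg U par) :
    IsHorizontallyExact (contactDer υ L - ∑ A, υ A * varDeriv A L) := by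
  classical
  obtain ⟨T, hT⟩ := exists_finset_pd_label L
  have hS : ∀ v ∉ (Finset.univ : Finset φ) ×ˢ T, pd v L = 0 := fun v hv =>
    hT v.2 (fun h => hv (by simp [h])) v.1
  rw [contactDer_eq, derSum_eq_sum _ hS, Finset.sum_product, ← Finset.sum_sub_distrib]
  refine IsHorizontallyExact.sum fun A _ => ?_
  rw [varDeriv_eq_sum A fun Λ hΛ => hT Λ hΛ A, Finset.mul_sum, ← Finset.sum_sub_distrib]
  refine IsHorizontallyExact.sum fun Λ _ => ?_
  rw [mul_smul_comm]
  exact isHorizontallyExact_totalDs_mul_sub Λ (υ A) (pd (A, Λ) L)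

end Derivations

end

end SuperYM

namespace SuperYM

noncomputable section

/-! ## Words in a Lie superalgebra and the Poincaré-Birkhoff-Witt theorem -/

namespace LieSuperalgebra

variable {ι : Type*} [Fintype ι] (𝔤 : LieSuperalgebra ι)

/-- The sign `(-1)^{[i][j]}`. -/
def ε (i j : ι) : ℝ := sgn (𝔤.par i * 𝔤.par j)

theorem ε_comm (i j : ι) : 𝔤.ε i j = 𝔤.ε j i := by rw [ε, ε, mul_comm]

theorem ε_mul_self (i j : ι) : 𝔤.ε i j * 𝔤.ε i j = 1 := sgn_mul_self _

theorem c_mul_ε (r x y z : ι) : 𝔤.c r x y * 𝔤.ε r z = 𝔤.c r x y * (𝔤.ε x z * 𝔤.ε y z) := by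
  by_cases h : 𝔤.c r x y = 0
  · rw [h, zero_mul, zero_mul]
  · rw [ε, ε, ε, 𝔤.c_par r x y h, add_mul, sgn_add]

/-- The graded Jacobi identity `[[x, y], z] = [x, [y, z]] + (-1)^{[y][z]} [[x, z], y]`. -/
theorem jacobi_left (s x y z : ι) : ∑ r, 𝔤.c r x y * 𝔤.c s r z
    = ∑ r, 𝔤.c r y z * 𝔤.c s x r + 𝔤.ε y z * ∑ r, 𝔤.c r x z * 𝔤.c s r y := by
  have hJ := 𝔤.jacobi s x y z
  have h1 : ∀ r, sgn (𝔤.par z * 𝔤.par y) * 𝔤.c s z r * 𝔤.c r x y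
      = -𝔤.ε x z * (𝔤.c r x y * 𝔤.c s r z) := fun r => by
    have h2 := 𝔤.c_mul_ε r x y z
    rw [𝔤.c_skew s z r]
    change 𝔤.ε z y * -(𝔤.ε z r * 𝔤.c s r z) * 𝔤.c r x y = _
    rw [𝔤.ε_comm z r, 𝔤.ε_comm z y]
    have h3 := 𝔤.ε_mul_self y z
    linear_combination (-𝔤.ε y z * 𝔤.c s r z) * h2 - 𝔤.c r x y * 𝔤.c s r z * 𝔤.ε x z * h3
  have h2 : ∀ r, sgn (𝔤.par y * 𝔤.par x) * 𝔤.c s y r * 𝔤.c r z x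
      = 𝔤.ε x z * 𝔤.ε y z * (𝔤.c r x z * 𝔤.c s r y) := fun r => by
    have h2 := 𝔤.c_mul_ε r z x y
    rw [𝔤.c_skew s y r, 𝔤.c_skew r x z]
    change 𝔤.ε y x * -(𝔤.ε y r * 𝔤.c s r y) * 𝔤.c r z x
      = 𝔤.ε x z * 𝔤.ε y z * (-(𝔤.ε x z * 𝔤.c r z x) * 𝔤.c s r y)
    rw [𝔤.ε_comm y r, 𝔤.ε_comm y x, 𝔤.ε_comm y z]
    have h3 := 𝔤.ε_mul_self x y
    have h4 := 𝔤.ε_mul_self x z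
    linear_combination (-𝔤.ε x y * 𝔤.c s r y) * h2 - 𝔤.c r z x * 𝔤.c s r y * 𝔤.ε z y * h3
      + 𝔤.c r z x * 𝔤.c s r y * 𝔤.ε z y * h4
  have h0 : ∀ r, sgn (𝔤.par x * 𝔤.par z) * 𝔤.c s x r * 𝔤.c r y z
      = 𝔤.ε x z * (𝔤.c r y z * 𝔤.c s x r) := fun r => by rw [ε]; ring
  simp only [h0, h1, h2, Finset.sum_add_distrib, ← Finset.mul_sum] at hJ
  have h3 := 𝔤.ε_mul_self x z
  set A := ∑ r, 𝔤.c r x y * 𝔤.c s r z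
  set B := ∑ r, 𝔤.c r y z * 𝔤.c s x r
  set C := ∑ r, 𝔤.c r x z * 𝔤.c s r y
  linear_combination (-𝔤.ε x z) * hJ + (B + 𝔤.ε y z * C - A) * h3

theorem c_self_of_even {x : ι} (hx : 𝔤.par x = 0) (r : ι) : 𝔤.c r x x = 0 := by
  have := 𝔤.c_skew r x x
  rw [hx, mul_zero, sgn_zero, one_mul] at this
  linarith

/-- The failure of a function of words to respect the defining relations of the universal
enveloping algebra. -/
def defect (N : List ι → ℝ) (u : List ι) (x y : ι) (v : List ι) : ℝ :=
  N (u ++ x :: y :: v) - 𝔤.ε x y * N (u ++ y :: x :: v) - ∑ r, 𝔤.c r x y * N (u ++ r :: v)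

theorem defect_swap (N : List ι → ℝ) (u : List ι) (x y : ι) (v : List ι) :
    𝔤.defect N u y x v = -(𝔤.ε x y * 𝔤.defect N u x y v) := by
  have h : ∀ r, 𝔤.c r y x * N (u ++ r :: v) = -𝔤.ε x y * (𝔤.c r x y * N (u ++ r :: v)) := fun r => by
    have := 𝔤.c_skew r y x
    change _ = -(𝔤.ε y x * _) at this
    rw [this, 𝔤.ε_comm y x]
    ring
  have h2 := 𝔤.ε_mul_self x y
  simp only [defect, h, ← Finset.mul_sum, 𝔤.ε_comm y x]
  linear_combination (-N (u ++ y :: x :: v)) * h2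

theorem defect_self_of_even (N : List ι → ℝ) (u : List ι) {x : ι} (v : List ι)
    (hx : 𝔤.par x = 0) : 𝔤.defect N u x x v = 0 := by
  simp [defect, ε, hx, 𝔤.c_self_of_even hx]

/-- The hexagon of the six permutations of three letters. -/
theorem defect_hexagon (N : List ι → ℝ) (u : List ι) (x y z : ι) (v : List ι)
    (hN : ∀ a b, 𝔤.defect N u a b v = 0) :
    𝔤.defect N u x y (z :: v) + 𝔤.ε x y * 𝔤.defect N (u ++ [y]) x z v
      + 𝔤.ε x y * 𝔤.ε x z * 𝔤.defect N u y z (x :: v)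
      = 𝔤.defect N (u ++ [x]) y z v + 𝔤.ε y z * 𝔤.defect N u x z (y :: v)
        + 𝔤.ε y z * 𝔤.ε x z * 𝔤.defect N (u ++ [z]) x y v := by
  -- Moving the letter `d` through the bracket of `a` and `b` involves words that are one letter
  -- shorter, on which `N` is assumed to respect the relations; the sign splits because the bracket
  -- is homogeneous.
  have hb : ∀ a b d, ∑ r, 𝔤.c r a b * N (u ++ r :: d :: v)
      = 𝔤.ε a d * 𝔤.ε b d * ∑ r, 𝔤.c r a b * N (u ++ d :: r :: v)
        + ∑ s, (∑ r, 𝔤.c r a b * 𝔤.c s r d) * N (u ++ s :: v) := fun a b d => by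
    simp only [Finset.sum_mul]
    rw [Finset.sum_comm, Finset.mul_sum, ← Finset.sum_add_distrib]
    refine Finset.sum_congr rfl fun r _ => ?_
    have h1 := hN r d
    have h2 := 𝔤.c_mul_ε r a b d
    simp only [defect] at h1
    simp only [mul_assoc]
    rw [← Finset.mul_sum]
    linear_combination 𝔤.c r a b * h1 + N (u ++ d :: r :: v) * h2
  have hb' : ∀ a b d, ∑ r, 𝔤.c r a b * N (u ++ d :: r :: v)
      = 𝔤.ε a d * 𝔤.ε b d * ∑ r, 𝔤.c r a b * N (u ++ r :: d :: v)
        + ∑ s, (∑ r, 𝔤.c r a b * 𝔤.c s d r) * N (u ++ s :: v) := fun a b d => by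
    simp only [Finset.sum_mul]
    rw [Finset.sum_comm, Finset.mul_sum, ← Finset.sum_add_distrib]
    refine Finset.sum_congr rfl fun r _ => ?_
    have h1 := hN d r
    have h2 := 𝔤.c_mul_ε r a b d
    simp only [defect, 𝔤.ε_comm d r] at h1
    simp only [mul_assoc]
    rw [← Finset.mul_sum]
    linear_combination 𝔤.c r a b * h1 + N (u ++ r :: d :: v) * h2
  have hJ : ∑ s, (∑ r, 𝔤.c r x y * 𝔤.c s r z) * N (u ++ s :: v)
      = ∑ s, (∑ r, 𝔤.c r y z * 𝔤.c s x r) * N (u ++ s :: v)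
        + 𝔤.ε y z * ∑ s, (∑ r, 𝔤.c r x z * 𝔤.c s r y) * N (u ++ s :: v) := by
    rw [Finset.mul_sum, ← Finset.sum_add_distrib]
    refine Finset.sum_congr rfl fun s _ => ?_
    rw [𝔤.jacobi_left s x y z]
    ring
  have h1 := hb x y z
  have h2 := hb' y z x
  have h3 := hb x z y
  have e1 := 𝔤.ε_mul_self y z
  have e2 := 𝔤.ε_mul_self x z
  rw [𝔤.ε_comm y x, 𝔤.ε_comm z x] at h2
  rw [𝔤.ε_comm z y] at h3
  simp only [defect, List.append_assoc, List.cons_append, List.nil_append]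
  linear_combination -h1 + h2 + 𝔤.ε y z * h3 - hJ
    + (𝔤.ε x y * ∑ r, 𝔤.c r x z * N (u ++ y :: r :: v)) * e1

/-- The square of two disjoint transpositions. -/
theorem defect_square (N : List ι → ℝ) (u t v : List ι) (x y x' y' : ι)
    (h : ∀ r, 𝔤.defect N u x y (t ++ r :: v) = 0)
    (h' : ∀ r, 𝔤.defect N (u ++ r :: t) x' y' v = 0) :
    𝔤.defect N u x y (t ++ x' :: y' :: v) - 𝔤.ε x' y' * 𝔤.defect N u x y (t ++ y' :: x' :: v)
      = 𝔤.defect N (u ++ x :: y :: t) x' y' v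
        - 𝔤.ε x y * 𝔤.defect N (u ++ y :: x :: t) x' y' v := by
  have hs : ∑ r, 𝔤.c r x' y' * 𝔤.defect N u x y (t ++ r :: v) = 0 :=
    Finset.sum_eq_zero fun r _ => by rw [h, mul_zero]
  have hs' : ∑ r, 𝔤.c r x y * 𝔤.defect N (u ++ r :: t) x' y' v = 0 :=
    Finset.sum_eq_zero fun r _ => by rw [h', mul_zero]
  have e1 : ∑ r, 𝔤.c r x' y' * 𝔤.defect N u x y (t ++ r :: v)
      = ∑ r, 𝔤.c r x' y' * N (u ++ x :: y :: (t ++ r :: v))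
        - 𝔤.ε x y * ∑ r, 𝔤.c r x' y' * N (u ++ y :: x :: (t ++ r :: v))
        - ∑ r, ∑ s, 𝔤.c r x' y' * (𝔤.c s x y * N (u ++ s :: (t ++ r :: v))) := by
    rw [Finset.mul_sum, ← Finset.sum_sub_distrib, ← Finset.sum_sub_distrib]
    refine Finset.sum_congr rfl fun r _ => ?_
    rw [← Finset.mul_sum, defect]
    ring
  have e2 : ∑ r, 𝔤.c r x y * 𝔤.defect N (u ++ r :: t) x' y' v
      = ∑ r, 𝔤.c r x y * N (u ++ r :: (t ++ x' :: y' :: v))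
        - 𝔤.ε x' y' * ∑ r, 𝔤.c r x y * N (u ++ r :: (t ++ y' :: x' :: v))
        - ∑ r, ∑ s, 𝔤.c r x y * (𝔤.c s x' y' * N (u ++ r :: (t ++ s :: v))) := by
    rw [Finset.mul_sum, ← Finset.sum_sub_distrib, ← Finset.sum_sub_distrib]
    refine Finset.sum_congr rfl fun r _ => ?_
    rw [← Finset.mul_sum, defect]
    simp only [List.append_assoc, List.cons_append]
    ring
  have e3 : ∑ r, ∑ s, 𝔤.c r x y * (𝔤.c s x' y' * N (u ++ r :: (t ++ s :: v)))
      = ∑ r, ∑ s, 𝔤.c r x' y' * (𝔤.c s x y * N (u ++ s :: (t ++ r :: v))) := by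
    rw [Finset.sum_comm]
    exact Finset.sum_congr rfl fun r _ => Finset.sum_congr rfl fun s _ => by ring
  rw [e1] at hs
  rw [e2, e3] at hs'
  simp only [defect, List.append_assoc, List.cons_append]
  linear_combination hs - hs'

variable (ρ : ι → ℕ)

/-- A pair of letters in the wrong order. -/
def IsBad (x y : ι) : Prop := ρ y < ρ x ∨ (x = y ∧ 𝔤.par x = 1)

/-- The number of inversions of a word. -/
def inversions : List ι → ℕ
  | [] => 0
  | x :: l => l.countP (fun y => decide (ρ y < ρ x)) + inversions l

variable {ρ} in
theorem inversions_swap_lt (u : List ι) {x y : ι} (v : List ι) (h : ρ y < ρ x) :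
    inversions ρ (u ++ y :: x :: v) < inversions ρ (u ++ x :: y :: v) := by
  induction u with
  | nil =>
    simp only [List.nil_append, inversions, List.countP_cons, h, not_lt_of_gt h, decide_true,
      decide_false]
    simp
    omega
  | cons z u ih =>
    simp only [List.cons_append, inversions]
    have : (u ++ y :: x :: v).countP (fun y => decide (ρ y < ρ z))
        = (u ++ x :: y :: v).countP (fun y => decide (ρ y < ρ z)) :=
      ((List.Perm.swap x y v).append_left u).countP_eq _
    omega

open scoped Classical in
/-- The normal form functional on words: `f` on normally ordered words, extended to all words by
the defining relations of the universal enveloping algebra. -/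
def normalForm (f : List ι → ℝ) (w : List ι) : ℝ :=
  if h : ∃ p : List ι × ι × ι × List ι, w = p.1 ++ p.2.1 :: p.2.2.1 :: p.2.2.2 ∧
      𝔤.IsBad ρ p.2.1 p.2.2.1 then
    let p := h.choose
    if hρ : ρ p.2.2.1 < ρ p.2.1 then
      𝔤.ε p.2.1 p.2.2.1 * normalForm f (p.1 ++ p.2.2.1 :: p.2.1 :: p.2.2.2)
        + ∑ r, 𝔤.c r p.2.1 p.2.2.1 * normalForm f (p.1 ++ r :: p.2.2.2)
    -- A repeated odd letter `x`: here `ε x x = -1`, and the relation reads `2 x x = ∑ c^r_{xx}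
    -- e_r`.
    else 1 / 2 * ∑ r, 𝔤.c r p.2.1 p.2.2.1 * normalForm f (p.1 ++ r :: p.2.2.2)
  else f w
-- Exchanging a pair removes an inversion at constant length; replacing a pair by its bracket
-- shortens the word.
termination_by (w.length, inversions ρ w)
decreasing_by
  · have hs := h.choose_spec.1
    have h1 := inversions_swap_lt h.choose.1 h.choose.2.2.2 hρ
    rw [Prod.lex_def]
    refine Or.inr ⟨?_, ?_⟩
    · conv_rhs => rw [hs]
      simp
    · conv_rhs => rw [hs]
      exact h1
  · have hs := h.choose_spec.1
    rw [Prod.lex_def]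
    refine Or.inl ?_
    conv_rhs => rw [hs]
    simp
  · have hs := h.choose_spec.1
    rw [Prod.lex_def]
    refine Or.inl ?_
    conv_rhs => rw [hs]
    simp

theorem normalForm_of_normal (f : List ι → ℝ) (w : List ι)
    (hw : ∀ u x y v, w = u ++ x :: y :: v → ¬𝔤.IsBad ρ x y) : 𝔤.normalForm ρ f w = f w := by
  rw [normalForm, dif_neg]
  rintro ⟨p, hp, hb⟩
  exact hw _ _ _ _ hp hb

/-- The recursion resolves one chosen bad pair, for which the relation holds by construction.
Nothing is known about the choice, so all other bad pairs have to be compared with it. -/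
theorem exists_defect_eq_zero (f : List ι → ℝ) (u : List ι) (x y : ι) (v : List ι)
    (hb : 𝔤.IsBad ρ x y) : ∃ u' x' y' v', u ++ x :: y :: v = u' ++ x' :: y' :: v' ∧
      𝔤.IsBad ρ x' y' ∧ 𝔤.defect (𝔤.normalForm ρ f) u' x' y' v' = 0 := by
  have h : ∃ p : List ι × ι × ι × List ι,
      u ++ x :: y :: v = p.1 ++ p.2.1 :: p.2.2.1 :: p.2.2.2 ∧ 𝔤.IsBad ρ p.2.1 p.2.2.1 :=
    ⟨⟨u, x, y, v⟩, rfl, hb⟩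
  refine ⟨h.choose.1, h.choose.2.1, h.choose.2.2.1, h.choose.2.2.2, h.choose_spec.1,
    h.choose_spec.2, ?_⟩
  have hN := normalForm.eq_def 𝔤 ρ f (u ++ x :: y :: v)
  rw [dif_pos h] at hN
  simp only at hN
  have hb' := h.choose_spec.2
  rw [defect, ← h.choose_spec.1, hN]
  split_ifs with hρ
  · ring
  · obtain ⟨h1, h2⟩ := hb'.resolve_left hρ
    have : h.choose.1 ++ h.choose.2.2.1 :: h.choose.2.1 :: h.choose.2.2.2 = u ++ x :: y :: v := by
      conv_rhs => rw [h.choose_spec.1]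
      rw [h1]
    rw [this, hN, dif_neg hρ, ← h1, ε, h2, mul_one, sgn_one]
    ring

variable {ρ}

/-- Exchanging the two letters changes the defect only by a sign factor, and a repeated even letter
has no defect. Injectivity of `ρ` makes the order of letters total. -/
theorem defect_eq_zero_of_isBad (hρ : Function.Injective ρ) (N : List ι → ℝ) (u v : List ι)
    (h : ∀ x y, 𝔤.IsBad ρ x y → 𝔤.defect N u x y v = 0) (x y : ι) : 𝔤.defect N u x y v = 0 := by
  rcases lt_trichotomy (ρ x) (ρ y) with hlt | heq | hgt
  · rw [𝔤.defect_swap, h y x (Or.inl hlt), mul_zero, neg_zero]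
  · obtain rfl := hρ heq
    rcases parity_cases (𝔤.par x) with hx | hx
    · exact 𝔤.defect_self_of_even N u v hx
    · exact h x x (Or.inr ⟨rfl, hx⟩)
  · exact h x y (Or.inl hgt)

/-- The diamond lemma: all ways of normally ordering a word agree. -/
theorem defect_normalForm_of_isBad (hρ : Function.Injective ρ) (f : List ι → ℝ) (w : List ι) :
    ∀ u x y v, w = u ++ x :: y :: v → 𝔤.IsBad ρ x y →
      𝔤.defect (𝔤.normalForm ρ f) u x y v = 0 := by
  set N := 𝔤.normalForm ρ f with hNdef
  have hwf : WellFounded (InvImage (Prod.Lex (· < ·) (· < ·)) fun w : List ι =>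
      (w.length, inversions ρ w)) :=
    InvImage.wf _ (WellFounded.prod_lex wellFounded_lt wellFounded_lt)
  induction w using hwf.induction with
  | _ w ih =>
  -- On shorter words the inductive hypothesis covers all pairs of letters, not only the bad ones.
  have hshort : ∀ u x y v, (u ++ x :: y :: v).length < w.length → 𝔤.defect N u x y v = 0 := by
    intro u x y v hl
    refine 𝔤.defect_eq_zero_of_isBad hρ N u v (fun a b hab => ?_) x y
    refine ih (u ++ a :: b :: v) ?_ u a b v rfl hab
    refine Prod.lex_def.2 (Or.inl ?_)
    simpa using hl
  have hinv : ∀ u x y v, (u ++ x :: y :: v).length = w.length →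
      inversions ρ (u ++ x :: y :: v) < inversions ρ w → 𝔤.IsBad ρ x y →
        𝔤.defect N u x y v = 0 := by
    intro u x y v hl hi hb
    exact ih (u ++ x :: y :: v) (Prod.lex_def.2 (Or.inr ⟨hl, hi⟩)) u x y v rfl hb
  -- It suffices that vanishing of the defect does not depend on the bad pair. Two bad pairs in one
  -- word coincide, share a letter (hexagon), or are disjoint (square), according to the length of
  -- `t`.
  have key : ∀ u x y v u' x' y' v', w = u ++ x :: y :: v → w = u' ++ x' :: y' :: v' →
      u.length ≤ u'.length → 𝔤.IsBad ρ x y → 𝔤.IsBad ρ x' y' →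
        (𝔤.defect N u x y v = 0 ↔ 𝔤.defect N u' x' y' v' = 0) := by
    intro u x y v u' x' y' v' hw hw' hlen hb hb'
    obtain ⟨t, rfl⟩ : ∃ t, u' = u ++ t :=
      (List.prefix_of_prefix_length_le ⟨_, hw.symm⟩ ⟨_, hw'.symm⟩ hlen).imp fun _ h => h.symm
    have hw2 := hw.symm.trans hw'
    rw [List.append_assoc, List.append_cancel_left_eq] at hw2
    match t, hw2 with
    | [], hw2 =>
      simp only [List.nil_append, List.cons.injEq] at hw2
      obtain ⟨rfl, rfl, rfl⟩ := hw2
      rw [List.append_nil]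
    | [a], hw2 =>
      simp only [List.cons_append, List.nil_append, List.cons.injEq] at hw2
      obtain ⟨rfl, rfl, rfl⟩ := hw2
      have hhex := 𝔤.defect_hexagon N u x y y' v' fun a b => hshort _ _ _ _ (by simp [hw])
      rcases hb with hxy | ⟨rfl, hx⟩ <;> rcases hb' with hyz | ⟨rfl, hy⟩
      · have i1 : inversions ρ (u ++ y :: x :: y' :: v') < inversions ρ w := by
          rw [hw]; exact inversions_swap_lt u _ hxy
        have i2 : inversions ρ (u ++ x :: y' :: y :: v') < inversions ρ w := by
          have := inversions_swap_lt (u ++ [x]) v' hyz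
          rw [hw]
          simpa using this
        have i3 : inversions ρ (u ++ y :: y' :: x :: v')
            < inversions ρ (u ++ y :: x :: y' :: v') := by
          have := inversions_swap_lt (u ++ [y]) v' (hyz.trans hxy)
          simpa using this
        have i4 : inversions ρ (u ++ y' :: x :: y :: v')
            < inversions ρ (u ++ x :: y' :: y :: v') :=
          inversions_swap_lt u _ (hyz.trans hxy)
        -- The four other edges of the hexagon belong to words with fewer inversions, so only the
        -- two defects to be compared remain.
        rw [hinv (u ++ [y]) x y' v' (by simp [hw]) (by simpa using i1) (Or.inl (hyz.trans hxy)),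
          hinv u y y' (x :: v') (by simp [hw]) (i3.trans i1) (Or.inl hyz),
          hinv u x y' (y :: v') (by simp [hw]) i2 (Or.inl (hyz.trans hxy)),
          hinv (u ++ [y']) x y v' (by simp [hw]) (by simpa using i4.trans i2) (Or.inl hxy)] at hhex
        simp only [mul_zero, add_zero] at hhex
        rw [hhex]
      · have i1 : inversions ρ (u ++ y :: x :: y :: v') < inversions ρ w := by
          rw [hw]; exact inversions_swap_lt u _ hxy
        have i3 : inversions ρ (u ++ y :: y :: x :: v')
            < inversions ρ (u ++ y :: x :: y :: v') := by
          have := inversions_swap_lt (u ++ [y]) v' hxy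
          simpa using this
        rw [hinv (u ++ [y]) x y v' (by simp [hw]) (by simpa using i1) (Or.inl hxy),
          hinv u y y (x :: v') (by simp [hw]) (i3.trans i1) (Or.inr ⟨rfl, hy⟩)] at hhex
        -- The exchange of the equal odd letters fixes the word, and the hexagon degenerates to `d₁
        -- = d₂ - d₁`, where `d₁`, `d₂` are the two defects.
        have hε : 𝔤.ε y y = -1 := by rw [ε, hy, mul_one, sgn_one]
        rw [hε] at hhex
        constructor
        · intro h0
          rw [h0] at hhex
          linarith
        · intro h0
          rw [h0] at hhex
          linarith
      · have i2 : inversions ρ (u ++ x :: y' :: x :: v') < inversions ρ w := by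
          have := inversions_swap_lt (u ++ [x]) v' hyz
          rw [hw]
          simpa using this
        have i4 : inversions ρ (u ++ y' :: x :: x :: v')
            < inversions ρ (u ++ x :: y' :: x :: v') :=
          inversions_swap_lt u _ hyz
        rw [hinv u x y' (x :: v') (by simp [hw]) i2 (Or.inl hyz),
          hinv (u ++ [y']) x x v' (by simp [hw]) (by simpa using i4.trans i2)
            (Or.inr ⟨rfl, hx⟩)] at hhex
        have hε : 𝔤.ε x x = -1 := by rw [ε, hx, mul_one, sgn_one]
        rw [hε] at hhex
        constructor
        · intro h0
          rw [h0] at hhex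
          linarith
        · intro h0
          rw [h0] at hhex
          linarith
      -- Three equal odd letters: the hexagon reads `2 d₁ - d₂ = 2 d₂ - d₁`, that is, `3 d₁ = 3 d₂`.
      · have hε : 𝔤.ε x x = -1 := by rw [ε, hx, mul_one, sgn_one]
        rw [hε] at hhex
        constructor
        · intro h0
          rw [h0] at hhex
          linarith
        · intro h0
          rw [h0] at hhex
          linarith
    | a :: b :: t, hw2 =>
      simp only [List.cons_append, List.cons.injEq] at hw2
      obtain ⟨rfl, rfl, rfl⟩ := hw2
      have hsq := 𝔤.defect_square N u t v' x y x' y'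
        (fun r => hshort _ _ _ _ (by simp [hw]))
        (fun r => hshort _ _ _ _ (by simp [hw]))
      -- Each pair of opposite edges of the square either involves a word with fewer inversions, or
      -- coincides because a repeated odd letter is exchanged, and then the defect is counted twice.
      have hl : (1 - 𝔤.ε x' y') * 𝔤.defect N u x y (t ++ x' :: y' :: v')
            = 𝔤.defect N u x y (t ++ x' :: y' :: v')
              - 𝔤.ε x' y' * 𝔤.defect N u x y (t ++ y' :: x' :: v') ∧ 𝔤.ε x' y' = -1 ∨
          𝔤.defect N u x y (t ++ y' :: x' :: v') = 0 := by
        rcases hb' with h | ⟨rfl, h⟩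
        · refine Or.inr (hinv _ _ _ _ (by simp [hw]) ?_ hb)
          have := inversions_swap_lt (u ++ x :: y :: t) v' h
          rw [hw]
          simpa using this
        · exact Or.inl ⟨by ring, by rw [ε, h, mul_one, sgn_one]⟩
      have hr : (1 - 𝔤.ε x y) * 𝔤.defect N (u ++ x :: y :: t) x' y' v'
            = 𝔤.defect N (u ++ x :: y :: t) x' y' v'
              - 𝔤.ε x y * 𝔤.defect N (u ++ y :: x :: t) x' y' v' ∧ 𝔤.ε x y = -1 ∨
          𝔤.defect N (u ++ y :: x :: t) x' y' v' = 0 := by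
        rcases hb with h | ⟨rfl, h⟩
        · refine Or.inr (hinv _ _ _ _ (by simp [hw]) ?_ hb')
          have := inversions_swap_lt u (t ++ x' :: y' :: v') h
          rw [hw]
          simpa using this
        · exact Or.inl ⟨by ring, by rw [ε, h, mul_one, sgn_one]⟩
      rcases hl with ⟨h1, h2⟩ | h1 <;> rcases hr with ⟨h3, h4⟩ | h3
      · rw [← h1, ← h3, h2, h4] at hsq
        constructor <;> intro h0 <;> rw [h0] at hsq <;> linarith
      · rw [← h1, h3, h2] at hsq
        constructor <;> intro h0 <;> rw [h0] at hsq <;> linarith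
      · rw [h1, ← h3, h4] at hsq
        constructor <;> intro h0 <;> rw [h0] at hsq <;> linarith
      · rw [h1, h3] at hsq
        constructor <;> intro h0 <;> rw [h0] at hsq <;> linarith
  intro u x y v hw hb
  obtain ⟨u', x', y', v', hw', hb', h0⟩ := 𝔤.exists_defect_eq_zero ρ f u x y v hb
  rw [← hw] at hw'
  rcases le_total u.length u'.length with hl | hl
  · exact (key u x y v u' x' y' v' hw hw' hl hb hb').2 h0
  · exact (key u' x' y' v' u x y v hw' hw hl hb' hb).1 h0

theorem defect_normalForm (hρ : Function.Injective ρ) (f : List ι → ℝ) (u : List ι) (x y : ι)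
    (v : List ι) : 𝔤.defect (𝔤.normalForm ρ f) u x y v = 0 :=
  𝔤.defect_eq_zero_of_isBad hρ _ u v
    (fun a b hab => 𝔤.defect_normalForm_of_isBad hρ f _ u a b v rfl hab) x y

end LieSuperalgebra

end

end SuperYM

namespace SuperYM

noncomputable section

namespace LieSuperalgebra

variable {ι : Type*} [Fintype ι] (𝔤 : LieSuperalgebra ι)

/-! ## Invariance of the Casimir form -/

/-- The functions of words respecting the relations of the universal enveloping algebra. -/
def wordFunctionals : Submodule ℝ (List ι → ℝ) where
  carrier := {N | ∀ u x y v, 𝔤.defect N u x y v = 0}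
  zero_mem' u x y v := by simp [defect]
  add_mem' {M N} hM hN u x y v := by
    have h1 := hM u x y v
    have h2 := hN u x y v
    simp only [defect, Pi.add_apply, mul_add, Finset.sum_add_distrib] at *
    linear_combination h1 + h2
  smul_mem' a N hN u x y v := by
    have h2 := hN u x y v
    have : ∀ r, 𝔤.c r x y * (a * N (u ++ r :: v)) = a * (𝔤.c r x y * N (u ++ r :: v)) :=
      fun r => by ring
    simp only [defect, Pi.smul_apply, smul_eq_mul, this, ← Finset.mul_sum] at *
    linear_combination a * h2

/-- The letter `i` acts on functions of words by `N ↦ N (· i)`. -/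
def letterAction (i : ι) : Module.End ℝ 𝔤.wordFunctionals where
  toFun N := ⟨fun w => N.1 (w ++ [i]), fun u x y v => by
    have := N.2 u x y (v ++ [i])
    simpa [defect] using this⟩
  map_add' _ _ := rfl
  map_smul' _ _ := rfl

theorem letterAction_val (i : ι) (N : 𝔤.wordFunctionals) (w : List ι) :
    (𝔤.letterAction i N).1 w = N.1 (w ++ [i]) := rfl

theorem wordFunctionals_swap (N : 𝔤.wordFunctionals) (u : List ι) (x y : ι) (v : List ι) :
    N.1 (u ++ x :: y :: v)
      = 𝔤.ε x y * N.1 (u ++ y :: x :: v) + ∑ r, 𝔤.c r x y * N.1 (u ++ r :: v) := by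
  have := N.2 u x y v
  rw [defect] at this
  linarith

theorem wordFunctionals_sum_val {κ : Type*} (S : Finset κ) (F : κ → 𝔤.wordFunctionals)
    (w : List ι) : (∑ k ∈ S, F k).1 w = ∑ k ∈ S, (F k).1 w := by
  rw [AddSubmonoidClass.coe_finsetSum, Finset.sum_apply]

/-- The action of the universal enveloping algebra on functions of words. -/
def wordAction : 𝔤.Enveloping →ₐ[ℝ] Module.End ℝ 𝔤.wordFunctionals :=
  RingQuot.liftAlgHom ℝ ⟨FreeAlgebra.lift ℝ 𝔤.letterAction, by
    rintro _ _ ⟨i, j⟩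
    rw [map_add, map_smul, map_sum]
    simp only [map_mul, map_smul, FreeAlgebra.lift_ι_apply]
    refine LinearMap.ext fun N => Subtype.ext (funext fun w => ?_)
    have h := 𝔤.wordFunctionals_swap N w i j []
    simp only [LinearMap.add_apply, LinearMap.smul_apply, LinearMap.sum_apply, Module.End.mul_apply,
      Submodule.coe_add, Submodule.coe_smul, Pi.add_apply, Pi.smul_apply, letterAction_val,
      wordFunctionals_sum_val, smul_eq_mul, List.append_assoc, List.cons_append,
      List.nil_append]
    exact h⟩

theorem wordAction_e (i : ι) : 𝔤.wordAction (𝔤.e i) = 𝔤.letterAction i := by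
  rw [wordAction, e, RingQuot.liftAlgHom_mkAlgHom_apply, FreeAlgebra.lift_ι_apply]

variable (h : Matrix ι ι ℝ)

/-- The coefficients of the bracket of `e_k` with `∑ h^{ij} e_i e_j`. -/
def casimirBracket (k a b : ι) : ℝ :=
  ∑ i, (𝔤.c a k i * h i b + 𝔤.ε k a * (h a i * 𝔤.c b k i))

variable {𝔤 h} [DecidableEq ι]

/-- The identity expressing centrality acts on `N` and is evaluated at the empty word. Carrying `k`
through the two letters of the Casimir element produces the coefficients of the bracket; the two
signs passed cancel because `h` is even. -/
theorem IsNondegenerateCasimir.sum_casimirBracket (hh : 𝔤.IsNondegenerateCasimir h)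
    (N : 𝔤.wordFunctionals) (k : ι) :
    ∑ a, ∑ b, 𝔤.casimirBracket h k a b * N.1 [a, b] = 0 := by
  have hc := congrArg (fun z => (𝔤.wordAction z N).1 []) (hh.central (𝔤.e k))
  simp only [map_mul, map_sum, map_smul, wordAction_e, Module.End.mul_apply, LinearMap.sum_apply,
    LinearMap.smul_apply, letterAction_val, wordFunctionals_sum_val, Submodule.coe_smul,
    Pi.smul_apply, smul_eq_mul, List.nil_append, List.cons_append] at hc
  have hterm : ∀ i j, h i j * N.1 [k, i, j] = h i j * N.1 [i, j, k]
      + ∑ r, (h i j * 𝔤.c r k i * N.1 [r, j] + 𝔤.ε k i * h i j * 𝔤.c r k j * N.1 [i, r]) := by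
    intro i j
    by_cases hij : h i j = 0
    · simp [hij]
    have h1 := 𝔤.wordFunctionals_swap N [] k i [j]
    have h2 := 𝔤.wordFunctionals_swap N [i] k j []
    have hε : 𝔤.ε k j = 𝔤.ε k i := by rw [ε, ε, hh.even i j hij]
    simp only [List.nil_append, List.cons_append, hε] at h1 h2
    rw [Finset.sum_add_distrib]
    have e1 : ∑ r, h i j * 𝔤.c r k i * N.1 [r, j] = h i j * ∑ r, 𝔤.c r k i * N.1 [r, j] := by
      rw [Finset.mul_sum]
      exact Finset.sum_congr rfl fun r _ => by ring
    have e2 : ∑ r, 𝔤.ε k i * h i j * 𝔤.c r k j * N.1 [i, r]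
        = 𝔤.ε k i * h i j * ∑ r, 𝔤.c r k j * N.1 [i, r] := by
      rw [Finset.mul_sum]
      exact Finset.sum_congr rfl fun r _ => by ring
    have e3 := 𝔤.ε_mul_self k i
    rw [e1, e2]
    linear_combination h i j * h1 + h i j * 𝔤.ε k i * h2 + h i j * N.1 [i, j, k] * e3
  simp only [hterm, Finset.sum_add_distrib, add_eq_left] at hc
  rw [← hc]
  simp only [casimirBracket, Finset.sum_mul, add_mul, Finset.sum_add_distrib]
  congr 1
  · rw [Finset.sum_comm' (t' := Finset.univ) (s' := fun _ => Finset.univ) (by simp)]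
    rw [Finset.sum_congr rfl fun b _ => Finset.sum_comm, Finset.sum_comm]
    refine Finset.sum_congr rfl fun i _ => Finset.sum_congr rfl fun j _ =>
      Finset.sum_congr rfl fun r _ => by ring
  · refine Finset.sum_congr rfl fun i _ => ?_
    rw [Finset.sum_comm]
    refine Finset.sum_congr rfl fun j _ => Finset.sum_congr rfl fun r _ => by ring

/-- The bracket inherits the graded symmetry of `h`, its two summands being interchanged. Hence no
coefficient is lost in passing to normally ordered words. -/
theorem IsNondegenerateCasimir.casimirBracket_symm (hh : 𝔤.IsNondegenerateCasimir h)
    (k a b : ι) : 𝔤.casimirBracket h k b a = 𝔤.ε a b * 𝔤.casimirBracket h k a b := by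
  unfold casimirBracket
  rw [Finset.mul_sum]
  refine Finset.sum_congr rfl fun i _ => ?_
  have key : ∀ a b, 𝔤.c b k i * h i a = 𝔤.ε a b * (𝔤.ε k a * (h a i * 𝔤.c b k i)) := by
    intro a b
    by_cases h1 : h a i = 0
    · have := hh.symm a i
      have h2 : h i a = 0 := by rw [hh.symm i a, h1, mul_zero]
      rw [h1, h2]
      ring
    by_cases h2 : 𝔤.c b k i = 0
    · rw [h2]; ring
    have h3 := 𝔤.c_par b k i h2
    have h4 := hh.even a i h1
    rw [hh.symm i a, ε, ε, h3, ← h4]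
    rcases parity_cases (𝔤.par a) with ha | ha <;> rcases parity_cases (𝔤.par k) with hk | hk <;>
      rw [ha, hk] <;> simp <;> ring
  have k1 := key a b
  have k2 := key b a
  rw [𝔤.ε_comm b a] at k2
  have e1 := 𝔤.ε_mul_self a b
  linear_combination k1 - 𝔤.ε a b * k2 - 𝔤.ε k b * h b i * 𝔤.c a k i * e1

/-- The functional dual to a normally ordered word of length two extends to all words by the diamond
lemma. Paired with the bracket it isolates one coefficient, counted twice for distinct letters
because of graded symmetry. The remaining coefficients follow by symmetry, and those of repeated odd
letters vanish by sign. -/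
theorem IsNondegenerateCasimir.casimirBracket_eq_zero (hh : 𝔤.IsNondegenerateCasimir h)
    (k a b : ι) : 𝔤.casimirBracket h k a b = 0 := by
  classical
  let ρ : ι → ℕ := fun i => Fintype.equivFin ι i
  have hρ : Function.Injective ρ := Fin.val_injective.comp (Fintype.equivFin ι).injective
  have main : ∀ a b, ¬𝔤.IsBad ρ a b → 𝔤.casimirBracket h k a b = 0 := by
    intro a b hab
    let f : List ι → ℝ := fun w => if w = [a, b] then 1 else 0
    let N : 𝔤.wordFunctionals := ⟨𝔤.normalForm ρ f, 𝔤.defect_normalForm hρ f⟩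
    have hN1 : ∀ r, N.1 [r] = 0 := fun r => by
      have := 𝔤.normalForm_of_normal ρ f [r] fun u x y v hw => by
        have := congrArg List.length hw
        simp at this
        omega
      rw [show N.1 [r] = 𝔤.normalForm ρ f [r] from rfl, this]
      simp [f]
    have hN2 : ∀ i j, ¬𝔤.IsBad ρ i j → N.1 [i, j] = if i = a ∧ j = b then 1 else 0 := by
      intro i j hij
      have := 𝔤.normalForm_of_normal ρ f [i, j] fun u x y v hw => by
        have h1 := congrArg List.length hw
        simp at h1
        obtain rfl : u = [] := List.length_eq_zero_iff.1 (by omega)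
        simp only [List.nil_append, List.cons.injEq] at hw
        rw [← hw.1, ← hw.2.1]
        exact hij
      rw [show N.1 [i, j] = 𝔤.normalForm ρ f [i, j] from rfl, this]
      simp [f]
    have hswap : ∀ i j, N.1 [i, j] = 𝔤.ε i j * N.1 [j, i] := fun i j => by
      have := 𝔤.wordFunctionals_swap N [] i j []
      simpa [hN1] using this
    -- Since `N` vanishes on single letters, it is graded symmetric on pairs: its only nonzero
    -- values are at `[a, b]` and, through the exchange relation, at `[b, a]`.
    have hN3 : ∀ i j, N.1 [i, j] = (if i = a ∧ j = b then 1 else 0)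
        + if a ≠ b ∧ i = b ∧ j = a then 𝔤.ε a b else 0 := by
      intro i j
      by_cases hij : 𝔤.IsBad ρ i j
      · have hne : ¬(i = a ∧ j = b) := fun e => hab (by rwa [← e.1, ← e.2])
        rw [if_neg hne, zero_add]
        rcases hij with hlt | ⟨rfl, hpar⟩
        · have : ¬𝔤.IsBad ρ j i := by
            rintro (h1 | ⟨rfl, -⟩)
            · exact lt_asymm h1 hlt
            · exact lt_irrefl _ hlt
          rw [hswap, hN2 j i this]
          have hne' : i ≠ j := fun e => by rw [e] at hlt; exact lt_irrefl _ hlt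
          by_cases hc : j = a ∧ i = b
          · obtain ⟨rfl, rfl⟩ := hc
            simp [hne'.symm, 𝔤.ε_comm]
          · rw [if_neg hc, mul_zero, if_neg]
            exact fun e => hc ⟨e.2.2, e.2.1⟩
        · have h0 := hswap i i
          rw [ε, hpar, mul_one, sgn_one] at h0
          rw [show N.1 [i, i] = 0 by linarith, if_neg]
          exact fun e => e.1 (e.2.2.symm.trans e.2.1)
      · rw [hN2 i j hij]
        have : ¬(a ≠ b ∧ i = b ∧ j = a) := by
          rintro ⟨h1, rfl, rfl⟩
          rcases lt_trichotomy (ρ i) (ρ j) with h2 | h2 | h2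
          · exact hab (Or.inl h2)
          · exact h1 (hρ h2).symm
          · exact hij (Or.inl h2)
        rw [if_neg this, add_zero]
    have hsum := hh.sum_casimirBracket N k
    simp only [hN3, mul_add, Finset.sum_add_distrib] at hsum
    have s1 : ∑ i, ∑ j, 𝔤.casimirBracket h k i j * (if i = a ∧ j = b then (1 : ℝ) else 0)
        = 𝔤.casimirBracket h k a b := by
      rw [Finset.sum_eq_single a, Finset.sum_eq_single b] <;> simp +contextual
    have s2 : ∑ i, ∑ j, 𝔤.casimirBracket h k i j *
        (if a ≠ b ∧ i = b ∧ j = a then 𝔤.ε a b else (0 : ℝ))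
        = 𝔤.casimirBracket h k b a * if a ≠ b then 𝔤.ε a b else 0 := by
      rw [Finset.sum_eq_single b, Finset.sum_eq_single a] <;> simp +contextual
    rw [s1, s2] at hsum
    by_cases hne : a ≠ b
    · rw [if_pos hne, hh.casimirBracket_symm k a b] at hsum
      have e := 𝔤.ε_mul_self a b
      linear_combination (1 / 2 : ℝ) * hsum - (1 / 2 : ℝ) * 𝔤.casimirBracket h k a b * e
    · rw [if_neg hne, mul_zero, add_zero] at hsum
      exact hsum
  by_cases hab : 𝔤.IsBad ρ a b
  · rcases hab with hlt | ⟨rfl, hpar⟩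
    · have h1 := main b a fun hb => by
        rcases hb with h1 | ⟨rfl, -⟩
        · exact lt_asymm h1 hlt
        · exact lt_irrefl _ hlt
      have := hh.casimirBracket_symm k b a
      rw [this, h1, mul_zero]
    · have := hh.casimirBracket_symm k a a
      rw [ε, hpar, mul_one, sgn_one] at this
      linarith
  · exact main a b hab

/-! ### The inverse matrix -/

theorem IsNondegenerateCasimir.inv_mul (hh : 𝔤.IsNondegenerateCasimir h) : h⁻¹ * h = 1 :=
  Matrix.nonsing_inv_mul h hh.nondegenerate

theorem IsNondegenerateCasimir.mul_inv (hh : 𝔤.IsNondegenerateCasimir h) : h * h⁻¹ = 1 :=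
  Matrix.mul_nonsing_inv h hh.nondegenerate

/-- Evenness means commuting with the parity operator `P`, a property inherited by the inverse. -/
theorem IsNondegenerateCasimir.inv_even (hh : 𝔤.IsNondegenerateCasimir h) (i j : ι)
    (hij : h⁻¹ i j ≠ 0) : 𝔤.par i = 𝔤.par j := by
  let P : Matrix ι ι ℝ := Matrix.diagonal fun i => sgn (𝔤.par i)
  have hPP : P * P = 1 := by
    rw [Matrix.diagonal_mul_diagonal]
    simp only [sgn_mul_self]
    exact Matrix.diagonal_one
  have hP : P * h = h * P := by
    ext a b
    rw [Matrix.diagonal_mul, Matrix.mul_diagonal]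
    by_cases hab : h a b = 0
    · rw [hab, mul_zero, zero_mul]
    · rw [hh.even a b hab, mul_comm]
  have hP' : P * h⁻¹ = h⁻¹ * P := by
    calc P * h⁻¹ = h⁻¹ * h * P * h⁻¹ := by rw [hh.inv_mul, Matrix.one_mul]
      _ = h⁻¹ * (P * h) * h⁻¹ := by rw [hP, Matrix.mul_assoc h⁻¹ h P]
      _ = h⁻¹ * P := by
        rw [Matrix.mul_assoc, Matrix.mul_assoc P, hh.mul_inv, Matrix.mul_one]
  have := congrFun (congrFun hP' i) j
  rw [Matrix.diagonal_mul, Matrix.mul_diagonal, mul_comm] at this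
  have hs := mul_left_cancel₀ hij this
  rcases parity_cases (𝔤.par i) with h1 | h1 <;> rcases parity_cases (𝔤.par j) with h2 | h2 <;>
    rw [h1, h2] at hs ⊢ <;> norm_num at hs

/-- For an even matrix, graded symmetry is `hᵀ = P h` with `P² = 1`; inverting this equation gives
the corresponding one for the inverse matrix. -/
theorem IsNondegenerateCasimir.inv_symm (hh : 𝔤.IsNondegenerateCasimir h) (i j : ι) :
    h⁻¹ i j = 𝔤.ε i j * h⁻¹ j i := by
  let P : Matrix ι ι ℝ := Matrix.diagonal fun i => sgn (𝔤.par i)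
  have hPP : P * P = 1 := by
    rw [Matrix.diagonal_mul_diagonal]
    simp only [sgn_mul_self]
    exact Matrix.diagonal_one
  have hT : h.transpose = P * h := by
    ext a b
    rw [Matrix.diagonal_mul, Matrix.transpose_apply, hh.symm b a]
    by_cases hab : h a b = 0
    · rw [hab, mul_zero, mul_zero]
    · rw [hh.even a b hab, parity_mul_self]
  have hinv : h⁻¹.transpose = h⁻¹ * P := by
    rw [Matrix.transpose_nonsing_inv, hT, Matrix.mul_inv_rev, Matrix.inv_eq_left_inv hPP]
  have := congrFun (congrFun hinv j) i
  rw [Matrix.mul_diagonal, Matrix.transpose_apply] at this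
  rw [this]
  by_cases hji : h⁻¹ j i = 0
  · rw [hji, mul_zero, zero_mul]
  · rw [ε, hh.inv_even j i hji, parity_mul_self, mul_comm]

/-- Invariance of the bilinear form inverse to the Casimir element. -/
theorem IsNondegenerateCasimir.invariance (hh : 𝔤.IsNondegenerateCasimir h) (j k l : ι) :
    ∑ i, 𝔤.c i j k * h⁻¹ i l + 𝔤.ε k l * ∑ i, 𝔤.c i j l * h⁻¹ i k = 0 := by
  -- Both indices of the vanishing bracket are lowered with `h⁻¹`; in each summand one of the
  -- factors `h⁻¹` cancels against `h`.
  have hz : ∑ a, ∑ b, h⁻¹ k a * 𝔤.casimirBracket h j a b * h⁻¹ b l = 0 :=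
    Finset.sum_eq_zero fun a _ => Finset.sum_eq_zero fun b _ => by
      rw [hh.casimirBracket_eq_zero]; ring
  have m1 : ∀ i l, ∑ b, h i b * h⁻¹ b l = if i = l then 1 else 0 := fun i l => by
    have := congrFun (congrFun hh.mul_inv i) l
    rwa [Matrix.mul_apply, Matrix.one_apply] at this
  have m2 : ∀ i l, ∑ b, h⁻¹ i b * h b l = if i = l then 1 else 0 := fun i l => by
    have := congrFun (congrFun hh.inv_mul i) l
    rwa [Matrix.mul_apply, Matrix.one_apply] at this
  have t1 : ∀ a, ∑ b, h⁻¹ k a * (∑ i, 𝔤.c a j i * h i b) * h⁻¹ b l = h⁻¹ k a * 𝔤.c a j l := by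
    intro a
    simp only [Finset.mul_sum, Finset.sum_mul]
    rw [Finset.sum_comm]
    have : ∀ i, ∑ b, h⁻¹ k a * (𝔤.c a j i * h i b) * h⁻¹ b l
        = h⁻¹ k a * 𝔤.c a j i * if i = l then 1 else 0 := fun i => by
      rw [← m1, Finset.mul_sum]
      exact Finset.sum_congr rfl fun b _ => by ring
    simp [this]
  have t2 : ∀ b, ∑ a, h⁻¹ k a * (∑ i, 𝔤.ε j a * (h a i * 𝔤.c b j i)) * h⁻¹ b l
      = 𝔤.ε j k * (𝔤.c b j k * h⁻¹ b l) := by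
    intro b
    simp only [Finset.mul_sum, Finset.sum_mul]
    rw [Finset.sum_comm]
    have : ∀ i, ∑ a, h⁻¹ k a * (𝔤.ε j a * (h a i * 𝔤.c b j i)) * h⁻¹ b l
        = 𝔤.ε j k * 𝔤.c b j i * h⁻¹ b l * if k = i then 1 else 0 := fun i => by
      rw [← m2, Finset.mul_sum]
      refine Finset.sum_congr rfl fun a _ => ?_
      by_cases ha : h⁻¹ k a = 0
      · rw [ha]; ring
      · rw [ε, ε, hh.inv_even k a ha]; ring
    simp only [this]
    simp
    ring
  simp only [casimirBracket, Finset.sum_add_distrib, mul_add, add_mul] at hz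
  rw [Finset.sum_congr rfl fun a _ => t1 a] at hz
  rw [Finset.sum_comm (f := fun a b => h⁻¹ k a * (∑ i, 𝔤.ε j a * (h a i * 𝔤.c b j i)) * h⁻¹ b l),
    Finset.sum_congr rfl fun b _ => t2 b, ← Finset.mul_sum] at hz
  have e1 : ∑ a, h⁻¹ k a * 𝔤.c a j l = 𝔤.ε j k * (𝔤.ε k l * ∑ i, 𝔤.c i j l * h⁻¹ i k) := by
    rw [Finset.mul_sum, Finset.mul_sum]
    refine Finset.sum_congr rfl fun a _ => ?_
    by_cases hc : 𝔤.c a j l = 0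
    · rw [hc]; ring
    by_cases ha : h⁻¹ k a = 0
    · have := hh.inv_symm a k
      rw [ha, mul_zero] at this
      rw [ha, this]; ring
    rw [hh.inv_symm k a, ε, ε, ε, ← hh.inv_even k a ha]
    have hp := 𝔤.c_par a j l hc
    rw [← hh.inv_even k a ha] at hp
    rw [hp]
    rcases parity_cases (𝔤.par j) with h1 | h1 <;> rcases parity_cases (𝔤.par l) with h2 | h2 <;>
      rw [h1, h2] <;> simp <;> ring
  rw [e1] at hz
  have e2 := 𝔤.ε_mul_self j k
  linear_combination 𝔤.ε j k * hz - (∑ i, 𝔤.c i j k * h⁻¹ i l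
    + 𝔤.ε k l * ∑ i, 𝔤.c i j l * h⁻¹ i k) * e2

end LieSuperalgebra

end

end SuperYM

namespace SuperYM

noncomputable section

/-! ## The Yang-Mills equations and their Noether identities -/

section YangMills

variable {n : ℕ} {U : Opens (Fin n → ℝ)} {ι : Type*} [Fintype ι] (𝔤 : LieSuperalgebra ι)

theorem isHomog_a (r : ι) (l : Fin n) (Λ : Multiset (Fin n)) :
    IsHomog (𝔤.par r) (a 𝔤 r l Λ : Alg 𝔤 U) :=
  isHomog_gen _

theorem isHomog_gh (r : ι) (Λ : Multiset (Fin n)) :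
    IsHomog (𝔤.par r + 1) (gh 𝔤 r Λ : Alg 𝔤 U) :=
  isHomog_gen _

theorem isHomog_aBar (r : ι) (l : Fin n) (Λ : Multiset (Fin n)) :
    IsHomog (𝔤.par r + 1) (aBar 𝔤 r l Λ : Alg 𝔤 U) :=
  isHomog_gen _

theorem isHomog_ghBar (r : ι) (Λ : Multiset (Fin n)) :
    IsHomog (𝔤.par r) (ghBar 𝔤 r Λ : Alg 𝔤 U) :=
  (isHomog_gen _).cast (by
    change 𝔤.par r + 1 + 1 = _
    rw [add_assoc, parity_one_add_one, add_zero])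

theorem a_mul_a (i j : ι) (l m : Fin n) (Λ M : Multiset (Fin n)) :
    (a 𝔤 i l Λ * a 𝔤 j m M : Alg 𝔤 U) = 𝔤.ε i j • (a 𝔤 j m M * a 𝔤 i l Λ) :=
  (isHomog_a 𝔤 i l Λ).mul_comm' (isHomog_a 𝔤 j m M)

theorem isHomog_c_smul {s : ZMod 2} (r i j : ι) {x : Alg 𝔤 U}
    (hx : 𝔤.par r = 𝔤.par i + 𝔤.par j → IsHomog s x) : IsHomog s (𝔤.c r i j • x) := by
  by_cases hc : 𝔤.c r i j = 0
  · rw [hc, zero_smul]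
    exact IsHomog.zero
  · exact (hx (𝔤.c_par r i j hc)).smul _

theorem isHomog_strength (r : ι) (l m : Fin n) :
    IsHomog (𝔤.par r) (strength 𝔤 r l m : Alg 𝔤 U) := by
  refine ((isHomog_a 𝔤 r m _).sub (isHomog_a 𝔤 r l _)).add ?_
  refine IsHomog.sum fun i _ => IsHomog.sum fun j _ => ?_
  refine isHomog_c_smul 𝔤 r i j fun hp => ?_
  rw [hp]
  exact (isHomog_a 𝔤 i l _).mul (isHomog_a 𝔤 j m _)

theorem strength_swap (r : ι) (l m : Fin n) :
    (strength 𝔤 r m l : Alg 𝔤 U) = -strength 𝔤 r l m := by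
  have h1 : ∑ i, ∑ j, 𝔤.c r i j • (a 𝔤 i m 0 * a 𝔤 j l 0 : Alg 𝔤 U)
      = -∑ i, ∑ j, 𝔤.c r i j • (a 𝔤 i l 0 * a 𝔤 j m 0 : Alg 𝔤 U) := by
    rw [Finset.sum_comm, ← Finset.sum_neg_distrib]
    refine Finset.sum_congr rfl fun j _ => ?_
    rw [← Finset.sum_neg_distrib]
    refine Finset.sum_congr rfl fun i _ => ?_
    rw [a_mul_a, smul_smul, ← neg_smul, 𝔤.c_skew r i j]
    congr 1
    have := 𝔤.ε_mul_self i j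
    change -(𝔤.ε i j * _) * 𝔤.ε i j = _
    linear_combination (-𝔤.c r j i) * this
  rw [strength, strength, h1]
  abel

variable (g : MetricTensor U)

theorem MetricTensor.coeff_swap (l m b k : Fin n) {x : Fin n → ℝ} (hx : x ∈ U) :
    g.coeff m l k b x = g.coeff l m b k x := by
  have hs : ((g.g x)⁻¹).IsSymm := by
    unfold Matrix.IsSymm
    rw [Matrix.transpose_nonsing_inv, (g.symm x hx).eq]
  rw [MetricTensor.coeff, MetricTensor.coeff, hs.apply l m, hs.apply b k]

/-- The coefficient function `√|det g| g^{lm} g^{bk}`, as a graded function. -/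
def coeffFn (l m b k : Fin n) : Alg 𝔤 U := ofBase (g.coeff l m b k) (g.coeff_smooth l m b k)

theorem ofBase_congr {φ : Type*} {par : φ → ZMod 2} {f f' : (Fin n → ℝ) → ℝ}
    (hf : ContDiffOn ℝ ∞ f U) (hf' : ContDiffOn ℝ ∞ f' U) (h : ∀ x ∈ U, f x = f' x) :
    (ofBase f hf : JetAlg U par) = ofBase f' hf' := by
  rw [ofBase, ofBase]
  congr 1
  ext x y
  exact h x x.2

theorem coeffFn_swap (l m b k : Fin n) : coeffFn 𝔤 g m l k b = coeffFn 𝔤 g l m b k :=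
  ofBase_congr _ _ fun _ hx => g.coeff_swap l m b k hx

theorem coeffFn_comm (l m b k : Fin n) : coeffFn 𝔤 g b k l m = coeffFn 𝔤 g l m b k :=
  ofBase_congr _ _ fun x _ => by
    rw [MetricTensor.coeff, MetricTensor.coeff]
    ring

theorem isHomog_coeffFn (l m b k : Fin n) : IsHomog 0 (coeffFn 𝔤 g l m b k) :=
  isHomog_ofBase _ _

theorem coeffFn_mul_comm (l m b k : Fin n) (x : Alg 𝔤 U) :
    coeffFn 𝔤 g l m b k * x = x * coeffFn 𝔤 g l m b k := by
  rw [(isHomog_coeffFn 𝔤 g l m b k).mul_comm, twist_zero]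

/-- The reindexing that interchanges the two strength factors of the Lagrangian. -/
theorem sum_six_swap {M : Type*} [AddCommMonoid M] {ι κ : Type*} [Fintype ι] [Fintype κ]
    (f : ι → ι → κ → κ → κ → κ → M) :
    ∑ i, ∑ j, ∑ l, ∑ m, ∑ b, ∑ k, f i j l m b k
      = ∑ i, ∑ j, ∑ l, ∑ m, ∑ b, ∑ k, f j i m l k b := by
  rw [Finset.sum_comm]
  refine Finset.sum_congr rfl fun j _ => Finset.sum_congr rfl fun i _ => ?_
  rw [Finset.sum_comm]
  refine Finset.sum_congr rfl fun l _ => Finset.sum_congr rfl fun m _ => ?_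
  rw [Finset.sum_comm]

section Rotation

variable {M : Type*} [AddCommMonoid M] {A B C D E F G : Type*} [Fintype A] [Fintype B] [Fintype C]
  [Fintype D] [Fintype E] [Fintype F] [Fintype G]

theorem sum_rotate_three (f : A → B → C → M) :
    ∑ x, ∑ y, ∑ z, f x y z = ∑ y, ∑ z, ∑ x, f x y z := by
  rw [Finset.sum_comm]
  exact Finset.sum_congr rfl fun _ _ => Finset.sum_comm

theorem sum_rotate_four (f : A → B → C → D → M) :
    ∑ x, ∑ y, ∑ z, ∑ t, f x y z t = ∑ y, ∑ z, ∑ t, ∑ x, f x y z t := by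
  rw [Finset.sum_comm]
  exact Finset.sum_congr rfl fun _ _ => sum_rotate_three _

theorem sum_rotate_five (f : A → B → C → D → E → M) :
    ∑ x, ∑ y, ∑ z, ∑ t, ∑ u, f x y z t u = ∑ y, ∑ z, ∑ t, ∑ u, ∑ x, f x y z t u := by
  rw [Finset.sum_comm]
  exact Finset.sum_congr rfl fun _ _ => sum_rotate_four _

theorem sum_rotate_seven (f : A → B → C → D → E → F → G → M) :
    ∑ x, ∑ y, ∑ z, ∑ t, ∑ u, ∑ v, ∑ w, f x y z t u v w
      = ∑ y, ∑ z, ∑ t, ∑ u, ∑ v, ∑ w, ∑ x, f x y z t u v w := by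
  rw [sum_rotate_five]
  exact Finset.sum_congr rfl fun _ _ => Finset.sum_congr rfl fun _ _ =>
    Finset.sum_congr rfl fun _ _ => Finset.sum_congr rfl fun _ _ => sum_rotate_three _

end Rotation

variable [DecidableEq ι] (h : Matrix ι ι ℝ)

/-- The momenta `P_i^{lb} = h_{ij} √|det g| g^{lm} g^{bk} ℱ^j_{mk}`. -/
def momentum (i : ι) (l b : Fin n) : Alg 𝔤 U :=
  ∑ j, ∑ m, ∑ k, h⁻¹ i j • (coeffFn 𝔤 g l m b k * strength 𝔤 j m k)

theorem momentum_swap (i : ι) (l b : Fin n) :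
    momentum 𝔤 g h i b l = -momentum 𝔤 g h i l b := by
  rw [momentum, momentum, ← Finset.sum_neg_distrib]
  refine Finset.sum_congr rfl fun j _ => ?_
  rw [Finset.sum_comm, ← Finset.sum_neg_distrib]
  refine Finset.sum_congr rfl fun m _ => ?_
  rw [← Finset.sum_neg_distrib]
  refine Finset.sum_congr rfl fun k _ => ?_
  rw [strength_swap, coeffFn_comm, mul_neg, smul_neg]

theorem lagrangian_eq : lagrangian 𝔤 g h
    = (1 / 4 : ℝ) • ∑ i, ∑ l, ∑ b, strength 𝔤 i l b * momentum 𝔤 g h i l b := by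
  simp only [lagrangian, momentum, Finset.mul_sum, Finset.smul_sum]
  refine Finset.sum_congr rfl fun i _ => ?_
  rw [Finset.sum_comm]
  refine Finset.sum_congr rfl fun l _ => ?_
  rw [Finset.sum_comm]
  rw [Finset.sum_comm]
  refine (Finset.sum_congr rfl fun j _ => Finset.sum_comm).trans ?_
  rw [Finset.sum_comm]
  refine Finset.sum_congr rfl fun b _ => Finset.sum_congr rfl fun j _ =>
    Finset.sum_congr rfl fun m _ => Finset.sum_congr rfl fun k _ => ?_
  rw [mul_smul_comm, smul_smul, ← mul_assoc, ← coeffFn_mul_comm]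
  rfl

variable {𝔤 g h}

theorem isHomog_momentum (hh : 𝔤.IsNondegenerateCasimir h) (i : ι) (l b : Fin n) :
    IsHomog (𝔤.par i) (momentum 𝔤 g h i l b) := by
  refine IsHomog.sum fun j _ => IsHomog.sum fun m _ => IsHomog.sum fun k _ => ?_
  by_cases hij : h⁻¹ i j = 0
  · rw [hij, zero_smul]
    exact IsHomog.zero
  · rw [hh.inv_even i j hij]
    exact (((isHomog_coeffFn 𝔤 g l m b k).mul (isHomog_strength 𝔤 j m k)).cast
      (zero_add _)).smul _

theorem isHomog_lagrangian (hh : 𝔤.IsNondegenerateCasimir h) :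
    IsHomog 0 (lagrangian 𝔤 g h) := by
  rw [lagrangian_eq]
  refine IsHomog.smul (IsHomog.sum fun i _ => IsHomog.sum fun l _ => IsHomog.sum fun b _ => ?_) _
  exact ((isHomog_strength 𝔤 i l b).mul (isHomog_momentum hh i l b)).cast (parity_add_self _)

theorem pd_coeffFn_mul (v : Jet n (YMField ι n ⊕ YMField ι n)) (l m b k : Fin n) (x : Alg 𝔤 U) :
    pd v (coeffFn 𝔤 g l m b k * x) = coeffFn 𝔤 g l m b k * pd v x := by
  rw [pd_mul, (isHomog_coeffFn 𝔤 g l m b k).twist, mul_zero, sgn_zero, one_smul, coeffFn,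
    pd_ofBase, zero_mul, zero_add]

/-- The variation of the Yang-Mills Lagrangian. -/
theorem pd_lagrangian (hh : 𝔤.IsNondegenerateCasimir h)
    (v : Jet n (YMField ι n ⊕ YMField ι n)) :
    pd v (lagrangian 𝔤 g h)
      = (1 / 2 : ℝ) • ∑ i, ∑ l, ∑ b, pd v (strength 𝔤 i l b) * momentum 𝔤 g h i l b := by
  -- The two strength factors contribute equally to the variation: interchanging them is compensated
  -- by the graded symmetry of `h⁻¹` and the symmetry of the metric.
  have h1 : ∑ i, ∑ l, ∑ b, twist (bvPar (ymFieldPar n 𝔤.par) v.1) (strength 𝔤 i l b)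
        * pd v (momentum 𝔤 g h i l b)
      = ∑ i, ∑ l, ∑ b, pd v (strength 𝔤 i l b) * momentum 𝔤 g h i l b := by
    have e1 : ∀ (G : ι → Fin n → Fin n → Alg 𝔤 U) (H : ι → Fin n → Fin n → Alg 𝔤 U),
        ∑ i, ∑ l, ∑ b, G i l b * ∑ j, ∑ m, ∑ k, h⁻¹ i j • (coeffFn 𝔤 g l m b k * H j m k)
          = ∑ i, ∑ j, ∑ l, ∑ m, ∑ b, ∑ k,
            h⁻¹ i j • (coeffFn 𝔤 g l m b k * (G i l b * H j m k)) := by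
      intro G H
      simp only [Finset.mul_sum]
      refine Finset.sum_congr rfl fun i _ => ?_
      rw [Finset.sum_comm (s := Finset.univ (α := ι))]
      refine Finset.sum_congr rfl fun l _ => ?_
      rw [Finset.sum_comm]
      refine (Finset.sum_congr rfl fun j _ => Finset.sum_comm).trans ?_
      refine Finset.sum_congr rfl fun j _ => Finset.sum_congr rfl fun m _ =>
        Finset.sum_congr rfl fun b _ => Finset.sum_congr rfl fun k _ => ?_
      rw [mul_smul_comm, ← mul_assoc, ← coeffFn_mul_comm, mul_assoc]
    have e2 : ∀ i l b, pd v (momentum 𝔤 g h i l b)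
        = ∑ j, ∑ m, ∑ k, h⁻¹ i j • (coeffFn 𝔤 g l m b k * pd v (strength 𝔤 j m k)) := by
      intro i l b
      simp only [momentum, map_sum, map_smul, pd_coeffFn_mul]
    simp only [e2]
    rw [e1]
    simp only [momentum]
    rw [e1, sum_six_swap]
    refine Finset.sum_congr rfl fun i _ => Finset.sum_congr rfl fun j _ =>
      Finset.sum_congr rfl fun l _ => Finset.sum_congr rfl fun m _ =>
      Finset.sum_congr rfl fun b _ => Finset.sum_congr rfl fun k _ => ?_
    rw [coeffFn_swap, (isHomog_strength 𝔤 j m k).twist, smul_mul_assoc,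
      (isHomog_strength 𝔤 j m k).mul_comm' ((isHomog_strength 𝔤 i l b).pd v), smul_smul,
      mul_smul_comm, smul_smul, hh.inv_symm i j, LieSuperalgebra.ε, mul_comm (𝔤.par i)]
    congr 1
    rw [mul_add, sgn_add, mul_comm (𝔤.par j) (bvPar _ _)]
    have := sgn_mul_self (bvPar (ymFieldPar n 𝔤.par) v.1 * 𝔤.par j)
    linear_combination (h⁻¹ j i * sgn (𝔤.par j * 𝔤.par i)) * this
  rw [lagrangian_eq, map_smul]
  simp only [map_sum, pd_mul, Finset.sum_add_distrib]
  rw [h1, ← two_smul ℝ, smul_smul]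
  norm_num

variable (𝔤) in
theorem pd_strength_singleton (r i : ι) (γ μ l b : Fin n) :
    pd (gaugeL r γ, {μ}) (strength 𝔤 i l b : Alg 𝔤 U)
      = (if r = i ∧ γ = b ∧ μ = l then 1 else 0) - if r = i ∧ γ = l ∧ μ = b then 1 else 0 := by
  classical
  have h0 : ∀ (j : ι) (m : Fin n), pd (gaugeL r γ, {μ}) (a 𝔤 j m 0 : Alg 𝔤 U) = 0 := fun j m =>
    pd_gen_of_ne fun e => Multiset.singleton_ne_zero μ (congrArg Prod.snd e)
  have h1 : ∀ (m k : Fin n), pd (gaugeL r γ, {μ}) (a 𝔤 i m {k} : Alg 𝔤 U)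
      = if r = i ∧ γ = m ∧ μ = k then 1 else 0 := fun m k => by
    rw [a, pd_gen]
    congr 1
    simp [and_assoc]
  simp only [strength, map_add, map_sub, map_sum, map_smul, pd_mul, h0, h1]
  simp

variable (𝔤) in
theorem pd_strength_zero (r i : ι) (γ l b : Fin n) :
    pd (gaugeL r γ, 0) (strength 𝔤 i l b : Alg 𝔤 U)
      = (if γ = l then ∑ k, 𝔤.c i r k • a 𝔤 k b 0 else 0)
        - if γ = b then ∑ k, 𝔤.c i r k • a 𝔤 k l 0 else 0 := by
  classical
  have h0 : ∀ (m k : Fin n), pd (gaugeL r γ, 0) (a 𝔤 i m {k} : Alg 𝔤 U) = 0 := fun m k =>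
    pd_gen_of_ne fun e => Multiset.singleton_ne_zero k (congrArg Prod.snd e).symm
  have h1 : ∀ (j : ι) (m : Fin n), pd (gaugeL r γ, 0) (a 𝔤 j m 0 : Alg 𝔤 U)
      = if r = j ∧ γ = m then 1 else 0 := fun j m => by
    rw [a, pd_gen]
    congr 1
    simp
  simp only [strength, map_add, map_sub, map_sum, map_smul, pd_mul, h0, h1,
    (isHomog_a 𝔤 _ _ _).twist, smul_add, Finset.sum_add_distrib]
  rw [sub_zero, zero_add, sub_eq_add_neg]
  congr 1
  · rw [Finset.sum_eq_single r]
    · by_cases hγ : γ = l <;> simp [hγ]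
    · intro j _ hj
      simp [hj.symm]
    · simp
  · rw [Finset.sum_comm, Finset.sum_eq_single r]
    · by_cases hγ : γ = b
      · simp only [hγ, true_and, and_true, if_true, mul_one, smul_smul, ← Finset.sum_neg_distrib]
        refine Finset.sum_congr rfl fun j _ => ?_
        rw [← neg_smul]
        congr 1
        have := 𝔤.c_skew i r j
        rw [this, neg_neg, mul_comm]
        rfl
      · simp [hγ]
    · intro j _ hj
      simp [hj.symm]
    · simp

variable (𝔤) in
theorem pd_strength_of_two_le (A : YMField ι n ⊕ YMField ι n) {Λ : Multiset (Fin n)}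
    (hΛ : 2 ≤ Multiset.card Λ) (i : ι) (l b : Fin n) :
    pd (A, Λ) (strength 𝔤 i l b : Alg 𝔤 U) = 0 := by
  have h0 : ∀ (j : ι) (m : Fin n) (M : Multiset (Fin n)), Multiset.card M ≤ 1 →
      pd (A, Λ) (a 𝔤 j m M : Alg 𝔤 U) = 0 := fun j m M hM =>
    pd_gen_of_ne fun e => by
      have := congrArg (fun p => Multiset.card p.2) e
      simp only at this
      omega
  simp only [strength, map_add, map_sub, map_sum, map_smul, pd_mul,
    fun j m => h0 j m 0 (by simp), fun j m k => h0 j m {k} (by simp)]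
  simp

theorem pd_lagrangian_singleton (hh : 𝔤.IsNondegenerateCasimir h) (r : ι) (γ μ : Fin n) :
    pd (gaugeL r γ, {μ}) (lagrangian 𝔤 g h) = -momentum 𝔤 g h r γ μ := by
  rw [pd_lagrangian hh]
  simp only [pd_strength_singleton, sub_mul, Finset.sum_sub_distrib, ite_and, ite_mul, one_mul,
    zero_mul]
  simp only [Finset.sum_ite_eq, Finset.mem_univ, if_true, Finset.sum_ite_irrel,
    Finset.sum_const_zero]
  rw [momentum_swap, ← neg_add', ← two_smul ℝ, smul_neg, smul_smul]
  norm_num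

theorem pd_lagrangian_zero (hh : 𝔤.IsNondegenerateCasimir h) (r : ι) (γ : Fin n) :
    pd (gaugeL r γ, 0) (lagrangian 𝔤 g h)
      = ∑ μ, ∑ i, ∑ k, 𝔤.c i r k • (a 𝔤 k μ 0 * momentum 𝔤 g h i γ μ) := by
  rw [pd_lagrangian hh]
  have e1 : ∀ i : ι, ∑ l, ∑ b, pd (gaugeL r γ, 0) (strength 𝔤 i l b) * momentum 𝔤 g h i l b
      = (2 : ℝ) • ∑ μ, ∑ k, 𝔤.c i r k • (a 𝔤 k μ 0 * momentum 𝔤 g h i γ μ) := by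
    intro i
    simp only [pd_strength_zero, sub_mul, Finset.sum_sub_distrib, ite_mul, zero_mul]
    simp only [Finset.sum_ite_eq, Finset.mem_univ, if_true, Finset.sum_ite_irrel,
      Finset.sum_const_zero]
    simp only [momentum_swap 𝔤 g h i γ, mul_neg, Finset.sum_neg_distrib, sub_neg_eq_add]
    rw [← two_smul ℝ]
    simp only [Finset.sum_mul, smul_mul_assoc]
  simp only [e1]
  rw [← Finset.smul_sum, smul_smul, Finset.sum_comm]
  norm_num

/-- The left hand sides of the Yang-Mills equations. -/
theorem varDeriv_lagrangian (hh : 𝔤.IsNondegenerateCasimir h) (r : ι) (γ : Fin n) :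
    varDeriv (gaugeL r γ) (lagrangian 𝔤 g h)
      = ∑ μ, (totalD μ (momentum 𝔤 g h r γ μ)
        + ∑ i, ∑ k, 𝔤.c i r k • (a 𝔤 k μ 0 * momentum 𝔤 g h i γ μ)) := by
  classical
  -- The Lagrangian is of first order, so only multi-indices of length at most one contribute.
  have hT : ∀ Λ ∉ insert 0 ((Finset.univ : Finset (Fin n)).image fun μ => ({μ} : Multiset _)),
      pd (gaugeL r γ, Λ) (lagrangian 𝔤 g h) = 0 := by
    intro Λ hΛ
    have h2 : 2 ≤ Multiset.card Λ := by
      by_contra hlt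
      have h3 : Multiset.card Λ = 0 ∨ Multiset.card Λ = 1 := by omega
      rcases h3 with h3 | h3
      · rw [Multiset.card_eq_zero] at h3
        exact hΛ (by simp [h3])
      · obtain ⟨μ, rfl⟩ := Multiset.card_eq_one.1 h3
        exact hΛ (by simp)
    rw [pd_lagrangian hh]
    simp [pd_strength_of_two_le 𝔤 _ h2]
  rw [varDeriv_eq_sum _ hT, Finset.sum_insert (by simp), Finset.sum_image
    fun μ _ ν _ e => by simpa using e]
  simp only [Multiset.card_zero, pow_zero, one_smul, totalDs_zero, Multiset.card_singleton, pow_one,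
    totalDs_singleton, pd_lagrangian_singleton hh, pd_lagrangian_zero hh, totalD_neg, neg_smul,
    neg_neg, Finset.sum_add_distrib]
  rw [add_comm]

/-- Invariance of the contraction of strengths and momenta. -/
theorem sum_strength_momentum (hh : 𝔤.IsNondegenerateCasimir h) (j : ι) :
    ∑ l, ∑ μ, ∑ i, ∑ k, 𝔤.c i j k • (strength 𝔤 k l μ * momentum 𝔤 g h i l μ) = 0 := by
  set Z := ∑ k, ∑ p, ∑ l, ∑ m, ∑ μ, ∑ b, (∑ i, 𝔤.c i j k * h⁻¹ i p) •
    (coeffFn 𝔤 g l m μ b * (strength 𝔤 k l μ * strength 𝔤 p m b)) with hZ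
  have h1 : ∑ l, ∑ μ, ∑ i, ∑ k, 𝔤.c i j k • (strength 𝔤 k l μ * momentum 𝔤 g h i l μ) = Z := by
    simp only [momentum, Finset.mul_sum, Finset.smul_sum, hZ, Finset.sum_smul]
    have e : ∀ l μ i k p m b, 𝔤.c i j k • (strength 𝔤 k l μ *
        h⁻¹ i p • (coeffFn 𝔤 g l m μ b * strength 𝔤 p m b)) = (𝔤.c i j k * h⁻¹ i p) •
        (coeffFn 𝔤 g l m μ b * (strength 𝔤 k l μ * strength 𝔤 p m b)) := fun l μ i k p m b => by
      rw [mul_smul_comm, smul_smul, ← mul_assoc, ← coeffFn_mul_comm, mul_assoc]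
    simp only [e]
    rw [sum_rotate_five, sum_rotate_five, sum_rotate_seven]
    exact Finset.sum_congr rfl fun k _ => Finset.sum_congr rfl fun p _ =>
      Finset.sum_congr rfl fun l _ => Finset.sum_comm
  -- Interchanging the two strengths changes the sign of the coefficient, which is the invariance of
  -- `h⁻¹`.
  have h2 : Z = -Z := by
    conv_lhs => rw [hZ, sum_six_swap]
    rw [hZ, ← Finset.sum_neg_distrib]
    refine Finset.sum_congr rfl fun k _ => ?_
    rw [← Finset.sum_neg_distrib]
    refine Finset.sum_congr rfl fun p _ => ?_
    simp only [← Finset.sum_neg_distrib]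
    refine Finset.sum_congr rfl fun l _ => Finset.sum_congr rfl fun m _ =>
      Finset.sum_congr rfl fun μ _ => Finset.sum_congr rfl fun b _ => ?_
    rw [coeffFn_swap, (isHomog_strength 𝔤 p m b).mul_comm' (isHomog_strength 𝔤 k l μ),
      mul_smul_comm, smul_smul, ← neg_smul]
    congr 1
    have := hh.invariance j k p
    change _ * 𝔤.ε p k = _
    rw [𝔤.ε_comm p k]
    linear_combination this
  rw [h1]
  have h3 : (2 : ℝ) • Z = 0 := by
    rw [two_smul]
    nth_rewrite 1 [h2]
    exact neg_add_cancel Z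
  exact (smul_eq_zero.1 h3).resolve_left two_ne_zero

variable (𝔤) in
-- Antisymmetrizing in the base indices combines two iterated brackets, and the Jacobi identity
-- rewrites them as the bracket with the quadratic part of the strength.
theorem sum_bracket_bracket (j s : ι) (l μ : Fin n) :
    ∑ r, ∑ i, ∑ k, (𝔤.c r j i * 𝔤.c s r k) •
        (a 𝔤 i l 0 * a 𝔤 k μ 0 - a 𝔤 i μ 0 * a 𝔤 k l 0 : Alg 𝔤 U)
      = ∑ k, 𝔤.c s j k • ∑ p, ∑ q, 𝔤.c k p q • (a 𝔤 p l 0 * a 𝔤 q μ 0 : Alg 𝔤 U) := by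
  have e1 : ∑ r, ∑ i, ∑ k, (𝔤.c r j i * 𝔤.c s r k) •
        (a 𝔤 i l 0 * a 𝔤 k μ 0 - a 𝔤 i μ 0 * a 𝔤 k l 0 : Alg 𝔤 U)
      = ∑ i, ∑ k, (∑ r, 𝔤.c r j i * 𝔤.c s r k - 𝔤.ε i k * ∑ r, 𝔤.c r j k * 𝔤.c s r i) •
        (a 𝔤 i l 0 * a 𝔤 k μ 0 : Alg 𝔤 U) := by
    have e2 : ∑ r, ∑ i, ∑ k, (𝔤.c r j i * 𝔤.c s r k) • (a 𝔤 i μ 0 * a 𝔤 k l 0 : Alg 𝔤 U)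
        = ∑ i, ∑ k, (𝔤.ε i k * ∑ r, 𝔤.c r j k * 𝔤.c s r i) •
          (a 𝔤 i l 0 * a 𝔤 k μ 0 : Alg 𝔤 U) := by
      simp only [Finset.mul_sum, Finset.sum_smul]
      rw [Finset.sum_congr rfl fun r _ => Finset.sum_comm, Finset.sum_comm]
      refine Finset.sum_congr rfl fun k _ => ?_
      rw [Finset.sum_comm]
      refine Finset.sum_congr rfl fun i _ => Finset.sum_congr rfl fun r _ => ?_
      rw [a_mul_a, smul_smul, 𝔤.ε_comm i k, mul_comm]
    simp only [smul_sub, Finset.sum_sub_distrib]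
    rw [e2]
    simp only [sub_smul, Finset.sum_sub_distrib]
    congr 1
    simp only [Finset.sum_smul]
    rw [Finset.sum_comm]
    exact Finset.sum_congr rfl fun i _ => Finset.sum_comm
  rw [e1]
  simp only [Finset.smul_sum, smul_smul]
  rw [sum_rotate_three]
  refine Finset.sum_congr rfl fun i _ => Finset.sum_congr rfl fun k _ => ?_
  rw [← Finset.sum_smul]
  congr 1
  rw [𝔤.jacobi_left s j i k, add_sub_cancel_right]
  exact Finset.sum_congr rfl fun r _ => mul_comm _ _

variable (𝔤 g h) in
/-- The terms of the divergence of the Yang-Mills equations. -/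
def divergenceTerm (j : ι) (l μ : Fin n) : Alg 𝔤 U :=
  totalD l (totalD μ (momentum 𝔤 g h j l μ))
    + ∑ i, ∑ k, 𝔤.c i j k • (a 𝔤 k μ {l} * momentum 𝔤 g h i l μ)
    + ∑ i, ∑ k, 𝔤.c i j k • (a 𝔤 k μ 0 * totalD l (momentum 𝔤 g h i l μ))
    + ∑ i, ∑ k, 𝔤.c i j k • (a 𝔤 k l 0 * totalD μ (momentum 𝔤 g h i l μ))
    + ∑ r, ∑ i, ∑ s, ∑ k, (𝔤.c r j i * 𝔤.c s r k) •
      (a 𝔤 i l 0 * a 𝔤 k μ 0 * momentum 𝔤 g h s l μ)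

theorem totalD_a_zero (k : ι) (l μ : Fin n) : totalD l (a 𝔤 k μ 0 : Alg 𝔤 U) = a 𝔤 k μ {l} :=
  totalD_gen l _

theorem sum_totalD_varDeriv_lagrangian (hh : 𝔤.IsNondegenerateCasimir h) (j : ι) :
    ∑ l, totalD l (varDeriv (gaugeL j l) (lagrangian 𝔤 g h))
      = ∑ l, ∑ μ, (totalD l (totalD μ (momentum 𝔤 g h j l μ))
        + ∑ i, ∑ k, 𝔤.c i j k • (a 𝔤 k μ {l} * momentum 𝔤 g h i l μ)
        + ∑ i, ∑ k, 𝔤.c i j k • (a 𝔤 k μ 0 * totalD l (momentum 𝔤 g h i l μ))) := by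
  refine Finset.sum_congr rfl fun l _ => ?_
  rw [varDeriv_lagrangian hh, totalD_sum]
  refine Finset.sum_congr rfl fun μ _ => ?_
  rw [totalD_add, totalD_sum, add_assoc, ← Finset.sum_add_distrib]
  congr 1
  refine Finset.sum_congr rfl fun i _ => ?_
  rw [totalD_sum, ← Finset.sum_add_distrib]
  refine Finset.sum_congr rfl fun k _ => ?_
  rw [totalD_smul, totalD_mul, totalD_a_zero, smul_add]

theorem sum_a_mul_varDeriv_lagrangian (hh : 𝔤.IsNondegenerateCasimir h) (j : ι) :
    ∑ r, ∑ i, ∑ l, 𝔤.c r j i • (a 𝔤 i l 0 * varDeriv (gaugeL r l) (lagrangian 𝔤 g h))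
      = ∑ l, ∑ μ, (∑ i, ∑ k, 𝔤.c i j k • (a 𝔤 k l 0 * totalD μ (momentum 𝔤 g h i l μ))
        + ∑ r, ∑ i, ∑ s, ∑ k, (𝔤.c r j i * 𝔤.c s r k) •
          (a 𝔤 i l 0 * a 𝔤 k μ 0 * momentum 𝔤 g h s l μ)) := by
  have e : ∀ r i l, 𝔤.c r j i • (a 𝔤 i l 0 * varDeriv (gaugeL r l) (lagrangian 𝔤 g h))
      = ∑ μ, (𝔤.c r j i • (a 𝔤 i l 0 * totalD μ (momentum 𝔤 g h r l μ))
        + ∑ s, ∑ k, (𝔤.c r j i * 𝔤.c s r k) •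
          (a 𝔤 i l 0 * a 𝔤 k μ 0 * momentum 𝔤 g h s l μ)) := by
    intro r i l
    rw [varDeriv_lagrangian hh, Finset.mul_sum, Finset.smul_sum]
    refine Finset.sum_congr rfl fun μ _ => ?_
    rw [mul_add, smul_add, Finset.mul_sum, Finset.smul_sum]
    congr 1
    refine Finset.sum_congr rfl fun s _ => ?_
    rw [Finset.mul_sum, Finset.smul_sum]
    refine Finset.sum_congr rfl fun k _ => ?_
    rw [mul_smul_comm, smul_smul, mul_assoc]
  refine (Finset.sum_congr rfl fun r _ => Finset.sum_congr rfl fun i _ =>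
    Finset.sum_congr rfl fun l _ => e r i l).trans ?_
  rw [sum_rotate_four, sum_rotate_four]
  refine Finset.sum_congr rfl fun l _ => Finset.sum_congr rfl fun μ _ => ?_
  simp only [Finset.sum_add_distrib]

theorem sum_divergenceTerm (hh : 𝔤.IsNondegenerateCasimir h) (j : ι) :
    ∑ r, ∑ i, ∑ l, 𝔤.c r j i • (a 𝔤 i l 0 * varDeriv (gaugeL r l) (lagrangian 𝔤 g h))
      + ∑ l, totalD l (varDeriv (gaugeL j l) (lagrangian 𝔤 g h))
      = ∑ l, ∑ μ, divergenceTerm 𝔤 g h j l μ := by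
  rw [sum_totalD_varDeriv_lagrangian hh, sum_a_mul_varDeriv_lagrangian hh, add_comm,
    ← Finset.sum_add_distrib]
  refine Finset.sum_congr rfl fun l _ => ?_
  rw [← Finset.sum_add_distrib]
  refine Finset.sum_congr rfl fun μ _ => ?_
  rw [divergenceTerm, ← add_assoc]

variable (𝔤) in
theorem sum_bracket_bracket_mul (j : ι) (l μ : Fin n) (P : ι → Alg 𝔤 U) :
    ∑ r, ∑ i, ∑ s, ∑ k, (𝔤.c r j i * 𝔤.c s r k) • (a 𝔤 i l 0 * a 𝔤 k μ 0 * P s)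
        - ∑ r, ∑ i, ∑ s, ∑ k, (𝔤.c r j i * 𝔤.c s r k) • (a 𝔤 i μ 0 * a 𝔤 k l 0 * P s)
      = ∑ s, ∑ k, 𝔤.c s j k •
          ((∑ p, ∑ q, 𝔤.c k p q • (a 𝔤 p l 0 * a 𝔤 q μ 0)) * P s) := by
  rw [sum_rotate_three, sum_rotate_three]
  nth_rewrite 2 [sum_rotate_three]
  nth_rewrite 2 [sum_rotate_three]
  rw [← Finset.sum_sub_distrib]
  refine Finset.sum_congr rfl fun s _ => ?_
  have := congrArg (· * P s) (sum_bracket_bracket 𝔤 j s l μ)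
  simp only [Finset.sum_mul, smul_mul_assoc, sub_mul, smul_sub, Finset.sum_sub_distrib] at this ⊢
  exact this

/-- Antisymmetry of the momenta cancels the second total derivatives and the terms containing a
derivative of a momentum. What multiplies undifferentiated momenta assembles into the strength. -/
theorem divergenceTerm_add_swap (j : ι) (l μ : Fin n) :
    divergenceTerm 𝔤 g h j l μ + divergenceTerm 𝔤 g h j μ l
      = ∑ i, ∑ k, 𝔤.c i j k • (strength 𝔤 k l μ * momentum 𝔤 g h i l μ) := by
  have hPs : ∀ i, momentum 𝔤 g h i μ l = -momentum 𝔤 g h i l μ :=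
    fun i => momentum_swap 𝔤 g h i l μ
  simp only [strength, add_mul, sub_mul, smul_add, smul_sub, Finset.sum_add_distrib,
    Finset.sum_sub_distrib]
  rw [← sum_bracket_bracket_mul]
  simp only [divergenceTerm, hPs, totalD_neg, mul_neg, smul_neg, Finset.sum_neg_distrib,
    totalD_totalD μ l]
  abel

/-- The Noether identities of the Yang-Mills Lagrangian. -/
theorem noether_identity (hh : 𝔤.IsNondegenerateCasimir h) (j : ι) :
    ∑ r, ∑ i, ∑ l, 𝔤.c r j i • (a 𝔤 i l 0 * varDeriv (gaugeL r l) (lagrangian 𝔤 g h))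
      + ∑ l, totalD l (varDeriv (gaugeL j l) (lagrangian 𝔤 g h)) = 0 := by
  rw [sum_divergenceTerm hh]
  -- The double sum is added to itself with `l` and `μ` interchanged, which leaves the invariant
  -- contraction of strengths and momenta.
  have h2 : (2 : ℝ) • ∑ l, ∑ μ, divergenceTerm 𝔤 g h j l μ = 0 := by
    rw [two_smul]
    nth_rewrite 2 [Finset.sum_comm]
    simp only [← Finset.sum_add_distrib, divergenceTerm_add_swap]
    exact sum_strength_momentum hh j
  exact (smul_eq_zero.1 h2).resolve_left two_ne_zero

end YangMills

end

end SuperYM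

namespace SuperYM

noncomputable section

/-! ## Gauge symmetry, the BRST operator and the master equation -/

section GaugeSymmetry

variable {n : ℕ} {U : Opens (Fin n → ℝ)} {ι : Type*} [Fintype ι] (𝔤 : LieSuperalgebra ι)

theorem isHomog_gaugeComp (r : ι) (l : Fin n) :
    IsHomog (𝔤.par r + 1) (gaugeComp 𝔤 r l : Alg 𝔤 U) := by
  refine (isHomog_gh 𝔤 r _).sub (IsHomog.sum fun j _ => IsHomog.sum fun i _ => ?_)
  refine isHomog_c_smul 𝔤 r j i fun hp => ?_
  exact ((isHomog_gh 𝔤 j 0).mul (isHomog_a 𝔤 i l 0)).cast (by rw [hp]; ring)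

theorem isHomog_ghostComp (r : ι) : IsHomog (𝔤.par r) (ghostComp 𝔤 r : Alg 𝔤 U) := by
  refine (IsHomog.sum fun i _ => IsHomog.sum fun j _ => ?_).neg
  rw [mul_smul]
  refine IsHomog.smul (isHomog_c_smul 𝔤 r i j fun hp => ?_) _
  refine ((isHomog_gh 𝔤 i 0).mul (isHomog_gh 𝔤 j 0)).cast ?_
  rw [hp, add_add_add_comm, parity_one_add_one, add_zero]

theorem isHomog_gaugeOp (A : YMField ι n ⊕ YMField ι n) :
    IsHomog (1 + bvPar (ymFieldPar n 𝔤.par) A) (gaugeOp 𝔤 A : Alg 𝔤 U) := by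
  rcases A with (⟨r, l⟩ | r) | z
  · exact (isHomog_gaugeComp 𝔤 r l).cast (add_comm _ _)
  · exact IsHomog.zero
  · exact IsHomog.zero

theorem isHomog_brstOp (A : YMField ι n ⊕ YMField ι n) :
    IsHomog (1 + bvPar (ymFieldPar n 𝔤.par) A) (brstOp 𝔤 A : Alg 𝔤 U) := by
  refine (isHomog_gaugeOp 𝔤 A).add ?_
  rcases A with (⟨r, l⟩ | r) | z
  · exact IsHomog.zero
  · refine (isHomog_ghostComp 𝔤 r).cast ?_
    change _ = 1 + (𝔤.par r + 1)
    rw [add_left_comm, parity_one_add_one, add_zero]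
  · exact IsHomog.zero

theorem brstOp_gauge (r : ι) (l : Fin n) :
    brstOp 𝔤 (gaugeL r l) = (gaugeComp 𝔤 r l : Alg 𝔤 U) := add_zero _

theorem brstOp_ghost (r : ι) : brstOp 𝔤 (ghostL n r) = (ghostComp 𝔤 r : Alg 𝔤 U) := zero_add _

theorem brstOp_inr (z : YMField ι n) : brstOp 𝔤 (Sum.inr z) = (0 : Alg 𝔤 U) := by
  change (0 : Alg 𝔤 U) + 0 = 0
  rw [add_zero]

theorem pdR_mul_of_pd_eq_zero {φ : Type*} {par : φ → ZMod 2} (v : Jet n φ) {x : JetAlg U par}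
    (hx : pd v x = 0) (y : JetAlg U par) : pdR v (x * y) = x * pdR v y := by
  rw [pdR_eq_twist, pd_mul, hx, zero_mul, zero_add, map_mul, twist_twist, parity_add_self,
    twist_zero, pdR_eq_twist]

theorem pdR_gen {φ : Type*} {par : φ → ZMod 2} (v w : Jet n φ) [Decidable (v = w)] :
    pdR v (gen w : JetAlg U par) = if v = w then 1 else 0 := by
  rw [pdR_eq_twist]
  split_ifs with h
  · rw [h, pd_gen_self, map_one]
  · rw [pd_gen_of_ne h, map_zero]

theorem pdR_noetherOp [DecidableEq ι] (r j : ι) (l : Fin n) (Λ : Multiset (Fin n)) :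
    pdR (gaugeBarL r l, Λ) (noetherOp 𝔤 j : Alg 𝔤 U)
      = (if Λ = 0 then ∑ i, 𝔤.c r j i • a 𝔤 i l 0 else 0)
        + if r = j ∧ Λ = {l} then 1 else 0 := by
  have h1 : ∀ (s i : ι) (m : Fin n), pdR (gaugeBarL r l, Λ) (a 𝔤 i m 0 * aBar 𝔤 s m 0 : Alg 𝔤 U)
      = if Λ = 0 then (if r = s then (if l = m then a 𝔤 i l 0 else 0) else 0) else 0 := by
    intro s i m
    have h0 : pd (gaugeBarL r l, Λ) (a 𝔤 i m 0 : Alg 𝔤 U) = 0 := pd_gen_of_ne (by simp)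
    rw [pdR_mul_of_pd_eq_zero _ h0, aBar, pdR_gen]
    simp only [Prod.mk.injEq, Sum.inr.injEq, Sum.inl.injEq]
    by_cases h1 : r = s <;> by_cases h2 : l = m <;> by_cases h3 : Λ = 0 <;> simp [h1, h2, h3]
  have h2 : ∀ m : Fin n, pdR (gaugeBarL r l, Λ) (aBar 𝔤 j m {m} : Alg 𝔤 U)
      = if l = m then (if r = j ∧ Λ = {l} then 1 else 0) else 0 := by
    intro m
    rw [aBar, pdR_gen]
    simp only [Prod.mk.injEq, Sum.inr.injEq, Sum.inl.injEq]
    by_cases h1 : r = j <;> by_cases h2 : l = m <;> simp [h1, h2]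
  rw [noetherOp, map_add]
  simp only [map_sum, map_smul, h1, h2]
  congr 1
  · split_ifs with h
    · rw [Finset.sum_eq_single r]
      · simp
      · intro s _ hs
        simp [hs.symm]
      · simp
    · simp
  · simp

/-- The gauge operator associated with the Noether operators. -/
theorem gaugeOperatorOf_neg_noetherOp :
    gaugeOperatorOf (fun j => -noetherOp (U := U) 𝔤 j) = gaugeOp 𝔤 := by
  classical
  funext A
  rcases A with (⟨r, l⟩ | r) | z
  · change ∑ j, ∑ᶠ Λ : Multiset (Fin n), (-1 : ℝ) ^ Multiset.card Λ •
      totalDs Λ (gh 𝔤 j 0 * pdR (gaugeBarL r l, Λ) (-noetherOp 𝔤 j)) = gaugeComp 𝔤 r l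
    have h1 : ∀ j, ∑ᶠ Λ : Multiset (Fin n), (-1 : ℝ) ^ Multiset.card Λ •
        totalDs Λ (gh 𝔤 j 0 * pdR (gaugeBarL r l, Λ) (-noetherOp (U := U) 𝔤 j))
        = (if r = j then gh 𝔤 r {l} else 0)
          - ∑ i, 𝔤.c r j i • (gh 𝔤 j 0 * a 𝔤 i l 0 : Alg 𝔤 U) := by
      intro j
      -- Among the antifield jets `ā^l_{Λ r}`, only those of index `0` and `{l}` occur in the
      -- Noether operator; the minus sign in front of it compensates the sign of the integration by
      -- parts.
      rw [finsum_eq_sum_of_support_subset (s := {0, {l}})]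
      · rw [Finset.sum_pair (Multiset.singleton_ne_zero l).symm]
        simp only [map_neg, pdR_noetherOp, Multiset.card_zero, pow_zero, one_smul, totalDs_zero,
          Multiset.card_singleton, pow_one, totalDs_singleton, Multiset.singleton_ne_zero,
          (Multiset.singleton_ne_zero l).symm, if_true, if_false, and_false, and_true, add_zero,
          zero_add, neg_smul, mul_neg, one_smul, totalD_neg, neg_neg]
        rw [add_comm, ← sub_eq_add_neg, Finset.mul_sum]
        congr 1
        · split_ifs with h
          · rw [mul_one, ← h]
            exact totalD_gen l _
          · rw [mul_zero, totalD_zero]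
        · exact Finset.sum_congr rfl fun i _ => mul_smul_comm _ _ _
      · intro Λ hΛ
        by_contra h
        simp only [Finset.coe_insert, Finset.coe_singleton, Set.mem_insert_iff,
          Set.mem_singleton_iff, not_or] at h
        refine hΛ ?_
        simp only [map_neg, pdR_noetherOp, h.1, h.2, if_false, and_false, add_zero, neg_zero,
          mul_zero, totalDs_eq, map_zero, smul_zero]
    simp only [h1, Finset.sum_sub_distrib, Finset.sum_ite_eq, Finset.mem_univ, if_true]
    rfl
  · rfl
  · rfl

variable [DecidableEq ι] {g : MetricTensor U} {h : Matrix ι ι ℝ}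

theorem pd_lagrangian_of_ne (hh : 𝔤.IsNondegenerateCasimir h) (A : YMField ι n ⊕ YMField ι n)
    (hA : ∀ r l, A ≠ gaugeL r l) (Λ : Multiset (Fin n)) :
    pd (A, Λ) (lagrangian 𝔤 g h) = 0 := by
  have h0 : ∀ (j : ι) (m : Fin n) (M : Multiset (Fin n)), pd (A, Λ) (a 𝔤 j m M : Alg 𝔤 U) = 0 :=
    fun j m M => pd_gen_of_ne fun e => hA j m (congrArg Prod.fst e)
  have h1 : ∀ i l b, pd (A, Λ) (strength 𝔤 i l b : Alg 𝔤 U) = 0 := by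
    intro i l b
    simp only [strength, map_add, map_sub, map_sum, map_smul, pd_mul, h0]
    simp
  rw [pd_lagrangian hh]
  simp [h1]

theorem varDeriv_lagrangian_of_ne (hh : 𝔤.IsNondegenerateCasimir h)
    (A : YMField ι n ⊕ YMField ι n) (hA : ∀ r l, A ≠ gaugeL r l) :
    varDeriv A (lagrangian 𝔤 g h) = 0 := by
  rw [varDeriv_eq_sum (T := ∅) A fun Λ _ => pd_lagrangian_of_ne 𝔤 hh A hA Λ, Finset.sum_empty]

/-- A contact derivation that acts on gauge fields as a gauge transformation is a variational
symmetry of the Yang-Mills Lagrangian. -/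
theorem isVariationalSymmetry_of_gaugeComp (hh : 𝔤.IsNondegenerateCasimir h)
    {υ : YMField ι n ⊕ YMField ι n → Alg 𝔤 U} (hυ : ∀ r l, υ (gaugeL r l) = gaugeComp 𝔤 r l) :
    IsVariationalSymmetry υ (lagrangian 𝔤 g h) := by
  have h1 := isHorizontallyExact_contactDer_sub υ (lagrangian 𝔤 g h)
  suffices h2 : IsHorizontallyExact (∑ A, υ A * varDeriv A (lagrangian 𝔤 g h)) by
    have := h1.add h2
    rwa [sub_add_cancel] at this
  have h3 : ∑ A, υ A * varDeriv A (lagrangian 𝔤 g h)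
      = ∑ r, ∑ l, gaugeComp 𝔤 r l * varDeriv (gaugeL r l) (lagrangian 𝔤 g h) := by
    rw [Fintype.sum_sum_type, Fintype.sum_sum_type, Fintype.sum_prod_type]
    have e1 : ∀ r : ι, varDeriv (ghostL n r) (lagrangian 𝔤 g h) = 0 := fun r =>
      varDeriv_lagrangian_of_ne 𝔤 hh _ (by simp)
    have e2 : ∀ z : YMField ι n, varDeriv (Sum.inr z) (lagrangian 𝔤 g h) = 0 := fun r =>
      varDeriv_lagrangian_of_ne 𝔤 hh _ (by simp)
    simp only [e1, e2, mul_zero, Finset.sum_const_zero, add_zero, hυ]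
  -- The Noether identity multiplied by `c^j` replaces the undifferentiated ghost terms by `c^j d_l
  -- ℰ_j^l`, which completes `c^j_l ℰ_j^l` to a total derivative.
  have h4 : ∑ r, ∑ l, gaugeComp 𝔤 r l * varDeriv (gaugeL r l) (lagrangian 𝔤 g h)
      = ∑ r, ∑ l, totalD l (gh 𝔤 r 0 * varDeriv (gaugeL r l) (lagrangian 𝔤 g h)) := by
    have e1 : ∀ (r : ι) (l : Fin n), totalD l (gh 𝔤 r 0 : Alg 𝔤 U) = gh 𝔤 r {l} :=
      fun r l => totalD_gen l _
    have e2 : ∑ j, gh 𝔤 j 0 * (∑ r, ∑ i, ∑ l, 𝔤.c r j i •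
          (a 𝔤 i l 0 * varDeriv (gaugeL r l) (lagrangian 𝔤 g h))
        + ∑ l, totalD l (varDeriv (gaugeL j l) (lagrangian 𝔤 g h))) = 0 :=
      Finset.sum_eq_zero fun j _ => by rw [noether_identity hh, mul_zero]
    have e3 : ∑ r, ∑ l, (∑ j, ∑ i, 𝔤.c r j i • (gh 𝔤 j 0 * a 𝔤 i l 0 : Alg 𝔤 U))
          * varDeriv (gaugeL r l) (lagrangian 𝔤 g h)
        = ∑ j, gh 𝔤 j 0 * (∑ r, ∑ i, ∑ l, 𝔤.c r j i •
          (a 𝔤 i l 0 * varDeriv (gaugeL r l) (lagrangian 𝔤 g h))) := by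
      simp only [Finset.sum_mul, Finset.mul_sum, smul_mul_assoc, mul_smul_comm, mul_assoc]
      rw [sum_rotate_three, sum_rotate_three]
      refine Finset.sum_congr rfl fun j _ => Finset.sum_congr rfl fun r _ => Finset.sum_comm
    simp only [mul_add, Finset.sum_add_distrib] at e2
    simp only [gaugeComp, sub_mul, totalD_mul, e1, Finset.sum_sub_distrib,
      Finset.sum_add_distrib, e3]
    rw [eq_neg_of_add_eq_zero_left e2, sub_neg_eq_add]
    simp only [Finset.mul_sum]
  rw [h3, h4]
  exact IsHorizontallyExact.sum fun r _ => IsHorizontallyExact.sum fun l _ =>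
    IsHorizontallyExact.totalD l _

theorem isVariationalSymmetry_gaugeOp (hh : 𝔤.IsNondegenerateCasimir h) :
    IsVariationalSymmetry (gaugeOp 𝔤) (lagrangian 𝔤 g h) :=
  isVariationalSymmetry_of_gaugeComp 𝔤 hh fun _ _ => rfl

end GaugeSymmetry

/-! ### Nilpotency of the BRST operator. -/

section Brst

variable {n : ℕ} {U : Opens (Fin n → ℝ)} {ι : Type*} [Fintype ι] (𝔤 : LieSuperalgebra ι)

theorem gh_mul_gh (i j : ι) (Λ M : Multiset (Fin n)) :
    (gh 𝔤 i Λ * gh 𝔤 j M : Alg 𝔤 U)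
      = -(sgn (𝔤.par i) * sgn (𝔤.par j) * 𝔤.ε i j) • (gh 𝔤 j M * gh 𝔤 i Λ : Alg 𝔤 U) := by
  rw [(isHomog_gh 𝔤 i Λ).mul_comm' (isHomog_gh 𝔤 j M)]
  congr 1
  rw [add_mul, mul_add, one_mul, mul_one, sgn_add, sgn_add, sgn_add, sgn_one, LieSuperalgebra.ε]
  ring

theorem LieSuperalgebra.c_skew' (r i j : ι) : 𝔤.c r i j = -(𝔤.ε i j * 𝔤.c r j i) := 𝔤.c_skew r i j

theorem LieSuperalgebra.c_mul_sgn (r i j : ι) :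
    𝔤.c r i j * sgn (𝔤.par r) = 𝔤.c r i j * (sgn (𝔤.par i) * sgn (𝔤.par j)) := by
  by_cases h : 𝔤.c r i j = 0
  · rw [h, zero_mul, zero_mul]
  · rw [𝔤.c_par r i j h, sgn_add]

/-- The action of the BRST operator on the ghosts, with the numerical factor one half dropped
by graded symmetry. -/
theorem contactDer_brstOp_gh (r : ι) (Λ : Multiset (Fin n)) :
    contactDer (brstOp 𝔤) (gh 𝔤 r Λ : Alg 𝔤 U) = totalDs Λ (ghostComp 𝔤 r) := by
  rw [gh, contactDer_gen]
  simp only [brstOp_ghost]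

theorem contactDer_brstOp_a (r : ι) (l : Fin n) (Λ : Multiset (Fin n)) :
    contactDer (brstOp 𝔤) (a 𝔤 r l Λ : Alg 𝔤 U) = totalDs Λ (gaugeComp 𝔤 r l) := by
  rw [a, contactDer_gen]
  simp only [brstOp_gauge]

theorem ghostComp_mul_gh (i j : ι) :
    (gh 𝔤 i 0 * ghostComp 𝔤 j : Alg 𝔤 U)
      = (sgn (𝔤.par j) * 𝔤.ε i j) • (ghostComp 𝔤 j * gh 𝔤 i 0 : Alg 𝔤 U) := by
  rw [(isHomog_gh 𝔤 i 0).mul_comm' (isHomog_ghostComp 𝔤 j)]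
  congr 1
  rw [add_mul, one_mul, sgn_add, LieSuperalgebra.ε, mul_comm]

/-- The cubic ghost expression whose vanishing is the graded Jacobi identity. -/
theorem sum_jacobi_ghosts (r : ι) :
    ∑ p, ∑ q, ∑ j, (sgn (𝔤.par q) * ∑ i, 𝔤.c i p q * 𝔤.c r i j) •
      (gh 𝔤 p 0 * gh 𝔤 q 0 * gh 𝔤 j 0 : Alg 𝔤 U) = 0 := by
  set J : ι → ι → ι → ℝ := fun p q j => ∑ i, 𝔤.c i p q * 𝔤.c r i j with hJ
  set c3 : ι → ι → ι → Alg 𝔤 U := fun p q j => gh 𝔤 p 0 * gh 𝔤 q 0 * gh 𝔤 j 0 with hc3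
  -- Each term on the right is the double bracket `J` with permuted arguments. Contracted with the
  -- graded antisymmetric ghost products, each gives minus the original sum.
  have hjac : ∀ p q j, J p q j
      = -(𝔤.ε p q * 𝔤.ε p j) * J q j p + 𝔤.ε q j * J p j q := by
    intro p q j
    have h1 : ∑ i, 𝔤.c i q j * 𝔤.c r p i = -(𝔤.ε p q * 𝔤.ε p j) * J q j p := by
      rw [hJ, Finset.mul_sum]
      refine Finset.sum_congr rfl fun i _ => ?_
      have h2 := 𝔤.c_mul_ε i q j p
      rw [𝔤.c_skew' r p i, 𝔤.ε_comm p i, 𝔤.ε_comm p q, 𝔤.ε_comm p j]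
      linear_combination (-𝔤.c r i p) * h2
    rw [← h1]
    exact 𝔤.jacobi_left r p q j
  have hA : ∑ p, ∑ q, ∑ j, (sgn (𝔤.par q) * (-(𝔤.ε p q * 𝔤.ε p j) * J q j p)) • c3 p q j
      = -∑ p, ∑ q, ∑ j, (sgn (𝔤.par q) * J p q j) • c3 p q j := by
    rw [sum_rotate_three, ← Finset.sum_neg_distrib]
    refine Finset.sum_congr rfl fun q _ => ?_
    rw [← Finset.sum_neg_distrib]
    refine Finset.sum_congr rfl fun j _ => ?_
    rw [← Finset.sum_neg_distrib]
    refine Finset.sum_congr rfl fun p _ => ?_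
    have e : c3 p q j = (𝔤.ε p q * 𝔤.ε p j * sgn (𝔤.par q) * sgn (𝔤.par j)) • c3 q j p := by
      simp only [hc3]
      rw [gh_mul_gh 𝔤 p q, neg_smul, neg_mul, smul_mul_assoc, mul_assoc (gh 𝔤 q 0) (gh 𝔤 p 0), gh_mul_gh 𝔤 p j,
        neg_smul, mul_neg, mul_smul_comm, smul_neg, neg_neg, smul_smul, mul_assoc (gh 𝔤 q 0) (gh 𝔤 j 0)]
      congr 1
      linear_combination (𝔤.ε p q * 𝔤.ε p j * sgn (𝔤.par q) * sgn (𝔤.par j)) *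
        sgn_mul_self (𝔤.par p)
    rw [e, smul_smul, ← neg_smul]
    congr 1
    have e1 := 𝔤.ε_mul_self p q
    have e2 := 𝔤.ε_mul_self p j
    have e3 := sgn_mul_self (𝔤.par q)
    linear_combination (-J q j p * sgn (𝔤.par j)) * (e1 * (𝔤.ε p j * 𝔤.ε p j) *
      (sgn (𝔤.par q) * sgn (𝔤.par q)) + e2 * (sgn (𝔤.par q) * sgn (𝔤.par q)) + e3)
  have hB : ∑ p, ∑ q, ∑ j, (sgn (𝔤.par q) * (𝔤.ε q j * J p j q)) • c3 p q j
      = -∑ p, ∑ q, ∑ j, (sgn (𝔤.par q) * J p q j) • c3 p q j := by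
    rw [← Finset.sum_neg_distrib]
    refine Finset.sum_congr rfl fun p _ => ?_
    rw [Finset.sum_comm, ← Finset.sum_neg_distrib]
    refine Finset.sum_congr rfl fun j _ => ?_
    rw [← Finset.sum_neg_distrib]
    refine Finset.sum_congr rfl fun q _ => ?_
    have e : c3 p q j = -(sgn (𝔤.par q) * sgn (𝔤.par j) * 𝔤.ε q j) • c3 p j q := by
      simp only [hc3]
      rw [mul_assoc, gh_mul_gh 𝔤 q j, mul_smul_comm, ← mul_assoc (gh 𝔤 p 0)]
    rw [e, smul_smul, ← neg_smul]
    congr 1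
    have e1 := 𝔤.ε_mul_self q j
    have e3 := sgn_mul_self (𝔤.par q)
    linear_combination (-J p j q * sgn (𝔤.par j)) * (e1 * (sgn (𝔤.par q) * sgn (𝔤.par q)) + e3)
  -- The Jacobi identity now reads `Z = -Z - Z` for the cubic ghost sum `Z`.
  have h1 : ∑ p, ∑ q, ∑ j, (sgn (𝔤.par q) * J p q j) • c3 p q j
      = -∑ p, ∑ q, ∑ j, (sgn (𝔤.par q) * J p q j) • c3 p q j
        - ∑ p, ∑ q, ∑ j, (sgn (𝔤.par q) * J p q j) • c3 p q j := by
    rw [sub_eq_add_neg]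
    nth_rewrite 2 [← hA]
    rw [← hB]
    simp only [← Finset.sum_add_distrib]
    refine Finset.sum_congr rfl fun p _ => Finset.sum_congr rfl fun q _ =>
      Finset.sum_congr rfl fun j _ => ?_
    rw [← add_smul, ← mul_add, add_comm, ← hjac]
  have h3 : (3 : ℝ) • ∑ p, ∑ q, ∑ j, (sgn (𝔤.par q) * J p q j) • c3 p q j = 0 := by
    have : (3 : ℝ) = 1 + 1 + 1 := by norm_num
    rw [this, add_smul, add_smul, one_smul]
    nth_rewrite 1 [h1]
    abel
  exact (smul_eq_zero.1 h3).resolve_left three_ne_zero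

/-- The two Leibniz terms agree by graded antisymmetry, which absorbs the factor one half.
Substituting the quadratic ghost term once more leaves the cubic Jacobi expression. -/
theorem contactDer_brstOp_ghostComp (r : ι) :
    contactDer (brstOp 𝔤) (ghostComp 𝔤 r : Alg 𝔤 U) = 0 := by
  have h1 : contactDer (brstOp 𝔤) (ghostComp 𝔤 r : Alg 𝔤 U)
      = -∑ i, ∑ j, (sgn (𝔤.par i) * 𝔤.c r i j) • (ghostComp 𝔤 i * gh 𝔤 j 0) := by
    have e1 : ∑ i, ∑ j, (1 / 2 * sgn (𝔤.par i) * 𝔤.c r i j) •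
          (sgn (1 * (𝔤.par i + 1)) • gh 𝔤 i 0 * ghostComp 𝔤 j : Alg 𝔤 U)
        = ∑ i, ∑ j, (1 / 2 * sgn (𝔤.par i) * 𝔤.c r i j) • (ghostComp 𝔤 i * gh 𝔤 j 0) := by
      rw [Finset.sum_comm]
      refine Finset.sum_congr rfl fun j _ => Finset.sum_congr rfl fun i _ => ?_
      rw [smul_mul_assoc, ghostComp_mul_gh, smul_smul, smul_smul]
      congr 1
      rw [one_mul, sgn_add, sgn_one, 𝔤.c_skew' r i j]
      have e2 := 𝔤.ε_mul_self i j
      have e3 := sgn_mul_self (𝔤.par i)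
      linear_combination (1 / 2 * sgn (𝔤.par j) * 𝔤.c r j i) *
        (e2 * (sgn (𝔤.par i) * sgn (𝔤.par i)) + e3)
    rw [contactDer_eq]
    simp only [ghostComp, map_neg, map_sum, map_smul]
    simp only [← contactDer_eq, contactDer_mul (isHomog_brstOp 𝔤), contactDer_brstOp_gh,
      totalDs_zero, (isHomog_gh 𝔤 _ _).twist, smul_add, Finset.sum_add_distrib]
    rw [e1]
    simp only [← Finset.sum_add_distrib, ← add_smul]
    congr 1
    refine Finset.sum_congr rfl fun i _ => Finset.sum_congr rfl fun j _ => ?_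
    congr 1
    ring
  have h2 : ∑ i, ∑ j, (sgn (𝔤.par i) * 𝔤.c r i j) • (ghostComp 𝔤 i * gh 𝔤 j 0 : Alg 𝔤 U)
      = -((1 / 2 : ℝ) • ∑ p, ∑ q, ∑ j, (sgn (𝔤.par q) * ∑ i, 𝔤.c i p q * 𝔤.c r i j) •
        (gh 𝔤 p 0 * gh 𝔤 q 0 * gh 𝔤 j 0)) := by
    have e : ∀ i j, (sgn (𝔤.par i) * 𝔤.c r i j) • (ghostComp 𝔤 i * gh 𝔤 j 0 : Alg 𝔤 U)
        = ∑ p, ∑ q, -((1 / 2 * sgn (𝔤.par q) * (𝔤.c i p q * 𝔤.c r i j)) •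
          (gh 𝔤 p 0 * gh 𝔤 q 0 * gh 𝔤 j 0)) := by
      intro i j
      simp only [ghostComp, neg_mul, Finset.sum_mul, smul_neg, Finset.sum_neg_distrib,
        Finset.smul_sum]
      congr 1
      refine Finset.sum_congr rfl fun p _ => Finset.sum_congr rfl fun q _ => ?_
      rw [smul_mul_assoc, smul_smul]
      congr 1
      have h3 := 𝔤.c_mul_sgn i p q
      have h4 := sgn_mul_self (𝔤.par p)
      linear_combination (1 / 2 * sgn (𝔤.par p) * 𝔤.c r i j) * h3
        + (1 / 2 * 𝔤.c i p q * 𝔤.c r i j * sgn (𝔤.par q)) * h4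
    refine (Finset.sum_congr rfl fun i _ => Finset.sum_congr rfl fun j _ => e i j).trans ?_
    rw [sum_rotate_four, sum_rotate_four]
    simp only [Finset.sum_neg_distrib]
    congr 1
    rw [Finset.smul_sum]
    refine Finset.sum_congr rfl fun p _ => ?_
    rw [Finset.smul_sum]
    refine Finset.sum_congr rfl fun q _ => ?_
    rw [Finset.smul_sum, Finset.sum_comm]
    refine Finset.sum_congr rfl fun j _ => ?_
    rw [smul_smul, ← Finset.sum_smul, ← mul_assoc, Finset.mul_sum]
  rw [h1, h2, sum_jacobi_ghosts, smul_zero, neg_zero, neg_zero]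

/-- The two Leibniz terms are equal, so the factor one half disappears; this is the form needed to
cancel the ghost-derivative terms of the BRST variation of the gauge component. -/
theorem totalD_ghostComp (r : ι) (l : Fin n) :
    totalD l (ghostComp 𝔤 r : Alg 𝔤 U)
      = -∑ j, ∑ i, (sgn (𝔤.par j) * 𝔤.c r j i) • (gh 𝔤 j 0 * gh 𝔤 i {l} : Alg 𝔤 U) := by
  have e1 : ∀ i : ι, totalD l (gh 𝔤 i 0 : Alg 𝔤 U) = gh 𝔤 i {l} := fun i => totalD_gen l _
  have e2 : ∑ i, ∑ j, (1 / 2 * sgn (𝔤.par i) * 𝔤.c r i j) • (gh 𝔤 i {l} * gh 𝔤 j 0 : Alg 𝔤 U)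
      = ∑ i, ∑ j, (1 / 2 * sgn (𝔤.par i) * 𝔤.c r i j) • (gh 𝔤 i 0 * gh 𝔤 j {l} : Alg 𝔤 U) := by
    rw [Finset.sum_comm]
    refine Finset.sum_congr rfl fun j _ => Finset.sum_congr rfl fun i _ => ?_
    rw [gh_mul_gh 𝔤 i j, smul_smul, 𝔤.c_skew' r i j]
    congr 1
    have e2 := 𝔤.ε_mul_self i j
    have e3 := sgn_mul_self (𝔤.par i)
    linear_combination (1 / 2 * sgn (𝔤.par j) * 𝔤.c r j i) *
      (e2 * (sgn (𝔤.par i) * sgn (𝔤.par i)) + e3)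
  simp only [ghostComp, totalD_neg, totalD_sum, totalD_smul, totalD_mul, e1, smul_add,
    Finset.sum_add_distrib]
  rw [e2]
  simp only [← Finset.sum_add_distrib, ← add_smul]
  congr 1
  refine Finset.sum_congr rfl fun i _ => Finset.sum_congr rfl fun j _ => ?_
  congr 1
  ring

/-- The Jacobi identity writes the left double bracket as a graded commutator of the adjoint actions
of `p` and `s`. Against the graded antisymmetric product of ghosts its two terms coincide, whence
the factor two. -/
theorem sum_jacobi_gauge (r : ι) (l : Fin n) :
    ∑ p, ∑ s, ∑ q, (sgn (𝔤.par p) * ∑ i, 𝔤.c i p s * 𝔤.c r i q) •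
        (gh 𝔤 p 0 * gh 𝔤 s 0 * a 𝔤 q l 0 : Alg 𝔤 U)
      = (2 : ℝ) • ∑ p, ∑ s, ∑ q, (sgn (𝔤.par p) * ∑ i, 𝔤.c i s q * 𝔤.c r p i) •
        (gh 𝔤 p 0 * gh 𝔤 s 0 * a 𝔤 q l 0) := by
  set K : ι → ι → ι → ℝ := fun p s q => ∑ i, 𝔤.c i s q * 𝔤.c r p i with hK
  set c3 : ι → ι → ι → Alg 𝔤 U := fun p s q => gh 𝔤 p 0 * gh 𝔤 s 0 * a 𝔤 q l 0 with hc3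
  have hjac : ∀ p s q, ∑ i, 𝔤.c i p s * 𝔤.c r i q = K p s q - 𝔤.ε p s * K s p q := by
    intro p s q
    have h1 : 𝔤.ε s q * ∑ i, 𝔤.c i p q * 𝔤.c r i s = -(𝔤.ε p s * K s p q) := by
      rw [hK, Finset.mul_sum, Finset.mul_sum, ← Finset.sum_neg_distrib]
      refine Finset.sum_congr rfl fun i _ => ?_
      have h2 := 𝔤.c_mul_ε i p q s
      have h3 := 𝔤.ε_mul_self s q
      rw [𝔤.ε_comm q s] at h2
      rw [𝔤.c_skew' r i s]
      linear_combination (-𝔤.ε s q * 𝔤.c r s i) * h2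
        - 𝔤.c i p q * 𝔤.ε p s * 𝔤.c r s i * h3
    rw [𝔤.jacobi_left r p s q, h1, sub_eq_add_neg]
  have hB : ∑ p, ∑ s, ∑ q, (sgn (𝔤.par p) * (𝔤.ε p s * K s p q)) • c3 p s q
      = -∑ p, ∑ s, ∑ q, (sgn (𝔤.par p) * K p s q) • c3 p s q := by
    rw [Finset.sum_comm, ← Finset.sum_neg_distrib]
    refine Finset.sum_congr rfl fun s _ => ?_
    rw [← Finset.sum_neg_distrib]
    refine Finset.sum_congr rfl fun p _ => ?_
    rw [← Finset.sum_neg_distrib]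
    refine Finset.sum_congr rfl fun q _ => ?_
    simp only [hc3]
    rw [gh_mul_gh 𝔤 p s, smul_mul_assoc, smul_smul, ← neg_smul]
    congr 1
    have e1 := 𝔤.ε_mul_self p s
    have e3 := sgn_mul_self (𝔤.par p)
    linear_combination (-K s p q * sgn (𝔤.par s)) * (e1 * (sgn (𝔤.par p) * sgn (𝔤.par p)) + e3)
  simp only [hjac, mul_sub, sub_smul, Finset.sum_sub_distrib]
  rw [hB, two_smul, sub_neg_eq_add]

/-- Terms without the gauge field cancel against the total derivative of the ghost component. Terms
quadratic in ghosts and linear in the gauge field cancel by `sum_jacobi_gauge`, its factor two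
matching the one half of the ghost component. -/
theorem contactDer_brstOp_gaugeComp (r : ι) (l : Fin n) :
    contactDer (brstOp 𝔤) (gaugeComp 𝔤 r l : Alg 𝔤 U) = 0 := by
  have h1 : ∑ j, ∑ i, 𝔤.c r j i • (ghostComp 𝔤 j * a 𝔤 i l 0 : Alg 𝔤 U)
      = -((1 / 2 : ℝ) • ∑ p, ∑ s, ∑ q, (sgn (𝔤.par p) * ∑ i, 𝔤.c i p s * 𝔤.c r i q) •
        (gh 𝔤 p 0 * gh 𝔤 s 0 * a 𝔤 q l 0 : Alg 𝔤 U)) := by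
    have e : ∀ i j, 𝔤.c r i j • (ghostComp 𝔤 i * a 𝔤 j l 0 : Alg 𝔤 U)
        = ∑ p, ∑ q, -((1 / 2 * sgn (𝔤.par p) * (𝔤.c i p q * 𝔤.c r i j)) •
          (gh 𝔤 p 0 * gh 𝔤 q 0 * a 𝔤 j l 0)) := by
      intro i j
      simp only [ghostComp, neg_mul, Finset.sum_mul, smul_neg, Finset.sum_neg_distrib,
        Finset.smul_sum]
      congr 1
      refine Finset.sum_congr rfl fun p _ => Finset.sum_congr rfl fun q _ => ?_
      rw [smul_mul_assoc, smul_smul]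
      congr 1
      ring
    refine (Finset.sum_congr rfl fun i _ => Finset.sum_congr rfl fun j _ => e i j).trans ?_
    rw [sum_rotate_four, sum_rotate_four]
    simp only [Finset.sum_neg_distrib]
    congr 1
    rw [Finset.smul_sum]
    refine Finset.sum_congr rfl fun p _ => ?_
    rw [Finset.smul_sum]
    refine Finset.sum_congr rfl fun q _ => ?_
    rw [Finset.smul_sum, Finset.sum_comm]
    refine Finset.sum_congr rfl fun j _ => ?_
    rw [smul_smul, ← Finset.sum_smul, ← mul_assoc, Finset.mul_sum]
  have h2 : ∑ j, ∑ i, 𝔤.c r j i • (sgn (1 * (𝔤.par j + 1)) • gh 𝔤 j 0 * gaugeComp 𝔤 i l : Alg 𝔤 U)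
      = -∑ j, ∑ i, (sgn (𝔤.par j) * 𝔤.c r j i) • (gh 𝔤 j 0 * gh 𝔤 i {l} : Alg 𝔤 U)
        + ∑ p, ∑ s, ∑ q, (sgn (𝔤.par p) * ∑ i, 𝔤.c i s q * 𝔤.c r p i) •
          (gh 𝔤 p 0 * gh 𝔤 s 0 * a 𝔤 q l 0) := by
    have e : ∀ j, ∑ i, 𝔤.c r j i • (sgn (1 * (𝔤.par j + 1)) • gh 𝔤 j 0 * gaugeComp 𝔤 i l : Alg 𝔤 U)
        = -∑ i, (sgn (𝔤.par j) * 𝔤.c r j i) • (gh 𝔤 j 0 * gh 𝔤 i {l} : Alg 𝔤 U)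
        + ∑ i, ∑ s, ∑ q, (sgn (𝔤.par j) * (𝔤.c i s q * 𝔤.c r j i)) •
          (gh 𝔤 j 0 * gh 𝔤 s 0 * a 𝔤 q l 0) := by
      intro j
      rw [← Finset.sum_neg_distrib, ← Finset.sum_add_distrib]
      refine Finset.sum_congr rfl fun i _ => ?_
      rw [smul_mul_assoc, smul_smul, one_mul, sgn_add, sgn_one, gaugeComp, mul_sub, smul_sub,
        sub_eq_add_neg, Finset.mul_sum, Finset.smul_sum, ← Finset.sum_neg_distrib, ← neg_smul]
      congr 2
      · ring
      · funext s
        rw [Finset.mul_sum, Finset.smul_sum, ← Finset.sum_neg_distrib]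
        refine Finset.sum_congr rfl fun q _ => ?_
        rw [mul_smul_comm, smul_smul, ← neg_smul, mul_assoc (gh 𝔤 j 0)]
        congr 1
        ring
    simp only [e, Finset.sum_add_distrib, Finset.sum_neg_distrib]
    congr 1
    refine Finset.sum_congr rfl fun j _ => ?_
    rw [sum_rotate_three]
    refine Finset.sum_congr rfl fun s _ => Finset.sum_congr rfl fun q _ => ?_
    rw [← Finset.sum_smul, Finset.mul_sum]
  have h3 : contactDer (brstOp 𝔤) (gaugeComp 𝔤 r l : Alg 𝔤 U)
      = totalD l (ghostComp 𝔤 r) - (∑ j, ∑ i, 𝔤.c r j i • (ghostComp 𝔤 j * a 𝔤 i l 0 : Alg 𝔤 U)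
        + ∑ j, ∑ i, 𝔤.c r j i •
          (sgn (1 * (𝔤.par j + 1)) • gh 𝔤 j 0 * gaugeComp 𝔤 i l : Alg 𝔤 U)) := by
    rw [contactDer_eq, gaugeComp]
    simp only [map_sub, map_sum, map_smul]
    simp only [← contactDer_eq, contactDer_mul (isHomog_brstOp 𝔤), contactDer_brstOp_gh,
      contactDer_brstOp_a, totalDs_zero, totalDs_singleton, (isHomog_gh 𝔤 _ _).twist, smul_add,
      Finset.sum_add_distrib]
  rw [h3, h1, h2, sum_jacobi_gauge, smul_smul, totalD_ghostComp]
  norm_num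

theorem isNilpotentDer_brstOp : IsNilpotentDer (brstOp (U := U) 𝔤) := by
  refine isNilpotentDer_of_components (isHomog_brstOp 𝔤) fun A => ?_
  rcases A with (⟨r, l⟩ | r) | z
  · exact (congrArg _ (brstOp_gauge 𝔤 r l)).trans (contactDer_brstOp_gaugeComp 𝔤 r l)
  · exact (congrArg _ (brstOp_ghost 𝔤 r)).trans (contactDer_brstOp_ghostComp 𝔤 r)
  · rw [brstOp_inr, contactDer_eq, map_zero]

end Brst

end

end SuperYM

namespace SuperYM

noncomputable section

/-! ## The master equation -/

section JetIdeal

variable {n : ℕ} {U : Opens (Fin n → ℝ)} {Z : Type*} {par : Z → ZMod 2} {K : Set (Z ⊕ Z)}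

theorem gen_mem_jetIdeal {v : Jet n (Z ⊕ Z)} (hv : v.1 ∈ K) :
    (gen v : JetAlg U (bvPar par)) ∈ (jetIdeal K : Ideal (JetAlg U (bvPar par))) :=
  Ideal.subset_span ⟨v, hv, rfl⟩

theorem smul_mem_ideal {φ : Type*} {p : φ → ZMod 2} (I : Ideal (JetAlg U p)) (r : ℝ)
    {x : JetAlg U p} (hx : x ∈ I) : r • x ∈ I := by
  rw [← one_mul x, ← smul_mul_assoc]
  exact I.mul_mem_left _ hx

theorem mul_mem_ideal_of_isHomog {φ : Type*} {p : φ → ZMod 2} (I : Ideal (JetAlg U p))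
    {s : ZMod 2} {x : JetAlg U p} (hs : IsHomog s x) (hx : x ∈ I) (y : JetAlg U p) : x * y ∈ I := by
  rw [hs.mul_comm]
  exact I.mul_mem_left _ hx

theorem totalD_mem_jetIdeal (l : Fin n) {x : JetAlg U (bvPar par)} (hx : x ∈ jetIdeal K) :
    totalD l x ∈ (jetIdeal K : Ideal (JetAlg U (bvPar par))) := by
  induction hx using Submodule.span_induction with
  | mem x hx =>
    obtain ⟨v, hv, rfl⟩ := hx
    rw [totalD_gen]
    exact gen_mem_jetIdeal hv
  | zero => simpa only [totalD_zero] using Submodule.zero_mem _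
  | add x y _ _ h1 h2 =>
    rw [totalD_add]
    exact Submodule.add_mem _ h1 h2
  | smul c x hx h1 =>
    rw [smul_eq_mul, totalD_mul]
    exact Submodule.add_mem _ (Ideal.mul_mem_left _ _ hx) (Ideal.mul_mem_left _ _ h1)

theorem totalDs_mem_jetIdeal (Λ : Multiset (Fin n)) {x : JetAlg U (bvPar par)}
    (hx : x ∈ jetIdeal K) : totalDs Λ x ∈ (jetIdeal K : Ideal (JetAlg U (bvPar par))) := by
  induction Λ using Multiset.induction with
  | empty => rwa [totalDs_zero]
  | cons l Λ ih =>
    rw [totalDs_cons]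
    exact totalD_mem_jetIdeal l ih

theorem pd_mem_jetIdeal {v : Jet n (Z ⊕ Z)} (hv : v.1 ∉ K) {x : JetAlg U (bvPar par)}
    (hx : x ∈ jetIdeal K) : pd v x ∈ (jetIdeal K : Ideal (JetAlg U (bvPar par))) := by
  induction hx using Submodule.span_induction with
  | mem x hx =>
    obtain ⟨w, hw, rfl⟩ := hx
    rw [pd_gen_of_ne (v := v) (w := w) fun h => hv (h ▸ hw)]
    exact Submodule.zero_mem _
  | zero => simpa only [map_zero] using Submodule.zero_mem _
  | add x y _ _ h1 h2 =>
    rw [map_add]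
    exact Submodule.add_mem _ h1 h2
  | smul c x hx h1 =>
    rw [smul_eq_mul, pd_mul]
    exact Submodule.add_mem _ (Ideal.mul_mem_left _ _ hx) (Ideal.mul_mem_left _ _ h1)

theorem varDeriv_mem_jetIdeal {A : Z ⊕ Z} (hA : A ∉ K) {x : JetAlg U (bvPar par)}
    (hx : x ∈ jetIdeal K) : varDeriv A x ∈ (jetIdeal K : Ideal (JetAlg U (bvPar par))) := by
  obtain ⟨T, hT⟩ := exists_finset_pd_label x
  rw [varDeriv_eq_sum A fun Λ hΛ => hT Λ hΛ A]
  exact Submodule.sum_mem _ fun Λ _ =>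
    smul_mem_ideal _ _ (totalDs_mem_jetIdeal Λ (pd_mem_jetIdeal hA hx))

end JetIdeal

theorem jetAlg_one_ne_zero {n : ℕ} {U : Opens (Fin n → ℝ)} [Nonempty U] {φ : Type*}
    {par : φ → ZMod 2} : (1 : JetAlg U par) ≠ 0 := by
  intro h
  have h1 := congrArg body h
  rw [map_one, map_zero] at h1
  have h2 := congrFun (congrArg Subtype.val h1) (Classical.arbitrary U, 0)
  exact _root_.one_ne_zero (α := ℝ) h2

/-! ### The extended Lagrangian as a proper solution of the master equation. -/

section Master

variable {n : ℕ} {U : Opens (Fin n → ℝ)} {ι : Type*} [Fintype ι] (𝔤 : LieSuperalgebra ι)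

theorem pd_gaugeComp_inr (z : YMField ι n) (Λ : Multiset (Fin n)) (r : ι) (l : Fin n) :
    pd (Sum.inr z, Λ) (gaugeComp 𝔤 r l : Alg 𝔤 U) = 0 := by
  have h0 : ∀ (j : ι) (m : Fin n) (M : Multiset (Fin n)),
      pd (Sum.inr z, Λ) (a 𝔤 j m M : Alg 𝔤 U) = 0 := fun j m M => pd_gen_of_ne (by simp)
  have h1 : ∀ (j : ι) (M : Multiset (Fin n)),
      pd (Sum.inr z, Λ) (gh 𝔤 j M : Alg 𝔤 U) = 0 := fun j M => pd_gen_of_ne (by simp)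
  simp only [gaugeComp, map_sub, map_sum, map_smul, pd_mul, h0, h1]
  simp

theorem pd_ghostComp_inr (z : YMField ι n) (Λ : Multiset (Fin n)) (r : ι) :
    pd (Sum.inr z, Λ) (ghostComp 𝔤 r : Alg 𝔤 U) = 0 := by
  have h1 : ∀ (j : ι) (M : Multiset (Fin n)),
      pd (Sum.inr z, Λ) (gh 𝔤 j M : Alg 𝔤 U) = 0 := fun j M => pd_gen_of_ne (by simp)
  simp only [ghostComp, map_neg, map_sum, map_smul, pd_mul, h1]
  simp

theorem gh_mem_jetIdeal (r : ι) (Λ : Multiset (Fin n)) :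
    (gh 𝔤 r Λ : Alg 𝔤 U) ∈ (jetIdeal ghosts : Ideal (Alg 𝔤 U)) :=
  gen_mem_jetIdeal ⟨r, rfl⟩

theorem gaugeComp_mem_jetIdeal (r : ι) (l : Fin n) :
    (gaugeComp 𝔤 r l : Alg 𝔤 U) ∈ (jetIdeal ghosts : Ideal (Alg 𝔤 U)) := by
  refine Submodule.sub_mem _ (gh_mem_jetIdeal 𝔤 r _) (Submodule.sum_mem _ fun j _ =>
    Submodule.sum_mem _ fun i _ => smul_mem_ideal _ _ ?_)
  exact mul_mem_ideal_of_isHomog _ (isHomog_gh 𝔤 j 0) (gh_mem_jetIdeal 𝔤 j 0) _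

theorem ghostComp_mem_jetIdeal (r : ι) :
    (ghostComp 𝔤 r : Alg 𝔤 U) ∈ (jetIdeal ghosts : Ideal (Alg 𝔤 U)) := by
  refine Submodule.neg_mem _ (Submodule.sum_mem _ fun j _ =>
    Submodule.sum_mem _ fun i _ => smul_mem_ideal _ _ ?_)
  exact Ideal.mul_mem_left _ _ (gh_mem_jetIdeal 𝔤 i 0)

/-- The derivatives of the quadratic ghost term are linear in the ghosts. -/
theorem pd_ghostComp_mem_jetIdeal (v : Jet n (YMField ι n ⊕ YMField ι n)) (r : ι) :
    pd v (ghostComp 𝔤 r : Alg 𝔤 U) ∈ (jetIdeal ghosts : Ideal (Alg 𝔤 U)) := by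
  classical
  simp only [ghostComp, map_neg, map_sum, map_smul, pd_mul, (isHomog_gh 𝔤 _ _).twist]
  refine Submodule.neg_mem _ (Submodule.sum_mem _ fun i _ =>
    Submodule.sum_mem _ fun j _ => smul_mem_ideal _ _ (Submodule.add_mem _ ?_ ?_))
  · exact Ideal.mul_mem_left _ _ (gh_mem_jetIdeal 𝔤 j 0)
  · exact mul_mem_ideal_of_isHomog _ ((isHomog_gh 𝔤 i 0).smul _)
      (smul_mem_ideal _ _ (gh_mem_jetIdeal 𝔤 i 0)) _

variable [DecidableEq ι] (g : MetricTensor U) (h : Matrix ι ι ℝ)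

/-- The terms of the extended Lagrangian that contain antifields. -/
def antifieldTerm : Alg 𝔤 U :=
  ∑ r, ∑ l, gaugeComp 𝔤 r l * aBar 𝔤 r l 0 + ∑ r, ghostComp 𝔤 r * ghBar 𝔤 r 0

theorem extendedLagrangian_eq :
    extendedLagrangian 𝔤 g h = lagrangian 𝔤 g h + antifieldTerm 𝔤 :=
  add_assoc _ _ _

theorem antifieldTerm_mem_jetIdeal_allBars :
    (antifieldTerm 𝔤 : Alg 𝔤 U) ∈ (jetIdeal allBars : Ideal (Alg 𝔤 U)) :=
  Submodule.add_mem _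
    (Submodule.sum_mem _ fun _ _ => Submodule.sum_mem _ fun _ _ =>
      Ideal.mul_mem_left _ _ (gen_mem_jetIdeal ⟨_, rfl⟩))
    (Submodule.sum_mem _ fun _ _ => Ideal.mul_mem_left _ _ (gen_mem_jetIdeal ⟨_, rfl⟩))

theorem antifieldTerm_mem_jetIdeal_ghosts :
    (antifieldTerm 𝔤 : Alg 𝔤 U) ∈ (jetIdeal ghosts : Ideal (Alg 𝔤 U)) :=
  Submodule.add_mem _
    (Submodule.sum_mem _ fun r _ => Submodule.sum_mem _ fun l _ =>
      mul_mem_ideal_of_isHomog _ (isHomog_gaugeComp 𝔤 r l) (gaugeComp_mem_jetIdeal 𝔤 r l) _)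
    (Submodule.sum_mem _ fun r _ =>
      mul_mem_ideal_of_isHomog _ (isHomog_ghostComp 𝔤 r) (ghostComp_mem_jetIdeal 𝔤 r) _)

theorem isHomog_antifieldTerm : IsHomog 0 (antifieldTerm 𝔤 : Alg 𝔤 U) := by
  refine (IsHomog.sum fun r _ => IsHomog.sum fun l _ => ?_).add (IsHomog.sum fun r _ => ?_)
  · exact ((isHomog_gaugeComp 𝔤 r l).mul (isHomog_aBar 𝔤 r l 0)).cast (parity_add_self _)
  · exact ((isHomog_ghostComp 𝔤 r).mul (isHomog_ghBar 𝔤 r 0)).cast (parity_add_self _)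

variable {g h}

theorem pdR_gaugeBar_extendedLagrangian (hh : 𝔤.IsNondegenerateCasimir h) (r : ι) (l : Fin n)
    (Λ : Multiset (Fin n)) : pdR (gaugeBarL r l, Λ) (extendedLagrangian 𝔤 g h)
      = if Λ = 0 then gaugeComp 𝔤 r l else 0 := by
  have h0 : pdR (gaugeBarL r l, Λ) (lagrangian 𝔤 g h) = 0 := by
    rw [pdR_eq_twist, pd_lagrangian_of_ne 𝔤 hh _ (by simp), map_zero]
  have h1 : ∀ s m, pdR (gaugeBarL r l, Λ) (gaugeComp 𝔤 s m * aBar 𝔤 s m 0 : Alg 𝔤 U)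
      = if r = s then (if l = m then (if Λ = 0 then gaugeComp 𝔤 r l else 0) else 0) else 0 := by
    intro s m
    rw [pdR_mul_of_pd_eq_zero _ (pd_gaugeComp_inr 𝔤 _ _ s m), aBar, pdR_gen]
    simp only [Prod.mk.injEq, Sum.inr.injEq, Sum.inl.injEq]
    by_cases h1 : r = s <;> by_cases h2 : l = m <;> by_cases h3 : Λ = 0 <;> simp [h1, h2, h3]
  have h2 : ∀ s, pdR (gaugeBarL r l, Λ) (ghostComp 𝔤 s * ghBar 𝔤 s 0 : Alg 𝔤 U) = 0 := by
    intro s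
    rw [pdR_mul_of_pd_eq_zero _ (pd_ghostComp_inr 𝔤 _ _ s), ghBar, pdR_gen, if_neg (by simp),
      mul_zero]
  rw [extendedLagrangian_eq, antifieldTerm]
  simp only [map_add, map_sum, h0, h1, h2]
  simp

theorem pdR_ghostBar_extendedLagrangian (hh : 𝔤.IsNondegenerateCasimir h) (r : ι)
    (Λ : Multiset (Fin n)) : pdR (ghostBarL n r, Λ) (extendedLagrangian 𝔤 g h)
      = if Λ = 0 then ghostComp 𝔤 r else 0 := by
  have h0 : pdR (ghostBarL n r, Λ) (lagrangian 𝔤 g h) = 0 := by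
    rw [pdR_eq_twist, pd_lagrangian_of_ne 𝔤 hh _ (by simp), map_zero]
  have h1 : ∀ s m, pdR (ghostBarL n r, Λ) (gaugeComp 𝔤 s m * aBar 𝔤 s m 0 : Alg 𝔤 U) = 0 := by
    intro s m
    rw [pdR_mul_of_pd_eq_zero _ (pd_gaugeComp_inr 𝔤 _ _ s m), aBar, pdR_gen, if_neg (by simp),
      mul_zero]
  have h2 : ∀ s, pdR (ghostBarL n r, Λ) (ghostComp 𝔤 s * ghBar 𝔤 s 0 : Alg 𝔤 U)
      = if r = s then (if Λ = 0 then ghostComp 𝔤 r else 0) else 0 := by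
    intro s
    rw [pdR_mul_of_pd_eq_zero _ (pd_ghostComp_inr 𝔤 _ _ s), ghBar, pdR_gen]
    simp only [Prod.mk.injEq, Sum.inr.injEq]
    by_cases h1 : r = s <;> by_cases h3 : Λ = 0 <;> simp [h1, h3]
  rw [extendedLagrangian_eq, antifieldTerm]
  simp only [map_add, map_sum, h0, h1, h2]
  simp

theorem varDerivR_eq_of_pdR (A : YMField ι n ⊕ YMField ι n) {S x : Alg 𝔤 U}
    (hS : ∀ Λ, pdR (A, Λ) S = if Λ = 0 then x else 0) : varDerivR A S = x := by
  rw [varDerivR_eq_sum A (T := {0}) fun Λ hΛ => by rw [hS, if_neg (by simpa using hΛ)]]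
  simp [hS]

/-- The left derivation defined by the extended Lagrangian is the BRST operator. -/
theorem fieldDer_extendedLagrangian (hh : 𝔤.IsNondegenerateCasimir h) :
    fieldDer (extendedLagrangian 𝔤 g h) = brstOp 𝔤 := by
  funext A
  rcases A with (⟨r, l⟩ | r) | z
  · exact (varDerivR_eq_of_pdR 𝔤 _ (pdR_gaugeBar_extendedLagrangian 𝔤 hh r l)).trans
      (brstOp_gauge 𝔤 r l).symm
  · exact (varDerivR_eq_of_pdR 𝔤 _ (pdR_ghostBar_extendedLagrangian 𝔤 hh r)).trans
      (brstOp_ghost 𝔤 r).symm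
  · exact (brstOp_inr 𝔤 z).symm

/-- The BRST operator annihilates antifields, and it annihilates their coefficients because these
are its own components. -/
theorem contactDer_brstOp_antifieldTerm :
    contactDer (brstOp 𝔤) (antifieldTerm 𝔤 : Alg 𝔤 U) = 0 := by
  have h1 : ∀ r l, contactDer (brstOp 𝔤) (aBar 𝔤 r l 0 : Alg 𝔤 U) = 0 := fun r l => by
    rw [aBar, contactDer_gen, totalDs_zero]
    exact brstOp_inr 𝔤 _
  have h2 : ∀ r, contactDer (brstOp 𝔤) (ghBar 𝔤 r 0 : Alg 𝔤 U) = 0 := fun r => by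
    rw [ghBar, contactDer_gen, totalDs_zero]
    exact brstOp_inr 𝔤 _
  rw [contactDer_eq, antifieldTerm]
  simp only [map_add, map_sum]
  simp only [← contactDer_eq, contactDer_mul (isHomog_brstOp 𝔤), h1, h2,
    contactDer_brstOp_gaugeComp, contactDer_brstOp_ghostComp]
  simp

/-- By the first variational formula the antibracket is `2 b(S)` up to a divergence, where `b` is
the BRST operator. There `b` kills the antifield terms, and the rest is a gauge variation of the
Yang-Mills Lagrangian. -/
theorem masterEquation_extendedLagrangian (hh : 𝔤.IsNondegenerateCasimir h) :
    MasterEquation (extendedLagrangian 𝔤 g h) := by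
  set S := extendedLagrangian 𝔤 g h with hS
  have h1 : contactDer (brstOp 𝔤) S = contactDer (brstOp 𝔤) (lagrangian 𝔤 g h) := by
    rw [hS, extendedLagrangian_eq, contactDer_eq, map_add]
    simp only [← contactDer_eq, contactDer_brstOp_antifieldTerm, add_zero]
  have h2 : IsHorizontallyExact (contactDer (brstOp 𝔤) S) := by
    rw [h1]
    exact isVariationalSymmetry_of_gaugeComp 𝔤 hh (brstOp_gauge 𝔤)
  have h3 : antibracket S S = (2 : ℝ) • ∑ A, brstOp 𝔤 A * varDeriv A S := by
    rw [← fieldDer_extendedLagrangian 𝔤 hh, ← hS, Fintype.sum_sum_type]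
    simp only [fieldDer, Sum.elim_inl, Sum.elim_inr, zero_mul, Finset.sum_const_zero, add_zero,
      antibracket, ← two_smul ℝ, Finset.smul_sum]
  have h4 := h2.sub (isHorizontallyExact_contactDer_sub (brstOp 𝔤) S)
  rw [sub_sub_cancel] at h4
  rw [MasterEquation, h3]
  exact h4.smul 2

theorem pd_gaugeComp_ghost (r s : ι) (l : Fin n) (Λ : Multiset (Fin n)) :
    pd (ghostL n r, Λ) (gaugeComp 𝔤 s l : Alg 𝔤 U)
      = (if r = s ∧ Λ = {l} then 1 else 0)
        - if Λ = 0 then ∑ i, 𝔤.c s r i • a 𝔤 i l 0 else 0 := by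
  have h0 : ∀ (j : ι) (m : Fin n) (M : Multiset (Fin n)),
      pd (ghostL n r, Λ) (a 𝔤 j m M : Alg 𝔤 U) = 0 := fun j m M => pd_gen_of_ne (by simp)
  have h1 : ∀ (j : ι) (M : Multiset (Fin n)),
      pd (ghostL n r, Λ) (gh 𝔤 j M : Alg 𝔤 U) = if r = j ∧ Λ = M then 1 else 0 := fun j M => by
    rw [gh, pd_gen]
    simp
  simp only [gaugeComp, map_sub, map_sum, map_smul, pd_mul, h0, h1, mul_zero, add_zero]
  congr 1
  split_ifs with hΛ
  · rw [Finset.sum_eq_single r]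
    · simp [hΛ]
    · intro j _ hj
      simp [hj.symm]
    · simp
  · simp [hΛ]

/-- The quadratic ghost term of the extended Lagrangian contributes terms linear in ghosts. -/
theorem varDeriv_ghost_extendedLagrangian (hh : 𝔤.IsNondegenerateCasimir h) (r : ι) :
    varDeriv (ghostL n r) (extendedLagrangian 𝔤 g h)
      = -noetherOp 𝔤 r + ∑ s, pd (ghostL n r, 0) (ghostComp 𝔤 s) * ghBar 𝔤 s 0 := by
  have h0 : ∀ (s : ι) (l : Fin n) (Λ M : Multiset (Fin n)),
      pd (ghostL n r, Λ) (aBar 𝔤 s l M : Alg 𝔤 U) = 0 := fun s l Λ M => pd_gen_of_ne (by simp)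
  have h1 : ∀ (s : ι) (Λ M : Multiset (Fin n)),
      pd (ghostL n r, Λ) (ghBar 𝔤 s M : Alg 𝔤 U) = 0 := fun s Λ M => pd_gen_of_ne (by simp)
  have h2 : ∀ (s : ι) (Λ : Multiset (Fin n)), Λ ≠ 0 →
      pd (ghostL n r, Λ) (ghostComp 𝔤 s : Alg 𝔤 U) = 0 := by
    intro s Λ hΛ
    have h3 : ∀ j : ι, pd (ghostL n r, Λ) (gh 𝔤 j 0 : Alg 𝔤 U) = 0 := fun j =>
      pd_gen_of_ne (by simp [hΛ])
    simp only [ghostComp, map_neg, map_sum, map_smul, pd_mul, h3]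
    simp
  have h3 : ∀ Λ, pd (ghostL n r, Λ) (extendedLagrangian 𝔤 g h)
      = ∑ s, ∑ l, ((if r = s ∧ Λ = {l} then 1 else 0)
        - if Λ = 0 then ∑ i, 𝔤.c s r i • a 𝔤 i l 0 else 0) * aBar 𝔤 s l 0
        + ∑ s, pd (ghostL n r, Λ) (ghostComp 𝔤 s) * ghBar 𝔤 s 0 := by
    intro Λ
    rw [extendedLagrangian_eq, antifieldTerm]
    simp only [map_add, map_sum, pd_lagrangian_of_ne 𝔤 hh (ghostL n r) (by simp), pd_mul, h0, h1,
      mul_zero, add_zero, zero_add, pd_gaugeComp_ghost]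
  have hT : ∀ Λ ∉ insert 0 ((Finset.univ : Finset (Fin n)).image fun μ => ({μ} : Multiset _)),
      pd (ghostL n r, Λ) (extendedLagrangian 𝔤 g h) = 0 := by
    intro Λ hΛ
    simp only [Finset.mem_insert, Finset.mem_image, Finset.mem_univ, true_and, not_or,
      not_exists] at hΛ
    rw [h3]
    simp only [h2 _ Λ hΛ.1, hΛ.1, fun l => (Ne.symm (hΛ.2 l) : Λ ≠ {l}), if_false, and_false,
      sub_zero, zero_mul, Finset.sum_const_zero, add_zero]
  have h4 : pd (ghostL n r, 0) (extendedLagrangian 𝔤 g h)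
      = -∑ s, ∑ i, ∑ l, 𝔤.c s r i • (a 𝔤 i l 0 * aBar 𝔤 s l 0)
        + ∑ s, pd (ghostL n r, 0) (ghostComp 𝔤 s) * ghBar 𝔤 s 0 := by
    rw [h3]
    simp only [(Multiset.singleton_ne_zero _).symm, and_false, if_false, if_true, zero_sub,
      neg_mul, Finset.sum_neg_distrib, Finset.sum_mul, smul_mul_assoc]
    congr 2
    exact Finset.sum_congr rfl fun s _ => Finset.sum_comm
  have h5 : ∀ μ : Fin n, pd (ghostL n r, {μ}) (extendedLagrangian 𝔤 g h) = aBar 𝔤 r μ 0 := by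
    intro μ
    rw [h3]
    simp only [h2 _ {μ} (Multiset.singleton_ne_zero μ), Multiset.singleton_ne_zero, if_false,
      sub_zero, zero_mul, Finset.sum_const_zero, add_zero, Multiset.singleton_inj, ite_and, ite_mul,
      one_mul, Finset.sum_ite_irrel, Finset.sum_ite_eq, Finset.mem_univ, if_true]
  rw [varDeriv_eq_sum _ hT, Finset.sum_insert (by simp), Finset.sum_image
    fun μ _ ν _ e => by simpa using e]
  have h6 : ∀ μ : Fin n, totalD μ (aBar 𝔤 r μ 0 : Alg 𝔤 U) = aBar 𝔤 r μ {μ} :=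
    fun μ => totalD_gen μ _
  simp only [Multiset.card_zero, pow_zero, one_smul, totalDs_zero, Multiset.card_singleton, pow_one,
    totalDs_singleton, h4, h5, h6, neg_smul, Finset.sum_neg_distrib, noetherOp]
  abel

theorem isHomog_extendedLagrangian (hh : 𝔤.IsNondegenerateCasimir h) :
    IsHomog 0 (extendedLagrangian 𝔤 g h) := by
  rw [extendedLagrangian_eq]
  exact (isHomog_lagrangian hh).add (isHomog_antifieldTerm 𝔤)

theorem isHomog_antifieldDer (hh : 𝔤.IsNondegenerateCasimir h) (A : YMField ι n ⊕ YMField ι n) :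
    IsHomog (1 + bvPar (ymFieldPar n 𝔤.par) A) (antifieldDer (extendedLagrangian 𝔤 g h) A) := by
  rcases A with z | z
  · exact IsHomog.zero
  · refine ((isHomog_extendedLagrangian 𝔤 hh).varDeriv (Sum.inl z)).cast ?_
    change 0 + ymFieldPar n 𝔤.par z = 1 + (ymFieldPar n 𝔤.par z + 1)
    rw [zero_add, add_left_comm, parity_one_add_one, add_zero]

theorem gaugeComp_ne_zero [Nonempty U] (r : ι) (l : Fin n) : (gaugeComp 𝔤 r l : Alg 𝔤 U) ≠ 0 := by
  intro h0
  have h1 := pd_gaugeComp_ghost (U := U) 𝔤 r r l {l}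
  rw [h0, map_zero] at h1
  simp only [and_self, if_true, Multiset.singleton_ne_zero, if_false, sub_zero] at h1
  exact jetAlg_one_ne_zero h1.symm

/-- The jet `ā^l_r` of index `{l}` occurs with coefficient `-1`; the additional term contains only
Noether antifields and cannot cancel it. -/
theorem varDeriv_ghost_extendedLagrangian_ne_zero [Nonempty U] (l : Fin n)
    (hh : 𝔤.IsNondegenerateCasimir h) (r : ι) :
    varDeriv (ghostL n r) (extendedLagrangian 𝔤 g h) ≠ 0 := by
  intro h0
  rw [varDeriv_ghost_extendedLagrangian 𝔤 hh] at h0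
  have h1 := congrArg (pdR (gaugeBarL r l, {l})) h0
  have h2 : ∀ s, pdR (gaugeBarL r l, {l}) (pd (ghostL n r, 0) (ghostComp 𝔤 s) * ghBar 𝔤 s 0
      : Alg 𝔤 U) = 0 := by
    intro s
    have h3 : pd (gaugeBarL r l, {l}) (pd (ghostL n r, 0) (ghostComp 𝔤 s : Alg 𝔤 U)) = 0 := by
      rw [pd_pd, pd_ghostComp_inr, map_zero, smul_zero]
    rw [pdR_mul_of_pd_eq_zero _ h3, ghBar, pdR_gen, if_neg (by simp), mul_zero]
  rw [map_add, map_neg, map_sum, pdR_noetherOp, map_zero] at h1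
  simp only [h2, Finset.sum_const_zero, Multiset.singleton_ne_zero, if_false, and_self, if_true,
    zero_add, add_zero, neg_eq_zero] at h1
  exact jetAlg_one_ne_zero h1

/-- The extended Lagrangian is a proper solution of the classical master equation. -/
theorem isProperSolution_extendedLagrangian [Nonempty U] [Nonempty ι] (l : Fin n)
    (hh : 𝔤.IsNondegenerateCasimir h) :
    IsProperSolution (lagrangian 𝔤 g h) (fun j => -noetherOp 𝔤 j) (extendedLagrangian 𝔤 g h) where
  nontrivial := by
    obtain ⟨r⟩ := ‹Nonempty ι›
    refine ⟨masterEquation_extendedLagrangian 𝔤 hh, ⟨gen (gaugeL r l, 0), ?_⟩,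
      ⟨gen (ghostBarL n r, 0), ?_⟩⟩
    · rw [fieldDer_extendedLagrangian 𝔤 hh, contactDer_gen, totalDs_zero]
      exact (brstOp_gauge 𝔤 r l).trans_ne (gaugeComp_ne_zero 𝔤 r l)
    · rw [contactDerR_gen (isHomog_antifieldDer 𝔤 hh), totalDs_zero]
      exact varDeriv_ghost_extendedLagrangian_ne_zero 𝔤 l hh r
  extends_L := by
    rw [extendedLagrangian_eq, add_sub_cancel_left]
    exact antifieldTerm_mem_jetIdeal_allBars 𝔤
  koszul_tate := by
    rintro (⟨r, l⟩ | r)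
    · change varDeriv (gaugeL r l) (extendedLagrangian 𝔤 g h)
        - varDeriv (gaugeL r l) (lagrangian 𝔤 g h) ∈ _
      rw [extendedLagrangian_eq, varDeriv_add, add_sub_cancel_left]
      exact varDeriv_mem_jetIdeal (by simp [ghosts]) (antifieldTerm_mem_jetIdeal_ghosts 𝔤)
    · change varDeriv (ghostL n r) (extendedLagrangian 𝔤 g h) - -noetherOp 𝔤 r ∈ _
      rw [varDeriv_ghost_extendedLagrangian 𝔤 hh, add_sub_cancel_left]
      refine Submodule.sum_mem _ fun s _ => ?_
      exact mul_mem_ideal_of_isHomog _ ((isHomog_ghostComp 𝔤 s).pd _)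
        (pd_ghostComp_mem_jetIdeal 𝔤 _ s) _

end Master

end

end SuperYM

namespace SuperYM

noncomputable section

/-! ## Functions of the base point -/

section BaseFunctions

variable {n : ℕ} {U : Opens (Fin n → ℝ)} {φ : Type*} {par : φ → ZMod 2}

theorem fibreDeriv_body (v : EvenJet n par) (x : JetAlg U par) :
    fibreDeriv v (body x) = body (pd v.1 x) := by
  induction x using JetAlg.induction with
  | h0 => simp
  | hadd x y hx hy => simp only [map_add, hx, hy]
  | hof f w => rw [pd_of_even v.2, body_of, body_of, Algebra.algebraMap_eq_smul_one, mul_smul_comm,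
    mul_smul_comm, mul_one, mul_one, map_smul]

theorem algebraMapInv_ι {R M : Type*} [CommRing R] [AddCommGroup M] [Module R M] (m : M) :
    ExteriorAlgebra.algebraMapInv (ExteriorAlgebra.ι R m) = 0 := by
  rw [ExteriorAlgebra.algebraMapInv, ExteriorAlgebra.lift_ι_apply]
  rfl

open scoped Classical in
/-- The Euler derivation of the odd variables. -/
def oddEuler : JetAlg U par →ₗ[ℝ] JetAlg U par :=
  derSum fun v => if par v.1 = 0 then 0 else gen v

theorem oddEuler_mul (x y : JetAlg U par) :
    oddEuler (x * y) = oddEuler x * y + x * oddEuler y := by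
  classical
  have := derSum_mul (p := 0) (X := fun v : Jet n φ => if par v.1 = 0 then (0 : JetAlg U par)
    else gen v) (fun v => by
      split_ifs
      · exact IsHomog.zero
      · exact (isHomog_gen v).cast (zero_add _).symm) x y
  rwa [twist_zero] at this

theorem oddEuler_of_one (f : SmoothFn U (EvenJet n par)) :
    oddEuler (JetAlg.of f 1 : JetAlg U par) = 0 := by
  classical
  rw [oddEuler, derSum_apply]
  refine finsum_eq_zero_of_forall_eq_zero fun v => ?_
  split_ifs with h
  · rw [zero_mul]
  · rw [pd_of_odd h]
    simp [JetAlg.of_zero]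

theorem oddEuler_of_ι (m : OddJet n par →₀ ℝ) :
    oddEuler (JetAlg.of 1 (ExteriorAlgebra.ι ℝ m) : JetAlg U par)
      = JetAlg.of 1 (ExteriorAlgebra.ι ℝ m) := by
  classical
  induction m using Finsupp.induction_linear with
  | zero => simp [JetAlg.of_zero]
  | add m m' h h' => rw [map_add, JetAlg.of_add, map_add, h, h']
  | single v r =>
    have h1 : (JetAlg.of 1 (ExteriorAlgebra.ι ℝ (Finsupp.single v r)) : JetAlg U par)
        = r • gen v.1 := by
      rw [gen, dif_neg v.2, ← JetAlg.of_smul, ← map_smul]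
      simp
    rw [h1, map_smul, oddEuler, derSum_gen, if_neg v.2]

/-- The Euler derivation counts odd factors. Multiplication by an odd generator raises its
eigenvalue by one, so the soul is a sum of eigenvectors with eigenvalues `1, 2, …`. -/
theorem sub_body_mem_iSup_eigenspace (x : JetAlg U par) :
    x - JetAlg.of (body x) 1 ∈ ⨆ (μ : ℝ) (_ : μ ≠ 0), Module.End.eigenspace oddEuler μ := by
  set W : Submodule ℝ (JetAlg U par) :=
    ⨆ k : ℕ, Module.End.eigenspace oddEuler ((k : ℝ) + 1) with hW
  have hle : W ≤ ⨆ (μ : ℝ) (_ : μ ≠ 0), Module.End.eigenspace oddEuler μ :=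
    iSup_le fun k => le_iSup₂_of_le ((k : ℝ) + 1) (by positivity) le_rfl
  refine hle ?_
  have hι : ∀ m : OddJet n par →₀ ℝ, ∀ y ∈ W,
      (JetAlg.of 1 (ExteriorAlgebra.ι ℝ m) : JetAlg U par) * y ∈ W := by
    intro m y hy
    induction hy using Submodule.iSup_induction' with
    | mem k y hy =>
      refine Submodule.mem_iSup_of_mem (k + 1) ?_
      rw [Module.End.mem_eigenspace_iff] at hy ⊢
      rw [oddEuler_mul, oddEuler_of_ι, hy, mul_smul_comm]
      push_cast
      rw [add_smul ((k : ℝ) + 1), one_smul, add_comm]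
    | zero => rw [mul_zero]; exact Submodule.zero_mem _
    | add y z _ _ h1 h2 => rw [mul_add]; exact Submodule.add_mem _ h1 h2
  induction x using JetAlg.induction with
  | h0 =>
    rw [map_zero, JetAlg.zero_of, sub_zero]
    exact Submodule.zero_mem _
  | hadd x y hx hy =>
    rw [map_add, JetAlg.add_of, add_sub_add_comm]
    exact Submodule.add_mem _ hx hy
  | hof f w =>
    induction w using CliffordAlgebra.left_induction with
    | algebraMap r =>
      have h1 : (JetAlg.of f (algebraMap ℝ _ r) : JetAlg U par) = JetAlg.of (r • f) 1 := by
        rw [Algebra.algebraMap_eq_smul_one]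
        exact (TensorProduct.smul_tmul r f _).symm
      erw [h1]
      rw [body_of_one, sub_self]
      exact Submodule.zero_mem _
    | add x y hx hy =>
      rw [JetAlg.of_add, map_add, JetAlg.add_of, add_sub_add_comm]
      exact Submodule.add_mem _ hx hy
    | ι_mul w m hw =>
      have h1 : (JetAlg.of f (CliffordAlgebra.ι _ m * w) : JetAlg U par)
          = JetAlg.of 1 (ExteriorAlgebra.ι ℝ m) * JetAlg.of f w := by
        rw [JetAlg.of_mul_of, one_mul]
      have h2 : body (JetAlg.of 1 (ExteriorAlgebra.ι ℝ m) : JetAlg U par) = 0 := by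
        rw [body_of, algebraMapInv_ι, map_zero, mul_zero]
      rw [h1, map_mul, h2, zero_mul, JetAlg.zero_of, sub_zero]
      have h3 := hι m _ hw
      have h4 : (JetAlg.of 1 (ExteriorAlgebra.ι ℝ m) : JetAlg U par)
          * JetAlg.of (body (JetAlg.of f w : JetAlg U par)) 1 ∈ W := by
        refine Submodule.mem_iSup_of_mem 0 ?_
        rw [Module.End.mem_eigenspace_iff, oddEuler_mul, oddEuler_of_ι, oddEuler_of_one]
        simp
      have h5 := W.add_mem h3 h4
      rwa [← mul_add, sub_add_cancel] at h5

/-- A graded function that does not depend on any jet variables is given by its body. -/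
theorem eq_of_body_of_pd_eq_zero {x : JetAlg U par} (hx : ∀ v, pd v x = 0) :
    x = JetAlg.of (body x) 1 := by
  have h1 : oddEuler (x - JetAlg.of (body x) 1) = 0 := by
    rw [map_sub, oddEuler_of_one, sub_zero, oddEuler, derSum_apply]
    simp [hx]
  -- Without dependence on jet variables the soul is annihilated by the Euler derivation;
  -- independence of the eigenspaces makes it zero.
  have h2 := Module.End.eigenspaces_iSupIndep (oddEuler (U := U) (par := par)) 0
  rw [← sub_eq_zero]
  refine Submodule.disjoint_def.1 h2 _ ?_ (sub_body_mem_iSup_eigenspace x)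
  rw [Module.End.mem_eigenspace_iff, h1, zero_smul]

/-- The value of a graded function at a point of the zero section. -/
def evalZero (x : U) : JetAlg U par →ₐ[ℝ] ℝ :=
  ((Pi.evalAlgHom ℝ (fun _ : U × (EvenJet n par → ℝ) => ℝ) (x, 0)).comp
    (SmoothFn U (EvenJet n par)).val).comp body

theorem evalZero_gen (x : U) (v : Jet n φ) : evalZero x (gen v : JetAlg U par) = 0 := by
  change (body (gen v : JetAlg U par)).1 (x, 0) = 0
  unfold gen
  split_ifs with h
  · rw [body_of_one]
    rfl
  · rw [body_of, algebraMapInv_ι, map_zero, mul_zero]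
    rfl

/-- A function of `x` alone equals its body, and the body is constant on fibres, so its values on
the zero section determine it. -/
theorem eq_zero_of_evalZero {f : JetAlg U par} (hf : f ∈ functionsOf (U := U) (par := par) ∅)
    (h : ∀ x, evalZero x f = 0) : f = 0 := by
  have hpd : ∀ v, pd v f = 0 := fun v => by
    simp only [functionsOf, Submodule.mem_iInf] at hf
    exact hf v (Set.notMem_empty _)
  have h1 : body f = 0 := by
    ext x y
    rw [eq_of_fibreDeriv_eq_zero (fun v => by rw [fibreDeriv_body, hpd, map_zero]) x y 0]
    exact h x
  rw [eq_of_body_of_pd_eq_zero hpd, h1, JetAlg.zero_of]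

end BaseFunctions

end

end SuperYM

namespace SuperYM

noncomputable section

/-! ## Chains, boundaries and the on-shell ideal -/

section FunctionsOf

variable {n : ℕ} {U : Opens (Fin n → ℝ)} {φ : Type*} {par : φ → ZMod 2} {K : Set φ}

theorem mem_functionsOf {x : JetAlg U par} :
    x ∈ functionsOf (U := U) (par := par) K ↔ ∀ v : Jet n φ, v.1 ∉ K → pd v x = 0 := by
  simp only [functionsOf, Submodule.mem_iInf, LinearMap.mem_ker]

theorem one_mem_functionsOf : (1 : JetAlg U par) ∈ functionsOf (U := U) (par := par) K :=
  mem_functionsOf.2 fun v _ => pd_one v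

theorem mul_mem_functionsOf {x y : JetAlg U par} (hx : x ∈ functionsOf (U := U) (par := par) K)
    (hy : y ∈ functionsOf (U := U) (par := par) K) :
    x * y ∈ functionsOf (U := U) (par := par) K := by
  rw [mem_functionsOf] at *
  intro v hv
  rw [pd_mul, hx v hv, hy v hv, zero_mul, mul_zero, add_zero]

theorem gen_mem_functionsOf {v : Jet n φ} (hv : v.1 ∈ K) :
    (gen v : JetAlg U par) ∈ functionsOf (U := U) (par := par) K :=
  mem_functionsOf.2 fun w hw => pd_gen_of_ne (v := w) (w := v) fun h => hw (h ▸ hv)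

theorem twist_mem_functionsOf (s : ZMod 2) {x : JetAlg U par}
    (hx : x ∈ functionsOf (U := U) (par := par) K) :
    twist s x ∈ functionsOf (U := U) (par := par) K := by
  rw [mem_functionsOf] at *
  intro v hv
  rw [pd_twist, hx v hv, map_zero, smul_zero]

theorem pd_mem_functionsOf (w : Jet n φ) {x : JetAlg U par}
    (hx : x ∈ functionsOf (U := U) (par := par) K) :
    pd w x ∈ functionsOf (U := U) (par := par) K := by
  rw [mem_functionsOf] at *
  intro v hv
  rw [pd_pd, hx v hv, map_zero, smul_zero]

theorem totalD_mem_functionsOf (l : Fin n) {x : JetAlg U par}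
    (hx : x ∈ functionsOf (U := U) (par := par) K) :
    totalD l x ∈ functionsOf (U := U) (par := par) K := by
  rw [mem_functionsOf] at *
  rintro ⟨A, M⟩ hv
  rw [pd_totalD, hx (A, M) hv, hx (A, M.erase l) hv, totalD_zero, ite_self, add_zero]

theorem totalDs_mem_functionsOf (Λ : Multiset (Fin n)) {x : JetAlg U par}
    (hx : x ∈ functionsOf (U := U) (par := par) K) :
    totalDs Λ x ∈ functionsOf (U := U) (par := par) K := by
  induction Λ using Multiset.induction with
  | empty => rwa [totalDs_zero]
  | cons l Λ ih =>
    rw [totalDs_cons]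
    exact totalD_mem_functionsOf l ih

/-- Total derivatives raise the jet order by at most one. -/
theorem pd_totalDs_of_card_le {A : φ} {k : ℕ} (Ξ : Multiset (Fin n)) {x : JetAlg U par}
    (hx : ∀ M : Multiset (Fin n), k ≤ Multiset.card M → pd (A, M) x = 0)
    (M : Multiset (Fin n)) (hM : k + Multiset.card Ξ ≤ Multiset.card M) :
    pd (A, M) (totalDs Ξ x) = 0 := by
  induction Ξ using Multiset.induction generalizing M with
  | empty => exact (congrArg _ (totalDs_zero x)).trans (hx M (by simpa using hM))
  | cons l Ξ ih =>
    rw [Multiset.card_cons] at hM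
    rw [totalDs_cons, pd_totalD, ih M (by omega), totalD_zero, zero_add]
    split_ifs with h
    · refine ih _ ?_
      rw [Multiset.card_erase_of_mem h, Nat.pred_eq_sub_one]
      omega
    · rfl

end FunctionsOf

/-! ### The Koszul-Tate operator on chains of low antifield number. -/

section KoszulTate

variable {n : ℕ} {U : Opens (Fin n → ℝ)} {ι : Type*} {par : ι → ZMod 2}

/-- Jets of the gauge fields, or of their antifields. -/
abbrev GaugeJet (ι : Type*) (n : ℕ) := (ι × Fin n) × Multiset (Fin n)

/-- The antifield jet `ā_v`. -/
def bar (v : GaugeJet ι n) : YMAlg U par := gen (Sum.inr (Sum.inl v.1), v.2)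

/-- The total derivatives `d_Λ ℰ` of the variational derivatives. -/
def eom (L : YMAlg U par) (v : GaugeJet ι n) : YMAlg U par :=
  totalDs v.2 (varDeriv (gaugeL v.1.1 v.1.2) L)

theorem isHomog_bar (v : GaugeJet ι n) : IsHomog (par v.1.1 + 1) (bar v : YMAlg U par) :=
  isHomog_gen _

theorem isHomog_eom {L : YMAlg U par} (hL : IsHomog 0 L) (v : GaugeJet ι n) :
    IsHomog (par v.1.1) (eom L v) :=
  ((hL.varDeriv (gaugeL v.1.1 v.1.2)).totalDs v.2).cast (zero_add _)

theorem eom_mem_onShellIdeal (L : YMAlg U par) (v : GaugeJet ι n) : eom L v ∈ onShellIdeal L :=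
  Ideal.subset_span ⟨v.1.1, v.1.2, v.2, rfl⟩

/-- `Ideal` means left ideal here; it is two-sided because the generators are homogeneous and the
algebra is graded commutative. -/
theorem mul_mem_onShellIdeal {L : YMAlg U par} (hL : IsHomog 0 L) {x : YMAlg U par}
    (hx : x ∈ onShellIdeal L) (y : YMAlg U par) : x * y ∈ onShellIdeal L := by
  induction hx using Submodule.span_induction with
  | mem x hx =>
    obtain ⟨r, l, Λ, rfl⟩ := hx
    exact mul_mem_ideal_of_isHomog _ (isHomog_eom hL ((r, l), Λ)) (eom_mem_onShellIdeal L _) y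
  | zero =>
    rw [zero_mul]
    exact Submodule.zero_mem _
  | add a b _ _ h1 h2 =>
    rw [add_mul]
    exact Submodule.add_mem _ h1 h2
  | smul c x _ h1 =>
    rw [smul_eq_mul, mul_assoc]
    exact Ideal.mul_mem_left _ _ h1

theorem isHomog_koszulTateComp {L : YMAlg U par} (hL : IsHomog 0 L) {Δ : ι → YMAlg U par}
    (hΔ : ∀ r, IsHomog (par r + 1) (Δ r)) (A : YMField ι n ⊕ YMField ι n) :
    IsHomog (1 + bvPar (ymFieldPar n par) A) (koszulTateComp L Δ A) := by
  rcases A with z | (p | r)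
  · exact IsHomog.zero
  · refine (hL.varDeriv (gaugeL p.1 p.2)).cast ?_
    change 0 + par p.1 = 1 + (par p.1 + 1)
    rw [zero_add, add_left_comm, parity_one_add_one, add_zero]
  · refine (hΔ r).cast ?_
    change _ = 1 + (par r + 1 + 1)
    rw [add_assoc, parity_one_add_one, add_zero, add_comm]

theorem koszulTate_fieldAlg (L : YMAlg U par) (Δ : ι → YMAlg U par) {f : YMAlg U par}
    (hf : f ∈ (fieldAlg : Submodule ℝ (YMAlg U par))) : koszulTate L Δ f = 0 := by
  refine finsum_eq_zero_of_forall_eq_zero fun v => ?_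
  obtain ⟨z | z, M⟩ := v
  · change _ * totalDs M 0 = 0
    rw [totalDs_eq, map_zero, mul_zero]
  · rw [pdR_eq_twist, mem_functionsOf.1 hf _ (by simp), map_zero, zero_mul]

theorem koszulTate_fieldAlg_mul {L : YMAlg U par} (hL : IsHomog 0 L) {Δ : ι → YMAlg U par}
    (hΔ : ∀ r, IsHomog (par r + 1) (Δ r)) {f : YMAlg U par}
    (hf : f ∈ (fieldAlg : Submodule ℝ (YMAlg U par))) (x : YMAlg U par) :
    koszulTate L Δ (f * x) = f * koszulTate L Δ x := by
  have h0 : contactDerR (koszulTateComp L Δ) f = 0 := koszulTate_fieldAlg L Δ hf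
  rw [koszulTate, contactDerR_mul (isHomog_koszulTateComp hL hΔ), h0, zero_mul, zero_add]

theorem koszulTate_bar {L : YMAlg U par} (hL : IsHomog 0 L) {Δ : ι → YMAlg U par}
    (hΔ : ∀ r, IsHomog (par r + 1) (Δ r)) (v : GaugeJet ι n) :
    koszulTate L Δ (bar v) = eom L v :=
  contactDerR_gen (isHomog_koszulTateComp hL hΔ) _

theorem koszulTate_ghostBar {L : YMAlg U par} (hL : IsHomog 0 L) {Δ : ι → YMAlg U par}
    (hΔ : ∀ r, IsHomog (par r + 1) (Δ r)) (r : ι) (Λ : Multiset (Fin n)) :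
    koszulTate L Δ (gen (ghostBarL n r, Λ)) = totalDs Λ (Δ r) :=
  contactDerR_gen (isHomog_koszulTateComp hL hΔ) _

theorem koszulTate_bar_mul_bar {L : YMAlg U par} (hL : IsHomog 0 L) {Δ : ι → YMAlg U par}
    (hΔ : ∀ r, IsHomog (par r + 1) (Δ r)) (v w : GaugeJet ι n) :
    koszulTate L Δ (bar v * bar w) = eom L v * twist 1 (bar w) + bar v * eom L w := by
  rw [koszulTate, contactDerR_mul (isHomog_koszulTateComp hL hΔ)]
  congr 2
  · exact koszulTate_bar hL hΔ v
  · exact koszulTate_bar hL hΔ w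

/-- The Koszul-Tate operator as a linear map. -/
theorem koszulTate_eq {L : YMAlg U par} (hL : IsHomog 0 L) {Δ : ι → YMAlg U par}
    (hΔ : ∀ r, IsHomog (par r + 1) (Δ r)) (f : YMAlg U par) :
    koszulTate L Δ f = contactDerRL 1 (koszulTateComp L Δ) f :=
  (contactDerRL_apply (isHomog_koszulTateComp hL hΔ) f).symm

/-- Each `ā` has antifield number one, so chains of number `k` in these antifields alone are
products of exactly `k` of them. -/
theorem gaugeBar_list {k : ℕ} {l : List (Jet n (YMField ι n ⊕ YMField ι n))}
    (hl : ∀ v ∈ l, v.1 ∈ (gaugeBars : Set (YMField ι n ⊕ YMField ι n)))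
    (hk : (l.map fun v => antNum v.1).sum = k) :
    ∃ l' : List (GaugeJet ι n), l'.length = k ∧
      l = l'.map fun v => (Sum.inr (Sum.inl v.1), v.2) := by
  induction l generalizing k with
  | nil => exact ⟨[], by simpa using hk, rfl⟩
  | cons v l ih =>
    obtain ⟨l', h1, h2⟩ := ih (fun w hw => hl w (List.mem_cons_of_mem _ hw)) rfl
    obtain ⟨p, hp⟩ := hl v List.mem_cons_self
    refine ⟨(p, v.2) :: l', ?_, ?_⟩
    · rw [List.length_cons, h1, ← hk, List.map_cons, List.sum_cons, ← hp, add_comm]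
      rfl
    · rw [List.map_cons, ← h2]
      congr 1
      exact Prod.ext hp.symm rfl

theorem chains_one_eq : (chains gaugeBars 1 : Submodule ℝ (YMAlg U par))
    = Submodule.span ℝ {Φ | ∃ f ∈ (fieldAlg : Submodule ℝ (YMAlg U par)), ∃ v : GaugeJet ι n,
      Φ = f * bar v} := by
  rw [chains]
  congr 1
  ext Φ
  constructor
  · rintro ⟨f, hf, l, hl, hk, rfl⟩
    obtain ⟨l', h1, rfl⟩ := gaugeBar_list hl hk
    obtain ⟨v, rfl⟩ := List.length_eq_one_iff.1 h1
    exact ⟨f, hf, v, by simp [bar]⟩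
  · rintro ⟨f, hf, v, rfl⟩
    exact ⟨f, hf, [(Sum.inr (Sum.inl v.1), v.2)], by simp [gaugeBars], by simp [antNum],
      by simp [bar]⟩

theorem chains_two_eq : (chains gaugeBars 2 : Submodule ℝ (YMAlg U par))
    = Submodule.span ℝ {Φ | ∃ f ∈ (fieldAlg : Submodule ℝ (YMAlg U par)), ∃ v w : GaugeJet ι n,
      Φ = f * (bar v * bar w)} := by
  rw [chains]
  congr 1
  ext Φ
  constructor
  · rintro ⟨f, hf, l, hl, hk, rfl⟩
    obtain ⟨l', h1, rfl⟩ := gaugeBar_list hl hk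
    obtain ⟨v, w, rfl⟩ := List.length_eq_two.1 h1
    exact ⟨f, hf, v, w, by simp [bar]⟩
  · rintro ⟨f, hf, v, w, rfl⟩
    exact ⟨f, hf, [(Sum.inr (Sum.inl v.1), v.2), (Sum.inr (Sum.inl w.1), w.2)],
      by simp [gaugeBars], by simp [antNum], by simp [bar]⟩

theorem varDeriv_mem_functionsOf {φ : Type*} {p : φ → ZMod 2} {K : Set φ} (A : φ)
    {x : JetAlg U p} (hx : x ∈ functionsOf (U := U) (par := p) K) :
    varDeriv A x ∈ functionsOf (U := U) (par := p) K := by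
  obtain ⟨T, hT⟩ := exists_finset_pd_label x
  rw [varDeriv_eq_sum A fun Λ hΛ => hT Λ hΛ A]
  exact Submodule.sum_mem _ fun Λ _ => Submodule.smul_mem _ _
    (totalDs_mem_functionsOf Λ (pd_mem_functionsOf _ hx))

theorem eom_mem_fieldAlg {L : YMAlg U par} (hL : L ∈ (fieldAlg : Submodule ℝ (YMAlg U par)))
    (v : GaugeJet ι n) : eom L v ∈ (fieldAlg : Submodule ℝ (YMAlg U par)) :=
  totalDs_mem_functionsOf _ (varDeriv_mem_functionsOf _ hL)

/-- The coefficients of a boundary of a chain quadratic in antifields vanish on-shell. -/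
theorem pdR_koszulTate_mem_onShellIdeal {L : YMAlg U par} (hL : IsHomog 0 L)
    (hLf : L ∈ (fieldAlg : Submodule ℝ (YMAlg U par))) {Δ : ι → YMAlg U par}
    (hΔ : ∀ r, IsHomog (par r + 1) (Δ r)) {H : YMAlg U par}
    (hH : H ∈ (chains gaugeBars 2 : Submodule ℝ (YMAlg U par))) (w : GaugeJet ι n) :
    pdR (Sum.inr (Sum.inl w.1), w.2) (koszulTate L Δ H) ∈ onShellIdeal L := by
  classical
  have hbar : ∀ v f, f ∈ (fieldAlg : Submodule ℝ (YMAlg U par)) → ∀ u,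
      pdR (Sum.inr (Sum.inl w.1), w.2) (f * (eom L u * bar v)) ∈ onShellIdeal L := by
    intro v f hf u
    rw [pdR_mul_of_pd_eq_zero _ (mem_functionsOf.1 hf _ (by simp)),
      pdR_mul_of_pd_eq_zero _ (mem_functionsOf.1 (eom_mem_fieldAlg hLf u) _ (by simp))]
    exact Ideal.mul_mem_left _ _ (mul_mem_onShellIdeal hL (eom_mem_onShellIdeal L u) _)
  rw [koszulTate_eq hL hΔ]
  rw [chains_two_eq] at hH
  induction hH using Submodule.span_induction with
  | mem x hx =>
    obtain ⟨f, hf, u, v, rfl⟩ := hx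
    rw [← koszulTate_eq hL hΔ, koszulTate_fieldAlg_mul hL hΔ hf, koszulTate_bar_mul_bar hL hΔ,
      (isHomog_bar v).twist, (isHomog_bar u).mul_comm' (isHomog_eom hL v), mul_smul_comm, mul_add,
      mul_smul_comm, mul_smul_comm, map_add, map_smul, map_smul]
    exact Submodule.add_mem _ (smul_mem_ideal _ _ (hbar v f hf u))
      (smul_mem_ideal _ _ (hbar u f hf v))
  | zero =>
    rw [map_zero, map_zero]
    exact Submodule.zero_mem _
  | add a b _ _ h1 h2 =>
    rw [map_add, map_add]
    exact Submodule.add_mem _ h1 h2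
  | smul c x _ h1 =>
    rw [map_smul, map_smul]
    exact smul_mem_ideal _ _ h1

end KoszulTate

/-! ### Independence and irreducibility of the Noether identities. -/

section YangMillsNoether

variable {n : ℕ} {U : Opens (Fin n → ℝ)} {ι : Type*} [Fintype ι] (𝔤 : LieSuperalgebra ι)

theorem isHomog_noetherOp (j : ι) : IsHomog (𝔤.par j + 1) (noetherOp 𝔤 j : Alg 𝔤 U) := by
  refine (IsHomog.sum fun r _ => IsHomog.sum fun i _ => IsHomog.sum fun l _ => ?_).add
    (IsHomog.sum fun l _ => isHomog_aBar 𝔤 j l _)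
  refine isHomog_c_smul 𝔤 r j i fun hp => ?_
  refine ((isHomog_a 𝔤 i l 0).mul (isHomog_aBar 𝔤 r l 0)).cast ?_
  rw [hp, add_comm (𝔤.par j), add_assoc, ← add_assoc (𝔤.par i), parity_add_self, zero_add]

theorem totalDs_noetherOp (j : ι) (Ξ : Multiset (Fin n)) :
    totalDs Ξ (noetherOp 𝔤 j : Alg 𝔤 U)
      = totalDs Ξ (∑ r, ∑ i, ∑ l, 𝔤.c r j i • (a 𝔤 i l 0 * aBar 𝔤 r l 0) : Alg 𝔤 U)
        + ∑ l, (bar ((j, l), l ::ₘ Ξ) : Alg 𝔤 U) := by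
  rw [noetherOp, totalDs_eq, map_add]
  congr 1
  rw [map_sum]
  refine Finset.sum_congr rfl fun l _ => ?_
  rw [← totalDs_eq, aBar, totalDs_gen, bar]
  rw [add_comm, Multiset.singleton_add]

/-- The highest order coefficients of the derivatives of the Noether operators. -/
theorem pdR_totalDs_noetherOp [DecidableEq ι] (r j : ι) (l : Fin n) {Ξ M : Multiset (Fin n)}
    (hM : Multiset.card Ξ + 1 ≤ Multiset.card M) :
    pdR (gaugeBarL r l, M) (totalDs Ξ (noetherOp 𝔤 j : Alg 𝔤 U))
      = if r = j ∧ M = l ::ₘ Ξ then 1 else 0 := by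
  have h0 : pdR (gaugeBarL r l, M)
      (totalDs Ξ (∑ r, ∑ i, ∑ l, 𝔤.c r j i • (a 𝔤 i l 0 * aBar 𝔤 r l 0) : Alg 𝔤 U)) = 0 := by
    rw [pdR_eq_twist, pd_totalDs_of_card_le (k := 1) Ξ ?_ M (by omega), map_zero]
    intro M hM
    have h1 : ∀ (i : ι) (m : Fin n), pd (gaugeBarL r l, M) (a 𝔤 i m 0 : Alg 𝔤 U) = 0 := fun i m =>
      pd_gen_of_ne (by simp)
    have h2 : ∀ (i : ι) (m : Fin n), pd (gaugeBarL r l, M) (aBar 𝔤 i m 0 : Alg 𝔤 U) = 0 :=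
      fun i m => pd_gen_of_ne fun h => by
        have := congrArg Prod.snd h
        simp only at this
        rw [this] at hM
        simp at hM
    simp only [map_sum, map_smul, pd_mul, h1, h2]
    simp
  have h1 : ∀ m : Fin n, pdR (gaugeBarL r l, M) (bar ((j, m), m ::ₘ Ξ) : Alg 𝔤 U)
      = if l = m then (if r = j ∧ M = l ::ₘ Ξ then 1 else 0) else 0 := by
    intro m
    rw [bar, pdR_gen]
    simp only [Prod.mk.injEq, Sum.inr.injEq, Sum.inl.injEq]
    by_cases h1 : r = j <;> by_cases h2 : l = m <;> simp [h1, h2]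
  rw [totalDs_noetherOp, map_add, h0, zero_add, map_sum]
  simp only [h1]
  simp

variable [DecidableEq ι] {g : MetricTensor U} {h : Matrix ι ι ℝ}

theorem a_mem_fieldAlg (r : ι) (l : Fin n) (Λ : Multiset (Fin n)) :
    (a 𝔤 r l Λ : Alg 𝔤 U) ∈ (fieldAlg : Submodule ℝ (Alg 𝔤 U)) :=
  gen_mem_functionsOf ⟨(r, l), rfl⟩

theorem lagrangian_mem_fieldAlg (hh : 𝔤.IsNondegenerateCasimir h) :
    lagrangian 𝔤 g h ∈ (fieldAlg : Submodule ℝ (Alg 𝔤 U)) := by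
  refine mem_functionsOf.2 fun v hv => pd_lagrangian_of_ne 𝔤 hh v.1 (fun r l e => hv ?_) v.2
  exact ⟨(r, l), e.symm⟩

/-- Noether identities of the Yang-Mills Lagrangian are irreducible. -/
theorem isIrreducibleNoether_lagrangian (l : Fin n) (hh : 𝔤.IsNondegenerateCasimir h) :
    IsIrreducibleNoether (lagrangian 𝔤 g h) (noetherOp 𝔤) := by
  intro G hG H hH h0
  -- The coefficients of every two-cycle vanish on-shell; the alternative of being a boundary is not
  -- needed.
  refine Or.inr ?_
  have hL := isHomog_lagrangian (g := g) hh
  have hLf := lagrangian_mem_fieldAlg (g := g) 𝔤 hh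
  have hΔ := isHomog_noetherOp (U := U) 𝔤
  have h1 : (∑ p ∈ G.support, G p * totalDs p.2 (noetherOp 𝔤 p.1))
      + koszulTate (lagrangian 𝔤 g h) (noetherOp 𝔤) H = 0 := by
    rw [← h0, koszulTate_eq hL hΔ, koszulTate_eq hL hΔ, map_add, Finsupp.sum, map_sum]
    congr 1
    refine Finset.sum_congr rfl fun p _ => ?_
    rw [← koszulTate_eq hL hΔ, koszulTate_fieldAlg_mul hL hΔ (hG p), koszulTate_ghostBar hL hΔ]
  -- A strict bound on the orders in the finite support, from which the induction descends.
  obtain ⟨N, hN⟩ : ∃ N, ∀ p ∈ G.support, Multiset.card p.2 < N :=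
    ⟨G.support.sup (fun p => Multiset.card p.2) + 1, fun p hp =>
      Nat.lt_succ_of_le (Finset.le_sup (f := fun p : ι × Multiset (Fin n) => Multiset.card p.2) hp)⟩
  intro p
  induction hk : N - Multiset.card p.2 using Nat.strong_induction_on generalizing p with
  | _ k ih =>
    subst hk
    by_cases hp : p ∈ G.support
    swap
    · rw [Finsupp.notMem_support_iff.1 hp]
      exact Submodule.zero_mem _
    have hpN := hN p hp
    -- The jet `ā^l` of index `l + p.2` has the top order occurring in the derivative of index `p.2`
    -- of the Noether operator `p.1`, and its coefficient there is one. The index `l` is arbitrary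
    -- but fixed.
    have h2 := congrArg (pdR (Sum.inr (Sum.inl (p.1, l)), l ::ₘ p.2)) h1
    rw [map_add, map_zero, map_sum] at h2
    have h3 := pdR_koszulTate_mem_onShellIdeal hL hLf hΔ hH ((p.1, l), l ::ₘ p.2)
    have h4 : ∑ q ∈ G.support, pdR (Sum.inr (Sum.inl (p.1, l)), l ::ₘ p.2)
        (G q * totalDs q.2 (noetherOp 𝔤 q.1)) ∈ onShellIdeal (lagrangian 𝔤 g h) := by
      rw [eq_neg_of_add_eq_zero_left h2]
      exact Submodule.neg_mem _ h3
    rw [← Finset.add_sum_erase _ _ hp] at h4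
    have h5 : ∀ q, pdR (Sum.inr (Sum.inl (p.1, l)), l ::ₘ p.2)
        (G q * totalDs q.2 (noetherOp 𝔤 q.1))
        = G q * pdR (gaugeBarL p.1 l, l ::ₘ p.2) (totalDs q.2 (noetherOp 𝔤 q.1)) := fun q =>
      pdR_mul_of_pd_eq_zero _ (mem_functionsOf.1 (hG q) _ (by simp)) _
    have h6 := (Submodule.add_mem_iff_left _ (Submodule.sum_mem _ fun q hq => ?_)).1 h4
    · rw [h5, pdR_totalDs_noetherOp 𝔤 _ _ _ (by simp), if_pos ⟨rfl, rfl⟩, mul_one] at h6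
      exact h6
    · rw [h5]
      -- Terms of higher order are on-shell by induction. Terms of equal or lower order contain the
      -- chosen jet only if the indices agree, which excludes all `q ≠ p`.
      by_cases hlt : Multiset.card p.2 < Multiset.card q.2
      · exact mul_mem_onShellIdeal hL (ih _ (by omega) q rfl) _
      · rw [pdR_totalDs_noetherOp 𝔤 _ _ _ (by simpa using hlt), if_neg, mul_zero]
        · exact Submodule.zero_mem _
        · rintro ⟨e1, e2⟩
          exact (Finset.mem_erase.1 hq).1 (Prod.ext e1.symm ((Multiset.cons_inj_right l).1 e2).symm)

/-- Every term of the Yang-Mills equations contains a gauge field jet: the zero section is a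
solution. -/
theorem onShellIdeal_le_jetIdeal (hh : 𝔤.IsNondegenerateCasimir h) :
    onShellIdeal (lagrangian 𝔤 g h) ≤ jetIdeal Set.univ := by
  refine Ideal.span_le.2 ?_
  rintro _ ⟨r, l, Λ, rfl⟩
  have ha : ∀ (i : ι) (m : Fin n) (M : Multiset (Fin n)),
      (a 𝔤 i m M : Alg 𝔤 U) ∈ (jetIdeal Set.univ : Ideal (Alg 𝔤 U)) := fun i m M =>
    gen_mem_jetIdeal trivial
  have hF : ∀ (i : ι) (m k : Fin n),
      (strength 𝔤 i m k : Alg 𝔤 U) ∈ (jetIdeal Set.univ : Ideal (Alg 𝔤 U)) := fun i m k =>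
    Submodule.add_mem _ (Submodule.sub_mem _ (ha _ _ _) (ha _ _ _))
      (Submodule.sum_mem _ fun p _ => Submodule.sum_mem _ fun q _ =>
        smul_mem_ideal _ _ (Ideal.mul_mem_left _ _ (ha _ _ _)))
  have hP : ∀ (i : ι) (m k : Fin n),
      momentum 𝔤 g h i m k ∈ (jetIdeal Set.univ : Ideal (Alg 𝔤 U)) := fun i m k =>
    Submodule.sum_mem _ fun p _ => Submodule.sum_mem _ fun q _ => Submodule.sum_mem _ fun s _ =>
      smul_mem_ideal _ _ (Ideal.mul_mem_left _ _ (hF _ _ _))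
  refine totalDs_mem_jetIdeal Λ ?_
  rw [varDeriv_lagrangian hh]
  exact Submodule.sum_mem _ fun μ _ => Submodule.add_mem _ (totalD_mem_jetIdeal μ (hP _ _ _))
    (Submodule.sum_mem _ fun p _ => Submodule.sum_mem _ fun q _ =>
      smul_mem_ideal _ _ (Ideal.mul_mem_left _ _ (hP _ _ _)))

theorem evalZero_of_mem_onShellIdeal (hh : 𝔤.IsNondegenerateCasimir h) (x : U) {f : Alg 𝔤 U}
    (hf : f ∈ onShellIdeal (lagrangian 𝔤 g h)) : evalZero x f = 0 := by
  have h1 := onShellIdeal_le_jetIdeal 𝔤 hh hf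
  have h2 : (jetIdeal Set.univ : Ideal (Alg 𝔤 U)) ≤ RingHom.ker (evalZero x) := by
    refine Ideal.span_le.2 ?_
    rintro _ ⟨v, _, rfl⟩
    exact evalZero_gen x v
  exact h2 h1

theorem deltaBar_eq_koszulTate (L : Alg 𝔤 U) : deltaBar L = koszulTate L fun _ => 0 := rfl

/-- `f r` is the coefficient of the jet `ā^l_r` of index `{l}`, hence vanishes on-shell; in
particular its value on the zero section, a solution of the equations, is zero. -/
theorem noetherOp_independent (l : Fin n) (hh : 𝔤.IsNondegenerateCasimir h) (f : ι → Alg 𝔤 U)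
    (hf : ∀ r, f r ∈ functionsOf ∅)
    (hΨ : ∃ Ψ ∈ (chains gaugeBars 2 : Submodule ℝ (Alg 𝔤 U)),
      ∑ r, f r * noetherOp 𝔤 r = deltaBar (lagrangian 𝔤 g h) Ψ) (r : ι) : f r = 0 := by
  obtain ⟨Ψ, hΨ, e⟩ := hΨ
  refine eq_zero_of_evalZero (hf r) fun x => evalZero_of_mem_onShellIdeal 𝔤 (g := g) hh x ?_
  have h1 := pdR_koszulTate_mem_onShellIdeal (isHomog_lagrangian (g := g) hh)
    (lagrangian_mem_fieldAlg 𝔤 hh) (Δ := fun _ => 0) (fun _ => IsHomog.zero) hΨ ((r, l), {l})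
  rw [← deltaBar_eq_koszulTate, ← e, map_sum] at h1
  have h2 : ∀ j, pdR (Sum.inr (Sum.inl (r, l)), {l}) (f j * noetherOp 𝔤 j)
      = if r = j then f r else 0 := by
    intro j
    rw [pdR_mul_of_pd_eq_zero _ (mem_functionsOf.1 (hf j) _ (by simp)), pdR_noetherOp]
    by_cases hj : r = j <;> simp [hj]
  simp only [h2] at h1
  simpa using h1

/-- The Noether identities, in terms of the Koszul differential. -/
theorem deltaBar_noetherOp (hh : 𝔤.IsNondegenerateCasimir h) (j : ι) :
    deltaBar (lagrangian 𝔤 g h) (noetherOp 𝔤 j) = 0 := by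
  have hL := isHomog_lagrangian (g := g) hh
  have hΔ : ∀ r, IsHomog (𝔤.par r + 1) ((fun _ => 0 : ι → Alg 𝔤 U) r) := fun _ => IsHomog.zero
  have h1 : ∀ (r : ι) (m : Fin n) (Λ : Multiset (Fin n)),
      koszulTate (lagrangian 𝔤 g h) (fun _ => 0) (aBar 𝔤 r m Λ)
        = totalDs Λ (varDeriv (gaugeL r m) (lagrangian 𝔤 g h)) := fun r m Λ =>
    koszulTate_bar hL hΔ ((r, m), Λ)
  rw [← noether_identity (g := g) hh j, deltaBar_eq_koszulTate, koszulTate_eq hL hΔ, noetherOp]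
  simp only [map_add, map_sum, map_smul]
  simp only [← koszulTate_eq hL hΔ, koszulTate_fieldAlg_mul hL hΔ (a_mem_fieldAlg 𝔤 _ _ _), h1,
    totalDs_zero, totalDs_singleton]

theorem noetherOp_mem_chains (j : ι) :
    (noetherOp 𝔤 j : Alg 𝔤 U) ∈ (chains gaugeBars 1 : Submodule ℝ (Alg 𝔤 U)) := by
  rw [chains_one_eq]
  refine Submodule.add_mem _ (Submodule.sum_mem _ fun r _ => Submodule.sum_mem _ fun i _ =>
    Submodule.sum_mem _ fun m _ => Submodule.smul_mem _ _ (Submodule.subset_span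
      ⟨_, a_mem_fieldAlg 𝔤 i m 0, ((r, m), 0), rfl⟩)) (Submodule.sum_mem _ fun m _ => ?_)
  exact Submodule.subset_span ⟨1, one_mem_functionsOf, ((j, m), {m}), (one_mul _).symm⟩

end YangMillsNoether

end

end SuperYM

namespace SuperYM

noncomputable section

/-! ## Vector fields with coefficients on the base, and straightening of functions -/

section BaseDerivation

variable {n : ℕ} {U : Opens (Fin n → ℝ)} {φ : Type*} {par : φ → ZMod 2}
  (β : Jet n φ → (Fin n → ℝ) → ℝ) (hβ : ∀ v, ContDiffOn ℝ ∞ (β v) U)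

/-- The vertical derivation `∑ β^v(x) ∂/∂y^v`. -/
def baseDer : JetAlg U par →ₗ[ℝ] JetAlg U par :=
  derSum fun v => ofBase (β v) (hβ v)

theorem ofBase_eq_zero {f : (Fin n → ℝ) → ℝ} (hf : ContDiffOn ℝ ∞ f U) (h : f = 0) :
    (ofBase f hf : JetAlg U par) = 0 := by
  subst h
  exact JetAlg.zero_of _

variable {β hβ} {p : ZMod 2} (hp : ∀ v : Jet n φ, par v.1 ≠ p → β v = 0)

include hp

theorem isHomog_baseDer_coeff (v : Jet n φ) :
    IsHomog (p + par v.1) (ofBase (β v) (hβ v) : JetAlg U par) := by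
  by_cases h : par v.1 = p
  · exact (isHomog_ofBase _ _).cast (by rw [h, parity_add_self])
  · rw [ofBase_eq_zero _ (hp v h)]
    exact IsHomog.zero

theorem baseDer_mul (x y : JetAlg U par) :
    baseDer β hβ (x * y) = baseDer β hβ x * y + twist p x * baseDer β hβ y :=
  derSum_mul (isHomog_baseDer_coeff hp) x y

/-- The coefficients depend on `x` only, so such a derivation commutes with all jet derivatives up
to sign; in particular it preserves functions of any given set of fields. -/
theorem pd_baseDer (w : Jet n φ) (x : JetAlg U par) :
    pd w (baseDer β hβ x) = sgn (p * par w.1) • baseDer β hβ (pd w x) := by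
  obtain ⟨S, hS⟩ := exists_finset_pd x
  have hS' : ∀ v ∉ S, pd v (pd w x) = 0 := fun v hv => by
    rw [pd_pd, hS v hv, map_zero, smul_zero]
  rw [baseDer, derSum_eq_sum _ hS, derSum_eq_sum _ hS', map_sum, Finset.smul_sum]
  refine Finset.sum_congr rfl fun v _ => ?_
  by_cases h : par v.1 = p
  · rw [pd_mul, pd_ofBase, zero_mul, zero_add, (isHomog_ofBase _ _).twist, mul_zero, sgn_zero,
      one_smul, pd_pd w v, mul_smul_comm, h, mul_comm]
  · rw [ofBase_eq_zero _ (hp v h), zero_mul, zero_mul, map_zero, smul_zero]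

theorem baseDer_mem_functionsOf {K : Set φ} {x : JetAlg U par}
    (hx : x ∈ functionsOf (U := U) (par := par) K) :
    baseDer β hβ x ∈ functionsOf (U := U) (par := par) K := by
  rw [mem_functionsOf] at *
  intro w hw
  rw [pd_baseDer hp, hx w hw, map_zero, smul_zero]

theorem baseDer_twist (s : ZMod 2) (x : JetAlg U par) :
    baseDer β hβ (twist s x) = sgn (s * p) • twist s (baseDer β hβ x) :=
  derSum_twist (isHomog_baseDer_coeff hp) s x

/-- For an odd derivation the graded commutator with itself is twice its square, and its components
vanish because the derivation kills functions of `x`. -/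
theorem baseDer_baseDer_of_odd (h1 : p = 1) (x : JetAlg U par) :
    baseDer β hβ (baseDer β hβ x) = 0 := by
  subst h1
  have hX := isHomog_baseDer_coeff (hβ := hβ) hp
  have h := derSum_commutator hX hX x
  simp only [derSum_ofBase, mul_one, sgn_one, smul_zero, sub_zero, derSum_zero, neg_smul, one_smul,
    sub_neg_eq_add] at h
  rw [← two_smul ℝ] at h
  exact (smul_eq_zero.1 h).resolve_left two_ne_zero

/-- An even derivation acts on the smooth factor only, which reduces the graded problem to
`baseField`. -/
theorem baseDer_of (h0 : p = 0) {s : Finset (Jet n φ)} (hs : ∀ v ∉ s, β v = 0)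
    [DecidablePred fun v : Jet n φ => par v.1 = 0]
    (f : SmoothFn U (EvenJet n par)) (w : ExteriorAlgebra ℝ (OddJet n par →₀ ℝ)) :
    (baseDer β hβ (JetAlg.of f w) : JetAlg U par)
      = JetAlg.of (baseField (s.subtype fun v => par v.1 = 0) (fun v => β v) (fun v => hβ v) f) w := by
  classical
  subst h0
  obtain ⟨S, hS⟩ := exists_finset_pd (JetAlg.of f w : JetAlg U par)
  have hS' : ∀ v ∉ S ∪ s, pd v (JetAlg.of f w : JetAlg U par) = 0 := fun v hv =>
    hS v fun h => hv (Finset.mem_union_left _ h)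
  rw [baseDer, derSum_eq_sum _ hS']
  have h1 : ∀ v ∈ S ∪ s, v ∉ (s.filter fun v => par v.1 = 0) →
      (ofBase (β v) (hβ v) : JetAlg U par) * pd v (JetAlg.of f w) = 0 := by
    intro v _ hv
    rw [ofBase_eq_zero, zero_mul]
    by_cases hv0 : par v.1 = 0
    · exact hs v fun h => hv (Finset.mem_filter.2 ⟨h, hv0⟩)
    · exact hp v hv0
  rw [← Finset.sum_subset (fun v hv => Finset.mem_union_right _ (Finset.mem_filter.1 hv).1) h1,
    ← Finset.subtype_map, Finset.sum_map, baseField_apply]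
  have h2 : ∀ T : Finset (EvenJet n par), ∀ F : EvenJet n par → SmoothFn U (EvenJet n par),
      (JetAlg.of (∑ v ∈ T, F v) w : JetAlg U par) = ∑ v ∈ T, JetAlg.of (F v) w := fun T F =>
    TensorProduct.sum_tmul T F w
  rw [h2]
  refine Finset.sum_congr rfl fun v _ => ?_
  change (ofBase (β v) (hβ v) : JetAlg U par) * pd v.1 (JetAlg.of f w) = _
  rw [pd_of_even v.2, ofBase, JetAlg.of_mul_of, one_mul]

/-- An even function `E` with `D E = 1`, for an even base derivation `D`, makes `1 + E D`
invertible. -/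
theorem bijective_add_mul_baseDer (h0 : p = 0) {s : Finset (Jet n φ)} (hs : ∀ v ∉ s, β v = 0)
    {E : JetAlg U par} (hE : IsHomog 0 E) (hDE : baseDer β hβ E = 1) :
    Function.Bijective fun x : JetAlg U par => x + E * baseDer β hβ x := by
  classical
  set D := baseDer (U := U) (par := par) β hβ with hD
  set D0 := baseField (U := U) (s.subtype fun v => par v.1 = 0)
    (fun v : EvenJet n par => β v) (fun v => hβ v) with hD0
  have hDof : ∀ f w, D (JetAlg.of f w) = JetAlg.of (D0 f) w := fun f w => baseDer_of hp h0 hs f w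
  have hbody : ∀ x, body (D x) = D0 (body x) := by
    intro x
    induction x using JetAlg.induction with
    | h0 => simp
    | hadd x y hx hy => simp only [map_add, hx, hy]
    | hof f w =>
      rw [hDof, body_of, body_of, Algebra.algebraMap_eq_smul_one, mul_smul_comm, mul_smul_comm,
        mul_one, mul_one, map_smul]
  set e := body E with he
  have he1 : D0 e = 1 := by rw [he, ← hbody, hDE, map_one]
  set G : SmoothFn U (EvenJet n par) →ₗ[ℝ] SmoothFn U (EvenJet n par) :=
    LinearMap.id + LinearMap.mulLeft ℝ e ∘ₗ D0 with hG
  have hGb : Function.Bijective G := bijective_add_mul_baseField _ _ _ he1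
  -- The operator with `E` replaced by its body; it is the bijection already known for smooth
  -- functions, tensored with the Grassmann algebra.
  set T0 : Module.End ℝ (JetAlg U par) :=
    1 + LinearMap.mulLeft ℝ (JetAlg.of e 1) ∘ₗ D with hT0
  have hT0u : IsUnit T0 := by
    rw [Module.End.isUnit_iff]
    let R : JetAlg U par ≃ₗ[ℝ] JetAlg U par :=
      LinearEquiv.rTensor (ExteriorAlgebra ℝ (OddJet n par →₀ ℝ)) (LinearEquiv.ofBijective G hGb)
    have hR : ∀ x, T0 x = R x := by
      intro x
      induction x using JetAlg.induction with
      | h0 => rw [map_zero, map_zero]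
      | hadd x y hx hy => rw [map_add, map_add, hx, hy]
      | hof f w =>
        change JetAlg.of f w + JetAlg.of e 1 * D (JetAlg.of f w) = JetAlg.of (f + e * D0 f) w
        rw [hDof, JetAlg.of_mul_of, one_mul, JetAlg.add_of]
    have hR' : ⇑T0 = R := funext hR
    rw [hR']
    exact R.bijective
  -- Multiplication by the soul of `E`. It is nilpotent, and it commutes with `D` because both `E`
  -- and its body have derivative one.
  set M : Module.End ℝ (JetAlg U par) := LinearMap.mulLeft ℝ (E - JetAlg.of e 1) with hM
  have hMnil : IsNilpotent M := by
    obtain ⟨k, hk⟩ := hE.isNilpotent_soul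
    refine ⟨k, ?_⟩
    rw [hM, LinearMap.pow_mulLeft, hk, LinearMap.mulLeft_zero_eq_zero]
  have hMD : Commute M D := by
    refine LinearMap.ext fun x => ?_
    have h1 : D (E - JetAlg.of e 1) = 0 := by
      rw [map_sub, hDE, hDof, he1]
      exact sub_self _
    change (E - JetAlg.of e 1) * D x = D ((E - JetAlg.of e 1) * x)
    rw [hD, baseDer_mul hp, ← hD, h1, zero_mul, zero_add, h0, twist_zero]
  have hMT : Commute M T0 := by
    refine (Commute.one_right M).add_right (Commute.mul_right ?_ hMD)
    refine LinearMap.ext fun x => ?_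
    change (E - JetAlg.of e 1) * (JetAlg.of e 1 * x) = JetAlg.of e 1 * ((E - JetAlg.of e 1) * x)
    rw [← mul_assoc, ← mul_assoc, (isHomog_of_one e).mul_comm (E - JetAlg.of e 1), twist_zero]
  obtain ⟨u, hu⟩ := hT0u
  have hMu : Commute M (↑u⁻¹ : Module.End ℝ (JetAlg U par)) := by
    rw [← hu] at hMT
    exact hMT.units_inv_right
  have hnil : IsNilpotent (M * (↑u⁻¹ * D)) := (hMu.mul_right hMD).isNilpotent_mul_right hMnil
  -- The soul contributes a perturbation `1 + M u⁻¹ D`, unipotent because `M` commutes with both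
  -- other factors.
  have hT : (1 + LinearMap.mulLeft ℝ E ∘ₗ D : Module.End ℝ (JetAlg U par))
      = u * (1 + M * (↑u⁻¹ * D)) := by
    rw [mul_add, mul_one, hMu.left_comm, Units.mul_inv_cancel_left, hu, hT0]
    refine LinearMap.ext fun x => ?_
    change x + E * D x = x + JetAlg.of e 1 * D x + (E - JetAlg.of e 1) * D x
    rw [sub_mul]
    abel
  have hTu : IsUnit (1 + LinearMap.mulLeft ℝ E ∘ₗ D : Module.End ℝ (JetAlg U par)) := by
    rw [hT]
    exact u.isUnit.mul hnil.isUnit_one_add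
  exact (Module.End.isUnit_iff _).1 hTu

/-- The bijection `1 + E D` restricts to functions of given fields. -/
theorem exists_mem_functionsOf_add_mul_baseDer (h0 : p = 0) {s : Finset (Jet n φ)}
    (hs : ∀ v ∉ s, β v = 0) {E : JetAlg U par} (hE : IsHomog 0 E) (hDE : baseDer β hβ E = 1)
    {K : Set φ} (hEK : E ∈ functionsOf (U := U) (par := par) K) {x : JetAlg U par}
    (hx : x ∈ functionsOf (U := U) (par := par) K) :
    ∃ y ∈ functionsOf (U := U) (par := par) K, y + E * baseDer β hβ y = x := by
  have hb := bijective_add_mul_baseDer hp h0 hs hE hDE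
  obtain ⟨y, hy⟩ := hb.2 x
  refine ⟨y, mem_functionsOf.2 fun w hw => hb.1 ?_, hy⟩
  simp only at hy ⊢
  rw [map_zero, mul_zero, add_zero, ← mem_functionsOf.1 hx w hw, ← hy, map_add, pd_mul,
    mem_functionsOf.1 hEK w hw, zero_mul, zero_add, hE.twist, mul_zero, sgn_zero, one_smul,
    pd_baseDer hp, h0, zero_mul, sgn_zero, one_smul]

end BaseDerivation

/-! ### Koszul boundaries and elimination of separated equations. -/

section Koszul

variable {n : ℕ} {U : Opens (Fin n → ℝ)} {ι : Type*} {par : ι → ZMod 2}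

/-- The boundaries of chains quadratic in antifields. -/
def boundaries (L : YMAlg U par) : Submodule ℝ (YMAlg U par) :=
  (chains gaugeBars 2).map (contactDerRL 1 (koszulTateComp L fun _ => 0))

theorem mem_boundaries {L : YMAlg U par} (hL : IsHomog 0 L) {x : YMAlg U par} :
    x ∈ boundaries L ↔ ∃ Ψ ∈ (chains gaugeBars 2 : Submodule ℝ (YMAlg U par)),
      x = deltaBar L Ψ := by
  have h := koszulTate_eq hL (Δ := fun _ => (0 : YMAlg U par)) fun _ => IsHomog.zero
  constructor
  · rintro ⟨Ψ, hΨ, rfl⟩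
    exact ⟨Ψ, hΨ, (h Ψ).symm⟩
  · rintro ⟨Ψ, hΨ, rfl⟩
    exact ⟨Ψ, hΨ, (h Ψ).symm⟩

theorem bar_mul_bar_mem_boundaries {L : YMAlg U par} (hL : IsHomog 0 L) {f : YMAlg U par}
    (hf : f ∈ (fieldAlg : Submodule ℝ (YMAlg U par))) (v w : GaugeJet ι n) :
    f * (eom L v * twist 1 (bar w) + bar v * eom L w) ∈ boundaries L := by
  refine (mem_boundaries hL).2 ⟨f * (bar v * bar w), ?_, ?_⟩
  · rw [chains_two_eq]
    exact Submodule.subset_span ⟨f, hf, v, w, rfl⟩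
  · have hΔ : ∀ r, IsHomog (par r + 1) ((fun _ => 0 : ι → YMAlg U par) r) := fun _ => IsHomog.zero
    rw [deltaBar, ← koszulTate, koszulTate_fieldAlg_mul hL hΔ hf, koszulTate_bar_mul_bar hL hΔ]

/-- Exchange of an equation of motion against an antifield, up to a boundary. -/
theorem eom_mul_bar_sub_mem_boundaries {L : YMAlg U par} (hL : IsHomog 0 L) {f : YMAlg U par}
    (hf : f ∈ (fieldAlg : Submodule ℝ (YMAlg U par))) (v w : GaugeJet ι n) :
    f * eom L v * bar w - sgn (par v.1.1 * par w.1.1) • (f * eom L w * bar v) ∈ boundaries L := by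
  have h1 := Submodule.smul_mem _ (sgn (par w.1.1 + 1)) (bar_mul_bar_mem_boundaries hL hf v w)
  convert h1 using 1
  rw [(isHomog_bar w).twist, (isHomog_bar v).mul_comm' (isHomog_eom hL w), mul_add, smul_add,
    mul_smul_comm, mul_smul_comm, mul_smul_comm, smul_smul, smul_smul, one_mul, sgn_mul_self,
    one_smul, sub_eq_add_neg, ← neg_smul, mul_assoc, mul_assoc]
  congr 2
  rw [sgn_add, sgn_one, add_mul, one_mul, sgn_add]
  linear_combination (sgn (par v.1.1 * par w.1.1)) * sgn_mul_self (par w.1.1)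

/-- The properties of a derivation that separates the equation of motion `E = d_Λ ℰ` of index `v`:
equations can be divided by `E`, and multiples of `E` in the kernel are trivial. -/
structure IsSeparating (L : YMAlg U par) (v : GaugeJet ι n)
    (D : YMAlg U par →ₗ[ℝ] YMAlg U par) : Prop where
  mul : ∀ x y, D (x * y) = D x * y + twist (par v.1.1) x * D y
  divide : ∀ f ∈ (fieldAlg : Submodule ℝ (YMAlg U par)),
    ∃ f' ∈ (fieldAlg : Submodule ℝ (YMAlg U par)), D (f' * eom L v) = D f
  trivial : ∀ f ∈ (fieldAlg : Submodule ℝ (YMAlg U par)), D (f * eom L v) = 0 →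
    f * eom L v = 0 ∧ f * bar v ∈ boundaries L

/-- For even `E = d_Λ ℰ` one has `D(f E) = (1 + E D) f`, and bijectivity of `1 + E D` yields both
division and triviality. For odd `E` the relations `D² = 0` and `E² = 0` replace analysis. -/
theorem isSeparating_baseDer {L : YMAlg U par} (hL : IsHomog 0 L)
    (hLf : L ∈ (fieldAlg : Submodule ℝ (YMAlg U par))) (v : GaugeJet ι n)
    {β : Jet n (YMField ι n ⊕ YMField ι n) → (Fin n → ℝ) → ℝ}
    {hβ : ∀ v, ContDiffOn ℝ ∞ (β v) U}
    (hp : ∀ u : Jet n (YMField ι n ⊕ YMField ι n),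
      bvPar (ymFieldPar n par) u.1 ≠ par v.1.1 → β u = 0)
    {s : Finset (Jet n (YMField ι n ⊕ YMField ι n))} (hs : ∀ v ∉ s, β v = 0)
    (hE : baseDer β hβ (eom L v) = 1) : IsSeparating L v (baseDer β hβ) := by
  have hhom := isHomog_eom hL v
  have hEf := eom_mem_fieldAlg hLf v
  have hmul := baseDer_mul (hβ := hβ) hp
  have h1 : ∀ f, baseDer β hβ (f * eom L v)
      = baseDer β hβ f * eom L v + twist (par v.1.1) f := fun f => by rw [hmul, hE, mul_one]
  refine ⟨hmul, ?_, ?_⟩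
  · intro f hf
    rcases parity_cases (par v.1.1) with h0 | h0
    · obtain ⟨y, hy, e⟩ := exists_mem_functionsOf_add_mul_baseDer hp h0 hs (h0 ▸ hhom) hE hEf
        (baseDer_mem_functionsOf hp hf)
      refine ⟨y, hy, ?_⟩
      rw [h1, ← e, h0, twist_zero, hhom.mul_comm, h0, twist_zero, add_comm]
    -- The quotient is `D f` up to sign: as `D² = 0`, only the term in which `D` hits `E` survives.
    · refine ⟨twist 1 (baseDer β hβ f), twist_mem_functionsOf _ (baseDer_mem_functionsOf hp hf), ?_⟩
      rw [h1, baseDer_twist hp, baseDer_baseDer_of_odd hp h0, map_zero, smul_zero, zero_mul,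
        zero_add, h0, twist_twist, parity_one_add_one, twist_zero]
  · intro f hf h2
    rw [h1] at h2
    rcases parity_cases (par v.1.1) with h0 | h0
    · have hb := bijective_add_mul_baseDer hp h0 hs (h0 ▸ hhom) hE
      have hf0 : f = 0 := hb.1 (by
        simp only [map_zero, mul_zero, add_zero]
        rw [← h2, hhom.mul_comm, h0, twist_zero, twist_zero, add_comm])
      rw [hf0, zero_mul, zero_mul]
      exact ⟨rfl, Submodule.zero_mem _⟩
    -- Vanishing of `D(f E)` forces `f = χ E`. Then `f E = χ E² = 0`, and `f ā` is half of the
    -- boundary of `χ ā ā`; this product need not vanish, since `ā` is even.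
    · set χ := twist 1 (baseDer β hβ f) with hχ
      have hχf : χ ∈ (fieldAlg : Submodule ℝ (YMAlg U par)) :=
        twist_mem_functionsOf _ (baseDer_mem_functionsOf hp hf)
      have hfχ : f = χ * eom L v := by
        have h3 := congrArg (twist 1) (eq_neg_of_add_eq_zero_right h2)
        rw [h0, twist_twist, parity_one_add_one, twist_zero, map_neg, map_mul, hhom.twist, h0,
          mul_one, sgn_one, neg_smul, one_smul, mul_neg, neg_neg] at h3
        exact h3
      have hEE : eom L v * eom L v = 0 := by
        have h3 := hhom.mul_comm' hhom
        rw [h0, mul_one, sgn_one, neg_smul, one_smul] at h3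
        have h4 : (2 : ℝ) • (eom L v * eom L v) = 0 := by
          rw [two_smul]
          nth_rewrite 1 [h3]
          exact neg_add_cancel _
        exact (smul_eq_zero.1 h4).resolve_left two_ne_zero
      refine ⟨by rw [hfχ, mul_assoc, hEE, mul_zero], ?_⟩
      have h3 := eom_mul_bar_sub_mem_boundaries hL hχf v v
      rw [h0, mul_one, sgn_one, neg_smul, one_smul, sub_neg_eq_add, ← two_smul ℝ, ← hfχ] at h3
      have h4 := Submodule.smul_mem _ (2 : ℝ)⁻¹ h3
      rwa [smul_smul, inv_mul_cancel₀ two_ne_zero, one_smul] at h4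

/-- Cycles linear in the antifields with separated equations of motion are boundaries. -/
theorem sum_mul_bar_mem_boundaries {L : YMAlg U par} (hL : IsHomog 0 L)
    (hLf : L ∈ (fieldAlg : Submodule ℝ (YMAlg U par))) (I : Set (GaugeJet ι n))
    (hD : ∀ v ∈ I, ∃ D, IsSeparating L v D ∧
      ∀ w ∈ I, Multiset.card w.2 ≤ Multiset.card v.2 → w ≠ v → D (eom L w) = 0)
    (S : Finset (GaugeJet ι n)) (hS : ∀ v ∈ S, v ∈ I) (f : GaugeJet ι n → YMAlg U par)
    (hf : ∀ v, f v ∈ (fieldAlg : Submodule ℝ (YMAlg U par)))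
    (h0 : ∑ v ∈ S, f v * eom L v = 0) : ∑ v ∈ S, f v * bar v ∈ boundaries L := by
  classical
  -- The equation of highest order is eliminated first, because its derivation kills only equations
  -- of no higher order.
  induction S using Finset.induction_on_max_value (fun v : GaugeJet ι n => Multiset.card v.2)
    generalizing f with
  | empty =>
    rw [Finset.sum_empty]
    exact Submodule.zero_mem _
  | insert v S hv hmax ih =>
    obtain ⟨D, hDv, hDw⟩ := hD v (hS v (Finset.mem_insert_self v S))
    choose ψ hψ hψD using fun w => hDv.divide (f w) (hf w)
    -- Subtracting multiples of the equation `v` makes all other coefficients constants of `D`.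
    set f' : GaugeJet ι n → YMAlg U par := fun w => f w - ψ w * eom L v with hf'
    have hf'f : ∀ w, f' w ∈ (fieldAlg : Submodule ℝ (YMAlg U par)) := fun w =>
      Submodule.sub_mem _ (hf w) (mul_mem_functionsOf (hψ w) (eom_mem_fieldAlg hLf v))
    have hDf' : ∀ w, D (f' w) = 0 := fun w => by rw [hf', map_sub, hψD, sub_self]
    -- The subtracted multiples are transferred to the coefficient of `v`, with the signs of
    -- exchanging two equations, so that the relation is preserved.
    set fv := f v + ∑ w ∈ S, sgn (par v.1.1 * par w.1.1) • (ψ w * eom L w) with hfv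
    have hfvf : fv ∈ (fieldAlg : Submodule ℝ (YMAlg U par)) :=
      Submodule.add_mem _ (hf v) (Submodule.sum_mem _ fun w _ => Submodule.smul_mem _ _
        (mul_mem_functionsOf (hψ w) (eom_mem_fieldAlg hLf w)))
    rw [Finset.sum_insert hv] at h0 ⊢
    have h1 : fv * eom L v + ∑ w ∈ S, f' w * eom L w = 0 := by
      rw [← h0, hfv, add_mul, Finset.sum_mul, add_assoc, ← Finset.sum_add_distrib]
      congr 1
      refine Finset.sum_congr rfl fun w _ => ?_
      rw [hf', sub_mul, smul_mul_assoc, mul_assoc, mul_assoc,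
        (isHomog_eom hL w).mul_comm' (isHomog_eom hL v), mul_smul_comm, smul_smul,
        mul_comm (par w.1.1), sgn_mul_self, one_smul]
      abel
    -- When `D` is applied to the relation, all other terms vanish: their coefficients and their
    -- equations are both killed by `D`.
    have h2 : D (fv * eom L v) = 0 := by
      have h3 := congrArg D h1
      rw [map_add, map_zero, map_sum] at h3
      rw [Finset.sum_eq_zero, add_zero] at h3
      · exact h3
      · intro w hw
        rw [hDv.mul, hDf', zero_mul, zero_add, hDw w (hS w (Finset.mem_insert_of_mem hw))
          (hmax w hw) (fun e => hv (e ▸ hw)), mul_zero]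
    obtain ⟨h4, h5⟩ := hDv.trivial fv hfvf h2
    rw [h4, zero_add] at h1
    have h6 := ih (fun w hw => hS w (Finset.mem_insert_of_mem hw)) f' hf'f h1
    -- The same transfer on antifields is not an identity, but it holds up to Koszul boundaries.
    have h7 : ∑ w ∈ S, (ψ w * eom L v * bar w
        - sgn (par v.1.1 * par w.1.1) • (ψ w * eom L w * bar v)) ∈ boundaries L :=
      Submodule.sum_mem _ fun w _ => eom_mul_bar_sub_mem_boundaries hL (hψ w) v w
    convert Submodule.add_mem _ (Submodule.add_mem _ h5 h6) h7 using 1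
    rw [hfv, add_mul, Finset.sum_mul, add_assoc, add_assoc, ← Finset.sum_add_distrib,
      ← Finset.sum_add_distrib]
    congr 1
    refine Finset.sum_congr rfl fun w _ => ?_
    rw [hf', sub_mul, smul_mul_assoc]
    abel

end Koszul

end

end SuperYM

namespace SuperYM

noncomputable section

/-! ## The symbol of the Yang-Mills equations -/

section PolynomialSymbol

open MvPolynomial

variable {n : ℕ}

/-- The quadratic symbol of the Yang-Mills equations. -/
def symbolCoeff (G : Matrix (Fin n) (Fin n) ℝ) (l m b k : Fin n) : ℝ :=
  G l m * G b k - G l k * G b m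

/-- The symbol of the derivative `d_Λ` of the component `l` of the Yang-Mills equations. -/
def symbolEntry (G : Matrix (Fin n) (Fin n) ℝ) (l : Fin n) (Λ : Multiset (Fin n)) (k : Fin n)
    (M : Multiset (Fin n)) : ℝ :=
  ∑ b, ∑ m, if M = Λ + {b, m} then symbolCoeff G l m b k else 0

/-- The polynomial with given coefficients of degree `N`. -/
def symPoly {N : ℕ} (q : Sym (Fin n) N → ℝ) : MvPolynomial (Fin n) ℝ :=
  ∑ Λ : Sym (Fin n) N, monomial (Multiset.toFinsupp (Λ : Multiset (Fin n))) (q Λ)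

theorem coeff_symPoly {N : ℕ} (q : Sym (Fin n) N → ℝ) (Λ : Sym (Fin n) N) :
    coeff (Multiset.toFinsupp (Λ : Multiset (Fin n))) (symPoly q) = q Λ := by
  rw [symPoly, coeff_sum, Finset.sum_eq_single Λ]
  · rw [coeff_monomial, if_pos rfl]
  · intro M _ hM
    rw [coeff_monomial, if_neg]
    exact fun h => hM (Subtype.ext (Multiset.toFinsupp.injective h))
  · simp

theorem eq_zero_of_symPoly_eq_zero {N : ℕ} {q : Sym (Fin n) N → ℝ} (h : symPoly q = 0)
    (Λ : Sym (Fin n) N) : q Λ = 0 := by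
  rw [← coeff_symPoly q Λ, h, coeff_zero]

theorem coeff_symPoly_of_forall {N : ℕ} {q : Sym (Fin n) N → ℝ} {l : Fin n}
    (hq : ∀ Λ : Sym (Fin n) N, l ∈ (Λ : Multiset (Fin n)) → q Λ = 0) {m : Fin n →₀ ℕ}
    (hm : m l ≠ 0) : coeff m (symPoly q) = 0 := by
  rw [symPoly, coeff_sum]
  refine Finset.sum_eq_zero fun Λ _ => ?_
  rw [coeff_monomial]
  split_ifs with h
  · refine hq Λ ?_
    rw [← h, Multiset.toFinsupp_apply] at hm
    exact Multiset.count_ne_zero.1 hm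
  · rfl

/-- The quadratic form of a matrix, as a polynomial. -/
def quadPoly (G : Matrix (Fin n) (Fin n) ℝ) : MvPolynomial (Fin n) ℝ :=
  ∑ b, ∑ m, C (G b m) * (X b * X m)

/-- The linear forms of the rows of a matrix. -/
def linPoly (G : Matrix (Fin n) (Fin n) ℝ) (l : Fin n) : MvPolynomial (Fin n) ℝ :=
  ∑ m, C (G l m) * X m

/-- By polarization a vanishing quadratic form has zero symmetric matrix, contradicting
invertibility once there is at least one index. -/
theorem quadPoly_ne_zero {G : Matrix (Fin n) (Fin n) ℝ} (hG : G.IsSymm) (hu : IsUnit G.det)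
    (l0 : Fin n) : quadPoly G ≠ 0 := by
  intro h
  have hev : ∀ v : Fin n → ℝ, ∑ b, ∑ m, G b m * (v b * v m) = 0 := by
    intro v
    have := congrArg (eval v) h
    simpa [quadPoly] using this
  have hpol : ∀ v w : Fin n → ℝ, ∑ b, ∑ m, G b m * (v b * w m) = 0 := by
    intro v w
    have h1 := hev (v + w)
    have h2 : ∑ b, ∑ m, G b m * (w b * v m) = ∑ b, ∑ m, G b m * (v b * w m) := by
      rw [Finset.sum_comm]
      refine Finset.sum_congr rfl fun b _ => Finset.sum_congr rfl fun m _ => ?_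
      rw [hG.apply]
      ring
    simp only [Pi.add_apply, mul_add, add_mul, Finset.sum_add_distrib] at h1
    rw [hev v, hev w, h2] at h1
    linarith
  have hG0 : G = 0 := by
    ext i j
    have := hpol (Pi.single i 1) (Pi.single j 1)
    rw [Finset.sum_eq_single i (by intro b _ hb; simp [hb]) (by simp),
      Finset.sum_eq_single j (by intro b _ hb; simp [hb]) (by simp)] at this
    simpa using this
  have : Nonempty (Fin n) := ⟨l0⟩
  rw [hG0, Matrix.det_zero] at hu
  exact not_isUnit_zero hu

/-- The symbols of independent derivatives of the Yang-Mills equations are linearly independent. -/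
theorem eq_zero_of_sum_symbolEntry {G : Matrix (Fin n) (Fin n) ℝ} (hG : G.IsSymm)
    (hu : IsUnit G.det) {l0 l1 : Fin n} (h01 : l1 ≠ l0) {N : ℕ}
    (q : Fin n → Sym (Fin n) N → ℝ) (hq : ∀ Λ : Sym (Fin n) N, l0 ∈ (Λ : Multiset (Fin n)) →
      q l0 Λ = 0)
    (h : ∀ (k : Fin n) (M : Sym (Fin n) (N + 2)),
      ∑ l, ∑ Λ : Sym (Fin n) N, q l Λ * symbolEntry G l Λ k M = 0) (l : Fin n)
    (Λ : Sym (Fin n) N) : q l Λ = 0 := by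
  set Q : Fin n → MvPolynomial (Fin n) ℝ := fun l => symPoly (q l) with hQ
  -- The coefficientwise relations say that the polynomial combination of symbols vanishes:
  -- multi-index addition is multiplication of monomials.
  have h1 : ∀ k, ∑ l, Q l * ∑ b, ∑ m, C (symbolCoeff G l m b k) * (X b * X m) = 0 := by
    intro k
    have e1 : ∀ l, Q l * ∑ b, ∑ m, C (symbolCoeff G l m b k) * (X b * X m)
        = ∑ Λ : Sym (Fin n) N, ∑ b, ∑ m, monomial
          (Multiset.toFinsupp ((Λ : Multiset (Fin n)) + {b, m}))
          (q l Λ * symbolCoeff G l m b k) := by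
      intro l
      simp only [hQ, symPoly]
      rw [Finset.sum_mul]
      refine Finset.sum_congr rfl fun Λ _ => ?_
      rw [Finset.mul_sum]
      refine Finset.sum_congr rfl fun b _ => ?_
      rw [Finset.mul_sum]
      refine Finset.sum_congr rfl fun m _ => ?_
      have e2 : (X b * X m : MvPolynomial (Fin n) ℝ)
          = monomial (Multiset.toFinsupp ({b, m} : Multiset (Fin n))) 1 := by
        rw [X, X, monomial_mul, one_mul, Multiset.insert_eq_cons, ← Multiset.singleton_add, map_add,
          Multiset.toFinsupp_singleton, Multiset.toFinsupp_singleton]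
      rw [e2, C_mul_monomial, mul_one, monomial_mul, map_add]
    have e3 : ∀ (Λ : Sym (Fin n) N) (b m : Fin n) (z : ℝ),
        monomial (Multiset.toFinsupp ((Λ : Multiset (Fin n)) + {b, m})) z
          = ∑ M : Sym (Fin n) (N + 2), monomial (Multiset.toFinsupp (M : Multiset (Fin n)))
            (if (M : Multiset (Fin n)) = Λ + {b, m} then z else 0) := by
      intro Λ b m z
      obtain ⟨M0, hM0⟩ : ∃ M0 : Sym (Fin n) (N + 2), (M0 : Multiset (Fin n)) = Λ + {b, m} :=
        ⟨⟨(Λ : Multiset (Fin n)) + {b, m}, (Multiset.card_add _ _).trans (congrArg (· + 2) Λ.2)⟩,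
          rfl⟩
      rw [← hM0, Finset.sum_eq_single M0]
      · rw [if_pos rfl]
      · intro M _ hM
        rw [if_neg fun e => hM (Sym.coe_injective e), map_zero]
      · exact fun h => absurd (Finset.mem_univ _) h
    simp only [e1]
    simp only [e3]
    have e4 : ∑ l, ∑ Λ : Sym (Fin n) N, ∑ b, ∑ m, ∑ M : Sym (Fin n) (N + 2),
        monomial (Multiset.toFinsupp (M : Multiset (Fin n)))
          (if (M : Multiset (Fin n)) = Λ + {b, m} then q l Λ * symbolCoeff G l m b k else 0)
        = ∑ M : Sym (Fin n) (N + 2), monomial (Multiset.toFinsupp (M : Multiset (Fin n)))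
          (∑ l, ∑ Λ : Sym (Fin n) N, q l Λ * symbolEntry G l Λ k M) := by
      rw [← sum_rotate_five]
      refine Finset.sum_congr rfl fun M _ => ?_
      simp only [symbolEntry, Finset.mul_sum, map_sum, mul_ite, mul_zero]
    rw [e4]
    simp only [h, map_zero, Finset.sum_const_zero]
  -- With `p^l` the linear forms of the rows of `G`, the symbol is the transverse one `p^l p^k -
  -- G^{lk} p²`.
  have h2 : ∀ l k, ∑ b, ∑ m, C (symbolCoeff G l m b k) * (X b * X m)
      = linPoly G l * linPoly G k - C (G l k) * quadPoly G := by
    intro l k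
    rw [linPoly, linPoly, quadPoly, Finset.sum_mul_sum, Finset.mul_sum,
      Finset.sum_comm (s := Finset.univ) (t := Finset.univ)
        (f := fun i j => C (G l i) * X i * (C (G k j) * X j)), ← Finset.sum_sub_distrib]
    refine Finset.sum_congr rfl fun b _ => ?_
    rw [Finset.mul_sum, ← Finset.sum_sub_distrib]
    refine Finset.sum_congr rfl fun m _ => ?_
    rw [symbolCoeff, map_sub, map_mul, map_mul, hG.apply k b]
    ring
  set W := ∑ l, Q l * linPoly G l with hW
  have h3 : ∀ k, W * linPoly G k = quadPoly G * ∑ l, C (G l k) * Q l := by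
    intro k
    have := h1 k
    simp only [h2, mul_sub, Finset.sum_sub_distrib, sub_eq_zero] at this
    rw [hW, Finset.sum_mul, Finset.mul_sum]
    refine Eq.trans ?_ (this.trans ?_)
    · exact Finset.sum_congr rfl fun l _ => by ring
    · exact Finset.sum_congr rfl fun l _ => by ring
  have hGi : G * G⁻¹ = 1 := Matrix.mul_nonsing_inv G hu
  -- Lowering the index `k` with `G⁻¹` gives `W p_s = p² Q_s`, so `Q` is parallel to `p`.
  have h4 : ∀ s, W * X s = quadPoly G * Q s := by
    intro s
    have e1 : ∑ k, C (G⁻¹ k s) * linPoly G k = X s := by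
      simp only [linPoly, Finset.mul_sum]
      rw [Finset.sum_comm]
      have : ∀ m, ∑ k, C (G⁻¹ k s) * (C (G k m) * X m) = C ((G * G⁻¹) m s) * X m := by
        intro m
        rw [Matrix.mul_apply, map_sum, Finset.sum_mul]
        refine Finset.sum_congr rfl fun k _ => ?_
        rw [hG.apply m k, map_mul]
        ring
      simp only [this, hGi, Matrix.one_apply]
      rw [Finset.sum_eq_single s]
      · simp
      · intro m _ hm
        simp [hm]
      · simp
    have e2 : ∑ k, C (G⁻¹ k s) * ∑ l, C (G l k) * Q l = Q s := by
      simp only [Finset.mul_sum]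
      rw [Finset.sum_comm]
      have : ∀ m, ∑ k, C (G⁻¹ k s) * (C (G m k) * Q m) = C ((G * G⁻¹) m s) * Q m := by
        intro m
        rw [Matrix.mul_apply, map_sum, Finset.sum_mul]
        refine Finset.sum_congr rfl fun k _ => ?_
        rw [map_mul]
        ring
      simp only [this, hGi, Matrix.one_apply]
      rw [Finset.sum_eq_single s]
      · simp
      · intro m _ hm
        simp [hm]
      · simp
    rw [← e1, ← e2, Finset.mul_sum, Finset.mul_sum]
    refine Finset.sum_congr rfl fun k _ => ?_
    rw [mul_left_comm, h3]
    ring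
  have h5 : ∀ s t, X s * Q t = X t * Q s := by
    intro s t
    refine mul_left_cancel₀ (quadPoly_ne_zero hG hu l0) ?_
    linear_combination X t * h4 s - X s * h4 t
  -- By hypothesis `Q l0` has no monomial containing `X l0`, while `X l1 * Q l0 = X l0 * Q l1` is
  -- divisible by `X l0`. The second index `l1` is indispensable here.
  have h6 : Q l0 = 0 := by
    ext m
    rw [coeff_zero]
    by_cases hm : m l0 = 0
    · have h7 := congrArg (coeff (m + Finsupp.single l1 1)) (h5 l1 l0)
      rw [add_comm m, coeff_X_mul, coeff_X_mul', if_neg] at h7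
      · exact h7
      · rw [Finsupp.mem_support_iff, not_not, Finsupp.add_apply, hm, add_zero,
          Finsupp.single_eq_of_ne h01.symm]
    · exact coeff_symPoly_of_forall hq hm
  have h7 : Q l = 0 := by
    have := h5 l0 l
    rw [h6, mul_zero] at this
    exact (mul_eq_zero.1 this).resolve_left (X_ne_zero l0)
  exact eq_zero_of_symPoly_eq_zero h7 Λ

end PolynomialSymbol

/-! ### Smooth right inverses of matrices with independent rows. -/

section RightInverse

variable {n : ℕ} {U : Opens (Fin n → ℝ)} {R K : Type*} [Fintype R] [DecidableEq R] [Fintype K]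

theorem contDiffOn_matrix_det {s : Set (Fin n → ℝ)} {A : (Fin n → ℝ) → Matrix R R ℝ}
    (hA : ∀ l m, ContDiffOn ℝ ∞ (fun x => A x l m) s) :
    ContDiffOn ℝ ∞ (fun x => (A x).det) s := by
  simp only [Matrix.det_apply]
  exact ContDiffOn.sum fun σ _ => ContDiffOn.const_smul _ (contDiffOn_prod fun i _ => hA _ _)

/-- A smooth family of matrices with independent rows has a smooth right inverse. -/
theorem exists_smooth_right_inverse {A : (Fin n → ℝ) → Matrix R K ℝ}
    (hA : ∀ r k, ContDiffOn ℝ ∞ (fun x => A x r k) U)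
    (hind : ∀ x ∈ U, ∀ q : R → ℝ, Matrix.vecMul q (A x) = 0 → q = 0) :
    ∃ B : (Fin n → ℝ) → Matrix K R ℝ, (∀ k r, ContDiffOn ℝ ∞ (fun x => B x k r) U) ∧
      ∀ x ∈ U, A x * B x = 1 := by
  -- The Gram matrix of the rows is invertible, and `Aᵀ (A Aᵀ)⁻¹` is a right inverse depending
  -- smoothly on the point.
  set S : (Fin n → ℝ) → Matrix R R ℝ := fun x => A x * (A x).transpose with hS
  have hSs : ∀ l m, ContDiffOn ℝ ∞ (fun x => S x l m) U := fun l m => by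
    simp only [hS, Matrix.mul_apply, Matrix.transpose_apply]
    exact ContDiffOn.sum fun k _ => (hA l k).mul (hA m k)
  have hSu : ∀ x ∈ U, (S x).det ≠ 0 := by
    intro x hx h0
    obtain ⟨v, hv, hv0⟩ := Matrix.exists_vecMul_eq_zero_iff.2 h0
    refine hv (hind x hx v ?_)
    have h1 : dotProduct (Matrix.vecMul v (A x)) (Matrix.vecMul v (A x)) = 0 := by
      have h2 := congrArg (fun z => dotProduct z v) hv0
      simp only [hS, zero_dotProduct, ← Matrix.vecMul_vecMul] at h2
      rwa [Matrix.vecMul_transpose, dotProduct_comm, Matrix.dotProduct_mulVec] at h2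
    exact dotProduct_self_eq_zero.1 h1
  have hinv : ∀ l m, ContDiffOn ℝ ∞ (fun x => (S x)⁻¹ l m) U := by
    intro l m
    have hadj : ContDiffOn ℝ ∞ (fun x => (S x).adjugate l m) U := by
      simp only [Matrix.adjugate_apply]
      refine contDiffOn_matrix_det fun i j => ?_
      by_cases hi : i = m
      · subst hi
        simpa using contDiffOn_const
      · simpa [Matrix.updateRow_ne hi] using hSs i j
    refine (((contDiffOn_matrix_det hSs).inv hSu).mul hadj).congr fun x _ => ?_
    simp [Matrix.inv_def]
  refine ⟨fun x => (A x).transpose * (S x)⁻¹, fun k r => ?_, fun x hx => ?_⟩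
  · simp only [Matrix.mul_apply, Matrix.transpose_apply]
    exact ContDiffOn.sum fun j _ => (hA j k).mul (hinv j r)
  · rw [← Matrix.mul_assoc]
    exact Matrix.mul_nonsing_inv _ (hSu x hx).isUnit

end RightInverse

end

end SuperYM

namespace SuperYM

noncomputable section

/-! ## Separation of the independent Yang-Mills equations -/

section TopOrder

variable {n : ℕ} {U : Opens (Fin n → ℝ)} {φ : Type*} {par : φ → ZMod 2}

/-- The highest order coefficients of total derivatives. -/
theorem pd_totalDs_of_card_eq {A : φ} {k : ℕ} {τ : Type*} [Fintype τ] (T : τ → Multiset (Fin n))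
    (z : τ → JetAlg U par) {f : JetAlg U par}
    (h1 : ∀ M, Multiset.card M = k → pd (A, M) f = ∑ t, if M = T t then z t else 0)
    (h2 : ∀ M, k + 1 ≤ Multiset.card M → pd (A, M) f = 0) (Λ M : Multiset (Fin n))
    (hM : Multiset.card M = k + Multiset.card Λ) :
    pd (A, M) (totalDs Λ f) = ∑ t, if M = Λ + T t then z t else 0 := by
  induction Λ using Multiset.induction generalizing M with
  | empty =>
    rw [totalDs_zero, h1 M (by simpa using hM)]
    simp only [zero_add]
  | cons l Λ ih =>
    rw [Multiset.card_cons] at hM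
    rw [totalDs_cons, pd_totalD, pd_totalDs_of_card_le Λ h2 M (by omega), totalD_zero, zero_add]
    split_ifs with h
    · obtain ⟨M, rfl⟩ := Multiset.exists_cons_of_mem h
      rw [Multiset.card_cons] at hM
      rw [Multiset.erase_cons_head, ih M (by omega)]
      simp only [Multiset.cons_add, Multiset.cons_inj_right]
    · refine (Finset.sum_eq_zero fun t _ => if_neg fun e => h ?_).symm
      rw [e]
      exact Multiset.mem_add.2 (Or.inl (Multiset.mem_cons_self l Λ))

theorem ofBase_mul {f f' : (Fin n → ℝ) → ℝ} (hf : ContDiffOn ℝ ∞ f U)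
    (hf' : ContDiffOn ℝ ∞ f' U) :
    (ofBase f hf * ofBase f' hf' : JetAlg U par) = ofBase (fun x => f x * f' x) (hf.mul hf') := by
  rw [ofBase, ofBase, JetAlg.of_mul_of, one_mul]
  rfl

theorem ofBase_smul (r : ℝ) {f : (Fin n → ℝ) → ℝ} (hf : ContDiffOn ℝ ∞ f U) :
    (r • ofBase f hf : JetAlg U par) = ofBase (fun x => r * f x) (contDiffOn_const.mul hf) :=
  TensorProduct.smul_tmul' r (baseFn f hf) 1

theorem ofBase_sum {κ : Type*} (S : Finset κ) {f : κ → (Fin n → ℝ) → ℝ}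
    (hf : ∀ k, ContDiffOn ℝ ∞ (f k) U) {F : (Fin n → ℝ) → ℝ} (hF : ContDiffOn ℝ ∞ F U)
    (h : ∀ x ∈ U, F x = ∑ k ∈ S, f k x) :
    (ofBase F hF : JetAlg U par) = ∑ k ∈ S, ofBase (f k) (hf k) := by
  have h2 : (JetAlg.of (∑ k ∈ S, baseFn (f k) (hf k)) 1 : JetAlg U par)
      = ∑ k ∈ S, ofBase (f k) (hf k) := TensorProduct.sum_tmul S _ _
  rw [← h2, ofBase]
  congr 1
  refine SmoothFn.ext fun x y => ?_
  rw [AddSubmonoidClass.coe_finsetSum, Finset.sum_apply]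
  exact h x x.2

theorem baseDer_extend {κ : Type*} [Fintype κ] {e : κ → Jet n φ} (he : Function.Injective e)
    {b : κ → (Fin n → ℝ) → ℝ} (hb : ∀ k, ContDiffOn ℝ ∞ (b k) U)
    (hβ : ∀ v, ContDiffOn ℝ ∞ (Function.extend e b 0 v) U) (x : JetAlg U par) :
    baseDer (Function.extend e b 0) hβ x = ∑ k, ofBase (b k) (hb k) * pd (e k) x := by
  classical
  obtain ⟨S, hS⟩ := exists_finset_pd x
  rw [baseDer, derSum_eq_sum _ (S := S ∪ Finset.univ.image e) fun v hv =>
      hS v fun h => hv (Finset.mem_union_left _ h),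
    ← Finset.sum_subset (Finset.subset_union_right (s₁ := S) (s₂ := Finset.univ.image e)),
    Finset.sum_image he.injOn]
  · refine Finset.sum_congr rfl fun k _ => ?_
    congr 1
    exact ofBase_congr _ _ fun x _ => by rw [he.extend_apply]
  · intro v _ hv
    rw [ofBase_eq_zero, zero_mul]
    exact Function.extend_apply' _ _ _ fun ⟨k, hk⟩ =>
      hv (Finset.mem_image.2 ⟨k, Finset.mem_univ k, hk⟩)

end TopOrder

/-! ### Leading symbols and the separating derivations. -/

section Separation

variable {n : ℕ} {U : Opens (Fin n → ℝ)} {ι : Type*} [Fintype ι] {𝔤 : LieSuperalgebra ι}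
  {g : MetricTensor U}

/-- The symbol of the Yang-Mills equations, with the density factor. -/
def MetricTensor.symbol (g : MetricTensor U) (l : Fin n) (Λ : Multiset (Fin n)) (k : Fin n)
    (M : Multiset (Fin n)) (x : Fin n → ℝ) : ℝ :=
  √|(g.g x).det| * symbolEntry (g.g x)⁻¹ l Λ k M

theorem MetricTensor.symbol_eq (g : MetricTensor U) (l : Fin n) (Λ : Multiset (Fin n)) (k : Fin n)
    (M : Multiset (Fin n)) (x : Fin n → ℝ) :
    g.symbol l Λ k M x = ∑ t : Fin n × Fin n, if M = Λ + {t.1, t.2} then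
      g.coeff l t.2 t.1 k x - g.coeff l k t.1 t.2 x else 0 := by
  rw [MetricTensor.symbol, symbolEntry, Fintype.sum_prod_type, Finset.mul_sum]
  refine Finset.sum_congr rfl fun b _ => ?_
  rw [Finset.mul_sum]
  refine Finset.sum_congr rfl fun m _ => ?_
  rw [mul_ite, mul_zero]
  congr 1
  rw [symbolCoeff, MetricTensor.coeff, MetricTensor.coeff]
  ring

theorem MetricTensor.symbol_smooth (g : MetricTensor U) (l : Fin n) (Λ : Multiset (Fin n))
    (k : Fin n) (M : Multiset (Fin n)) : ContDiffOn ℝ ∞ (g.symbol l Λ k M) U := by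
  have h0 : g.symbol l Λ k M = fun x => ∑ t : Fin n × Fin n, if M = Λ + {t.1, t.2} then
      g.coeff l t.2 t.1 k x - g.coeff l k t.1 t.2 x else 0 := funext (g.symbol_eq l Λ k M)
  rw [h0]
  refine ContDiffOn.sum fun t _ => ?_
  split_ifs
  · exact (g.coeff_smooth _ _ _ _).sub (g.coeff_smooth _ _ _ _)
  · exact contDiffOn_const

variable (𝔤) in
theorem ofBase_symbol (l : Fin n) (Λ : Multiset (Fin n)) (k : Fin n) (M : Multiset (Fin n)) :
    (ofBase (g.symbol l Λ k M) (g.symbol_smooth l Λ k M) : Alg 𝔤 U)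
      = ∑ t : Fin n × Fin n, if M = Λ + {t.1, t.2} then
          coeffFn 𝔤 g l t.2 t.1 k - coeffFn 𝔤 g l k t.1 t.2 else 0 := by
  have hs : ∀ t : Fin n × Fin n, ContDiffOn ℝ ∞ (fun x => if M = Λ + {t.1, t.2} then
      g.coeff l t.2 t.1 k x - g.coeff l k t.1 t.2 x else 0) U := by
    intro t
    split_ifs
    · exact (g.coeff_smooth _ _ _ _).sub (g.coeff_smooth _ _ _ _)
    · exact contDiffOn_const
  rw [ofBase_sum Finset.univ hs _ fun x _ => g.symbol_eq l Λ k M x]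
  refine Finset.sum_congr rfl fun t _ => ?_
  by_cases ht : M = Λ + {t.1, t.2}
  · simp only [if_pos ht]
    rw [sub_eq_add_neg, ← neg_one_smul ℝ, coeffFn, coeffFn, ofBase_smul, ofBase, ofBase, ofBase,
      ← JetAlg.add_of]
    congr 1
    refine SmoothFn.ext fun x y => ?_
    change g.coeff l t.2 t.1 k x - g.coeff l k t.1 t.2 x
      = g.coeff l t.2 t.1 k x + -1 * g.coeff l k t.1 t.2 x
    ring
  · simp only [if_neg ht]
    exact ofBase_eq_zero _ rfl

variable [DecidableEq ι] {h : Matrix ι ι ℝ}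

theorem pd_momentum_singleton (r i : ι) (l b β ν : Fin n) :
    pd (gaugeL i β, {ν}) (momentum 𝔤 g h r l b)
      = h⁻¹ r i • (coeffFn 𝔤 g l ν b β - coeffFn 𝔤 g l β b ν) := by
  simp only [momentum, map_sum, map_smul, pd_coeffFn_mul, pd_strength_singleton, mul_sub, smul_sub,
    Finset.sum_sub_distrib]
  congr 1
  · rw [Finset.sum_eq_single i, Finset.sum_eq_single ν, Finset.sum_eq_single β]
    · simp
    · intro k _ hk
      simp [hk.symm]
    · simp
    · intro m _ hm
      simp [hm.symm]
    · simp
    · intro j _ hj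
      simp [hj.symm]
    · simp
  · rw [Finset.sum_eq_single i, Finset.sum_eq_single β, Finset.sum_eq_single ν]
    · simp
    · intro k _ hk
      simp [hk.symm]
    · simp
    · intro m _ hm
      simp [hm.symm]
    · simp
    · intro j _ hj
      simp [hj.symm]
    · simp

theorem pd_momentum_of_two_le (A : YMField ι n ⊕ YMField ι n) {M : Multiset (Fin n)}
    (hM : 2 ≤ Multiset.card M) (r : ι) (l b : Fin n) :
    pd (A, M) (momentum 𝔤 g h r l b) = 0 := by
  simp only [momentum, map_sum, map_smul, pd_coeffFn_mul, pd_strength_of_two_le 𝔤 A hM]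
  simp

theorem pd_a_mul_momentum_of_two_le (A : YMField ι n ⊕ YMField ι n) {M : Multiset (Fin n)}
    (hM : 2 ≤ Multiset.card M) (i r : ι) (m l b : Fin n) :
    pd (A, M) (a 𝔤 i m 0 * momentum 𝔤 g h r l b) = 0 := by
  have h0 : pd (A, M) (a 𝔤 i m 0 : Alg 𝔤 U) = 0 := pd_gen_of_ne fun e => by
    have := congrArg (fun p => Multiset.card p.2) e
    simp only [Multiset.card_zero] at this
    omega
  rw [pd_mul, h0, zero_mul, pd_momentum_of_two_le A hM, mul_zero, zero_add]

theorem pd_varDeriv_lagrangian (hh : 𝔤.IsNondegenerateCasimir h) (r i : ι) (l β : Fin n)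
    {M : Multiset (Fin n)} (hM : Multiset.card M = 2) :
    pd (gaugeL i β, M) (varDeriv (gaugeL r l) (lagrangian 𝔤 g h))
      = ∑ t : Fin n × Fin n, if M = {t.1, t.2} then
          h⁻¹ r i • (coeffFn 𝔤 g l t.2 t.1 β - coeffFn 𝔤 g l β t.1 t.2) else 0 := by
  rw [varDeriv_lagrangian hh, Fintype.sum_prod_type]
  simp only [map_add, map_sum, map_smul, pd_a_mul_momentum_of_two_le (gaugeL i β) hM.ge, smul_zero,
    Finset.sum_const_zero, add_zero]
  refine Finset.sum_congr rfl fun μ _ => ?_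
  have h1 : ∀ M, Multiset.card M = 1 → pd (gaugeL i β, M) (momentum 𝔤 g h r l μ)
      = ∑ ν, if M = {ν} then
          h⁻¹ r i • (coeffFn 𝔤 g l ν μ β - coeffFn 𝔤 g l β μ ν) else 0 := by
    intro M hM
    obtain ⟨κ, rfl⟩ := Multiset.card_eq_one.1 hM
    rw [pd_momentum_singleton]
    simp
  have h2 := pd_totalDs_of_card_eq (fun ν : Fin n => {ν}) _ h1
    (fun M hM => pd_momentum_of_two_le _ hM r l μ) {μ} M (by simpa using hM)
  rw [totalDs_singleton] at h2
  exact h2.trans (Finset.sum_congr rfl fun ν _ => by rw [Multiset.singleton_add]; rfl)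

theorem pd_varDeriv_lagrangian_of_three_le (hh : 𝔤.IsNondegenerateCasimir h) (r i : ι)
    (l β : Fin n) (M : Multiset (Fin n)) (hM : 3 ≤ Multiset.card M) :
    pd (gaugeL i β, M) (varDeriv (gaugeL r l) (lagrangian 𝔤 g h)) = 0 := by
  rw [varDeriv_lagrangian hh]
  simp only [map_add, map_sum, map_smul,
    pd_a_mul_momentum_of_two_le (gaugeL i β) (le_trans (by omega) hM), smul_zero,
    Finset.sum_const_zero, add_zero]
  refine Finset.sum_eq_zero fun μ _ => ?_
  rw [← totalDs_singleton]
  exact pd_totalDs_of_card_le {μ} (fun M hM => pd_momentum_of_two_le _ hM r l μ) M (by simpa using hM)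

/-- The highest order coefficients of the derivatives of the Yang-Mills equations. -/
theorem pd_eom_lagrangian (hh : 𝔤.IsNondegenerateCasimir h) (w : GaugeJet ι n) (i : ι) (β : Fin n)
    {M : Multiset (Fin n)} (hM : Multiset.card M = 2 + Multiset.card w.2) :
    pd (gaugeL i β, M) (eom (lagrangian 𝔤 g h) w)
      = h⁻¹ w.1.1 i • ofBase (g.symbol w.1.2 w.2 β M) (g.symbol_smooth w.1.2 w.2 β M) := by
  rw [eom, pd_totalDs_of_card_eq (fun t : Fin n × Fin n => {t.1, t.2}) _
    (fun M hM => pd_varDeriv_lagrangian hh w.1.1 i w.1.2 β hM)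
    (fun M hM => pd_varDeriv_lagrangian_of_three_le hh w.1.1 i w.1.2 β M hM) w.2 M hM,
    ofBase_symbol, Finset.smul_sum]
  refine Finset.sum_congr rfl fun t _ => ?_
  rw [smul_ite, smul_zero]

theorem pd_eom_lagrangian_of_lt (hh : 𝔤.IsNondegenerateCasimir h) (w : GaugeJet ι n) (i : ι)
    (β : Fin n) {M : Multiset (Fin n)} (hM : 2 + Multiset.card w.2 < Multiset.card M) :
    pd (gaugeL i β, M) (eom (lagrangian 𝔤 g h) w) = 0 :=
  pd_totalDs_of_card_le (k := 3) w.2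
    (fun M hM => pd_varDeriv_lagrangian_of_three_le hh w.1.1 i w.1.2 β M hM) M (by omega)

/-- The indices of independent derivatives of the Yang-Mills equations. -/
def IsIndependentIndex (l0 l : Fin n) (Λ : Multiset (Fin n)) : Prop := ¬(l = l0 ∧ l0 ∈ Λ)

instance (l0 l : Fin n) (Λ : Multiset (Fin n)) : Decidable (IsIndependentIndex l0 l Λ) :=
  inferInstanceAs (Decidable (¬_))

/-- The rows of the symbol matrix with independent indices are linearly independent at every point,
so a smooth right inverse exists. It is extended by zero to the dependent indices. -/
theorem exists_symbol_inverse (g : MetricTensor U) {l0 l1 : Fin n} (h01 : l1 ≠ l0) (N : ℕ) :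
    ∃ B : (Fin n × Sym (Fin n) (N + 2)) → (Fin n × Sym (Fin n) N) → (Fin n → ℝ) → ℝ,
      (∀ c v, ContDiffOn ℝ ∞ (B c v) U) ∧ ∀ v w : Fin n × Sym (Fin n) N,
        IsIndependentIndex l0 v.1 v.2 → IsIndependentIndex l0 w.1 w.2 → ∀ x ∈ U,
          ∑ c, B c v x * g.symbol w.1 w.2 c.1 c.2 x = if w = v then 1 else 0 := by
  classical
  set R := {w : Fin n × Sym (Fin n) N // IsIndependentIndex l0 w.1 w.2} with hR
  obtain ⟨B, hB, hAB⟩ := exists_smooth_right_inverse (U := U)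
    (A := fun x => Matrix.of fun (w : R) (c : Fin n × Sym (Fin n) (N + 2)) =>
      g.symbol w.1.1 w.1.2 c.1 c.2 x)
    (fun r k => g.symbol_smooth _ _ _ _) (by
      intro x hx q hq
      have hs : ((g.g x)⁻¹).IsSymm := by
        unfold Matrix.IsSymm
        rw [Matrix.transpose_nonsing_inv, (g.symm x hx).eq]
      have hd := (g.nondegenerate x hx).ne_zero
      have hsq : √|(g.g x).det| ≠ 0 := (Real.sqrt_pos.2 (abs_pos.2 hd)).ne'
      have hu : IsUnit ((g.g x)⁻¹).det := by
        rw [Matrix.isUnit_nonsing_inv_det_iff]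
        exact g.nondegenerate x hx
      -- Extending `q` by zero to dependent indices is precisely the vanishing required of the
      -- component `l0`.
      have h1 := eq_zero_of_sum_symbolEntry hs hu h01
        (fun l Λ => Function.extend (Subtype.val : R → _) q 0 (l, Λ)) (by
          intro Λ hΛ
          exact Function.extend_apply' _ _ _ fun ⟨w, hw⟩ => w.2 (by rw [hw]; exact ⟨rfl, hΛ⟩))
        (by
          intro k M
          have h2 := congrFun hq (k, M)
          rw [Matrix.vecMul, dotProduct] at h2
          refine mul_left_cancel₀ hsq ?_
          rw [mul_zero, ← Fintype.sum_prod_type (f := fun p : Fin n × Sym (Fin n) N =>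
            Function.extend (Subtype.val : R → _) q 0 (p.1, p.2) *
              symbolEntry (g.g x)⁻¹ p.1 p.2 k M), Finset.mul_sum]
          refine Eq.trans (Fintype.sum_of_injective (Subtype.val : R → _) Subtype.val_injective
            _ _ ?_ ?_).symm h2
          · intro p hp
            rw [Function.extend_apply' _ _ _ hp]
            simp
          · intro w
            rw [Prod.mk.eta, Subtype.val_injective.extend_apply]
            simp only [Matrix.of_apply, MetricTensor.symbol]
            ring)
      funext w
      have := h1 w.1.1 w.1.2
      rwa [Prod.mk.eta, Subtype.val_injective.extend_apply] at this)
  refine ⟨fun c v x => if hv : IsIndependentIndex l0 v.1 v.2 then B x c ⟨v, hv⟩ else 0, ?_, ?_⟩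
  · intro c v
    by_cases hv : IsIndependentIndex l0 v.1 v.2
    · simp only [dif_pos hv]
      exact hB c ⟨v, hv⟩
    · simp only [dif_neg hv]
      exact contDiffOn_const
  · intro v w hv hw x hx
    have h1 := congrFun (congrFun (hAB x hx) ⟨w, hw⟩) ⟨v, hv⟩
    rw [Matrix.mul_apply, Matrix.one_apply] at h1
    simp only [Subtype.mk.injEq] at h1
    rw [← h1]
    refine Finset.sum_congr rfl fun c _ => ?_
    simp only [dif_pos hv]
    exact mul_comm _ _

/-- The independent derivatives of the Yang-Mills equations are separated by derivations. -/
theorem exists_isSeparating (hh : 𝔤.IsNondegenerateCasimir h) {l0 l1 : Fin n} (h01 : l1 ≠ l0)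
    (v : GaugeJet ι n) (hv : IsIndependentIndex l0 v.1.2 v.2) :
    ∃ D, IsSeparating (lagrangian 𝔤 g h) v D ∧ ∀ w : GaugeJet ι n,
      IsIndependentIndex l0 w.1.2 w.2 → Multiset.card w.2 ≤ Multiset.card v.2 → w ≠ v →
        D (eom (lagrangian 𝔤 g h) w) = 0 := by
  classical
  obtain ⟨B, hB, hBA⟩ := exists_symbol_inverse g h01 (Multiset.card v.2)
  set v' : Fin n × Sym (Fin n) (Multiset.card v.2) := (v.1.2, ⟨v.2, rfl⟩) with hv'
  set e : ι × (Fin n × Sym (Fin n) (Multiset.card v.2 + 2)) →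
    Jet n (YMField ι n ⊕ YMField ι n) := fun p => (gaugeL p.1 p.2.1, p.2.2) with he
  have hei : Function.Injective e := by
    rintro ⟨i, k, M⟩ ⟨i', k', M'⟩ hpq
    simp only [he, Prod.mk.injEq, Sum.inl.injEq, Sym.coe_inj] at hpq
    obtain ⟨⟨rfl, rfl⟩, rfl⟩ := hpq
    rfl
  -- The leading symbol of the full system is the product of the Lie algebra matrix `h⁻¹` and the
  -- metric symbol, so the coefficients combine `h` with the right inverse of the latter.
  set b : ι × (Fin n × Sym (Fin n) (Multiset.card v.2 + 2)) → (Fin n → ℝ) → ℝ :=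
    fun p x => h p.1 v.1.1 * B p.2 v' x with hb
  have hbs : ∀ p, ContDiffOn ℝ ∞ (b p) U := fun p => contDiffOn_const.mul (hB p.2 v')
  have hβ : ∀ u, ContDiffOn ℝ ∞ (Function.extend e b 0 u) U := by
    intro u
    by_cases hu : ∃ p, e p = u
    · obtain ⟨p, rfl⟩ := hu
      rw [hei.extend_apply]
      exact hbs p
    · rw [Function.extend_apply' _ _ _ hu]
      exact contDiffOn_const
  have hcalc : ∀ w : GaugeJet ι n, IsIndependentIndex l0 w.1.2 w.2 →
      Multiset.card w.2 = Multiset.card v.2 →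
      baseDer (Function.extend e b 0) hβ (eom (lagrangian 𝔤 g h) w) = if w = v then 1 else 0 := by
    intro w hw hwv
    obtain ⟨⟨r, l⟩, Λ⟩ := w
    simp only at hw hwv
    rw [baseDer_extend hei hbs, Fintype.sum_prod_type]
    have h1 : ∀ i : ι, ∑ c : Fin n × Sym (Fin n) (Multiset.card v.2 + 2),
        (ofBase (b (i, c)) (hbs (i, c)) : Alg 𝔤 U) *
          pd (e (i, c)) (eom (lagrangian 𝔤 g h) ((r, l), Λ))
        = (h⁻¹ r i * h i v.1.1) • if (l, Λ) = (v.1.2, v.2) then 1 else 0 := by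
      intro i
      have h2 : ∀ c : Fin n × Sym (Fin n) (Multiset.card v.2 + 2),
          (ofBase (b (i, c)) (hbs (i, c)) : Alg 𝔤 U) *
            pd (e (i, c)) (eom (lagrangian 𝔤 g h) ((r, l), Λ))
          = (h⁻¹ r i * h i v.1.1) • ofBase (fun x => B c v' x * g.symbol l Λ c.1 c.2 x)
            ((hB c v').mul (g.symbol_smooth l Λ c.1 c.2)) := by
        intro c
        have hc : Multiset.card (c.2 : Multiset (Fin n)) = Multiset.card v.2 + 2 := c.2.2
        simp only [he]
        rw [pd_eom_lagrangian hh ((r, l), Λ) i c.1 (by rw [hc, hwv, add_comm]), mul_smul_comm,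
          ofBase_mul, ofBase_smul, ofBase_smul]
        refine ofBase_congr _ _ fun x _ => ?_
        simp only [hb]
        ring
      rw [Finset.sum_congr rfl fun c _ => h2 c, ← Finset.smul_sum]
      congr 1
      set Λ' : Sym (Fin n) (Multiset.card v.2) := ⟨Λ, hwv⟩ with hΛ'
      have hs : ContDiffOn ℝ ∞ (fun _ => if (l, Λ) = (v.1.2, v.2) then (1 : ℝ) else 0)
          (U : Set (Fin n → ℝ)) :=
        contDiffOn_const
      rw [← ofBase_sum Finset.univ _ hs]
      · split_ifs with hlv
        · rfl
        · exact ofBase_eq_zero _ rfl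
      · intro x hx
        refine Eq.trans ?_ (hBA v' (l, Λ') hv hw x hx).symm
        refine if_congr ⟨fun e => ?_, fun e => ?_⟩ rfl rfl
        · have e1 : l = v.1.2 := congrArg Prod.fst e
          have e2 : Λ = v.2 := congrArg Prod.snd e
          exact Prod.ext e1 (Subtype.ext e2)
        · have e1 : l = v.1.2 := congrArg Prod.fst e
          have e2 : Λ' = ⟨v.2, rfl⟩ := congrArg Prod.snd e
          exact Prod.ext e1 (congrArg Subtype.val e2)
    rw [Finset.sum_congr rfl fun i _ => h1 i, ← Finset.sum_smul, ← Matrix.mul_apply, hh.inv_mul,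
      Matrix.one_apply]
    by_cases hr : r = v.1.1 <;> by_cases hl : (l, Λ) = (v.1.2, v.2)
    · rw [if_pos hr, if_pos hl, if_pos, one_smul]
      simp only [Prod.mk.injEq] at hl
      exact Prod.ext (Prod.ext hr hl.1) hl.2
    · rw [if_neg hl, smul_zero, if_neg]
      rintro rfl
      exact hl rfl
    · rw [if_neg hr, zero_smul, if_neg]
      rintro rfl
      exact hr rfl
    · rw [if_neg hr, zero_smul, if_neg]
      rintro rfl
      exact hr rfl
  refine ⟨baseDer (Function.extend e b 0) hβ, ?_, ?_⟩
  · refine isSeparating_baseDer (isHomog_lagrangian hh) (lagrangian_mem_fieldAlg 𝔤 hh) v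
      (s := Finset.univ.image e) ?_ ?_ ?_
    · intro u hu
      by_cases hu' : ∃ p, e p = u
      · obtain ⟨p, rfl⟩ := hu'
        rw [hei.extend_apply]
        -- Evenness of `h` makes the derivation homogeneous, of the parity of the equation it
        -- separates.
        have h0 : h p.1 v.1.1 = 0 := by
          by_contra h0
          exact hu (hh.even _ _ h0)
        funext x
        simp only [hb, h0, zero_mul]
        rfl
      · exact Function.extend_apply' _ _ _ hu'
    · intro u hu
      exact Function.extend_apply' _ _ _ fun ⟨p, hp⟩ =>
        hu (Finset.mem_image.2 ⟨p, Finset.mem_univ p, hp⟩)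
    · rw [hcalc v hv rfl, if_pos rfl]
  · intro w hw hwv hne
    rcases hwv.lt_or_eq with hlt | heq
    -- Equations of lower order do not contain the jets along which `D` differentiates, those of
    -- order two more than `v`.
    · rw [baseDer_extend hei hbs]
      refine Finset.sum_eq_zero fun p _ => ?_
      have hc : Multiset.card (p.2.2 : Multiset (Fin n)) = Multiset.card v.2 + 2 := p.2.2.2
      rw [pd_eom_lagrangian_of_lt hh w p.1 p.2.1 (by rw [hc]; omega), mul_zero]
    · rw [hcalc w hw heq, if_neg hne]

end Separation

end

end SuperYM

namespace SuperYM

noncomputable section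

/-! ## Completeness of the Noether identities -/

section FieldSpan

variable {n : ℕ} {U : Opens (Fin n → ℝ)} {ι : Type*} {par : ι → ZMod 2} {κ : Type*}

/-- Combinations of the elements `y k`, `k ∈ s`, with coefficients in the field algebra. -/
def fieldSpan (s : Set κ) (y : κ → YMAlg U par) : Submodule ℝ (YMAlg U par) :=
  Submodule.span ℝ {x | ∃ f ∈ (fieldAlg : Submodule ℝ (YMAlg U par)), ∃ k ∈ s, x = f * y k}

variable {s : Set κ} {y : κ → YMAlg U par}

theorem mul_mem_fieldSpan {f : YMAlg U par} (hf : f ∈ (fieldAlg : Submodule ℝ (YMAlg U par)))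
    {k : κ} (hk : k ∈ s) : f * y k ∈ fieldSpan s y :=
  Submodule.subset_span ⟨f, hf, k, hk, rfl⟩

theorem mem_fieldSpan {k : κ} (hk : k ∈ s) : y k ∈ fieldSpan s y := by
  have := mul_mem_fieldSpan (y := y) one_mem_functionsOf hk
  rwa [one_mul] at this

theorem fieldAlg_mul_mem_fieldSpan {f x : YMAlg U par}
    (hf : f ∈ (fieldAlg : Submodule ℝ (YMAlg U par))) (hx : x ∈ fieldSpan s y) :
    f * x ∈ fieldSpan s y := by
  induction hx using Submodule.span_induction with
  | mem x hx =>
    obtain ⟨f', hf', k, hk, rfl⟩ := hx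
    rw [← mul_assoc]
    exact mul_mem_fieldSpan (mul_mem_functionsOf hf hf') hk
  | zero =>
    rw [mul_zero]
    exact Submodule.zero_mem _
  | add a b _ _ h1 h2 =>
    rw [mul_add]
    exact Submodule.add_mem _ h1 h2
  | smul c x _ h1 =>
    rw [mul_smul_comm]
    exact Submodule.smul_mem _ _ h1

theorem exists_finsupp_of_mem_fieldSpan {x : YMAlg U par} (hx : x ∈ fieldSpan s y) :
    ∃ G : κ →₀ YMAlg U par, (∀ k, G k ∈ (fieldAlg : Submodule ℝ (YMAlg U par))) ∧
      (∀ k ∈ G.support, k ∈ s) ∧ x = G.sum fun k f => f * y k := by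
  classical
  have h0 : ∀ k, (0 : YMAlg U par) * y k = 0 := fun k => zero_mul _
  have ha : ∀ k (a b : YMAlg U par), (a + b) * y k = a * y k + b * y k := fun k a b => add_mul _ _ _
  induction hx using Submodule.span_induction with
  | mem x hx =>
    obtain ⟨f, hf, k, hk, rfl⟩ := hx
    refine ⟨Finsupp.single k f, fun k' => ?_, fun k' hk' => ?_, ?_⟩
    · rw [Finsupp.single_apply]
      split_ifs
      · exact hf
      · exact Submodule.zero_mem _
    · have := Finsupp.support_single_subset hk'
      rw [Finset.mem_singleton] at this
      rwa [this]
    · rw [Finsupp.sum_single_index (zero_mul _)]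
  | zero => exact ⟨0, fun _ => Submodule.zero_mem _, by simp, by simp⟩
  | add a b _ _ h1 h2 =>
    obtain ⟨G, hG, hGs, rfl⟩ := h1
    obtain ⟨G', hG', hGs', rfl⟩ := h2
    refine ⟨G + G', fun k => Submodule.add_mem _ (hG k) (hG' k), fun k hk => ?_, ?_⟩
    · rcases Finset.mem_union.1 (Finsupp.support_add hk) with h | h
      · exact hGs k h
      · exact hGs' k h
    · rw [Finsupp.sum_add_index' h0 ha]
  | smul c x _ h1 =>
    obtain ⟨G, hG, hGs, rfl⟩ := h1
    refine ⟨c • G, fun k => Submodule.smul_mem _ _ (hG k),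
      fun k hk => hGs k (Finsupp.support_smul hk), ?_⟩
    rw [Finsupp.sum_smul_index' h0, Finsupp.smul_sum]
    simp only [smul_mul_assoc]

theorem chains_one_eq_fieldSpan :
    (chains gaugeBars 1 : Submodule ℝ (YMAlg U par)) = fieldSpan Set.univ bar := by
  rw [chains_one_eq, fieldSpan]
  simp only [Set.mem_univ, true_and]

theorem totalD_mem_fieldSpan_bar {k : ℕ} (l : Fin n) {x : YMAlg U par}
    (hx : x ∈ fieldSpan {v : GaugeJet ι n | Multiset.card v.2 ≤ k} bar) :
    totalD l x ∈ fieldSpan {v : GaugeJet ι n | Multiset.card v.2 ≤ k + 1} bar := by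
  induction hx using Submodule.span_induction with
  | mem x hx =>
    obtain ⟨f, hf, v, hv, rfl⟩ := hx
    rw [totalD_mul]
    refine Submodule.add_mem _ (mul_mem_fieldSpan (totalD_mem_functionsOf l hf) (Nat.le_succ_of_le hv))
      ?_
    have h1 : totalD l (bar v : YMAlg U par) = bar (v.1, l ::ₘ v.2) := totalD_gen l _
    rw [h1]
    refine mul_mem_fieldSpan hf ?_
    rw [Set.mem_ofPred_eq, Multiset.card_cons]
    exact Nat.succ_le_succ hv
  | zero =>
    rw [totalD_zero]
    exact Submodule.zero_mem _
  | add a b _ _ h1 h2 =>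
    rw [totalD_add]
    exact Submodule.add_mem _ h1 h2
  | smul c x _ h1 =>
    rw [totalD_smul]
    exact Submodule.smul_mem _ _ h1

theorem totalDs_mem_fieldSpan_bar (Ξ : Multiset (Fin n)) {x : YMAlg U par}
    (hx : x ∈ fieldSpan {v : GaugeJet ι n | Multiset.card v.2 ≤ 0} bar) :
    totalDs Ξ x ∈ fieldSpan {v : GaugeJet ι n | Multiset.card v.2 ≤ Multiset.card Ξ} bar := by
  induction Ξ using Multiset.induction with
  | empty => rwa [totalDs_zero]
  | cons l Ξ ih =>
    rw [totalDs_cons, Multiset.card_cons]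
    exact totalD_mem_fieldSpan_bar l ih

end FieldSpan

/-! ### Reduction of one-cycles and the completeness statement. -/

section Completeness

variable {n : ℕ} {U : Opens (Fin n → ℝ)} {ι : Type*} [Fintype ι] (𝔤 : LieSuperalgebra ι)

/-- One-chains reduce to combinations of derivatives of the Noether operators and of independent
jets of antifields. -/
theorem bar_mem_sup_fieldSpan (l0 : Fin n) (v : GaugeJet ι n) :
    (bar v : Alg 𝔤 U) ∈ fieldSpan Set.univ (fun p : ι × Multiset (Fin n) =>
        (totalDs p.2 (noetherOp 𝔤 p.1) : Alg 𝔤 U))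
      ⊔ fieldSpan {v : GaugeJet ι n | IsIndependentIndex l0 v.1.2 v.2} bar := by
  induction hk : Multiset.card v.2 using Nat.strong_induction_on generalizing v with
  | _ k ih =>
    set I := fieldSpan {v : GaugeJet ι n | IsIndependentIndex l0 v.1.2 v.2}
      (bar : _ → Alg 𝔤 U) with hI
    by_cases hv : IsIndependentIndex l0 v.1.2 v.2
    · exact Submodule.mem_sup_right (mem_fieldSpan hv)
    · obtain ⟨⟨r, l⟩, M⟩ := v
      obtain ⟨rfl, hM⟩ := not_not.1 hv
      simp only at hM hk
      obtain ⟨Ξ, rfl⟩ := Multiset.exists_cons_of_mem hM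
      rw [Multiset.card_cons] at hk
      -- The derivative `Ξ` of the Noether operator is solved for its divergence term with index
      -- `l`, which here is `l0`. The other divergence terms have a component different from `l0`
      -- and are independent.
      have h1 : (bar ((r, l), l ::ₘ Ξ) : Alg 𝔤 U) = totalDs Ξ (noetherOp 𝔤 r)
          - totalDs Ξ (∑ s, ∑ i, ∑ m, 𝔤.c s r i • (a 𝔤 i m 0 * aBar 𝔤 s m 0) : Alg 𝔤 U)
          - ∑ m ∈ Finset.univ.erase l, (bar ((r, m), m ::ₘ Ξ) : Alg 𝔤 U) := by
        rw [totalDs_noetherOp, add_sub_cancel_left,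
          ← Finset.add_sum_erase _ _ (Finset.mem_univ l), add_sub_cancel_right]
      rw [h1]
      refine Submodule.sub_mem _ (Submodule.sub_mem _
        (Submodule.mem_sup_left (mem_fieldSpan (k := (r, Ξ))
          (y := fun p : ι × Multiset (Fin n) => (totalDs p.2 (noetherOp 𝔤 p.1) : Alg 𝔤 U))
          (Set.mem_univ _))) ?_)
        (Submodule.mem_sup_right (Submodule.sum_mem _ fun m hm => mem_fieldSpan ?_))
      · have h2 := totalDs_mem_fieldSpan_bar Ξ (x := (∑ s, ∑ i, ∑ m,
            𝔤.c s r i • (a 𝔤 i m 0 * aBar 𝔤 s m 0) : Alg 𝔤 U))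
          (Submodule.sum_mem _ fun s _ => Submodule.sum_mem _ fun i _ =>
            Submodule.sum_mem _ fun m _ => Submodule.smul_mem _ _
              (mul_mem_fieldSpan (y := bar) (k := ((s, m), 0)) (gen_mem_functionsOf ⟨(i, m), rfl⟩)
                (by simp)))
        refine Submodule.span_le.2 ?_ h2
        rintro _ ⟨f, hf, w, hw, rfl⟩
        obtain ⟨d, hd, e, he, hde⟩ := Submodule.mem_sup.1 (ih (Multiset.card w.2)
          (by rw [← hk]; exact Nat.lt_succ_of_le hw) w rfl)
        rw [← hde, mul_add]
        exact Submodule.add_mem_sup (fieldAlg_mul_mem_fieldSpan hf hd)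
          (fieldAlg_mul_mem_fieldSpan hf he)
      · exact fun h => (Finset.mem_erase.1 hm).1 h.1

variable [DecidableEq ι] {g : MetricTensor U} {h : Matrix ι ι ℝ}

theorem deltaBar_sum_totalDs_noetherOp (hh : 𝔤.IsNondegenerateCasimir h)
    (G : (ι × Multiset (Fin n)) →₀ Alg 𝔤 U)
    (hG : ∀ p, G p ∈ (fieldAlg : Submodule ℝ (Alg 𝔤 U))) :
    deltaBar (lagrangian 𝔤 g h) (G.sum fun p f => f * totalDs p.2 (noetherOp 𝔤 p.1)) = 0 := by
  have hL := isHomog_lagrangian (g := g) hh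
  have hΔ : ∀ r, IsHomog (𝔤.par r + 1) ((fun _ => 0 : ι → Alg 𝔤 U) r) := fun _ => IsHomog.zero
  rw [deltaBar_eq_koszulTate, koszulTate_eq hL hΔ, Finsupp.sum, map_sum]
  refine Finset.sum_eq_zero fun p _ => ?_
  have h1 : koszulTate (lagrangian 𝔤 g h) (fun _ => 0) (totalDs p.2 (noetherOp 𝔤 p.1)) = 0 := by
    rw [koszulTate, contactDerR_totalDs (isHomog_koszulTateComp hL hΔ)]
    have := deltaBar_noetherOp 𝔤 (g := g) hh p.1
    rw [deltaBar] at this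
    rw [this, totalDs_eq, map_zero]
  rw [← koszulTate_eq hL hΔ, koszulTate_fieldAlg_mul hL hΔ (hG p), h1, mul_zero]

/-- One-cycles factorize through the Noether operators. -/
theorem exists_eq_sum_totalDs_noetherOp (hh : 𝔤.IsNondegenerateCasimir h) {l0 l1 : Fin n}
    (h01 : l1 ≠ l0) {Φ : Alg 𝔤 U} (hΦ : Φ ∈ (chains gaugeBars 1 : Submodule ℝ (Alg 𝔤 U)))
    (h0 : deltaBar (lagrangian 𝔤 g h) Φ = 0) :
    ∃ G : (ι × Multiset (Fin n)) →₀ Alg 𝔤 U,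
      (∀ p, G p ∈ (fieldAlg : Submodule ℝ (Alg 𝔤 U))) ∧
      ∃ Ψ ∈ (chains gaugeBars 2 : Submodule ℝ (Alg 𝔤 U)),
        Φ = (G.sum fun p f => f * totalDs p.2 (noetherOp 𝔤 p.1))
          + deltaBar (lagrangian 𝔤 g h) Ψ := by
  have hL := isHomog_lagrangian (g := g) hh
  have hLf := lagrangian_mem_fieldAlg (g := g) 𝔤 hh
  have hΔ : ∀ r, IsHomog (𝔤.par r + 1) ((fun _ => 0 : ι → Alg 𝔤 U) r) := fun _ => IsHomog.zero
  have h1 : Φ ∈ fieldSpan Set.univ (fun p : ι × Multiset (Fin n) =>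
        (totalDs p.2 (noetherOp 𝔤 p.1) : Alg 𝔤 U))
      ⊔ fieldSpan {v : GaugeJet ι n | IsIndependentIndex l0 v.1.2 v.2} bar := by
    rw [chains_one_eq_fieldSpan] at hΦ
    refine Submodule.span_le.2 ?_ hΦ
    rintro _ ⟨f, hf, w, _, rfl⟩
    obtain ⟨d, hd, e, he, hde⟩ := Submodule.mem_sup.1 (bar_mem_sup_fieldSpan 𝔤 (U := U) l0 w)
    rw [← hde, mul_add]
    exact Submodule.add_mem_sup (fieldAlg_mul_mem_fieldSpan hf hd)
      (fieldAlg_mul_mem_fieldSpan hf he)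
  obtain ⟨d, hd, e, he, rfl⟩ := Submodule.mem_sup.1 h1
  obtain ⟨G, hG, _, rfl⟩ := exists_finsupp_of_mem_fieldSpan hd
  obtain ⟨F, hF, hFs, rfl⟩ := exists_finsupp_of_mem_fieldSpan he
  -- The combination of Noether operators is itself a cycle, so the remaining combination of
  -- independent antifield jets is one too, that is, a relation among independent equations.
  have h2 : ∑ v ∈ F.support, F v * eom (lagrangian 𝔤 g h) v = 0 := by
    have h3 := deltaBar_sum_totalDs_noetherOp 𝔤 (g := g) hh G hG
    rw [deltaBar_eq_koszulTate, koszulTate_eq hL hΔ] at h0 h3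
    rw [map_add, h3, zero_add, Finsupp.sum, map_sum] at h0
    rw [← h0]
    refine Finset.sum_congr rfl fun v _ => ?_
    rw [← koszulTate_eq hL hΔ, koszulTate_fieldAlg_mul hL hΔ (hF v), koszulTate_bar hL hΔ]
  have h3 := sum_mul_bar_mem_boundaries hL hLf
    {v : GaugeJet ι n | IsIndependentIndex l0 v.1.2 v.2}
    (fun v hv => exists_isSeparating hh h01 v hv) F.support hFs F hF h2
  obtain ⟨Ψ, hΨ, hΨe⟩ := (mem_boundaries hL).1 h3
  refine ⟨G, hG, Ψ, hΨ, ?_⟩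
  rw [← hΨe]
  rfl

theorem isCompleteNoether_lagrangian (hh : 𝔤.IsNondegenerateCasimir h) {l0 l1 : Fin n}
    (h01 : l1 ≠ l0) : IsCompleteNoether (lagrangian 𝔤 g h) (noetherOp 𝔤) where
  chain := noetherOp_mem_chains 𝔤
  cycle := deltaBar_noetherOp 𝔤 hh
  independent := noetherOp_independent 𝔤 l0 hh
  complete _ hΦ h0 := exists_eq_sum_totalDs_noetherOp 𝔤 hh h01 hΦ h0

end Completeness

end

end SuperYM

theorem mainTheorem3 {n : ℕ} (hn : 2 ≤ n) (U : TopologicalSpace.Opens (Fin n → ℝ)) [Nonempty U]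
    (g : SuperYM.MetricTensor U) {ι : Type*} [Fintype ι] [DecidableEq ι] [Nonempty ι]
    (𝔤 : SuperYM.LieSuperalgebra ι) (h : Matrix ι ι ℝ) (hh : 𝔤.IsNondegenerateCasimir h) :
    -- the Noether identities
    (∀ j, ∑ r, ∑ i, ∑ l, 𝔤.c r j i • (SuperYM.a 𝔤 i l 0 *
          SuperYM.varDeriv (SuperYM.gaugeL r l) (SuperYM.lagrangian 𝔤 g h))
        + ∑ l, SuperYM.totalD l
          (SuperYM.varDeriv (SuperYM.gaugeL j l) (SuperYM.lagrangian 𝔤 g h)) = 0) ∧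
    -- are complete and irreducible
    SuperYM.IsCompleteNoether (SuperYM.lagrangian 𝔤 g h) (SuperYM.noetherOp 𝔤) ∧
    SuperYM.IsIrreducibleNoether (SuperYM.lagrangian 𝔤 g h) (SuperYM.noetherOp 𝔤) ∧
    -- the associated gauge operator is a gauge symmetry
    SuperYM.gaugeOperatorOf (fun j => -SuperYM.noetherOp (U := U) 𝔤 j) = SuperYM.gaugeOp 𝔤 ∧
    SuperYM.IsVariationalSymmetry (SuperYM.gaugeOp 𝔤) (SuperYM.lagrangian 𝔤 g h) ∧
    -- its BRST extension is nilpotent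
    SuperYM.IsNilpotentDer (SuperYM.brstOp (U := U) 𝔤) ∧
    -- the extended Lagrangian is a proper solution of the master equation
    SuperYM.IsProperSolution (SuperYM.lagrangian 𝔤 g h) (fun j => -SuperYM.noetherOp 𝔤 j)
      (SuperYM.extendedLagrangian 𝔤 g h) := by
  -- The dimension enters only here: completeness needs two distinct base indices, the other
  -- assertions at most one.
  have h01 : (⟨1, by omega⟩ : Fin n) ≠ ⟨0, by omega⟩ := fun e => one_ne_zero (congrArg Fin.val e)
  exact ⟨SuperYM.noether_identity hh, SuperYM.isCompleteNoether_lagrangian 𝔤 hh h01,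
    SuperYM.isIrreducibleNoether_lagrangian 𝔤 ⟨0, by omega⟩ hh,
    SuperYM.gaugeOperatorOf_neg_noetherOp 𝔤, SuperYM.isVariationalSymmetry_gaugeOp 𝔤 hh,
    SuperYM.isNilpotentDer_brstOp 𝔤, SuperYM.isProperSolution_extendedLagrangian 𝔤 ⟨0, by omega⟩ hh⟩
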